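/- Let $(X,g,J_1,J_2,J_3)$ be a finite-dimensional hyper-Kähler manifold with Kähler forms $\omega_i=g(J_i\cdot,\cdot)$, and let $K$ be a compact connected Lie group with Lie algebra $\mathfrak k$ acting smoothly on $X$, the action being Hamiltonian for each $\omega_i$ with equivariant moment map $\mu_i\colon X\to\mathfrak k^*$ ($i=1,2,3$). Let $\sigma$ be a smooth involution of $X$ and $\tau$ a smooth involutive automorphism of $K$ such that $\sigma(k\cdot x)=\tau(k)\cdot\sigma(x)$ and, for $i=1,2,3$, $$\sigma^*J_i=(-1)^iJ_i,\qquad \sigma^*\omega_i=(-1)^i\omega_i,\qquad \sigma^*\mu_i=(-1)^i\,\tau\mu_i .$$ Write $\mu=(\mu_1,\mu_2,\mu_3)$, and suppose that $0$ is a regular value of $\mu$ and that $K$ acts freely on $\mu^{-1}(0)$. Put $Y=\mu_1^{-1}(0)\cap\mu_3^{-1}(0)$, let $X^\sigma$ be the fixed locus of $\sigma$, $Y^\sigma=Y\cap X^\sigma$ and $(\mu^{-1}(0))^\sigma=\mu^{-1}(0)\cap X^\sigma$. Let $K^\tau$ be the fixed subgroup of $\tau$, with Lie algebra $\mathfrak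 k^\tau$, and let $Y^\sigma/\!\!/K^\tau$ be the quotient by $K^\tau$ of the zero level of the moment map $Y^\sigma\to(\mathfrak k^\tau)^*$ obtained by restricting $\mu_2$. Let $X/\!\!/\!\!/K=\mu^{-1}(0)/K$ be the hyper-Kähler quotient: a smooth Hausdorff, second countable manifold for which $\mu^{-1}(0)\to\mu^{-1}(0)/K$ is a Riemannian submersion, with the hyper-Kähler structure $\bar g,\bar J_i,\bar\omega_i$ such that $\bar\omega_i$ pulls back to $\omega_i|_{\mu^{-1}(0)}$. Let $\bar\sigma$ be the map induced by $\sigma$ on $X/\!\!/\!\!/K$. Then this hyper-Kähler quotient exists, and: 1. $Y$ is $\sigma$-invariant and $Y^\sigma$ is $K^\tau$-invariant. If $0$ is a regular value of $(\mu_1,\mu_3)$, then $Y$ and $Y^\sigma$ are embedded Kähler submanifolds of $X$ with respect to $J_2,\omega_2$. The zero level defining $Y^\sigma/\!\!/K^\tau$ is $(\mu^{-1}(0))^\sigma$, so that $Y^\sigma/\!\!/K^\tau=(\mu^{-1}(0))^\sigma/K^\tau$, and this symplectic quotient is a smooth (Hausdorff, second countable) Kähler manifold: $(\mu^{-1}(0))^\sigma$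 is an embedded submanifold of $X$, its projection to the quotient is a Riemannian submersion, and the Kähler form pulls back to the restriction of $\omega_2$. 2. The fixed locus $(X/\!\!/\!\!/K)^{\bar\sigma}$ is an embedded Kähler submanifold of $X/\!\!/\!\!/K$ with respect to $\bar J_2,\bar\omega_2$, is totally geodesic, and is totally real with respect to $\bar J_1,\bar J_3$ and Lagrangian with respect to $\bar\omega_1,\bar\omega_3$. 3. The map $Y^\sigma/\!\!/K^\tau\to(X/\!\!/\!\!/K)^{\bar\sigma}$ induced by the inclusion $(\mu^{-1}(0))^\sigma\subset\mu^{-1}(0)$ is a local diffeomorphism that preserves the metrics, complex structures and Kähler forms (with respect to $\bar J_2,\bar\omega_2$). -/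

import Mathlib

open scoped Manifold ContDiff Topology

noncomputable section

/-! ### Tensors on a smooth manifold modelled on a real normed space -/

section Tensors

variable {F : Type*} [NormedAddCommGroup F] [NormedSpace ℝ F]
  {M : Type*} [TopologicalSpace M] [ChartedSpace F M]

/-- The coordinate expression, in the preferred chart at `x₀`, of a field `B` of bilinear forms
on the tangent spaces: the pull-back of `B` by the inverse of the chart. -/
def chartForm
    (B : ∀ x : M, TangentSpace 𝓘(ℝ, F) x →L[ℝ] TangentSpace 𝓘(ℝ, F) x →L[ℝ] ℝ)
    (x₀ : M) (y : F) : F →L[ℝ] F →L[ℝ] ℝ :=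
  let A : F →L[ℝ] F := mfderiv 𝓘(ℝ, F) 𝓘(ℝ, F) (extChartAt 𝓘(ℝ, F) x₀).symm y
  let b : F →L[ℝ] F →L[ℝ] ℝ := B ((extChartAt 𝓘(ℝ, F) x₀).symm y)
  b.bilinearComp A A

/-- A (smooth) `2`-form `Ω` is closed: in every preferred chart its exterior derivative
`dΩ(u, v, w) = D_u Ω(v, w) + D_v Ω(w, u) + D_w Ω(u, v)` vanishes. -/
def IsClosedTwoForm
    (Ω : ∀ x : M, TangentSpace 𝓘(ℝ, F) x →L[ℝ] TangentSpace 𝓘(ℝ, F) x →L[ℝ] ℝ) : Prop :=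
  ∀ (x₀ : M), ∀ y ∈ (extChartAt 𝓘(ℝ, F) x₀).target, ∀ u v w : F,
    fderiv ℝ (chartForm Ω x₀) y u v w + fderiv ℝ (chartForm Ω x₀) y v w u
      + fderiv ℝ (chartForm Ω x₀) y w u v = 0

/-- The Nijenhuis tensor of a field `J` of endomorphisms of the tangent spaces vanishes:
`[JV, JW] - J[JV, W] - J[V, JW] - [V, W] = 0` at `x`, for all vector fields `V`, `W` that are
smooth near `x`. -/
def NijenhuisVanishes [IsManifold 𝓘(ℝ, F) ∞ M]
    (J : ∀ x : M, TangentSpace 𝓘(ℝ, F) x →L[ℝ] TangentSpace 𝓘(ℝ, F) x) : Prop :=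
  ∀ (x : M) (V W : ∀ y : M, TangentSpace 𝓘(ℝ, F) y),
    ContMDiffAt 𝓘(ℝ, F) (𝓘(ℝ, F).prod 𝓘(ℝ, F)) ∞
      (fun y => (Bundle.TotalSpace.mk y (V y) : TangentBundle 𝓘(ℝ, F) M)) x →
    ContMDiffAt 𝓘(ℝ, F) (𝓘(ℝ, F).prod 𝓘(ℝ, F)) ∞
      (fun y => (Bundle.TotalSpace.mk y (W y) : TangentBundle 𝓘(ℝ, F) M)) x →
    VectorField.mlieBracket 𝓘(ℝ, F) (fun y => J y (V y)) (fun y => J y (W y)) x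
      - J x (VectorField.mlieBracket 𝓘(ℝ, F) (fun y => J y (V y)) W x)
      - J x (VectorField.mlieBracket 𝓘(ℝ, F) V (fun y => J y (W y)) x)
      - VectorField.mlieBracket 𝓘(ℝ, F) V W x = 0

end Tensors

/-! ### Kähler and hyper-Kähler structures -/

section Structures

variable (F : Type*) [NormedAddCommGroup F] [NormedSpace ℝ F]
  (M : Type*) [TopologicalSpace M] [ChartedSpace F M] [IsManifold 𝓘(ℝ, F) ∞ M]

/-- Smooth Riemannian metrics on `M`. -/
abbrev SmoothMetric :=
  Bundle.ContMDiffRiemannianMetric 𝓘(ℝ, F) ∞ F (fun x : M => TangentSpace 𝓘(ℝ, F) x)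

variable {F M}

/-- The pair `(g, J)` is Kähler: `J` is a smooth integrable complex structure, `g` is Hermitian for
`J`, and the `2`-form `ω(u, v) = g(J u, v)` is closed. -/
structure IsKahler (g : SmoothMetric F M)
    (J : ∀ x : M, TangentSpace 𝓘(ℝ, F) x →L[ℝ] TangentSpace 𝓘(ℝ, F) x) : Prop where
  contMDiff_J : ContMDiff 𝓘(ℝ, F) (𝓘(ℝ, F).prod 𝓘(ℝ, F →L[ℝ] F)) ∞
    (fun x => Bundle.TotalSpace.mk' (F →L[ℝ] F)
      (E := fun x : M => TangentSpace 𝓘(ℝ, F) x →L[ℝ] TangentSpace 𝓘(ℝ, F) x) x (J x))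
  J_J : ∀ (x : M) (v : TangentSpace 𝓘(ℝ, F) x), J x (J x v) = -v
  hermitian : ∀ (x : M) (u v : TangentSpace 𝓘(ℝ, F) x),
    g.inner x (J x u) (J x v) = g.inner x u v
  integrable : NijenhuisVanishes J
  closed : IsClosedTwoForm (fun x => (g.inner x).comp (J x))

variable (F M)

/-- A Kähler structure on `M`. -/
structure KahlerStructure where
  g : SmoothMetric F M
  J : ∀ x : M, TangentSpace 𝓘(ℝ, F) x →L[ℝ] TangentSpace 𝓘(ℝ, F) x
  isKahler : IsKahler g J

/-- A hyper-Kähler structure on `M`: one metric that is Kähler for each of three complex structures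
`J 0`, `J 1`, `J 2` (in the usual notation `J₁`, `J₂`, `J₃`) with `J₁ J₂ = J₃`. -/
structure HyperKahlerStructure where
  g : SmoothMetric F M
  J : Fin 3 → ∀ x : M, TangentSpace 𝓘(ℝ, F) x →L[ℝ] TangentSpace 𝓘(ℝ, F) x
  isKahler : ∀ i, IsKahler g (J i)
  quaternion : ∀ (x : M) (v : TangentSpace 𝓘(ℝ, F) x), J 0 x (J 1 x v) = J 2 x v

variable {F M}

/-- The Kähler form `ω(u, v) = g(J u, v)`. -/
def KahlerStructure.form (κ : KahlerStructure F M) (x : M) :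
    TangentSpace 𝓘(ℝ, F) x →L[ℝ] TangentSpace 𝓘(ℝ, F) x →L[ℝ] ℝ :=
  (κ.g.inner x).comp (κ.J x)

/-- The `i`-th Kähler structure `(g, J i, ω i)` of a hyper-Kähler structure. -/
def HyperKahlerStructure.kahler (hk : HyperKahlerStructure F M) (i : Fin 3) :
    KahlerStructure F M :=
  ⟨hk.g, hk.J i, hk.isKahler i⟩

/-! ### Submanifolds -/

/-- The tangent space at `p` of a subset `S` of `M` that carries a manifold structure for which the
inclusion is smooth, as a subspace of the tangent space of `M`. -/
def subTangent {F' : Type*} [NormedAddCommGroup F'] [NormedSpace ℝ F']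
    (S : Set M) [ChartedSpace F' S] (p : S) : Submodule ℝ (TangentSpace 𝓘(ℝ, F) (p : M)) :=
  LinearMap.range
    (mfderiv 𝓘(ℝ, F') 𝓘(ℝ, F) (Subtype.val : S → M) p :
      TangentSpace 𝓘(ℝ, F') p →ₗ[ℝ] TangentSpace 𝓘(ℝ, F) (p : M))

/-- The differential of `f` preserves the metrics and the complex structures (and hence the Kähler
forms). -/
def PreservesKahler {F' : Type*} [NormedAddCommGroup F'] [NormedSpace ℝ F']
    {N : Type*} [TopologicalSpace N] [ChartedSpace F' N] [IsManifold 𝓘(ℝ, F') ∞ N]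
    (κN : KahlerStructure F' N) (κ : KahlerStructure F M) (f : N → M) : Prop :=
  ∀ (p : N) (u v : TangentSpace 𝓘(ℝ, F') p),
    κ.g.inner (f p) (mfderiv 𝓘(ℝ, F') 𝓘(ℝ, F) f p u) (mfderiv 𝓘(ℝ, F') 𝓘(ℝ, F) f p v)
        = κN.g.inner p u v ∧
    mfderiv 𝓘(ℝ, F') 𝓘(ℝ, F) f p (κN.J p u)
        = κ.J (f p) (mfderiv 𝓘(ℝ, F') 𝓘(ℝ, F) f p u)

/-- The subset `S`, with the given manifold structure and Kähler structure, is an embedded Kähler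
submanifold of `M`: its Kähler structure is the restriction of that of `M`. -/
structure IsKahlerSubmanifold {F' : Type*} [NormedAddCommGroup F'] [NormedSpace ℝ F']
    (κ : KahlerStructure F M) (S : Set M) [ChartedSpace F' S] [IsManifold 𝓘(ℝ, F') ∞ S]
    (κS : KahlerStructure F' S) : Prop where
  embedding : Manifold.IsSmoothEmbedding 𝓘(ℝ, F') 𝓘(ℝ, F) ∞ (Subtype.val : S → M)
  restrict : PreservesKahler κS κ (Subtype.val : S → M)

/-- `S` can be given the structure of an embedded Kähler submanifold of `M`. -/
def AdmitsKahlerSubmanifold (κ : KahlerStructure F M) (S : Set M) : Prop :=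
  ∃ (d : ℕ) (_ : ChartedSpace (EuclideanSpace ℝ (Fin d)) S)
    (_ : IsManifold (𝓡 d) ∞ S) (κS : KahlerStructure (EuclideanSpace ℝ (Fin d)) S),
    IsKahlerSubmanifold κ S κS

/-- `S` is totally real for `J`: `T_p M = T_p S ⊕ J (T_p S)` at each point. -/
def IsTotallyReal {F' : Type*} [NormedAddCommGroup F'] [NormedSpace ℝ F']
    (κ : KahlerStructure F M) (S : Set M) [ChartedSpace F' S] : Prop :=
  ∀ p : S, IsCompl (subTangent (F := F) (F' := F') S p)
    ((subTangent (F := F) (F' := F') S p).map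
      (κ.J p : TangentSpace 𝓘(ℝ, F) (p : M) →ₗ[ℝ] TangentSpace 𝓘(ℝ, F) (p : M)))

/-- `S` is Lagrangian: each `T_p S` is its own orthogonal complement with respect to the
symplectic form. -/
def IsLagrangian {F' : Type*} [NormedAddCommGroup F'] [NormedSpace ℝ F']
    (κ : KahlerStructure F M) (S : Set M) [ChartedSpace F' S] : Prop :=
  ∀ (p : S) (v : TangentSpace 𝓘(ℝ, F) (p : M)),
    v ∈ subTangent (F := F) (F' := F') S p ↔
      ∀ w ∈ subTangent (F := F) (F' := F') S p, κ.form p v w = 0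

/-- The smooth curve `γ` is a geodesic of `g` on the open set `s`: in charts, it satisfies the
Euler-Lagrange equation `d/dt g(γ', w) = (1/2) (D_w g)(γ', γ')`, for all constant vectors `w`,
which is the geodesic equation `γ'' + Γ(γ', γ') = 0` with its index lowered. -/
def IsGeodesicOn (g : SmoothMetric F M) (γ : ℝ → M) (s : Set ℝ) : Prop :=
  ContMDiffOn 𝓘(ℝ, ℝ) 𝓘(ℝ, F) ∞ γ s ∧
  ∀ t ∈ s, ∀ w : F,
    deriv (fun r => chartForm g.inner (γ t) (extChartAt 𝓘(ℝ, F) (γ t) (γ r))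
        (deriv (fun r' => extChartAt 𝓘(ℝ, F) (γ t) (γ r')) r) w) t
      = (1 / 2) * fderiv ℝ (chartForm g.inner (γ t)) (extChartAt 𝓘(ℝ, F) (γ t) (γ t)) w
          (deriv (fun r' => extChartAt 𝓘(ℝ, F) (γ t) (γ r')) t)
          (deriv (fun r' => extChartAt 𝓘(ℝ, F) (γ t) (γ r')) t)

/-- `S` is totally geodesic: a geodesic of the ambient manifold that is tangent to `S` at some time
stays in `S` for all nearby times. -/
def IsTotallyGeodesic {F' : Type*} [NormedAddCommGroup F'] [NormedSpace ℝ F']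
    (g : SmoothMetric F M) (S : Set M) [ChartedSpace F' S] : Prop :=
  ∀ (ε : ℝ) (γ : ℝ → M), 0 < ε → IsGeodesicOn g γ (Set.Ioo (-ε) ε) →
    ∀ h₀ : γ 0 ∈ S,
      mfderiv 𝓘(ℝ, ℝ) 𝓘(ℝ, F) γ 0 (1 : ℝ) ∈ subTangent (F := F) (F' := F') S ⟨γ 0, h₀⟩ →
      ∀ᶠ t in 𝓝 (0 : ℝ), γ t ∈ S

/-! ### Quotients -/

/-- The space of `G`-orbits in `Z`, for a `G`-invariant subset `Z` of a `G`-space, with the quotient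
topology. -/
abbrev OrbitSpace (G : Type*) [Group G] {X : Type*} [MulAction G X] (Z : Set X) :=
  Quotient ((MulAction.orbitRel G X).comap (Subtype.val : Z → X))

/-- `π : Z → Q` exhibits the Kähler structure of `Q` as the reduction of that of `M`: `Z` is an
embedded submanifold of `M`, `π` is a surjective Riemannian submersion (isometric on the orthogonal
complement of the vertical space `ker dπ`), and `π^* ω_Q` is the restriction of `ω_M` to `Z`. -/
structure IsKahlerReduction {F' F'' : Type*} [NormedAddCommGroup F'] [NormedSpace ℝ F']
    [NormedAddCommGroup F''] [NormedSpace ℝ F'']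
    (κ : KahlerStructure F M) (Z : Set M) [ChartedSpace F' Z]
    {Q : Type*} [TopologicalSpace Q] [ChartedSpace F'' Q] [IsManifold 𝓘(ℝ, F'') ∞ Q]
    (κQ : KahlerStructure F'' Q) (π : Z → Q) : Prop where
  embedding : Manifold.IsSmoothEmbedding 𝓘(ℝ, F') 𝓘(ℝ, F) ∞ (Subtype.val : Z → M)
  surjective : Function.Surjective π
  submersion : Manifold.IsSubmersion 𝓘(ℝ, F') 𝓘(ℝ, F'') ∞ π
  metric : ∀ (z : Z) (u v : TangentSpace 𝓘(ℝ, F') z),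
    (∀ w : TangentSpace 𝓘(ℝ, F') z, mfderiv 𝓘(ℝ, F') 𝓘(ℝ, F'') π z w = 0 →
      κ.g.inner z (mfderiv 𝓘(ℝ, F') 𝓘(ℝ, F) (Subtype.val : Z → M) z u)
        (mfderiv 𝓘(ℝ, F') 𝓘(ℝ, F) (Subtype.val : Z → M) z w) = 0) →
    κQ.g.inner (π z) (mfderiv 𝓘(ℝ, F') 𝓘(ℝ, F'') π z u) (mfderiv 𝓘(ℝ, F') 𝓘(ℝ, F'') π z v)
      = κ.g.inner z (mfderiv 𝓘(ℝ, F') 𝓘(ℝ, F) (Subtype.val : Z → M) z u)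
          (mfderiv 𝓘(ℝ, F') 𝓘(ℝ, F) (Subtype.val : Z → M) z v)
  form : ∀ (z : Z) (u v : TangentSpace 𝓘(ℝ, F') z),
    κQ.form (π z) (mfderiv 𝓘(ℝ, F') 𝓘(ℝ, F'') π z u) (mfderiv 𝓘(ℝ, F') 𝓘(ℝ, F'') π z v)
      = κ.form z (mfderiv 𝓘(ℝ, F') 𝓘(ℝ, F) (Subtype.val : Z → M) z u)
          (mfderiv 𝓘(ℝ, F') 𝓘(ℝ, F) (Subtype.val : Z → M) z v)

end Structures

/-! ### Hamiltonian actions and involutions -/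

section Actions

variable {E : Type*} [NormedAddCommGroup E] [NormedSpace ℝ E]
  {X : Type*} [TopologicalSpace X] [ChartedSpace E X] [IsManifold 𝓘(ℝ, E) ∞ X]
  {EK : Type*} [NormedAddCommGroup EK] [NormedSpace ℝ EK]
  {K : Type*} [TopologicalSpace K] [ChartedSpace EK K] [Group K] [MulAction K X]

/-- The value at `x` of the vector field on `X` generated by the element `ξ` of the Lie algebra
(the tangent space at `1`) of `K`. -/
def fundamentalField (ξ : GroupLieAlgebra 𝓘(ℝ, EK) K) (x : X) : TangentSpace 𝓘(ℝ, E) x :=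
  (mfderiv 𝓘(ℝ, EK) 𝓘(ℝ, E) (fun k : K => k • x) 1 : EK →L[ℝ] E) ξ

/-- The differential at `1` of a map that fixes `1`, as an endomorphism of the Lie algebra, whose
underlying vector space is the model space `EK`. -/
def diffOne (f : K → K) : EK →L[ℝ] EK :=
  mfderiv 𝓘(ℝ, EK) 𝓘(ℝ, EK) f 1

/-- The differential at `x` of a map from `X` to the dual of the Lie algebra. -/
def diffMoment (μ : X → EK →L[ℝ] ℝ) (x : X) : TangentSpace 𝓘(ℝ, E) x →L[ℝ] EK →L[ℝ] ℝ :=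
  mfderiv 𝓘(ℝ, E) 𝓘(ℝ, EK →L[ℝ] ℝ) μ x

variable (K) in
/-- The action of `K` on `X` is Hamiltonian for the Kähler form of `κ`, with equivariant moment map
`μ : X → 𝔨^*`. The dual of the Lie algebra of `K` is the dual of the model space `EK`. -/
structure IsMomentMap (κ : KahlerStructure E X) (μ : X → EK →L[ℝ] ℝ) : Prop where
  contMDiff : ContMDiff 𝓘(ℝ, E) 𝓘(ℝ, EK →L[ℝ] ℝ) ∞ μ
  symplectic : ∀ (k : K) (x : X) (u v : TangentSpace 𝓘(ℝ, E) x),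
    κ.form (k • x) (mfderiv 𝓘(ℝ, E) 𝓘(ℝ, E) (fun y : X => k • y) x u)
      (mfderiv 𝓘(ℝ, E) 𝓘(ℝ, E) (fun y : X => k • y) x v) = κ.form x u v
  hamiltonian : ∀ (x : X) (ξ : GroupLieAlgebra 𝓘(ℝ, EK) K) (v : TangentSpace 𝓘(ℝ, E) x),
    diffMoment μ x v ξ = κ.form x (fundamentalField ξ x) v
  equivariant : ∀ (k : K) (x : X) (ξ : EK),
    μ (k • x) (diffOne (fun h : K => k * h * k⁻¹) ξ) = μ x ξ

/-- `0` is a regular value of `f`. -/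
def IsRegularAtZero {V : Type*} [NormedAddCommGroup V] [NormedSpace ℝ V] (f : X → V) : Prop :=
  ∀ x, f x = 0 → Function.Surjective (mfderiv 𝓘(ℝ, E) 𝓘(ℝ, V) f x)

/-- `σ` and `τ` are smooth involutions of `X` and of the Lie group `K`, intertwined by the action,
such that `σ^* J_i = (-1)^i J_i`, `σ^* ω_i = (-1)^i ω_i` and `σ^* μ_i = (-1)^i τ μ_i` for
`i = 1, 2, 3`. (The index `i` of `Fin 3` stands for `i + 1`.) -/
structure CompatibleInvolutions (hk : HyperKahlerStructure E X) (μ : Fin 3 → X → EK →L[ℝ] ℝ)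
    (σ : X → X) (τ : K →* K) : Prop where
  contMDiff_σ : ContMDiff 𝓘(ℝ, E) 𝓘(ℝ, E) ∞ σ
  involutive_σ : Function.Involutive σ
  contMDiff_τ : ContMDiff 𝓘(ℝ, EK) 𝓘(ℝ, EK) ∞ τ
  involutive_τ : Function.Involutive τ
  map_smul : ∀ (k : K) (x : X), σ (k • x) = τ k • σ x
  complex : ∀ (i : Fin 3) (x : X) (v : TangentSpace 𝓘(ℝ, E) x),
    mfderiv 𝓘(ℝ, E) 𝓘(ℝ, E) σ x (hk.J i x v)
      = (-1 : ℝ) ^ (i.val + 1) • hk.J i (σ x) (mfderiv 𝓘(ℝ, E) 𝓘(ℝ, E) σ x v)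
  form : ∀ (i : Fin 3) (x : X) (u v : TangentSpace 𝓘(ℝ, E) x),
    (hk.kahler i).form (σ x) (mfderiv 𝓘(ℝ, E) 𝓘(ℝ, E) σ x u) (mfderiv 𝓘(ℝ, E) 𝓘(ℝ, E) σ x v)
      = (-1 : ℝ) ^ (i.val + 1) * (hk.kahler i).form x u v
  moment : ∀ (i : Fin 3) (x : X) (ξ : EK),
    μ i (σ x) ξ = (-1 : ℝ) ^ (i.val + 1) * μ i x (diffOne τ ξ)

/-- The fixed subgroup `K^τ`. -/
def fixedSubgroup (τ : K →* K) : Subgroup K := τ.eqLocus (MonoidHom.id K)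

/-- `μ⁻¹(0) = μ₁⁻¹(0) ∩ μ₂⁻¹(0) ∩ μ₃⁻¹(0)`. -/
def zeroLevel (μ : Fin 3 → X → EK →L[ℝ] ℝ) : Set X := {x | ∀ i, μ i x = 0}

/-- `Y = μ₁⁻¹(0) ∩ μ₃⁻¹(0)`. -/
def complexZeroLevel (μ : Fin 3 → X → EK →L[ℝ] ℝ) : Set X := {x | μ 0 x = 0 ∧ μ 2 x = 0}

/-- The zero level in `Y^σ` of the moment map `Y^σ → 𝔨^* → (𝔨^τ)^*` of the action of `K^τ`, which
is the restriction of `μ₂`; here `𝔨^τ`, the Lie algebra of `K^τ`, is the fixed space of `τ`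
in `𝔨`. -/
def realZeroLevel (μ : Fin 3 → X → EK →L[ℝ] ℝ) (σ : X → X) (τ : K →* K) : Set X :=
  {x | x ∈ complexZeroLevel μ ∩ Function.fixedPoints σ ∧
    ∀ ξ : EK, diffOne τ ξ = ξ → μ 1 x ξ = 0}

theorem CompatibleInvolutions.map_mem_zeroLevel {hk : HyperKahlerStructure E X}
    {μ : Fin 3 → X → EK →L[ℝ] ℝ} {σ : X → X} {τ : K →* K}
    (h : CompatibleInvolutions hk μ σ τ) {x : X} (hx : x ∈ zeroLevel μ) :
    σ x ∈ zeroLevel μ := by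
  intro i
  ext ξ
  rw [h.moment i x ξ, hx i]
  simp

/-- The map `σ̄` induced by `σ` on the hyper-Kähler quotient `μ⁻¹(0) / K`. -/
def CompatibleInvolutions.quotientMap {hk : HyperKahlerStructure E X}
    {μ : Fin 3 → X → EK →L[ℝ] ℝ} {σ : X → X} {τ : K →* K}
    (h : CompatibleInvolutions hk μ σ τ) :
    OrbitSpace K (zeroLevel μ) → OrbitSpace K (zeroLevel μ) :=
  Quotient.map (fun z => ⟨σ z, h.map_mem_zeroLevel z.2⟩) (by
    rintro ⟨a, ha⟩ ⟨b, hb⟩ ⟨k, hk⟩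
    exact ⟨τ k, by
      have := congrArg σ hk
      exact (h.map_smul k b).symm.trans this⟩)

end Actions

end

noncomputable section
set_option linter.unusedSectionVars false
open Set Function

/-! ### The inverse function theorem on manifolds -/

section InverseFunction

variable {E : Type*} [NormedAddCommGroup E] [NormedSpace ℝ E] [FiniteDimensional ℝ E]
  {F : Type*} [NormedAddCommGroup F] [NormedSpace ℝ F] [FiniteDimensional ℝ F]
  {M : Type*} [TopologicalSpace M] [ChartedSpace E M] [IsManifold 𝓘(ℝ, E) ∞ M]
  {N : Type*} [TopologicalSpace N] [ChartedSpace F N] [IsManifold 𝓘(ℝ, F) ∞ N]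

/-! Quotient structures are recovered from the three Kähler forms, and fixed loci are understood
through the eigenspaces of the differential of an involution. Write `𝔨z` for the tangent space of
the orbit of `z`.

The hyper-Kähler quotient. Regularity of `0` makes the infinitesimal action injective on `μ⁻¹(0)`
(`infAct_injective`), and `T_z μ⁻¹(0)` is the common orthogonal of `𝔨z` for the three forms. It
contains `𝔨z`, because orbits in the zero level are isotropic. Its vectors that are `g`-orthogonal
to `𝔨z` form a quaternionic subspace. Since `K` is compact and acts freely, slices give charts of
the orbit space (`exists_slice`, `exists_quotient_manifold`). The restricted forms are basic, so
they descend, and pulling back along local sections shows that the descended forms are smooth and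
closed. The rest is algebra: `ω_{i+2}(J_i ·, ·) = ω_{i+1}` with cyclic indices, and `g = -ω_i(J_i ·,
·)`, which gives smoothness of `J_i` and `g`. Integrability comes from `nijenhuisAt_of_closedAt`: an
almost complex structure that relates two closed 2-forms, the first nondegenerate, is integrable. No
connection is used. This is `exists_descent`.

Fixed loci. Both `σ` and the induced map on the quotient multiply the forms by `-1, 1, -1`
(`IsRealInvolution`). Such an involution is therefore an isometry that commutes with `J₂` and
anticommutes with `J₁` and `J₃`. At a fixed point `J₁` exchanges the eigenspaces of the
differential, so each has half the dimension. Averaging a chart over the involution linearises it,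
which exhibits its fixed locus, also inside the zero set of an equivariant submersion, as an
embedded submanifold (`exists_equation_fixed`, `exists_manifold_fixed`). The tangent space is the
`+1`-eigenspace, within the kernel of the constraint. In the quotient it is stable under `J₂`,
complementary to its image under `J₁` or `J₃`, and its own orthogonal for `ω₁` and `ω₃`. Total
geodesy is uniqueness of geodesics: a geodesic tangent to the fixed locus and its image under the
isometry have the same initial data.

The comparison map. If `k z = z'` with `z`, `z'` fixed by `σ`, then `τ(k) z = z'`, so `τ(k) = k` by
freeness and the map is injective. A tangent vector of the fixed locus lifts to `μ⁻¹(0)`, and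
averaging the lift over `dσ` makes it tangent to `(μ⁻¹(0))^σ`. Hence `(μ⁻¹(0))^σ` submerses onto an
open part of the fixed locus, and the comparison map is an open embedding. The manifold and Kähler
structures of `Y^σ // K^τ` are pulled back along it; it then remains to see that they are the
reduced ones (`exists_realQuotient`). -/

omit [FiniteDimensional ℝ F] in
/-- The inverse function theorem in a vector space, as a smooth local homeomorphism. -/
theorem exists_partialDiffeomorph_of_contDiffOn {f : E → F} {U : Set E} (hU : IsOpen U)
    (hf : ContDiffOn ℝ ∞ f U) {a : E} (ha : a ∈ U) (hb : Bijective (fderiv ℝ f a)) :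
    ∃ Φ : PartialDiffeomorph 𝓘(ℝ, E) 𝓘(ℝ, F) E F ∞,
      a ∈ Φ.source ∧ Φ.source ⊆ U ∧ EqOn f Φ Φ.source := by
  have hfa : ∀ x ∈ U, ContDiffAt ℝ ∞ f x := fun x hx => hf.contDiffAt (hU.mem_nhds hx)
  have hn : (∞ : WithTop ℕ∞) ≠ 0 := by simp
  let f' : E ≃L[ℝ] F := (LinearEquiv.ofBijective (fderiv ℝ f a : E →ₗ[ℝ] F) hb).toContinuousLinearEquiv
  have hf' : HasFDerivAt f (f' : E →L[ℝ] F) a := by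
    have := ((hfa a ha).differentiableAt hn).hasFDerivAt
    exact this
  let e := (hfa a ha).toOpenPartialHomeomorph f hf' hn
  -- The inverse is known to be smooth only at images of points where the derivative is invertible.
  -- These points form an open set, and restricting to it makes the inverse smooth on the whole
  -- target.
  let V : Set E := U ∩ {x | fderiv ℝ f x ∈ range ((↑) : (E ≃L[ℝ] F) → E →L[ℝ] F)}
  have hV : IsOpen V :=
    (hf.continuousOn_fderiv_of_isOpen hU (by simp)).isOpen_inter_preimage hU
      (ContinuousLinearEquiv.isOpen)
  let e' := e.restrOpen V hV
  have hcoe : ∀ x, e' x = f x := fun x => rfl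
  have hsrc : e'.source = e.source ∩ V := rfl
  refine ⟨{ toPartialEquiv := e'.toPartialEquiv
            open_source := e'.open_source
            open_target := e'.open_target
            contMDiffOn_toFun := ?_
            contMDiffOn_invFun := ?_ }, ?_, ?_, ?_⟩
  · rw [contMDiffOn_iff_contDiffOn]
    exact hf.mono (fun x hx => hx.2.1)
  · rw [contMDiffOn_iff_contDiffOn]
    intro y hy
    have hx : e'.symm y ∈ e'.source := e'.map_target hy
    obtain ⟨g, hg⟩ := hx.2.2
    refine (e'.contDiffAt_symm (f₀' := g) hy ?_ (hfa _ hx.2.1)).contDiffWithinAt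
    have := ((hfa _ hx.2.1).differentiableAt hn).hasFDerivAt
    rw [← hg] at this
    exact this
  · exact ⟨(hfa a ha).mem_toOpenPartialHomeomorph_source hf' hn, ha, ⟨f', hf'.fderiv.symm⟩⟩
  · exact fun x hx => hx.2.1
  · exact fun x hx => rfl

/-- The preferred chart, as a partial diffeomorphism. -/
def chartDiffeo (x : M) : PartialDiffeomorph 𝓘(ℝ, E) 𝓘(ℝ, E) M E ∞ where
  toPartialEquiv := (chartAt E x).toPartialEquiv
  open_source := (chartAt E x).open_source
  open_target := (chartAt E x).open_target
  contMDiffOn_toFun := contMDiffOn_chart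
  contMDiffOn_invFun := contMDiffOn_chart_symm

omit [FiniteDimensional ℝ F] in
/-- The inverse function theorem: a smooth map with bijective differential at `x` is a local
diffeomorphism at `x`. -/
theorem isLocalDiffeomorphAt_of_bijective_mfderiv {f : M → N} {U : Set M} (hU : IsOpen U)
    (hf : ContMDiffOn 𝓘(ℝ, E) 𝓘(ℝ, F) ∞ f U) {x : M} (hx : x ∈ U)
    (hb : Bijective (mfderiv 𝓘(ℝ, E) 𝓘(ℝ, F) f x)) :
    ∃ Φ : PartialDiffeomorph 𝓘(ℝ, E) 𝓘(ℝ, F) M N ∞,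
      x ∈ Φ.source ∧ Φ.source ⊆ U ∧ EqOn f Φ Φ.source := by
  have hV : IsOpen (U ∩ f ⁻¹' (chartAt F (f x)).source) :=
    hf.continuousOn.isOpen_inter_preimage hU (chartAt F (f x)).open_source
  set V := U ∩ f ⁻¹' (chartAt F (f x)).source with hVdef
  have hW : IsOpen ((chartAt E x).target ∩ (chartAt E x).symm ⁻¹' V) :=
    (chartAt E x).symm.isOpen_inter_preimage hV
  set W := (chartAt E x).target ∩ (chartAt E x).symm ⁻¹' V with hWdef
  set fh : E → F := (chartAt F (f x)) ∘ f ∘ (chartAt E x).symm with hfh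
  have hxs := mem_chart_source E x
  have hfxs := mem_chart_source F (f x)
  have hxV : x ∈ V := ⟨hx, hfxs⟩
  have ha : chartAt E x x ∈ W := ⟨(chartAt E x).map_source hxs, by
    simpa [(chartAt E x).left_inv hxs] using hxV⟩
  have hsm : ContMDiffOn 𝓘(ℝ, E) 𝓘(ℝ, F) ∞ fh W := by
    refine (contMDiffOn_chart (x := f x)).comp
      (hf.comp (contMDiffOn_chart_symm.mono inter_subset_left) fun y hy => hy.2.1) ?_
    exact fun y hy => hy.2.2
  have hfx : MDifferentiableAt 𝓘(ℝ, E) 𝓘(ℝ, F) f x :=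
    (hf.contMDiffAt (hU.mem_nhds hx)).mdifferentiableAt (by simp)
  have hbij : Bijective (fderiv ℝ fh (chartAt E x x)) := by
    rw [← mfderiv_eq_fderiv]
    have h1 : MDifferentiableAt 𝓘(ℝ, E) 𝓘(ℝ, E) (chartAt E x).symm (chartAt E x x) :=
      (mdifferentiable_chart x).mdifferentiableAt_symm ha.1
    have h2 : MDifferentiableAt 𝓘(ℝ, F) 𝓘(ℝ, F) (chartAt F (f x)) (f x) :=
      (mdifferentiable_chart (f x)).mdifferentiableAt hfxs
    have hinv := (chartAt E x).left_inv hxs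
    rw [hfh, mfderiv_comp (I' := 𝓘(ℝ, F)) (chartAt E x x), mfderiv_comp (I' := 𝓘(ℝ, E)) (chartAt E x x)]
    · simp only [comp_apply]
      rw [hinv]
      refine ((mdifferentiable_chart (f x)).mfderiv_bijective hfxs).comp (hb.comp ?_)
      exact (mdifferentiable_chart (I := 𝓘(ℝ, E)) x).symm.mfderiv_bijective ha.1
    · rw [hinv]; exact hfx
    · exact h1
    · rw [comp_apply, hinv]; exact h2
    · refine MDifferentiableAt.comp (I' := 𝓘(ℝ, E)) _ ?_ h1
      rw [hinv]; exact hfx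
  obtain ⟨Φ, haΦ, hΦW, hΦ⟩ :=
    exists_partialDiffeomorph_of_contDiffOn hW (contMDiffOn_iff_contDiffOn.1 hsm) ha hbij
  refine ⟨((chartDiffeo x).trans Φ).trans (chartDiffeo (f x)).symm, ?_, ?_, ?_⟩
  · refine ⟨⟨hxs, haΦ⟩, ?_⟩
    change Φ (chartAt E x x) ∈ (chartAt F (f x)).target
    rw [← hΦ haΦ]
    simp [hfh]
  · rintro y ⟨⟨hy1, hy2⟩, -⟩
    have := (hΦW hy2).2.1
    change (chartAt E x).symm (chartAt E x y) ∈ U at this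
    rwa [(chartAt E x).left_inv hy1] at this
  · rintro y ⟨⟨hy1, hy2⟩, hy3⟩
    change f y = (chartAt F (f x)).symm (Φ (chartAt E x y))
    rw [← show fh (chartAt E x y) = Φ (chartAt E x y) from hΦ hy2]
    have := (hΦW hy2).2.2
    change f ((chartAt E x).symm (chartAt E x y)) ∈ (chartAt F (f x)).source at this
    rw [(chartAt E x).left_inv hy1] at this
    simp only [hfh, comp_apply]
    rw [(chartAt E x).left_inv hy1, (chartAt F (f x)).left_inv this]

/-- A surjective linear map can be completed to a linear isomorphism with a product. -/
theorem exists_bijective_prod_of_surjective {A : E →L[ℝ] F} (hA : Surjective A) {c : ℕ}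
    (hc : Module.finrank ℝ E = Module.finrank ℝ F + c) :
    ∃ l : E →L[ℝ] EuclideanSpace ℝ (Fin c), Bijective (A.prod l) := by
  have hker : Module.finrank ℝ (LinearMap.ker (A : E →ₗ[ℝ] F)) = c := by
    have := LinearMap.finrank_range_add_finrank_ker (A : E →ₗ[ℝ] F)
    rw [LinearMap.range_eq_top.2 hA, finrank_top] at this
    omega
  -- Projecting onto the kernel along a complement detects what `A` kills, so the pair is injective;
  -- the dimension count makes it bijective.
  obtain ⟨p, hp⟩ := Submodule.exists_isCompl (LinearMap.ker (A : E →ₗ[ℝ] F))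
  let i : LinearMap.ker (A : E →ₗ[ℝ] F) ≃ₗ[ℝ] EuclideanSpace ℝ (Fin c) :=
    LinearEquiv.ofFinrankEq _ _ (by simp [hker])
  let l : E →ₗ[ℝ] EuclideanSpace ℝ (Fin c) :=
    i.toLinearMap ∘ₗ Submodule.projectionOnto _ _ hp
  refine ⟨LinearMap.toContinuousLinearMap l, ?_⟩
  have hinj : Injective (A.prod (LinearMap.toContinuousLinearMap l)) := by
    rw [injective_iff_map_eq_zero]
    intro x hx
    have h1 : A x = 0 := congrArg Prod.fst hx
    have h2 : l x = 0 := congrArg Prod.snd hx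
    have h3 : Submodule.projectionOnto _ _ hp x = 0 := by
      apply i.injective
      simpa [l] using h2
    have := Submodule.projectionOnto_apply_left hp ⟨x, h1⟩
    rw [show ((⟨x, h1⟩ : LinearMap.ker (A : E →ₗ[ℝ] F)) : E) = x from rfl, h3] at this
    exact (congrArg Subtype.val this).symm
  have hd : Module.finrank ℝ E = Module.finrank ℝ (F × EuclideanSpace ℝ (Fin c)) := by
    simp [hc]
  exact ⟨hinj, (LinearMap.injective_iff_surjective_of_finrank_eq_finrank
    (f := (A.prod (LinearMap.toContinuousLinearMap l) : E →ₗ[ℝ] F × EuclideanSpace ℝ (Fin c))) hd).1 hinj⟩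

omit [FiniteDimensional ℝ E] [FiniteDimensional ℝ F] [IsManifold 𝓘(ℝ, E) ∞ M] in
theorem HasMFDerivAt.prodMk_vectorSpace {F' : Type*} [NormedAddCommGroup F'] [NormedSpace ℝ F']
    {f : M → F} {g : M → F'} {x : M} {f' : TangentSpace 𝓘(ℝ, E) x →L[ℝ] F}
    {g' : TangentSpace 𝓘(ℝ, E) x →L[ℝ] F'} (hf : HasMFDerivAt 𝓘(ℝ, E) 𝓘(ℝ, F) f x f')
    (hg : HasMFDerivAt 𝓘(ℝ, E) 𝓘(ℝ, F') g x g') :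
    HasMFDerivAt 𝓘(ℝ, E) 𝓘(ℝ, F × F') (fun y => (f y, g y)) x (f'.prod g') :=
  ⟨hf.1.prodMk hg.1, hf.2.prodMk hg.2⟩

/-- A submersion to a vector space is, locally, the first component of a local diffeomorphism. -/
theorem exists_partialDiffeomorph_fst {G : M → F} {U : Set M} (hU : IsOpen U)
    (hG : ContMDiffOn 𝓘(ℝ, E) 𝓘(ℝ, F) ∞ G U) {x : M} (hx : x ∈ U)
    (hs : Surjective (mfderiv 𝓘(ℝ, E) 𝓘(ℝ, F) G x)) {c : ℕ}
    (hc : Module.finrank ℝ E = Module.finrank ℝ F + c) :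
    ∃ Φ : PartialDiffeomorph 𝓘(ℝ, E) 𝓘(ℝ, F × EuclideanSpace ℝ (Fin c)) M
        (F × EuclideanSpace ℝ (Fin c)) ∞,
      x ∈ Φ.source ∧ Φ.source ⊆ U ∧ ∀ y ∈ Φ.source, (Φ y).1 = G y := by
  have hbx := (mdifferentiable_chart (I := 𝓘(ℝ, E)) x).mfderiv_bijective (mem_chart_source E x)
  let B : E →L[ℝ] E := mfderiv 𝓘(ℝ, E) 𝓘(ℝ, E) (chartAt E x) x
  let A : E →L[ℝ] F := mfderiv 𝓘(ℝ, E) 𝓘(ℝ, F) G x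
  obtain ⟨l, hl⟩ := exists_bijective_prod_of_surjective (A := A) hs hc
  let Bi : E ≃ₗ[ℝ] E := LinearEquiv.ofBijective (B : E →ₗ[ℝ] E) hbx
  -- Undoing the differential of the chart makes the second component have differential exactly `l`
  -- at `x`.
  let l' : E →L[ℝ] EuclideanSpace ℝ (Fin c) := l.comp Bi.symm.toLinearMap.toContinuousLinearMap
  let f : M → F × EuclideanSpace ℝ (Fin c) := fun y => (G y, l' (chartAt E x y))
  have hχ : ContMDiffOn 𝓘(ℝ, E) 𝓘(ℝ, EuclideanSpace ℝ (Fin c)) ∞ (fun y => l' (chartAt E x y))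
      (chartAt E x).source :=
    l'.contMDiff.comp_contMDiffOn contMDiffOn_chart
  have hf : ContMDiffOn 𝓘(ℝ, E) 𝓘(ℝ, F × EuclideanSpace ℝ (Fin c)) ∞ f
      (U ∩ (chartAt E x).source) :=
    (hG.mono inter_subset_left).prodMk_space (hχ.mono inter_subset_right)
  have hGd : HasMFDerivAt 𝓘(ℝ, E) 𝓘(ℝ, F) G x A :=
    ((hG.contMDiffAt (hU.mem_nhds hx)).mdifferentiableAt (by simp)).hasMFDerivAt
  have hχd : HasMFDerivAt 𝓘(ℝ, E) 𝓘(ℝ, EuclideanSpace ℝ (Fin c)) (fun y => l' (chartAt E x y)) x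
      (l'.comp B) := by
    have h1 : HasMFDerivAt 𝓘(ℝ, E) 𝓘(ℝ, EuclideanSpace ℝ (Fin c)) l' (chartAt E x x) l' :=
      l'.hasMFDerivAt
    exact h1.comp x ((mdifferentiable_chart x).mdifferentiableAt (mem_chart_source E x)).hasMFDerivAt
  have hfd : mfderiv 𝓘(ℝ, E) 𝓘(ℝ, F × EuclideanSpace ℝ (Fin c)) f x = A.prod (l'.comp B) :=
    (hGd.prodMk_vectorSpace hχd).mfderiv
  have hlB : l'.comp B = l := by
    ext1 v
    exact congrArg l (Bi.symm_apply_apply v)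
  obtain ⟨Φ, h1, h2, h3⟩ := isLocalDiffeomorphAt_of_bijective_mfderiv
    (hU.inter (chartAt E x).open_source) hf ⟨hx, mem_chart_source E x⟩
    (by rw [hfd, hlB]; exact hl)
  exact ⟨Φ, h1, h2.trans inter_subset_left, fun y hy => (congrArg Prod.fst (h3 hy)).symm⟩

open Manifold IsManifold in
/-- A smooth map with surjective differentials is a submersion. -/
theorem isSubmersion_of_surjective_mfderiv {f : M → N} (hf : ContMDiff 𝓘(ℝ, E) 𝓘(ℝ, F) ∞ f)
    (hs : ∀ x, Surjective (mfderiv 𝓘(ℝ, E) 𝓘(ℝ, F) f x)) {c : ℕ}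
    (hc : ∀ _ : M, Module.finrank ℝ E = Module.finrank ℝ F + c) :
    IsSubmersionOfComplement (EuclideanSpace ℝ (Fin c)) 𝓘(ℝ, E) 𝓘(ℝ, F) ∞ f := by
  intro x
  have hV : IsOpen (f ⁻¹' (chartAt F (f x)).source) :=
    (chartAt F (f x)).open_source.preimage hf.continuous
  have hG : ContMDiffOn 𝓘(ℝ, E) 𝓘(ℝ, F) ∞ (chartAt F (f x) ∘ f) (f ⁻¹' (chartAt F (f x)).source) :=
    contMDiffOn_chart.comp hf.contMDiffOn fun y hy => hy
  have hfs := mem_chart_source F (f x)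
  have hsG : Surjective (mfderiv 𝓘(ℝ, E) 𝓘(ℝ, F) (chartAt F (f x) ∘ f) x) := by
    rw [mfderiv_comp (I' := 𝓘(ℝ, F)) x
      ((mdifferentiable_chart (f x)).mdifferentiableAt hfs) (hf.mdifferentiableAt (by simp))]
    exact ((mdifferentiable_chart (I := 𝓘(ℝ, F)) (f x)).mfderiv_surjective hfs).comp (hs x)
  obtain ⟨Φ, hxΦ, hΦV, hΦ⟩ := exists_partialDiffeomorph_fst hV hG hfs hsG (hc x)
  let i : E ≃L[ℝ] F × EuclideanSpace ℝ (Fin c) :=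
    ContinuousLinearEquiv.ofFinrankEq (by simp [hc x])
  let χ : OpenPartialHomeomorph M E :=
    Φ.toOpenPartialHomeomorph.trans i.symm.toHomeomorph.toOpenPartialHomeomorph
  have hχs : χ.source = Φ.source := by simp [χ]
  refine IsSubmersionAtOfComplement.mk_of_continuousAt hf.continuous.continuousAt i χ
    (chartAt F (f x)) ?_ hfs ?_ (chart_mem_maximalAtlas _) ?_
  · rw [hχs]; exact hxΦ
  · apply OpenPartialHomeomorph.mem_maximalAtlas_of_contMDiffOn
    · rw [hχs]
      exact i.symm.toContinuousLinearMap.contMDiff.comp_contMDiffOn Φ.contMDiffOn_toFun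
    · refine Φ.contMDiffOn_invFun.comp (t := Φ.target) i.toContinuousLinearMap.contMDiff.contMDiffOn ?_
      intro y hy
      simpa [χ] using hy
  · intro y hy
    have hy' : i y ∈ Φ.target := by simpa [χ] using hy
    have h1 : χ.symm y = Φ.symm (i y) := rfl
    have h2 := hΦ _ (Φ.map_target hy')
    have h3 := Φ.right_inv hy'
    simp only [comp_apply, mfld_simps]
    rw [h1]
    change (chartAt F (f x) ∘ f) (Φ.toPartialEquiv.symm (i y)) = _
    rw [← h2, h3]

end InverseFunction

/-! ### Manifold structures from families of charts -/

section Charts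

variable {H : Type*} [NormedAddCommGroup H] [NormedSpace ℝ H] {M : Type*} [TopologicalSpace M]

/-- The charted space structure defined by a family of charts whose sources cover. -/
abbrev chartedSpaceOfCharts (e : M → OpenPartialHomeomorph M H) (he : ∀ x, x ∈ (e x).source) :
    ChartedSpace H M where
  atlas := range e
  chartAt := e
  mem_chart_source := he
  chart_mem_atlas x := mem_range_self x

theorem isManifold_chartedSpaceOfCharts (e : M → OpenPartialHomeomorph M H)
    (he : ∀ x, x ∈ (e x).source)
    (hs : ∀ x y, ContDiffOn ℝ ∞ ((e x).symm.trans (e y)) ((e x).symm.trans (e y)).source) :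
    letI := chartedSpaceOfCharts e he
    IsManifold 𝓘(ℝ, H) ∞ M := by
  let _ := chartedSpaceOfCharts e he
  apply isManifold_of_contDiffOn
  rintro _ _ ⟨x, rfl⟩ ⟨y, rfl⟩
  simpa using! hs x y

end Charts

/-! ### Embedded submanifolds -/

section Submanifold

variable {E : Type*} [NormedAddCommGroup E] [NormedSpace ℝ E] [FiniteDimensional ℝ E]
  {M : Type*} [TopologicalSpace M] [ChartedSpace E M] [IsManifold 𝓘(ℝ, E) ∞ M]
  {C : Type*} [NormedAddCommGroup C] [NormedSpace ℝ C] [FiniteDimensional ℝ C]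
  {D : Type*} [NormedAddCommGroup D] [NormedSpace ℝ D] [FiniteDimensional ℝ D]

open Classical in
/-- The chart of a subset `S` of `M` given by a local diffeomorphism that flattens `S`. -/
def sliceChart (S : Set M) (p : S) (Φ : PartialDiffeomorph 𝓘(ℝ, E) 𝓘(ℝ, C × D) M (C × D) ∞)
    (hΦ : ∀ y ∈ Φ.source, y ∈ S ↔ (Φ y).1 = 0) : OpenPartialHomeomorph S D where
  toFun s := (Φ s).2
  -- Off the target the inverse takes the junk value `p`, only to be a total function.
  invFun y := if h : ((0 : C), y) ∈ Φ.target then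
      ⟨Φ.symm (0, y), (hΦ _ (Φ.map_target h)).2 (congrArg Prod.fst (Φ.right_inv h))⟩ else p
  source := Subtype.val ⁻¹' Φ.source
  target := {y | ((0 : C), y) ∈ Φ.target}
  map_source' := by
    rintro s hs
    have h1 := (hΦ s hs).1 s.2
    have h2 := Φ.map_source hs
    rwa [show Φ.toPartialEquiv s = ((0 : C), (Φ s).2) from Prod.ext h1 rfl] at h2
  map_target' := by
    rintro y (hy : _ ∈ Φ.target)
    simp only [hy, dif_pos, mem_preimage]
    exact Φ.map_target hy
  left_inv' := by
    rintro s hs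
    have h1 := (hΦ s hs).1 s.2
    have h2 := Φ.map_source hs
    have h3 : Φ.toPartialEquiv s = ((0 : C), (Φ s).2) := Prod.ext h1 rfl
    rw [h3] at h2
    simp only [h2, dif_pos]
    apply Subtype.ext
    change Φ.toPartialEquiv.symm _ = _
    rw [← h3]
    exact Φ.left_inv hs
  right_inv' := by
    rintro y (hy : _ ∈ Φ.target)
    simp only [hy, dif_pos]
    exact congrArg Prod.snd (Φ.right_inv hy)
  open_source := Φ.open_source.preimage continuous_subtype_val
  open_target := Φ.open_target.preimage (by fun_prop)
  continuousOn_toFun := continuous_snd.comp_continuousOn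
    (Φ.contMDiffOn_toFun.continuousOn.comp continuous_subtype_val.continuousOn fun s hs => hs)
  continuousOn_invFun := by
    have h1 : ContinuousOn (fun y : D => Φ.symm ((0 : C), y)) {y | ((0 : C), y) ∈ Φ.target} :=
      Φ.contMDiffOn_invFun.continuousOn.comp (by fun_prop) fun y hy => hy
    rw [Topology.IsInducing.subtypeVal.continuousOn_iff]
    refine h1.congr fun y (hy : _ ∈ Φ.target) => ?_
    simp [hy]

open Classical in
omit [FiniteDimensional ℝ E] [IsManifold 𝓘(ℝ, E) ∞ M] [FiniteDimensional ℝ C]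
  [FiniteDimensional ℝ D] in
theorem coe_sliceChart_symm (S : Set M) (p : S)
    (Φ : PartialDiffeomorph 𝓘(ℝ, E) 𝓘(ℝ, C × D) M (C × D) ∞)
    (hΦ : ∀ y ∈ Φ.source, y ∈ S ↔ (Φ y).1 = 0) {y : D} (hy : ((0 : C), y) ∈ Φ.target) :
    ((sliceChart S p Φ hΦ).symm y : M) = Φ.symm (0, y) := by
  change ((if h : ((0 : C), y) ∈ Φ.target then
      ⟨Φ.symm (0, y), (hΦ _ (Φ.map_target h)).2 (congrArg Prod.fst (Φ.right_inv h))⟩ else p : S) : M) = _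
  rw [dif_pos hy]

open Manifold IsManifold in
/-- A subset that is locally the zero set of a submersion is an embedded submanifold. -/
theorem exists_submanifold (S : Set M) {c d : ℕ}
    (hcd : S.Nonempty → Module.finrank ℝ E = c + d)
    (h : ∀ p ∈ S, ∃ U : Set M, IsOpen U ∧ p ∈ U ∧ ∃ G : M → EuclideanSpace ℝ (Fin c),
      ContMDiffOn 𝓘(ℝ, E) 𝓘(ℝ, EuclideanSpace ℝ (Fin c)) ∞ G U ∧
      Surjective (mfderiv 𝓘(ℝ, E) 𝓘(ℝ, EuclideanSpace ℝ (Fin c)) G p) ∧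
      ∀ y ∈ U, y ∈ S ↔ G y = 0) :
    ∃ (_ : ChartedSpace (EuclideanSpace ℝ (Fin d)) S), IsManifold (𝓡 d) ∞ S ∧
      IsSmoothEmbedding (𝓡 d) 𝓘(ℝ, E) ∞ (Subtype.val : S → M) := by
  have h' : ∀ p : S, ∃ Φ : PartialDiffeomorph 𝓘(ℝ, E)
      𝓘(ℝ, EuclideanSpace ℝ (Fin c) × EuclideanSpace ℝ (Fin d)) M
      (EuclideanSpace ℝ (Fin c) × EuclideanSpace ℝ (Fin d)) ∞, (p : M) ∈ Φ.source ∧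
      ∀ y ∈ Φ.source, y ∈ S ↔ (Φ y).1 = 0 := by
    intro p
    obtain ⟨U, hU, hpU, G, hG, hs, hSG⟩ := h p p.2
    obtain ⟨Φ, h1, h2, h3⟩ := exists_partialDiffeomorph_fst hU hG hpU hs (c := d)
      (by simpa using hcd ⟨p, p.2⟩)
    exact ⟨Φ, h1, fun y hy => by rw [h3 y hy]; exact hSG y (h2 hy)⟩
  choose Φ hpΦ hΦ using h'
  let e : S → OpenPartialHomeomorph S (EuclideanSpace ℝ (Fin d)) := fun p =>
    sliceChart S p (Φ p) (hΦ p)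
  have he : ∀ p, p ∈ (e p).source := hpΦ
  let i1 := chartedSpaceOfCharts e he
  have i2 : IsManifold (𝓡 d) ∞ S := by
    refine isManifold_chartedSpaceOfCharts e he fun p q => ?_
    -- A transition map between slice charts is an ambient transition map restricted to `0 × D` and
    -- projected to `D`, hence smooth.
    have h1 : ContDiffOn ℝ ∞ (fun y : EuclideanSpace ℝ (Fin d) =>
        (Φ q ((Φ p).symm (0, y))).2) {y | (0, y) ∈ (Φ p).target ∧ (Φ p).symm (0, y) ∈ (Φ q).source} := by
      rw [← contMDiffOn_iff_contDiffOn]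
      have hsnd : ContMDiff 𝓘(ℝ, EuclideanSpace ℝ (Fin c) × EuclideanSpace ℝ (Fin d)) (𝓡 d) ∞
        (fun y : EuclideanSpace ℝ (Fin c) × EuclideanSpace ℝ (Fin d) => y.2) :=
        contDiff_snd.contMDiff
      have hin : ContMDiff (𝓡 d) 𝓘(ℝ, EuclideanSpace ℝ (Fin c) × EuclideanSpace ℝ (Fin d)) ∞
        (fun y : EuclideanSpace ℝ (Fin d) => ((0 : EuclideanSpace ℝ (Fin c)), y)) :=
        (contDiff_const.prodMk contDiff_id).contMDiff
      refine hsnd.comp_contMDiffOn ((Φ q).contMDiffOn_toFun.comp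
        ((Φ p).contMDiffOn_invFun.comp hin.contMDiffOn fun y hy => hy.1) fun y hy => hy.2)
    refine (h1.congr fun y hy => ?_).mono fun y hy => ?_
    · exact congrArg (fun m => (Φ q m).2) (coe_sliceChart_symm S p (Φ p) (hΦ p) hy.1)
    · refine ⟨hy.1, ?_⟩
      have := hy.2
      change ((e p).symm y : M) ∈ (Φ q).source at this
      rwa [coe_sliceChart_symm S p (Φ p) (hΦ p) hy.1] at this
  refine ⟨i1, i2, ⟨IsImmersionOfComplement.isImmersion
    (F := EuclideanSpace ℝ (Fin c)) fun p => ?_, Topology.IsEmbedding.subtypeVal⟩⟩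
  let j : (EuclideanSpace ℝ (Fin d) × EuclideanSpace ℝ (Fin c)) ≃L[ℝ] E :=
    ContinuousLinearEquiv.ofFinrankEq (by simp [hcd ⟨p, p.2⟩, add_comm])
  let i : E ≃L[ℝ] EuclideanSpace ℝ (Fin c) × EuclideanSpace ℝ (Fin d) :=
    j.symm.trans (ContinuousLinearEquiv.prodComm ℝ _ _)
  let χ : OpenPartialHomeomorph M E :=
    (Φ p).toOpenPartialHomeomorph.trans i.symm.toHomeomorph.toOpenPartialHomeomorph
  have hχs : χ.source = (Φ p).source := by simp [χ]
  refine IsImmersionAtOfComplement.mk_of_continuousAt continuous_subtype_val.continuousAt j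
    (e p) χ (he p) (by rw [hχs]; exact hpΦ p) (chart_mem_maximalAtlas p) ?_ ?_
  · apply OpenPartialHomeomorph.mem_maximalAtlas_of_contMDiffOn
    · rw [hχs]
      exact i.symm.toContinuousLinearMap.contMDiff.comp_contMDiffOn (Φ p).contMDiffOn_toFun
    · refine (Φ p).contMDiffOn_invFun.comp (t := (Φ p).target)
        i.toContinuousLinearMap.contMDiff.contMDiffOn ?_
      intro y hy
      simpa [χ] using hy
  · intro y hy
    have hy' : ((0 : EuclideanSpace ℝ (Fin c)), y) ∈ (Φ p).target := by
      have h1 : y ∈ (e p).target := by simpa using hy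
      exact h1
    simp only [comp_apply, mfld_simps]
    rw [coe_sliceChart_symm S p (Φ p) (hΦ p) hy']
    change i.symm (Φ p ((Φ p).symm (0, y))) = j (y, 0)
    rw [show Φ p ((Φ p).symm (0, y)) = (0, y) from (Φ p).right_inv hy']
    rfl

/-- The zero set of a map that is submersive along it is an embedded submanifold. -/
theorem exists_submanifold_of_regular {V : Type*} [NormedAddCommGroup V] [NormedSpace ℝ V]
    [FiniteDimensional ℝ V] {Φ : M → V} (hΦ : ContMDiff 𝓘(ℝ, E) 𝓘(ℝ, V) ∞ Φ) {d : ℕ}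
    (hd : {x | Φ x = 0}.Nonempty → Module.finrank ℝ E = Module.finrank ℝ V + d)
    (hreg : ∀ x, Φ x = 0 → Surjective (mfderiv 𝓘(ℝ, E) 𝓘(ℝ, V) Φ x)) :
    ∃ (_ : ChartedSpace (EuclideanSpace ℝ (Fin d)) {x | Φ x = 0}),
      IsManifold (𝓡 d) ∞ {x | Φ x = 0} ∧
      Manifold.IsSmoothEmbedding (𝓡 d) 𝓘(ℝ, E) ∞ (Subtype.val : {x | Φ x = 0} → M) := by
  let i : V ≃L[ℝ] EuclideanSpace ℝ (Fin (Module.finrank ℝ V)) :=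
    ContinuousLinearEquiv.ofFinrankEq (by simp)
  refine exists_submanifold _ hd fun p hp => ⟨univ, isOpen_univ, trivial, i ∘ Φ,
    (i.toContinuousLinearMap.contMDiff.comp hΦ).contMDiffOn, ?_, ?_⟩
  · have h1 := (i.toContinuousLinearMap.hasMFDerivAt.comp p
      (hΦ.mdifferentiableAt (x := p) (by simp)).hasMFDerivAt).mfderiv
    change Surjective (mfderiv 𝓘(ℝ, E) _ (i.toContinuousLinearMap ∘ Φ) p)
    rw [h1]
    exact i.surjective.comp (hreg p hp)
  · intro y _
    simp

/-- Local equations of the fixed locus of an involution inside the zero set of an equivariant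
submersion. -/
theorem exists_equation_fixed {V : Type*} [NormedAddCommGroup V] [NormedSpace ℝ V]
    [FiniteDimensional ℝ V] {σ : M → M} (hσ : ContMDiff 𝓘(ℝ, E) 𝓘(ℝ, E) ∞ σ)
    (hinv : Involutive σ) {Φ : M → V} (hΦ : ContMDiff 𝓘(ℝ, E) 𝓘(ℝ, V) ∞ Φ) {T : V →L[ℝ] V}
    (hT : ∀ v, T (T v) = v) (hΦσ : ∀ x, Φ (σ x) = T (Φ x)) {p : M} (hp : σ p = p)
    (hs : Surjective (mfderiv 𝓘(ℝ, E) 𝓘(ℝ, V) Φ p)) {L : E →L[ℝ] E}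
    (hL : L = mfderiv 𝓘(ℝ, E) 𝓘(ℝ, E) σ p) :
    ∃ U : Set M, IsOpen U ∧ p ∈ U ∧
      ∃ G : M → LinearMap.ker (T - 1 : V →ₗ[ℝ] V) × LinearMap.ker (L + 1 : E →ₗ[ℝ] E),
      ContMDiffOn 𝓘(ℝ, E)
        𝓘(ℝ, LinearMap.ker (T - 1 : V →ₗ[ℝ] V) × LinearMap.ker (L + 1 : E →ₗ[ℝ] E)) ∞ G U ∧
      Surjective (mfderiv 𝓘(ℝ, E)
        𝓘(ℝ, LinearMap.ker (T - 1 : V →ₗ[ℝ] V) × LinearMap.ker (L + 1 : E →ₗ[ℝ] E)) G p) ∧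
      ∀ y ∈ U, (Φ y = 0 ∧ σ y = y) ↔ G y = 0 := by
  have hdσ : HasMFDerivAt 𝓘(ℝ, E) 𝓘(ℝ, E) σ p L := by
    rw [hL]; exact (hσ.mdifferentiableAt (by simp)).hasMFDerivAt
  have hLL : ∀ v, L (L v) = v := by
    have h1 : HasMFDerivAt 𝓘(ℝ, E) 𝓘(ℝ, E) σ (σ p) L := by rw [hp]; exact hdσ
    have h2 := (h1.comp p hdσ).mfderiv
    rw [hinv.comp_self, mfderiv_id] at h2
    exact fun v => (congrArg (fun A : E →L[ℝ] E => A v) h2).symm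
  have hAL : ∀ v : E, mfderiv 𝓘(ℝ, E) 𝓘(ℝ, V) Φ p (L v) = T (mfderiv 𝓘(ℝ, E) 𝓘(ℝ, V) Φ p v) := by
    have h0 := (hΦ.mdifferentiableAt (x := p) (by simp)).hasMFDerivAt
    have h1 : HasMFDerivAt 𝓘(ℝ, E) 𝓘(ℝ, V) Φ (σ p) (mfderiv 𝓘(ℝ, E) 𝓘(ℝ, V) Φ p) := by
      rw [hp]; exact h0
    have h2 := (h1.comp p hdσ).mfderiv
    have h3 := (T.hasMFDerivAt.comp p h0).mfderiv
    rw [show Φ ∘ σ = T ∘ Φ from funext hΦσ, h3] at h2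
    exact fun v => (congrArg (fun A : E →L[ℝ] V => A v) h2).symm
  obtain ⟨A, hA⟩ : ∃ A : E →L[ℝ] V, A = mfderiv 𝓘(ℝ, E) 𝓘(ℝ, V) Φ p := ⟨_, rfl⟩
  rw [← hA] at hs hAL
  replace hAL : ∀ v : E, A (L v) = T (A v) := hAL
  have hΦd : HasMFDerivAt 𝓘(ℝ, E) 𝓘(ℝ, V) Φ p A := by
    rw [hA]; exact (hΦ.mdifferentiableAt (by simp)).hasMFDerivAt
  have hcs := mem_chart_source E p
  obtain ⟨B', hB'⟩ : ∃ B' : E →L[ℝ] E, B' = mfderiv 𝓘(ℝ, E) 𝓘(ℝ, E) (chartAt E p) p := ⟨_, rfl⟩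
  have hB'b : Bijective B' := by
    rw [hB']; exact (mdifferentiable_chart p).mfderiv_bijective hcs
  -- The chart is normalised to have the identity as differential at `p`, so that `L` is the linear
  -- part of `σ` in it.
  let B : E ≃L[ℝ] E := (LinearEquiv.ofBijective (B' : E →ₗ[ℝ] E) hB'b).toContinuousLinearEquiv
  let φ : M → E := fun x => B.symm (chartAt E p x)
  have hφ : ContMDiffOn 𝓘(ℝ, E) 𝓘(ℝ, E) ∞ φ (chartAt E p).source :=
    B.symm.toContinuousLinearMap.contMDiff.comp_contMDiffOn contMDiffOn_chart
  have hφd : HasMFDerivAt 𝓘(ℝ, E) 𝓘(ℝ, E) φ p (ContinuousLinearMap.id ℝ E) := by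
    have h0 : HasMFDerivAt 𝓘(ℝ, E) 𝓘(ℝ, E) (chartAt E p) p B' := by
      rw [hB']
      exact ((mdifferentiable_chart (I := 𝓘(ℝ, E)) p).mdifferentiableAt hcs).hasMFDerivAt
    have h1 := B.symm.toContinuousLinearMap.hasMFDerivAt.comp p h0
    refine h1.congr_mfderiv ?_
    exact ContinuousLinearMap.ext fun v : E => B.symm_apply_apply v
  let W : Set M := (chartAt E p).source ∩ σ ⁻¹' (chartAt E p).source
  have hW : IsOpen W := (chartAt E p).open_source.inter
    ((chartAt E p).open_source.preimage hσ.continuous)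
  have hpW : p ∈ W := ⟨hcs, by rw [mem_preimage, hp]; exact hcs⟩
  -- Averaging the chart over the involution linearises `σ`: now `ψ ∘ σ = L ∘ ψ`, while the
  -- differential at `p` is still the identity, so `ψ` is a chart near `p`.
  let ψ : M → E := fun x => (1 / 2 : ℝ) • (φ x + L (φ (σ x)))
  have hψ : ContMDiffOn 𝓘(ℝ, E) 𝓘(ℝ, E) ∞ ψ W := by
    have h1 : ContMDiffOn 𝓘(ℝ, E) 𝓘(ℝ, E) ∞ (fun x => L (φ (σ x))) W :=
      L.contMDiff.comp_contMDiffOn (hφ.comp hσ.contMDiffOn fun x hx => hx.2)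
    exact ((1 / 2 : ℝ) • ContinuousLinearMap.id ℝ E).contMDiff.comp_contMDiffOn
      ((hφ.mono inter_subset_left).add h1)
  have hψσ : ∀ x, ψ (σ x) = L (ψ x) := by
    intro x
    simp only [ψ, hinv x, map_smul, map_add, hLL]
    rw [add_comm]
  have hψd : HasMFDerivAt 𝓘(ℝ, E) 𝓘(ℝ, E) ψ p (ContinuousLinearMap.id ℝ E) := by
    have h1 : HasMFDerivAt 𝓘(ℝ, E) 𝓘(ℝ, E) φ (σ p) (ContinuousLinearMap.id ℝ E) := by
      rw [hp]; exact hφd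
    have h2 := L.hasMFDerivAt.comp p (h1.comp p hdσ)
    have h3 := (hφd.add h2).const_smul (1 / 2 : ℝ)
    refine h3.congr_mfderiv ?_
    refine ContinuousLinearMap.ext fun v : E => ?_
    change (1 / 2 : ℝ) • (v + L (L v)) = v
    rw [hLL, ← two_smul ℝ v, smul_smul]
    norm_num
  obtain ⟨Ψ, hpΨ, hΨW, hΨ⟩ := isLocalDiffeomorphAt_of_bijective_mfderiv hW hψ hpW
    (by rw [hψd.mfderiv]; exact bijective_id)
  -- At a fixed point `Φ` takes values in the fixed space of `T`, so only that component of `Φ = 0`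
  -- is imposed. The condition `σ y = y` is the vanishing of the `(-1)`-component of `ψ`. With the
  -- redundant equations dropped, the system is submersive.
  let P1 : V →L[ℝ] LinearMap.ker (T - 1 : V →ₗ[ℝ] V) :=
    ((1 / 2 : ℝ) • (ContinuousLinearMap.id ℝ V + T)).codRestrict _ (by
      intro v
      simp [hT, add_comm])
  let P2 : E →L[ℝ] LinearMap.ker (L + 1 : E →ₗ[ℝ] E) :=
    ((1 / 2 : ℝ) • (ContinuousLinearMap.id ℝ E - L)).codRestrict _ (by
      intro v
      simp [hLL])
  have hP1 : ∀ v, T v = v → (P1 v : V) = v := by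
    intro v hv
    change (1 / 2 : ℝ) • (v + T v) = v
    rw [hv, ← two_smul ℝ v, smul_smul]
    norm_num
  have hP2 : ∀ v, L v = -v → (P2 v : E) = v := by
    intro v hv
    change (1 / 2 : ℝ) • (v - L v) = v
    rw [hv, sub_neg_eq_add, ← two_smul ℝ v, smul_smul]
    norm_num
  have hGd := (P1.hasMFDerivAt.comp p hΦd).prodMk_vectorSpace (P2.hasMFDerivAt.comp p hψd)
  refine ⟨Ψ.source ∩ σ ⁻¹' Ψ.source, Ψ.open_source.inter (Ψ.open_source.preimage hσ.continuous),
    ⟨hpΨ, by rw [mem_preimage, hp]; exact hpΨ⟩, fun y => (P1 (Φ y), P2 (ψ y)), ?_, ?_, ?_⟩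
  · exact (P1.contMDiff.comp hΦ).contMDiffOn.prodMk_space
      (P2.contMDiff.comp_contMDiffOn (hψ.mono (inter_subset_left.trans hΨW)))
  · rw [show mfderiv 𝓘(ℝ, E) _ (fun y => (P1 (Φ y), P2 (ψ y))) p = _ from hGd.mfderiv]
    rintro ⟨⟨v, hv⟩, ⟨w, hw⟩⟩
    have hv' : T v = v := by simpa [sub_eq_zero] using hv
    have hw' : L w = -w := by simpa [add_eq_zero_iff_eq_neg] using hw
    obtain ⟨u, hu⟩ : ∃ u : E, A u = v := hs v
    -- Averaging a preimage over `L` keeps its image `v`, which `T` fixes, and removes its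
    -- `(-1)`-component.
    let u' : E := (1 / 2 : ℝ) • (u + L u)
    have h1 : A u' = v := by
      simp only [u', map_smul, map_add, hAL, hu, hv', ← two_smul ℝ v, smul_smul]
      norm_num
    have h2 : L u' = u' := by
      simp only [u', map_smul, map_add, hLL, add_comm]
    refine ⟨u' + w, Prod.ext (Subtype.ext ?_) (Subtype.ext ?_)⟩
    · change (P1 (A (u' + w)) : V) = v
      change (1 / 2 : ℝ) • (A (u' + w) + T (A (u' + w))) = v
      rw [map_add, h1, map_add, hv', show T (A w) = -A w by rw [← hAL, hw', map_neg]]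
      rw [show v + A w + (v + -A w) = (2 : ℝ) • v by rw [two_smul]; abel, smul_smul]
      norm_num
    · change (1 / 2 : ℝ) • ((u' + w) - L (u' + w)) = w
      rw [map_add, h2, hw', show u' + w - (u' + -w) = (2 : ℝ) • w by rw [two_smul]; abel, smul_smul]
      norm_num
  · rintro y ⟨hy1, hy2⟩
    have key : P2 (ψ y) = 0 ↔ σ y = y := by
      have h1 : P2 (ψ y) = 0 ↔ ψ y = ψ (σ y) := by
        rw [← Subtype.coe_inj]
        change (1 / 2 : ℝ) • (ψ y - L (ψ y)) = 0 ↔ _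
        rw [smul_eq_zero, sub_eq_zero, hψσ]
        norm_num
      rw [h1]
      constructor
      · intro h
        rw [hΨ hy1, hΨ hy2] at h
        exact (Ψ.injOn hy1 hy2 h).symm
      · intro h
        rw [h]
    constructor
    · rintro ⟨h1, h2⟩
      exact Prod.ext (by simp [h1]) (key.2 h2)
    · intro h
      have h2 : σ y = y := key.1 (congrArg Prod.snd h)
      have h3 : P1 (Φ y) = 0 := congrArg Prod.fst h
      have h4 := hP1 (Φ y) (by rw [← hΦσ, h2])
      rw [h3] at h4
      exact ⟨h4.symm, h2⟩

/-- The fixed locus of an involution, inside the zero set of an equivariant submersion, is an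
embedded submanifold. -/
theorem exists_submanifold_fixed {V : Type*} [NormedAddCommGroup V] [NormedSpace ℝ V]
    [FiniteDimensional ℝ V] {σ : M → M} (hσ : ContMDiff 𝓘(ℝ, E) 𝓘(ℝ, E) ∞ σ)
    (hinv : Involutive σ) {Φ : M → V} (hΦ : ContMDiff 𝓘(ℝ, E) 𝓘(ℝ, V) ∞ Φ) {T : V →L[ℝ] V}
    (hT : ∀ v, T (T v) = v) (hΦσ : ∀ x, Φ (σ x) = T (Φ x)) (S : Set M)
    (hS : ∀ x, x ∈ S ↔ Φ x = 0 ∧ σ x = x)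
    (hs : ∀ x ∈ S, Surjective (mfderiv 𝓘(ℝ, E) 𝓘(ℝ, V) Φ x)) {b d : ℕ}
    (hb : ∀ x ∈ S, ∀ L : E →L[ℝ] E, L = mfderiv 𝓘(ℝ, E) 𝓘(ℝ, E) σ x →
      Module.finrank ℝ (LinearMap.ker (L + 1 : E →ₗ[ℝ] E)) = b)
    (hd : S.Nonempty → Module.finrank ℝ E =
      Module.finrank ℝ (LinearMap.ker (T - 1 : V →ₗ[ℝ] V)) + b + d) :
    ∃ (_ : ChartedSpace (EuclideanSpace ℝ (Fin d)) S), IsManifold (𝓡 d) ∞ S ∧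
      Manifold.IsSmoothEmbedding (𝓡 d) 𝓘(ℝ, E) ∞ (Subtype.val : S → M) := by
  refine exists_submanifold S hd fun p hp => ?_
  obtain ⟨hp0, hpσ⟩ := (hS p).1 hp
  obtain ⟨L, hL⟩ : ∃ L : E →L[ℝ] E, L = mfderiv 𝓘(ℝ, E) 𝓘(ℝ, E) σ p := ⟨_, rfl⟩
  obtain ⟨U, hU, hpU, G, hG, hsG, hGS⟩ := exists_equation_fixed hσ hinv hΦ hT hΦσ hpσ (hs p hp) hL
  let i : (LinearMap.ker (T - 1 : V →ₗ[ℝ] V) × LinearMap.ker (L + 1 : E →ₗ[ℝ] E)) ≃L[ℝ]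
      EuclideanSpace ℝ (Fin (Module.finrank ℝ (LinearMap.ker (T - 1 : V →ₗ[ℝ] V)) + b)) :=
    ContinuousLinearEquiv.ofFinrankEq (by rw [Module.finrank_prod, hb p hp L hL]; simp)
  refine ⟨U, hU, hpU, i ∘ G, i.toContinuousLinearMap.contMDiff.comp_contMDiffOn hG, ?_, ?_⟩
  · have h1 := (i.toContinuousLinearMap.hasMFDerivAt.comp p
      ((hG.contMDiffAt (hU.mem_nhds hpU)).mdifferentiableAt (by simp)).hasMFDerivAt).mfderiv
    change Surjective (mfderiv 𝓘(ℝ, E) _ (i.toContinuousLinearMap ∘ G) p)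
    rw [h1]
    exact i.surjective.comp hsG
  · intro y hy
    rw [hS, hGS y hy]
    simp

end Submanifold

/-! ### Quotients by free actions of compact Lie groups -/

section LinearComplement

variable {E : Type*} [NormedAddCommGroup E] [NormedSpace ℝ E] [FiniteDimensional ℝ E]
  {F : Type*} [NormedAddCommGroup F] [NormedSpace ℝ F] [FiniteDimensional ℝ F]

/-- An injective linear map can be completed to a linear isomorphism from a product. -/
theorem exists_bijective_coprod_of_injective {A : E →L[ℝ] F} (hA : Injective A) {n : ℕ}
    (hn : Module.finrank ℝ F = Module.finrank ℝ E + n) :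
    ∃ l : EuclideanSpace ℝ (Fin n) →L[ℝ] F, Bijective (A.coprod l) := by
  obtain ⟨p, hp⟩ := Submodule.exists_isCompl (LinearMap.range (A : E →ₗ[ℝ] F))
  have hr : Module.finrank ℝ (LinearMap.range (A : E →ₗ[ℝ] F)) = Module.finrank ℝ E :=
    LinearMap.finrank_range_of_inj hA
  have hpn : Module.finrank ℝ p = n := by
    have := Submodule.finrank_add_eq_of_isCompl hp
    omega
  let i : EuclideanSpace ℝ (Fin n) ≃ₗ[ℝ] p := LinearEquiv.ofFinrankEq _ _ (by simp [hpn])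
  let l : EuclideanSpace ℝ (Fin n) →ₗ[ℝ] F := p.subtype ∘ₗ i.toLinearMap
  refine ⟨LinearMap.toContinuousLinearMap l, ?_⟩
  have hinj : Injective (A.coprod (LinearMap.toContinuousLinearMap l)) := by
    rw [injective_iff_map_eq_zero]
    rintro ⟨x, y⟩ hxy
    have h1 : A x + l y = 0 := by simpa using hxy
    have h2 : l y ∈ LinearMap.range (A : E →ₗ[ℝ] F) ⊓ p := by
      refine ⟨⟨-x, ?_⟩, (i y).2⟩
      change A (-x) = l y
      rw [map_neg]; exact (eq_neg_of_add_eq_zero_right h1).symm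
    rw [hp.inf_eq_bot] at h2
    have h3 : l y = 0 := by simpa using h2
    have h4 : y = 0 := by
      apply i.injective
      simpa [l] using h3
    rw [h3, add_zero] at h1
    exact Prod.ext (hA (by simpa using h1)) h4
  have hd : Module.finrank ℝ (E × EuclideanSpace ℝ (Fin n)) = Module.finrank ℝ F := by
    simp [hn]
  exact ⟨hinj, (LinearMap.injective_iff_surjective_of_finrank_eq_finrank
    (f := (A.coprod (LinearMap.toContinuousLinearMap l) :
      E × EuclideanSpace ℝ (Fin n) →ₗ[ℝ] F)) hd).1 hinj⟩

end LinearComplement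

/-! ### Slices and charts of the orbit space -/

section Quotient

variable {F : Type*} [NormedAddCommGroup F] [NormedSpace ℝ F] [FiniteDimensional ℝ F]
  {Z : Type*} [TopologicalSpace Z] [ChartedSpace F Z] [IsManifold 𝓘(ℝ, F) ∞ Z]
  {EK : Type*} [NormedAddCommGroup EK] [NormedSpace ℝ EK] [FiniteDimensional ℝ EK]
  {K : Type*} [TopologicalSpace K] [ChartedSpace EK K] [Group K]
  [MulAction K Z] {Q : Type*} [TopologicalSpace Q] {π : Z → Q}

/-- If a compact group acts continuously and freely, then elements that move some point close to
`z` to a point close to `z` are close to `1`. -/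
theorem exists_nhds_forall_smul_mem [T2Space Z] [CompactSpace K] [ContinuousSMul K Z]
    (hfree : ∀ (z : Z) (k : K), k • z = z → k = 1) (z : Z) {N : Set K} (hN : IsOpen N)
    (h1 : 1 ∈ N) : ∃ V : Set Z, IsOpen V ∧ z ∈ V ∧ ∀ p ∈ V, ∀ k : K, k • p ∈ V → k ∈ N := by
  -- The triples with `k p ≠ q` form an open set, which contains `Nᶜ × {(z, z)}` by freeness. Since
  -- `Nᶜ` is compact, the tube lemma thickens `(z, z)` to a neighbourhood.
  let O : Set (K × (Z × Z)) := {x | x.1 • x.2.1 ≠ x.2.2}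
  have hO : IsOpen O := by
    have h1 : Continuous fun x : K × (Z × Z) => x.1 • x.2.1 :=
      continuous_fst.smul (continuous_fst.comp continuous_snd)
    exact isOpen_ne_fun h1 (continuous_snd.comp continuous_snd)
  have hsub : Nᶜ ×ˢ ({(z, z)} : Set (Z × Z)) ⊆ O := by
    rintro ⟨k, p⟩ ⟨hk, hp⟩
    rw [mem_singleton_iff] at hp
    subst hp
    intro h
    exact hk (by rw [hfree z k h]; exact h1)
  obtain ⟨u, v, hu, hv, huN, hzv, huv⟩ :=
    generalized_tube_lemma hN.isClosed_compl.isCompact isCompact_singleton hO hsub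
  have hzv' : v ∈ 𝓝 (z, z) := hv.mem_nhds (hzv rfl)
  rw [nhds_prod_eq, Filter.mem_prod_self_iff] at hzv'
  obtain ⟨V', hV', hVv⟩ := hzv'
  obtain ⟨V, hVV, hVo, hzV⟩ := mem_nhds_iff.1 hV'
  refine ⟨V, hVo, hzV, fun p hp k hkp => ?_⟩
  by_contra hk
  have h2 : ((k, (p, k • p)) : K × (Z × Z)) ∈ O :=
    huv ⟨huN (mem_compl hk), hVv ⟨hVV hp, hVV hkp⟩⟩
  exact h2 rfl

variable [LieGroup 𝓘(ℝ, EK) ∞ K]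

/-- The local slice of the action at `z`: a local diffeomorphism `(a, w) ↦ k(a) • s(w)`. -/
theorem exists_slice
    (hact : ContMDiff (𝓘(ℝ, EK).prod 𝓘(ℝ, F)) 𝓘(ℝ, F) ∞ fun p : K × Z => p.1 • p.2)
    (z : Z) (hinf : Injective (mfderiv 𝓘(ℝ, EK) 𝓘(ℝ, F) (fun k : K => k • z) 1)) {n : ℕ}
    (hn : Module.finrank ℝ F = Module.finrank ℝ EK + n) :
    ∃ (s : EuclideanSpace ℝ (Fin n) → Z)
      (Φ : PartialDiffeomorph 𝓘(ℝ, EK × EuclideanSpace ℝ (Fin n)) 𝓘(ℝ, F)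
        (EK × EuclideanSpace ℝ (Fin n)) Z ∞),
      s 0 = z ∧ (0, 0) ∈ Φ.source ∧
      ∀ p ∈ Φ.source, chartAt EK (1 : K) 1 + p.1 ∈ (chartAt EK (1 : K)).target ∧
        Φ p = (chartAt EK (1 : K)).symm (chartAt EK (1 : K) 1 + p.1) • s p.2 := by
  have hK1 := mem_chart_source EK (1 : K)
  have hz1 := mem_chart_source F z
  have hKt : chartAt EK (1 : K) 1 ∈ (chartAt EK (1 : K)).target := (chartAt EK 1).map_source hK1
  have hzt : chartAt F z z ∈ (chartAt F z).target := (chartAt F z).map_source hz1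
  obtain ⟨CK, hCK⟩ : ∃ CK : EK →L[ℝ] EK, CK = mfderiv 𝓘(ℝ, EK) 𝓘(ℝ, EK)
    (chartAt EK (1 : K)).symm (chartAt EK (1 : K) 1) := ⟨_, rfl⟩
  obtain ⟨Cz, hCz⟩ : ∃ Cz : F →L[ℝ] F, Cz = mfderiv 𝓘(ℝ, F) 𝓘(ℝ, F)
    (chartAt F z).symm (chartAt F z z) := ⟨_, rfl⟩
  obtain ⟨B, hB⟩ : ∃ B : EK →L[ℝ] F, B = mfderiv 𝓘(ℝ, EK) 𝓘(ℝ, F) (fun k : K => k • z) 1 :=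
    ⟨_, rfl⟩
  rw [← hB] at hinf
  have hCKb : Bijective CK := by
    rw [hCK]; exact (mdifferentiable_chart (I := 𝓘(ℝ, EK)) (1 : K)).symm.mfderiv_bijective hKt
  have hCzb : Bijective Cz := by
    rw [hCz]; exact (mdifferentiable_chart (I := 𝓘(ℝ, F)) z).symm.mfderiv_bijective hzt
  obtain ⟨l0, hl0⟩ := exists_bijective_coprod_of_injective (A := B.comp CK)
    (hinf.comp hCKb.1) hn
  let Cze : F ≃L[ℝ] F := (LinearEquiv.ofBijective (Cz : F →ₗ[ℝ] F) hCzb).toContinuousLinearEquiv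
  -- Chosen so that the slice `s` has differential `l0` at the origin, a complement to the tangent
  -- space of the orbit.
  let l : EuclideanSpace ℝ (Fin n) →L[ℝ] F := Cze.symm.toContinuousLinearMap.comp l0
  have hCl : ∀ w, Cz (l w) = l0 w := fun w => Cze.apply_symm_apply (l0 w)
  let kk : EK → K := fun a => (chartAt EK (1 : K)).symm (chartAt EK (1 : K) 1 + a)
  let s : EuclideanSpace ℝ (Fin n) → Z := fun w => (chartAt F z).symm (chartAt F z z + l w)
  have hkk0 : kk 0 = 1 := by simp [kk]
  have hs0 : s 0 = z := by simp [s]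
  let OK : Set EK := {a | chartAt EK (1 : K) 1 + a ∈ (chartAt EK (1 : K)).target}
  let OZ : Set (EuclideanSpace ℝ (Fin n)) := {w | chartAt F z z + l w ∈ (chartAt F z).target}
  have hOK : IsOpen OK := (chartAt EK (1 : K)).open_target.preimage (by fun_prop)
  have hOZ : IsOpen OZ := (chartAt F z).open_target.preimage (by fun_prop)
  have h0K : (0 : EK) ∈ OK := by simp [OK]
  have h0Z : (0 : EuclideanSpace ℝ (Fin n)) ∈ OZ := by simp [OZ]
  have hkk : ContMDiffOn 𝓘(ℝ, EK) 𝓘(ℝ, EK) ∞ kk OK :=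
    contMDiffOn_chart_symm.comp (contDiff_const.add contDiff_id).contMDiff.contMDiffOn
      fun a ha => ha
  have hs : ContMDiffOn 𝓘(ℝ, EuclideanSpace ℝ (Fin n)) 𝓘(ℝ, F) ∞ s OZ :=
    contMDiffOn_chart_symm.comp (contDiff_const.add l.contDiff).contMDiff.contMDiffOn
      fun a ha => ha
  let Θ : EK × EuclideanSpace ℝ (Fin n) → Z := fun p => kk p.1 • s p.2
  have hO : IsOpen (OK ×ˢ OZ) := hOK.prod hOZ
  have hΘ : ContMDiffOn 𝓘(ℝ, EK × EuclideanSpace ℝ (Fin n)) 𝓘(ℝ, F) ∞ Θ (OK ×ˢ OZ) := by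
    have h1 : ContMDiffOn 𝓘(ℝ, EK × EuclideanSpace ℝ (Fin n)) 𝓘(ℝ, EK) ∞
        (fun p : EK × EuclideanSpace ℝ (Fin n) => kk p.1) (OK ×ˢ OZ) :=
      hkk.comp contDiff_fst.contMDiff.contMDiffOn fun p hp => hp.1
    have h2 : ContMDiffOn 𝓘(ℝ, EK × EuclideanSpace ℝ (Fin n)) 𝓘(ℝ, F) ∞
        (fun p : EK × EuclideanSpace ℝ (Fin n) => s p.2) (OK ×ˢ OZ) :=
      hs.comp contDiff_snd.contMDiff.contMDiffOn fun p hp => hp.2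
    exact hact.comp_contMDiffOn (h1.prodMk h2)
  have h00 : ((0 : EK), (0 : EuclideanSpace ℝ (Fin n))) ∈ OK ×ˢ OZ := ⟨h0K, h0Z⟩
  obtain ⟨D, hD⟩ : ∃ D : EK × EuclideanSpace ℝ (Fin n) →L[ℝ] F,
      HasMFDerivAt 𝓘(ℝ, EK × EuclideanSpace ℝ (Fin n)) 𝓘(ℝ, F) Θ (0, 0) D :=
    ⟨_, ((hΘ.contMDiffAt (hO.mem_nhds h00)).mdifferentiableAt (by simp)).hasMFDerivAt⟩
  have hD1 : D.comp (ContinuousLinearMap.inl ℝ EK (EuclideanSpace ℝ (Fin n))) = B.comp CK := by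
    have h1 : HasMFDerivAt 𝓘(ℝ, EK) 𝓘(ℝ, EK × EuclideanSpace ℝ (Fin n))
        (ContinuousLinearMap.inl ℝ EK (EuclideanSpace ℝ (Fin n))) 0
        (ContinuousLinearMap.inl ℝ EK (EuclideanSpace ℝ (Fin n))) :=
      ContinuousLinearMap.hasMFDerivAt _
    have h2 := (HasMFDerivAt.comp (g := Θ) (0 : EK) hD h1).mfderiv
    have h3 : HasMFDerivAt 𝓘(ℝ, EK) 𝓘(ℝ, EK) kk 0 CK := by
      have h4 : HasMFDerivAt 𝓘(ℝ, EK) 𝓘(ℝ, EK) (chartAt EK (1 : K)).symm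
          (chartAt EK (1 : K) 1 + 0) CK := by
        rw [add_zero, hCK]
        exact ((mdifferentiable_chart (I := 𝓘(ℝ, EK)) (1 : K)).mdifferentiableAt_symm hKt).hasMFDerivAt
      have h5 : HasMFDerivAt 𝓘(ℝ, EK) 𝓘(ℝ, EK) (fun a : EK => chartAt EK (1 : K) 1 + a) 0
          (ContinuousLinearMap.id ℝ EK) := ((hasFDerivAt_id (𝕜 := ℝ) (0 : EK)).const_add _).hasMFDerivAt
      exact h4.comp (0 : EK) h5
    have h6 : HasMFDerivAt 𝓘(ℝ, EK) 𝓘(ℝ, F) (fun k : K => k • z) (kk 0) B := by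
      rw [hkk0, hB]
      exact ((hact.comp (contMDiff_id.prodMk contMDiff_const)).mdifferentiableAt (by simp)).hasMFDerivAt
    have h7 := (h6.comp (0 : EK) h3).mfderiv
    have h8 : Θ ∘ ContinuousLinearMap.inl ℝ EK (EuclideanSpace ℝ (Fin n)) =
        (fun k : K => k • z) ∘ kk := by
      funext a
      simp [Θ, hs0]
    rw [h8] at h2
    exact h2.symm.trans h7
  have hD2 : D.comp (ContinuousLinearMap.inr ℝ EK (EuclideanSpace ℝ (Fin n))) = l0 := by
    have h1 : HasMFDerivAt 𝓘(ℝ, EuclideanSpace ℝ (Fin n)) 𝓘(ℝ, EK × EuclideanSpace ℝ (Fin n))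
        (ContinuousLinearMap.inr ℝ EK (EuclideanSpace ℝ (Fin n))) 0
        (ContinuousLinearMap.inr ℝ EK (EuclideanSpace ℝ (Fin n))) :=
      ContinuousLinearMap.hasMFDerivAt _
    have h2 : mfderiv 𝓘(ℝ, EuclideanSpace ℝ (Fin n)) 𝓘(ℝ, F) (fun w => Θ (0, w)) 0 =
        D.comp (ContinuousLinearMap.inr ℝ EK (EuclideanSpace ℝ (Fin n))) :=
      (HasMFDerivAt.comp (g := Θ) (0 : EuclideanSpace ℝ (Fin n)) hD h1).mfderiv
    have h3 : HasMFDerivAt 𝓘(ℝ, EuclideanSpace ℝ (Fin n)) 𝓘(ℝ, F) s 0 l0 := by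
      have h4 : HasMFDerivAt 𝓘(ℝ, F) 𝓘(ℝ, F) (chartAt F z).symm (chartAt F z z + l 0) Cz := by
        rw [map_zero, add_zero, hCz]
        exact ((mdifferentiable_chart (I := 𝓘(ℝ, F)) z).mdifferentiableAt_symm hzt).hasMFDerivAt
      have h5 : HasMFDerivAt 𝓘(ℝ, EuclideanSpace ℝ (Fin n)) 𝓘(ℝ, F)
          (fun w => chartAt F z z + l w) 0 l := (l.hasFDerivAt.const_add _).hasMFDerivAt
      refine (h4.comp (0 : EuclideanSpace ℝ (Fin n)) h5).congr_mfderiv ?_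
      exact ContinuousLinearMap.ext hCl
    have h8 : (fun w => Θ (0, w)) = s := by
      funext a
      simp [Θ, hkk0]
    rw [h8] at h2
    exact h2.symm.trans h3.mfderiv
  have hDeq : D = (B.comp CK).coprod l0 := by
    rw [← hD1, ← hD2]
    ext p <;> simp
  obtain ⟨Φ, h1, h2, h3⟩ := isLocalDiffeomorphAt_of_bijective_mfderiv hO hΘ h00
    (by rw [hD.mfderiv, hDeq]; exact hl0)
  exact ⟨s, Φ, hs0, h1, fun p hp => ⟨(h2 hp).1, (h3 hp).symm⟩⟩

/-- A chart of the quotient around the orbit of `z`, with a smooth local section. -/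
theorem exists_quotient_chart [T2Space Z] [CompactSpace K]
    (hact : ContMDiff (𝓘(ℝ, EK).prod 𝓘(ℝ, F)) 𝓘(ℝ, F) ∞ fun p : K × Z => p.1 • p.2)
    (hfree : ∀ (z : Z) (k : K), k • z = z → k = 1)
    (hinf : ∀ z : Z, Injective (mfderiv 𝓘(ℝ, EK) 𝓘(ℝ, F) (fun k : K => k • z) 1))
    (hπ : IsOpenQuotientMap π) (hπK : ∀ z z', π z = π z' ↔ ∃ k : K, k • z = z') {n : ℕ}
    (hn : Module.finrank ℝ F = Module.finrank ℝ EK + n) (z : Z) :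
    ∃ (e : OpenPartialHomeomorph Q (EuclideanSpace ℝ (Fin n))) (s : EuclideanSpace ℝ (Fin n) → Z),
      π z ∈ e.source ∧ ContMDiffOn 𝓘(ℝ, F) (𝓡 n) ∞ (e ∘ π) (π ⁻¹' e.source) ∧
      ContMDiffOn (𝓡 n) 𝓘(ℝ, F) ∞ s e.target ∧ ∀ y ∈ e.target, π (s y) = e.symm y := by
  have hcs : ContinuousSMul K Z := ⟨hact.continuous⟩
  obtain ⟨s, Φ, hs0, h0, hΦ⟩ := exists_slice hact z (hinf z) hn
  obtain ⟨A, W, hA, hW, h0A, h0W, hAW⟩ :=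
    isOpen_prod_iff.1 Φ.open_source 0 0 h0
  -- Group elements with coordinate in `A`: for them `k • s w` is a value of `Φ` on `A × W`, where
  -- `Φ` is injective.
  let N : Set K := (chartAt EK (1 : K)).source ∩
    (chartAt EK (1 : K)) ⁻¹' {b | b - chartAt EK (1 : K) 1 ∈ A}
  have hN : IsOpen N := (chartAt EK (1 : K)).isOpen_inter_preimage (hA.preimage (by fun_prop))
  have h1N : (1 : K) ∈ N := ⟨mem_chart_source _ _, by simpa using h0A⟩
  obtain ⟨V, hV, hzV, hVN⟩ := exists_nhds_forall_smul_mem hfree z hN h1N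
  have hsΦ : ∀ w ∈ W, s w = Φ (0, w) := by
    intro w hw
    rw [(hΦ (0, w) (hAW ⟨h0A, hw⟩)).2]
    simp
  have hΦc : ContMDiffOn 𝓘(ℝ, EK × EuclideanSpace ℝ (Fin n)) 𝓘(ℝ, F) ∞ Φ Φ.source :=
    Φ.contMDiffOn_toFun
  have hsW : ContMDiffOn (𝓡 n) 𝓘(ℝ, F) ∞ s W := by
    refine (hΦc.comp (t := Φ.source) (f := fun w : EuclideanSpace ℝ (Fin n) => ((0 : EK), w))
      (contDiff_const.prodMk contDiff_id).contMDiff.contMDiffOn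
      fun w hw => hAW ⟨h0A, hw⟩).congr fun w hw => hsΦ w hw
  let W0 : Set (EuclideanSpace ℝ (Fin n)) := W ∩ s ⁻¹' V
  have hW0 : IsOpen W0 := hsW.continuousOn.isOpen_inter_preimage hW hV
  have h0W0 : (0 : EuclideanSpace ℝ (Fin n)) ∈ W0 := ⟨h0W, by rw [mem_preimage, hs0]; exact hzV⟩
  -- Two slice points in one orbit differ by some `k ∈ N` with coordinate `a`, so `Φ (a, w) = Φ (0,
  -- w')` and injectivity of `Φ` gives `w = w'`.
  have hinj : InjOn (π ∘ s) W0 := by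
    rintro w ⟨hw, hwV⟩ w' ⟨hw', hwV'⟩ h
    obtain ⟨k, hk⟩ := (hπK _ _).1 h
    have hkN : k ∈ N := hVN (s w) hwV k (by rw [hk]; exact hwV')
    let a := chartAt EK (1 : K) k - chartAt EK (1 : K) 1
    have haA : a ∈ A := hkN.2
    have h2 := (hΦ (a, w) (hAW ⟨haA, hw⟩)).2
    have h3 : chartAt EK (1 : K) 1 + a = chartAt EK (1 : K) k := by simp [a]
    rw [h3, (chartAt EK (1 : K)).left_inv hkN.1, hk, hsΦ w' hw'] at h2
    exact congrArg Prod.snd (Φ.injOn (hAW ⟨haA, hw⟩) (hAW ⟨h0A, hw'⟩) h2)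
  have himg : ∀ O ⊆ W, π '' (Φ '' (A ×ˢ O)) = π '' (s '' O) := by
    intro O hO
    apply Subset.antisymm
    · rintro _ ⟨_, ⟨⟨a, w⟩, ⟨ha, hw⟩, rfl⟩, rfl⟩
      refine ⟨s w, ⟨w, hw, rfl⟩, ?_⟩
      exact (hπK _ _).2 ⟨_, (hΦ (a, w) (hAW ⟨ha, hO hw⟩)).2.symm⟩
    · rintro _ ⟨_, ⟨w, hw, rfl⟩, rfl⟩
      exact ⟨s w, ⟨(0, w), ⟨h0A, hw⟩, (hsΦ w (hO hw)).symm⟩, rfl⟩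
  -- In the quotient the image of a slice piece equals that of `Φ '' (A ×ˢ O)`, which is open in
  -- `Z`, and the projection is open.
  have hopen : ∀ O : Set (EuclideanSpace ℝ (Fin n)), IsOpen O → O ⊆ W → IsOpen (π '' (s '' O)) := by
    intro O hO hOW
    rw [← himg O hOW]
    refine hπ.isOpenMap _ (Φ.toOpenPartialHomeomorph.isOpen_image_of_subset_source
      (hA.prod hO) fun p hp => hAW ⟨hp.1, hOW hp.2⟩)
  let e0 : OpenPartialHomeomorph (EuclideanSpace ℝ (Fin n)) Q :=
    OpenPartialHomeomorph.ofContinuousOpenRestrict (hinj.toPartialEquiv (π ∘ s) W0)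
      (hπ.continuous.comp_continuousOn (hsW.continuousOn.mono inter_subset_left)) (by
        intro O hO
        have h2 : (W0.domRestrict (π ∘ s)) '' O = π '' (s '' (Subtype.val '' O)) := by
          simp only [image_image]; rfl
        exact h2 ▸ hopen _ (hW0.isOpenMap_subtype_val _ hO) (by
          rintro _ ⟨w, _, rfl⟩; exact w.2.1)) hW0
  have he0 : ∀ w, e0 w = π (s w) := fun w => rfl
  have hes : e0.source = W0 := rfl
  refine ⟨e0.symm, s, ?_, ?_, hsW.mono inter_subset_left, fun y _ => rfl⟩
  · have := e0.map_source h0W0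
    rwa [he0, hs0] at this
  · intro p hp
    have hp' : π p ∈ e0.target := hp
    obtain ⟨w0, hw0, hw0p⟩ : ∃ w ∈ W0, π (s w) = π p :=
      ⟨e0.symm (π p), e0.map_target hp', e0.right_inv hp'⟩
    obtain ⟨k, hk⟩ := (hπK _ _).1 hw0p
    have hkp : k⁻¹ • p = Φ (0, w0) := by
      rw [← hk, inv_smul_smul, hsΦ w0 hw0.1]
    have hΦ0 : ((0 : EK), w0) ∈ Φ.source := hAW ⟨h0A, hw0.1⟩
    have hkinv : ContMDiff 𝓘(ℝ, F) 𝓘(ℝ, F) ∞ (fun p : Z => k⁻¹ • p) :=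
      hact.comp (contMDiff_const.prodMk contMDiff_id)
    have hsymm : ContMDiffAt 𝓘(ℝ, F) 𝓘(ℝ, EK × EuclideanSpace ℝ (Fin n)) ∞
        Φ.toPartialEquiv.symm (k⁻¹ • p) := by
      refine Φ.contMDiffOn_invFun.contMDiffAt (Φ.open_target.mem_nhds ?_)
      rw [hkp]
      exact Φ.map_source hΦ0
    have hinvp : Φ.toPartialEquiv.symm (k⁻¹ • p) = (0, w0) := by
      rw [hkp]; exact Φ.left_inv hΦ0
    -- After a translation by `k⁻¹` into the range of `Φ`, the quotient chart reads off the slice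
    -- coordinate of `Φ⁻¹`, which is smooth.
    have hf : ContMDiffAt 𝓘(ℝ, F) (𝓡 n) ∞
        (fun p => (Φ.toPartialEquiv.symm (k⁻¹ • p)).2) p :=
      (contDiff_snd.contMDiff (E := EK × EuclideanSpace ℝ (Fin n))).contMDiffAt.comp p
        (hsymm.comp p hkinv.contMDiffAt)
    refine (hf.congr_of_eventuallyEq ?_).contMDiffWithinAt
    have hev1 : ∀ᶠ p' in 𝓝 p, k⁻¹ • p' ∈ Φ.target := by
      refine hkinv.continuous.continuousAt.eventually_mem (Φ.open_target.mem_nhds ?_)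
      rw [hkp]
      exact Φ.map_source hΦ0
    have hev2 : ∀ᶠ p' in 𝓝 p, Φ.toPartialEquiv.symm (k⁻¹ • p') ∈ A ×ˢ W0 := by
      refine (hsymm.comp p hkinv.contMDiffAt).continuousAt.eventually_mem ((hA.prod hW0).mem_nhds ?_)
      rw [comp_apply, hinvp]
      exact ⟨h0A, hw0⟩
    filter_upwards [hev1, hev2] with p' h1 h2
    have h3 : Φ (Φ.toPartialEquiv.symm (k⁻¹ • p')) = k⁻¹ • p' := Φ.right_inv h1
    rw [(hΦ _ (hAW ⟨h2.1, h2.2.1⟩)).2] at h3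
    have h4 : π p' = π (s (Φ.toPartialEquiv.symm (k⁻¹ • p')).2) := by
      refine ((hπK _ _).2 ⟨_, h3⟩ |>.trans ?_).symm
      exact (hπK _ _).2 ⟨k, smul_inv_smul k p'⟩
    change e0.symm (π p') = _
    rw [h4, ← he0]
    exact e0.left_inv h2.2

/-- The quotient of a manifold by a free action of a compact Lie group is a manifold, and the
projection is a submersion. -/
theorem exists_quotient_manifold [T2Space Z] [CompactSpace K]
    (hact : ContMDiff (𝓘(ℝ, EK).prod 𝓘(ℝ, F)) 𝓘(ℝ, F) ∞ fun p : K × Z => p.1 • p.2)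
    (hfree : ∀ (z : Z) (k : K), k • z = z → k = 1)
    (hinf : ∀ z : Z, Injective (mfderiv 𝓘(ℝ, EK) 𝓘(ℝ, F) (fun k : K => k • z) 1))
    (hπ : IsOpenQuotientMap π) (hπK : ∀ z z', π z = π z' ↔ ∃ k : K, k • z = z') {n : ℕ}
    (hn : Nonempty Z → Module.finrank ℝ F = Module.finrank ℝ EK + n) :
    ∃ (_ : ChartedSpace (EuclideanSpace ℝ (Fin n)) Q), IsManifold (𝓡 n) ∞ Q ∧
      ContMDiff 𝓘(ℝ, F) (𝓡 n) ∞ π ∧ ∀ z, Surjective (mfderiv 𝓘(ℝ, F) (𝓡 n) π z) := by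
  have h : ∀ q : Q, ∃ (e : OpenPartialHomeomorph Q (EuclideanSpace ℝ (Fin n)))
      (s : EuclideanSpace ℝ (Fin n) → Z),
      q ∈ e.source ∧ ContMDiffOn 𝓘(ℝ, F) (𝓡 n) ∞ (e ∘ π) (π ⁻¹' e.source) ∧
      ContMDiffOn (𝓡 n) 𝓘(ℝ, F) ∞ s e.target ∧ ∀ y ∈ e.target, π (s y) = e.symm y := by
    intro q
    obtain ⟨z, rfl⟩ := hπ.surjective q
    exact exists_quotient_chart hact hfree hinf hπ hπK (hn ⟨z⟩) z
  choose e s he heπ hs hπs using h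
  let i1 := chartedSpaceOfCharts e he
  have i2 : IsManifold (𝓡 n) ∞ Q := by
    refine isManifold_chartedSpaceOfCharts e he fun q q' => ?_
    rw [← contMDiffOn_iff_contDiffOn]
    -- A transition map is a smooth section followed by the smooth function `e q' ∘ π`.
    refine ((heπ q').comp ((hs q).mono fun y hy => hy.1) ?_).congr ?_
    · intro y hy
      rw [mem_preimage, mem_preimage, hπs q y hy.1]
      exact hy.2
    · intro y hy
      change e q' ((e q).symm y) = e q' (π (s q y))
      rw [hπs q y hy.1]
  have hsymm : ∀ q, ContMDiffOn (𝓡 n) (𝓡 n) ∞ (e q).symm (e q).target := fun q =>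
    contMDiffOn_chart_symm (x := q)
  have hπc : ContMDiff 𝓘(ℝ, F) (𝓡 n) ∞ π := by
    intro z
    have hO : IsOpen (π ⁻¹' (e (π z)).source) := (e (π z)).open_source.preimage hπ.continuous
    have h1 : ContMDiffOn 𝓘(ℝ, F) (𝓡 n) ∞ ((e (π z)).symm ∘ (e (π z) ∘ π))
        (π ⁻¹' (e (π z)).source) :=
      (hsymm (π z)).comp (heπ (π z)) fun p hp => (e (π z)).map_source hp
    refine (h1.congr fun p hp => ?_).contMDiffAt (hO.mem_nhds (he (π z)))
    exact ((e (π z)).left_inv hp).symm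
  refine ⟨i1, i2, hπc, fun z => ?_⟩
  set q := π z with hq
  have hyt : e q q ∈ (e q).target := (e q).map_source (he q)
  -- The section meets the orbit of `z` but perhaps not `z`. Translated by `k` it passes through
  -- `z`, and its composite with `π` is still the inverse chart, so `dπ` is onto at `z`.
  obtain ⟨k, hk⟩ := (hπK _ _).1 ((hπs q _ hyt).trans ((e q).left_inv (he q)))
  have hsd : MDifferentiableAt (𝓡 n) 𝓘(ℝ, F) (fun y => k • s q y) (e q q) := by
    have h1 : ContMDiffOn (𝓡 n) 𝓘(ℝ, F) ∞ (fun y => k • s q y) (e q).target :=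
      hact.comp_contMDiffOn (contMDiffOn_const.prodMk (hs q))
    exact (h1.contMDiffAt ((e q).open_target.mem_nhds hyt)).mdifferentiableAt (by simp)
  have hπd : MDifferentiableAt 𝓘(ℝ, F) (𝓡 n) π (k • s q (e q q)) :=
    hπc.mdifferentiableAt (by simp)
  have h2 := mfderiv_comp (e q q) hπd hsd
  have h3 : π ∘ (fun y => k • s q y) =ᶠ[𝓝 (e q q)] (e q).symm := by
    filter_upwards [(e q).open_target.mem_nhds hyt] with y hy
    rw [← hπs q y hy]
    exact ((hπK _ _).2 ⟨k, rfl⟩).symm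
  rw [h3.mfderiv_eq] at h2
  have h4 : Surjective (mfderiv (𝓡 n) (𝓡 n) (e q).symm (e q q)) :=
    (mdifferentiable_chart (I := 𝓡 n) q).symm.mfderiv_surjective hyt
  rw [h2] at h4
  have h5 : Surjective (mfderiv 𝓘(ℝ, F) (𝓡 n) π (k • s q (e q q))) := Surjective.of_comp h4
  rwa [hk] at h5

end Quotient

/-! ### Tensors in charts -/

section ChartTensors

variable {F : Type*} [NormedAddCommGroup F] [NormedSpace ℝ F]
  {M : Type*} [TopologicalSpace M] [ChartedSpace F M]

/-- The differential of the inverse of the preferred chart at `x₀`, in coordinates. -/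
def chartInv (x₀ : M) (y : F) : F →L[ℝ] F :=
  mfderiv 𝓘(ℝ, F) 𝓘(ℝ, F) (extChartAt 𝓘(ℝ, F) x₀).symm y

/-- The coordinate expression of a field of endomorphisms of the tangent spaces. -/
def chartEnd (J : ∀ x : M, TangentSpace 𝓘(ℝ, F) x →L[ℝ] TangentSpace 𝓘(ℝ, F) x)
    (x₀ : M) (y : F) : F →L[ℝ] F :=
  (chartInv x₀ y).inverse ∘L
    ((J ((extChartAt 𝓘(ℝ, F) x₀).symm y) : F →L[ℝ] F) ∘L chartInv x₀ y)

theorem chartForm_apply (B : ∀ x : M, TangentSpace 𝓘(ℝ, F) x →L[ℝ] TangentSpace 𝓘(ℝ, F) x →L[ℝ] ℝ)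
    (x₀ : M) (y u v : F) : chartForm B x₀ y u v =
      B ((extChartAt 𝓘(ℝ, F) x₀).symm y) (chartInv x₀ y u) (chartInv x₀ y v) := rfl

/-- The field of bilinear forms `B` is smooth at `x`. -/
def SmoothFormAt [IsManifold 𝓘(ℝ, F) ∞ M]
    (B : ∀ x : M, TangentSpace 𝓘(ℝ, F) x →L[ℝ] TangentSpace 𝓘(ℝ, F) x →L[ℝ] ℝ) (x : M) : Prop :=
  ContMDiffAt 𝓘(ℝ, F) (𝓘(ℝ, F).prod 𝓘(ℝ, F →L[ℝ] F →L[ℝ] ℝ)) ∞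
    (fun b ↦ Bundle.TotalSpace.mk' (F →L[ℝ] F →L[ℝ] ℝ)
      (E := fun x : M => TangentSpace 𝓘(ℝ, F) x →L[ℝ] TangentSpace 𝓘(ℝ, F) x →L[ℝ] ℝ) b (B b)) x

variable [IsManifold 𝓘(ℝ, F) ∞ M]

theorem isInvertible_chartInv {x₀ : M} {y : F} (hy : y ∈ (extChartAt 𝓘(ℝ, F) x₀).target) :
    (chartInv x₀ y).IsInvertible := by
  have := isInvertible_mfderivWithin_extChartAt_symm (I := 𝓘(ℝ, F)) hy
  rwa [show range 𝓘(ℝ, F) = univ from ModelWithCorners.range_eq_univ _, mfderivWithin_univ] at this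

theorem hasMFDerivAt_extChartAt_symm {x₀ : M} {y : F} (hy : y ∈ (extChartAt 𝓘(ℝ, F) x₀).target) :
    HasMFDerivAt 𝓘(ℝ, F) 𝓘(ℝ, F) (extChartAt 𝓘(ℝ, F) x₀).symm y
      (chartInv x₀ y : F →L[ℝ] F) := by
  have h : ContMDiffAt 𝓘(ℝ, F) 𝓘(ℝ, F) ∞ (extChartAt 𝓘(ℝ, F) x₀).symm y :=
    (contMDiffOn_extChartAt_symm x₀).contMDiffAt ((isOpen_extChartAt_target x₀).mem_nhds hy)
  exact (h.mdifferentiableAt (by simp)).hasMFDerivAt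

theorem chartInv_self (x₀ : M) :
    chartInv x₀ (extChartAt 𝓘(ℝ, F) x₀ x₀) = ContinuousLinearMap.id ℝ F := by
  have := mfderivWithin_range_extChartAt_symm (I := 𝓘(ℝ, F)) (x := x₀)
  rwa [show range 𝓘(ℝ, F) = univ from ModelWithCorners.range_eq_univ _, mfderivWithin_univ] at this

/-- The link between smoothness of bundle sections, defined through trivialisations, and smoothness
of the coordinate expressions in which the tensor computations take place. -/
theorem symmL_trivializationAt_eq {x₀ x : M} (hx : x ∈ (chartAt F x₀).source) :
    (trivializationAt F (TangentSpace 𝓘(ℝ, F)) x₀).symmL ℝ x =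
      chartInv x₀ (extChartAt 𝓘(ℝ, F) x₀ x) := by
  have := TangentBundle.symmL_trivializationAt (I := 𝓘(ℝ, F)) hx
  rwa [show range 𝓘(ℝ, F) = univ from ModelWithCorners.range_eq_univ _, mfderivWithin_univ] at this

theorem continuousLinearMapAt_trivializationAt_eq {x₀ x : M} (hx : x ∈ (chartAt F x₀).source) :
    (trivializationAt F (TangentSpace 𝓘(ℝ, F)) x₀).continuousLinearMapAt ℝ x =
      (chartInv x₀ (extChartAt 𝓘(ℝ, F) x₀ x)).inverse := by
  have hb : x ∈ (trivializationAt F (TangentSpace 𝓘(ℝ, F)) x₀).baseSet := by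
    simpa using hx
  rw [← symmL_trivializationAt_eq hx]
  symm
  apply ContinuousLinearMap.inverse_eq
  · ext v
    exact (trivializationAt F (TangentSpace 𝓘(ℝ, F)) x₀).symmL_continuousLinearMapAt (R := ℝ) hb v
  · ext v
    exact (trivializationAt F (TangentSpace 𝓘(ℝ, F)) x₀).continuousLinearMapAt_symmL (R := ℝ) hb v

theorem contMDiffAt_comp_extChartAt_iff {V : Type*} [NormedAddCommGroup V] [NormedSpace ℝ V]
    {x₀ : M} {f : M → V} {g : F → V} (h : f =ᶠ[𝓝 x₀] g ∘ extChartAt 𝓘(ℝ, F) x₀) :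
    ContMDiffAt 𝓘(ℝ, F) 𝓘(ℝ, V) ∞ f x₀ ↔ ContDiffAt ℝ ∞ g (extChartAt 𝓘(ℝ, F) x₀ x₀) := by
  rw [h.contMDiffAt_iff, contMDiffAt_iff_source,
    show range 𝓘(ℝ, F) = univ from ModelWithCorners.range_eq_univ _, contMDiffWithinAt_univ,
    contMDiffAt_iff_contDiffAt]
  have h' : (g ∘ extChartAt 𝓘(ℝ, F) x₀) ∘ (extChartAt 𝓘(ℝ, F) x₀).symm
      =ᶠ[𝓝 (extChartAt 𝓘(ℝ, F) x₀ x₀)] g := ?_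
  · exact ⟨fun h => h.congr_of_eventuallyEq h'.symm, fun h => h.congr_of_eventuallyEq h'⟩
  filter_upwards [extChartAt_target_mem_nhds (I := 𝓘(ℝ, F)) x₀] with y hy
  simp only [comp_apply]
  rw [(extChartAt 𝓘(ℝ, F) x₀).right_inv hy]

/-- A field of bilinear forms is smooth at `x` iff its coordinate expression is. -/
theorem smoothFormAt_iff
    {B : ∀ x : M, TangentSpace 𝓘(ℝ, F) x →L[ℝ] TangentSpace 𝓘(ℝ, F) x →L[ℝ] ℝ} {x₀ : M} :
    SmoothFormAt B x₀ ↔ ContDiffAt ℝ ∞ (chartForm B x₀) (extChartAt 𝓘(ℝ, F) x₀ x₀) := by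
  rw [SmoothFormAt, contMDiffAt_hom_bundle]
  refine (and_iff_right contMDiffAt_id).trans ?_
  apply contMDiffAt_comp_extChartAt_iff
  filter_upwards [(chartAt F x₀).open_source.mem_nhds (mem_chart_source F x₀)] with x hx
  ext u v
  have hb : x ∈ (trivializationAt F (TangentSpace 𝓘(ℝ, F)) x₀).baseSet := by simpa using hx
  have h1 := inCoordinates_apply_eq₂ (F₁ := F) (F₂ := F) (F₃ := ℝ)
    (E₁ := fun x : M => TangentSpace 𝓘(ℝ, F) x) (E₂ := fun x : M => TangentSpace 𝓘(ℝ, F) x)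
    (E₃ := Bundle.Trivial M ℝ) (x₀ := x₀) (x := x) (ϕ := B x) (v := u) (w := v) hb hb (mem_univ _)
  refine h1.trans ?_
  rw [comp_apply, chartForm_apply]
  have h2 := symmL_trivializationAt_eq hx
  have h3 : ∀ u : F, (trivializationAt F (TangentSpace 𝓘(ℝ, F)) x₀).symm x u =
    chartInv x₀ (extChartAt 𝓘(ℝ, F) x₀ x) u := fun u => by
    have := congrArg (fun A : F →L[ℝ] F => A u) h2
    exact (Bundle.Trivialization.symmL_apply _ hb u).symm.trans this
  have h4 : (extChartAt 𝓘(ℝ, F) x₀).symm (extChartAt 𝓘(ℝ, F) x₀ x) = x :=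
    (extChartAt 𝓘(ℝ, F) x₀).left_inv (by rwa [extChartAt_source])
  have h5 : ∀ x' : M, x' = x → ∀ a b : F, B x a b = B x' a b := by
    rintro _ rfl a b
    rfl
  have h6 : ∀ c : ℝ, (trivializationAt ℝ (Bundle.Trivial M ℝ) x₀).linearMapAt ℝ x c = c := by
    intro c
    simp
  refine (h6 _).trans ?_
  refine (congrArg₂ (fun a b : F => B x a b) (h3 u) (h3 v)).trans ?_
  exact h5 _ h4 _ _

/-- A field of endomorphisms is smooth at `x`. -/
def SmoothEndAt (J : ∀ x : M, TangentSpace 𝓘(ℝ, F) x →L[ℝ] TangentSpace 𝓘(ℝ, F) x)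
    (x : M) : Prop :=
  ContMDiffAt 𝓘(ℝ, F) (𝓘(ℝ, F).prod 𝓘(ℝ, F →L[ℝ] F)) ∞
    (fun x => Bundle.TotalSpace.mk' (F →L[ℝ] F)
      (E := fun x : M => TangentSpace 𝓘(ℝ, F) x →L[ℝ] TangentSpace 𝓘(ℝ, F) x) x (J x)) x

/-- A field of endomorphisms is smooth at `x` iff its coordinate expression is. -/
theorem smoothEndAt_iff
    {J : ∀ x : M, TangentSpace 𝓘(ℝ, F) x →L[ℝ] TangentSpace 𝓘(ℝ, F) x} {x₀ : M} :
    SmoothEndAt J x₀ ↔ ContDiffAt ℝ ∞ (chartEnd J x₀) (extChartAt 𝓘(ℝ, F) x₀ x₀) := by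
  rw [SmoothEndAt, contMDiffAt_hom_bundle]
  refine (and_iff_right contMDiffAt_id).trans ?_
  apply contMDiffAt_comp_extChartAt_iff
  filter_upwards [(chartAt F x₀).open_source.mem_nhds (mem_chart_source F x₀)] with x hx
  have h4 : (extChartAt 𝓘(ℝ, F) x₀).symm (extChartAt 𝓘(ℝ, F) x₀ x) = x :=
    (extChartAt 𝓘(ℝ, F) x₀).left_inv (by rwa [extChartAt_source])
  have h5 : ∀ x' : M, x' = x → (J x : F →L[ℝ] F) = J x' := by
    rintro _ rfl
    rfl
  have h2 := symmL_trivializationAt_eq hx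
  have h3 := continuousLinearMapAt_trivializationAt_eq hx
  have h7 : ∀ A A' B B' C C' : F →L[ℝ] F, A = A' → B = B' → C = C' →
      A ∘L (B ∘L C) = A' ∘L (B' ∘L C') := by
    rintro _ _ _ _ _ _ rfl rfl rfl
    rfl
  exact h7 _ _ _ _ _ _ h3 (h5 _ h4) h2

/-- The coordinate expression of `φ` in the preferred charts at `x₀` and `x₁`. -/
def chartMap {F' : Type*} [NormedAddCommGroup F'] [NormedSpace ℝ F']
    {N : Type*} [TopologicalSpace N] [ChartedSpace F' N] (φ : N → M) (x₀ : N) (x₁ : M)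
    (y : F') : F :=
  extChartAt 𝓘(ℝ, F) x₁ (φ ((extChartAt 𝓘(ℝ, F') x₀).symm y))

/-- The differential, as a linear map between the model spaces. -/
def mdiff {F' : Type*} [NormedAddCommGroup F'] [NormedSpace ℝ F']
    {N : Type*} [TopologicalSpace N] [ChartedSpace F' N] (φ : N → M) (p : N) : F' →L[ℝ] F :=
  mfderiv 𝓘(ℝ, F') 𝓘(ℝ, F) φ p

section Pullback

variable {F' : Type*} [NormedAddCommGroup F'] [NormedSpace ℝ F']
    {N : Type*} [TopologicalSpace N] [ChartedSpace F' N] [IsManifold 𝓘(ℝ, F') ∞ N]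
    {φ : N → M} {x₀ : N} {x₁ : M} {p : N}

theorem contDiffAt_chartMap {n : ℕ∞ω} (hn : n ≤ ∞) (hφ : ContMDiffAt 𝓘(ℝ, F') 𝓘(ℝ, F) n φ p)
    (hp : p ∈ (chartAt F' x₀).source) (hp' : φ p ∈ (chartAt F x₁).source) :
    ContDiffAt ℝ n (chartMap φ x₀ x₁ : F' → F) (extChartAt 𝓘(ℝ, F') x₀ p) := by
  rw [← extChartAt_source 𝓘(ℝ, F')] at hp
  rw [← extChartAt_source 𝓘(ℝ, F)] at hp'
  have h1 : ContMDiffAt 𝓘(ℝ, F') 𝓘(ℝ, F') ∞ (extChartAt 𝓘(ℝ, F') x₀).symm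
      (extChartAt 𝓘(ℝ, F') x₀ p) := (contMDiffOn_extChartAt_symm x₀).contMDiffAt
    ((isOpen_extChartAt_target x₀).mem_nhds ((extChartAt 𝓘(ℝ, F') x₀).map_source hp))
  replace h1 := h1.of_le hn
  have h0 : (extChartAt 𝓘(ℝ, F') x₀).symm (extChartAt 𝓘(ℝ, F') x₀ p) = p :=
    (extChartAt 𝓘(ℝ, F') x₀).left_inv hp
  have h2 : ContMDiffAt 𝓘(ℝ, F') 𝓘(ℝ, F) n (φ ∘ (extChartAt 𝓘(ℝ, F') x₀).symm)
      (extChartAt 𝓘(ℝ, F') x₀ p) := ContMDiffAt.comp _ (by rwa [h0]) h1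
  have h3 : ContMDiffAt 𝓘(ℝ, F) 𝓘(ℝ, F) ∞ (extChartAt 𝓘(ℝ, F) x₁) (φ p) :=
    contMDiffAt_extChartAt' (by rwa [extChartAt_source] at hp')
  exact (ContMDiffAt.comp (extChartAt 𝓘(ℝ, F') x₀ p) (g := extChartAt 𝓘(ℝ, F) x₁)
    (by rw [comp_apply, h0]; exact h3.of_le hn) h2).contDiffAt

theorem chartMap_apply (hp : p ∈ (chartAt F' x₀).source) :
    chartMap φ x₀ x₁ (extChartAt 𝓘(ℝ, F') x₀ p) = extChartAt 𝓘(ℝ, F) x₁ (φ p) := by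
  rw [← extChartAt_source 𝓘(ℝ, F')] at hp
  rw [chartMap, (extChartAt 𝓘(ℝ, F') x₀).left_inv hp]

/-- The differential of `φ` in terms of its coordinate expression. -/
theorem mdiff_comp_chartInv (hφ : ContMDiffAt 𝓘(ℝ, F') 𝓘(ℝ, F) 1 φ p)
    (hp : p ∈ (chartAt F' x₀).source) (hp' : φ p ∈ (chartAt F x₁).source) :
    mdiff φ p ∘L chartInv x₀ (extChartAt 𝓘(ℝ, F') x₀ p) =
      chartInv x₁ (extChartAt 𝓘(ℝ, F) x₁ (φ p)) ∘L
        fderiv ℝ (chartMap φ x₀ x₁) (extChartAt 𝓘(ℝ, F') x₀ p) := by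
  have hs : p ∈ (extChartAt 𝓘(ℝ, F') x₀).source := by rwa [extChartAt_source]
  have hs' : φ p ∈ (extChartAt 𝓘(ℝ, F) x₁).source := by rwa [extChartAt_source]
  have h0 : (extChartAt 𝓘(ℝ, F') x₀).symm (extChartAt 𝓘(ℝ, F') x₀ p) = p :=
    (extChartAt 𝓘(ℝ, F') x₀).left_inv hs
  have hy := (extChartAt 𝓘(ℝ, F') x₀).map_source hs
  have hy' := (extChartAt 𝓘(ℝ, F) x₁).map_source hs'
  have h1 := hasMFDerivAt_extChartAt_symm hy
  have h2 : HasMFDerivAt 𝓘(ℝ, F') 𝓘(ℝ, F) φ p (mdiff φ p : F' →L[ℝ] F) :=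
    (hφ.mdifferentiableAt (by simp)).hasMFDerivAt
  have h3 := hasMFDerivAt_extChartAt_symm hy'
  have h4 : HasMFDerivAt 𝓘(ℝ, F') 𝓘(ℝ, F) (chartMap φ x₀ x₁) (extChartAt 𝓘(ℝ, F') x₀ p)
      (fderiv ℝ (chartMap φ x₀ x₁) (extChartAt 𝓘(ℝ, F') x₀ p) : F' →L[ℝ] F) :=
    ((contDiffAt_chartMap (by simp) hφ hp hp').differentiableAt (by simp)).hasFDerivAt.hasMFDerivAt
  have h5 : HasMFDerivAt 𝓘(ℝ, F') 𝓘(ℝ, F) (φ ∘ (extChartAt 𝓘(ℝ, F') x₀).symm)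
      (extChartAt 𝓘(ℝ, F') x₀ p)
      (mdiff φ p ∘L chartInv x₀ (extChartAt 𝓘(ℝ, F') x₀ p) : F' →L[ℝ] F) := by
    refine HasMFDerivAt.comp (I' := 𝓘(ℝ, F')) _ ?_ h1
    rw [h0]
    exact h2
  have h6 : HasMFDerivAt 𝓘(ℝ, F') 𝓘(ℝ, F) ((extChartAt 𝓘(ℝ, F) x₁).symm ∘ chartMap φ x₀ x₁)
      (extChartAt 𝓘(ℝ, F') x₀ p) (chartInv x₁ (extChartAt 𝓘(ℝ, F) x₁ (φ p)) ∘L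
        fderiv ℝ (chartMap φ x₀ x₁) (extChartAt 𝓘(ℝ, F') x₀ p) : F' →L[ℝ] F) := by
    refine HasMFDerivAt.comp (I' := 𝓘(ℝ, F)) _ ?_ h4
    rw [chartMap_apply hp]
    exact h3
  refine hasMFDerivAt_unique (I := 𝓘(ℝ, F')) (I' := 𝓘(ℝ, F)) h5 (h6.congr_of_eventuallyEq ?_)
  have h7 : ∀ᶠ y in 𝓝 (extChartAt 𝓘(ℝ, F') x₀ p),
      (φ ∘ (extChartAt 𝓘(ℝ, F') x₀).symm) y ∈ (extChartAt 𝓘(ℝ, F) x₁).source := by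
    refine h5.continuousAt.eventually_mem ((isOpen_extChartAt_source x₁).mem_nhds ?_)
    rwa [comp_apply, h0]
  filter_upwards [h7] with y hy
  exact ((extChartAt 𝓘(ℝ, F) x₁).left_inv hy).symm

/-- The points near `p`, expressed in coordinates. -/
theorem eventually_extChartAt_symm (hp : p ∈ (chartAt F' x₀).source) {P : N → Prop}
    (h : ∀ᶠ q in 𝓝 p, P q) :
    ∀ᶠ y in 𝓝 (extChartAt 𝓘(ℝ, F') x₀ p), ∃ q ∈ (chartAt F' x₀).source,
      y = extChartAt 𝓘(ℝ, F') x₀ q ∧ P q := by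
  have hs : p ∈ (extChartAt 𝓘(ℝ, F') x₀).source := by rwa [extChartAt_source]
  have hy := (extChartAt 𝓘(ℝ, F') x₀).map_source hs
  have hc : Filter.Tendsto (extChartAt 𝓘(ℝ, F') x₀).symm (𝓝 (extChartAt 𝓘(ℝ, F') x₀ p)) (𝓝 p) := by
    have := (hasMFDerivAt_extChartAt_symm hy).continuousAt
    rwa [ContinuousAt, (extChartAt 𝓘(ℝ, F') x₀).left_inv hs] at this
  filter_upwards [hc.eventually h, (isOpen_extChartAt_target x₀).mem_nhds hy] with y h1 h2
  refine ⟨_, ?_, ((extChartAt 𝓘(ℝ, F') x₀).right_inv h2).symm, h1⟩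
  rw [← extChartAt_source 𝓘(ℝ, F')]
  exact (extChartAt 𝓘(ℝ, F') x₀).map_target h2

/-- The coordinate expression of the pull-back of a field of bilinear forms. -/
theorem chartForm_pullback
    {B : ∀ x : M, TangentSpace 𝓘(ℝ, F) x →L[ℝ] TangentSpace 𝓘(ℝ, F) x →L[ℝ] ℝ}
    {B' : ∀ x : N, TangentSpace 𝓘(ℝ, F') x →L[ℝ] TangentSpace 𝓘(ℝ, F') x →L[ℝ] ℝ}
    (hφ : ContMDiffAt 𝓘(ℝ, F') 𝓘(ℝ, F) 1 φ p)
    (hp : p ∈ (chartAt F' x₀).source) (hp' : φ p ∈ (chartAt F x₁).source)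
    (hB : ∀ᶠ q in 𝓝 p, ∀ u v : F', B' q u v =
      B (φ q) (mdiff φ q u : F) (mdiff φ q v : F)) :
    chartForm B' x₀ =ᶠ[𝓝 (extChartAt 𝓘(ℝ, F') x₀ p)] fun y =>
      (chartForm B x₁ (chartMap φ x₀ x₁ y)).bilinearComp (fderiv ℝ (chartMap φ x₀ x₁) y)
        (fderiv ℝ (chartMap φ x₀ x₁) y) := by
  have h1 : ∀ᶠ q in 𝓝 p, ContMDiffAt 𝓘(ℝ, F') 𝓘(ℝ, F) 1 φ q := (contMDiffAt_iff_contMDiffAt_nhds (by simp)).1 hφ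
  have h2 : ∀ᶠ q in 𝓝 p, φ q ∈ (chartAt F x₁).source :=
    hφ.continuousAt.eventually_mem ((chartAt F x₁).open_source.mem_nhds hp')
  filter_upwards [eventually_extChartAt_symm hp (hB.and (h1.and h2))] with y
  rintro ⟨q, hq, rfl, hBq, hφq, hq'⟩
  have h3 := mdiff_comp_chartInv hφq hq hq'
  have h0 : (extChartAt 𝓘(ℝ, F') x₀).symm (extChartAt 𝓘(ℝ, F') x₀ q) = q :=
    (extChartAt 𝓘(ℝ, F') x₀).left_inv (by rwa [extChartAt_source])
  have h0' : (extChartAt 𝓘(ℝ, F) x₁).symm (extChartAt 𝓘(ℝ, F) x₁ (φ q)) = φ q :=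
    (extChartAt 𝓘(ℝ, F) x₁).left_inv (by rwa [extChartAt_source])
  have h5 : ∀ x' : N, x' = q → ∀ a b : F', B' x' a b = B' q a b := by
    rintro _ rfl a b
    rfl
  have h5' : ∀ x' : M, x' = φ q → ∀ a b : F, B x' a b = B (φ q) a b := by
    rintro _ rfl a b
    rfl
  have h6 := fun u : F' => congrArg (fun A : F' →L[ℝ] F => A u) h3
  refine ContinuousLinearMap.ext fun u : F' => ContinuousLinearMap.ext fun v : F' => ?_
  rw [chartMap_apply hq]
  refine (h5 _ h0 _ _).trans ((hBq _ _).trans ?_)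
  refine Eq.trans ?_ (h5' _ h0' _ _).symm
  exact congrArg₂ (fun a b : F => B (φ q) a b) (h6 u) (h6 v)

end Pullback

end ChartTensors

/-! ### Closed forms and endomorphisms on vector spaces -/

section VectorSpace

variable {F : Type*} [NormedAddCommGroup F] [NormedSpace ℝ F]
  {F' : Type*} [NormedAddCommGroup F'] [NormedSpace ℝ F']

/-- The exterior derivative of the `2`-form `β` vanishes at `y`. -/
def ClosedAt (β : F → F →L[ℝ] F →L[ℝ] ℝ) (y : F) : Prop :=
  ∀ u v w : F, fderiv ℝ β y u v w + fderiv ℝ β y v w u + fderiv ℝ β y w u v = 0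

theorem ClosedAt.congr {β β' : F → F →L[ℝ] F →L[ℝ] ℝ} {y : F} (h : ClosedAt β y)
    (hβ : β' =ᶠ[𝓝 y] β) : ClosedAt β' y := by
  intro u v w
  rw [hβ.fderiv_eq]
  exact h u v w

theorem fderiv_clm_apply_apply {G G' : Type*} [NormedAddCommGroup G] [NormedSpace ℝ G]
    [NormedAddCommGroup G'] [NormedSpace ℝ G'] {β : F → F' →L[ℝ] G →L[ℝ] G'} {y : F}
    (h : DifferentiableAt ℝ β y) (u : F) (v : F') (w : G) :
    fderiv ℝ (fun y' => β y' v w) y u = fderiv ℝ β y u v w := by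
  have h1 := (h.hasFDerivAt.clm_apply (hasFDerivAt_const v y)).clm_apply (hasFDerivAt_const w y)
  rw [h1.fderiv]
  simp

theorem contDiffAt_clm_apply_iff {D G : Type*} [NormedAddCommGroup D] [NormedSpace ℝ D]
    [NormedAddCommGroup G] [NormedSpace ℝ G] {n : ℕ∞ω} {f : D → F →L[ℝ] G} {y : D}
    [FiniteDimensional ℝ F] :
    ContDiffAt ℝ n f y ↔ ∀ v, ContDiffAt ℝ n (fun x => f x v) y := by
  simp only [← contDiffWithinAt_univ]
  refine ⟨fun h v => h.clm_apply contDiffWithinAt_const, fun h => ?_⟩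
  let d := Module.finrank ℝ F
  have hd : d = Module.finrank ℝ (Fin d → ℝ) := (Module.finrank_fin_fun ℝ).symm
  let e₁ := ContinuousLinearEquiv.ofFinrankEq hd
  let e₂ := (e₁.arrowCongr (1 : G ≃L[ℝ] G)).trans (ContinuousLinearEquiv.piRing (Fin d))
  rw [← id_comp f, ← e₂.symm_comp_self]
  exact e₂.symm.contDiff.contDiffAt.comp_contDiffWithinAt y
    (contDiffWithinAt_pi.mpr fun i => h _)

theorem ContDiffAt.clm_bilinearComp [FiniteDimensional ℝ F'] {n : ℕ∞ω} {β : F' → F →L[ℝ] F →L[ℝ] ℝ} {A : F' → F' →L[ℝ] F}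
    {y : F'} (hβ : ContDiffAt ℝ n β y) (hA : ContDiffAt ℝ n A y) :
    ContDiffAt ℝ n (fun y' => (β y').bilinearComp (A y') (A y')) y := by
  refine contDiffAt_clm_apply_iff.2 fun u => contDiffAt_clm_apply_iff.2 fun v => ?_
  exact (hβ.clm_apply (hA.clm_apply contDiffAt_const)).clm_apply (hA.clm_apply contDiffAt_const)

/-- The derivative of the pull-back of a bilinear form. -/
theorem fderiv_pullback_apply [FiniteDimensional ℝ F'] {β : F → F →L[ℝ] F →L[ℝ] ℝ} {f : F' → F}
    {y : F'} (hf : ContDiffAt ℝ 2 f y) (hβ : ContDiffAt ℝ 1 β (f y)) (u v w : F') :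
    fderiv ℝ (fun y' => (β (f y')).bilinearComp (fderiv ℝ f y') (fderiv ℝ f y')) y u v w =
      fderiv ℝ β (f y) (fderiv ℝ f y u) (fderiv ℝ f y v) (fderiv ℝ f y w)
        + β (f y) (fderiv ℝ (fderiv ℝ f) y u v) (fderiv ℝ f y w)
        + β (f y) (fderiv ℝ f y v) (fderiv ℝ (fderiv ℝ f) y u w) := by
  have h1 : ContDiffAt ℝ 1 (fderiv ℝ f) y := hf.fderiv_right (by norm_num)
  have h2 : ContDiffAt ℝ 1 (fun y' => β (f y')) y := hβ.comp y (hf.of_le (by norm_num))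
  have h3 : DifferentiableAt ℝ
      (fun y' => (β (f y')).bilinearComp (fderiv ℝ f y') (fderiv ℝ f y')) y :=
    (h2.clm_bilinearComp h1).differentiableAt (by simp)
  rw [← fderiv_clm_apply_apply h3]
  have h5 : HasFDerivAt (fun y' => β (f y')) (fderiv ℝ β (f y) ∘L fderiv ℝ f y) y :=
    (hβ.differentiableAt (by simp)).hasFDerivAt.comp y
      (hf.differentiableAt (by simp)).hasFDerivAt
  have h6 : ∀ v, HasFDerivAt (fun y' => fderiv ℝ f y' v) _ y := fun v =>
    (h1.differentiableAt (by simp)).hasFDerivAt.clm_apply (hasFDerivAt_const v y)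
  have h7 := (h5.clm_apply (h6 v)).clm_apply (h6 w)
  have h8 : fderiv ℝ (fun y' => (β (f y')).bilinearComp (fderiv ℝ f y') (fderiv ℝ f y') v w) y
    = _ := h7.fderiv
  rw [h8]
  simp
  ring

/-- This is `d f^* = f^* d`: in the cyclic sum the terms with second derivatives of `f` cancel, by
symmetry of the second derivative and antisymmetry of the form. -/
theorem ClosedAt.pullback [FiniteDimensional ℝ F'] {β : F → F →L[ℝ] F →L[ℝ] ℝ} {f : F' → F} {y : F'}
    (hf : ContDiffAt ℝ 2 f y) (hβ : ContDiffAt ℝ 1 β (f y)) (h : ClosedAt β (f y))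
    (hs : ∀ u v, β (f y) u v = -β (f y) v u) :
    ClosedAt (fun y' => (β (f y')).bilinearComp (fderiv ℝ f y') (fderiv ℝ f y')) y := by
  have h9 : ∀ u v, fderiv ℝ (fderiv ℝ f) y u v = fderiv ℝ (fderiv ℝ f) y v u := fun u v =>
    (hf.isSymmSndFDerivAt (by simp)) u v
  intro u v w
  rw [fderiv_pullback_apply hf hβ, fderiv_pullback_apply hf hβ, fderiv_pullback_apply hf hβ]
  have h10 := h (fderiv ℝ f y u) (fderiv ℝ f y v) (fderiv ℝ f y w)
  rw [h9 v u, h9 w u, h9 w v, hs (fderiv ℝ f y u) (fderiv ℝ (fderiv ℝ f) y v w),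
    hs (fderiv ℝ f y v) (fderiv ℝ (fderiv ℝ f) y u w),
    hs (fderiv ℝ f y w) (fderiv ℝ (fderiv ℝ f) y u v)]
  linarith

/-- The Nijenhuis tensor of the field `J` of endomorphisms vanishes at `y`. -/
def NijenhuisAt (J : F → F →L[ℝ] F) (y : F) : Prop :=
  ∀ u v : F, fderiv ℝ J y (J y u) v - fderiv ℝ J y (J y v) u + J y (fderiv ℝ J y v u)
    - J y (fderiv ℝ J y u v) = 0

/-- Differentiating `df ∘ J' = J ∘ df` expresses `df` of the Nijenhuis tensor of `J'` through that
of `J`. The second derivatives of `f` cancel by symmetry, and injectivity of `df` concludes. -/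
theorem NijenhuisAt.of_comp {J : F → F →L[ℝ] F} {J' : F' → F' →L[ℝ] F'} {f : F' → F} {y : F'}
    (hf : ContDiffAt ℝ 2 f y) (hJ : DifferentiableAt ℝ J (f y)) (hJ' : DifferentiableAt ℝ J' y)
    (hinj : Injective (fderiv ℝ f y))
    (hc : ∀ᶠ y' in 𝓝 y, fderiv ℝ f y' ∘L J' y' = J (f y') ∘L fderiv ℝ f y')
    (h : NijenhuisAt J (f y)) : NijenhuisAt J' y := by
  have h1 : DifferentiableAt ℝ (fderiv ℝ f) y :=
    (hf.fderiv_right (m := 1) (by norm_num)).differentiableAt (by simp)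
  have h2 : HasFDerivAt (fun y' => J (f y')) (fderiv ℝ J (f y) ∘L fderiv ℝ f y) y :=
    hJ.hasFDerivAt.comp y (hf.differentiableAt (by simp)).hasFDerivAt
  have h3 := hc.self_of_nhds
  have h3' : ∀ v, fderiv ℝ f y (J' y v) = J (f y) (fderiv ℝ f y v) := fun v =>
    congrArg (fun A : F' →L[ℝ] F => A v) h3
  have h9 : ∀ u v, fderiv ℝ (fderiv ℝ f) y u v = fderiv ℝ (fderiv ℝ f) y v u := fun u v =>
    (hf.isSymmSndFDerivAt (by simp)) u v
  have h4 : ∀ u v, fderiv ℝ (fderiv ℝ f) y u (J' y v) + fderiv ℝ f y (fderiv ℝ J' y u v) =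
      fderiv ℝ J (f y) (fderiv ℝ f y u) (fderiv ℝ f y v)
        + J (f y) (fderiv ℝ (fderiv ℝ f) y u v) := by
    intro u v
    have h5 := (h1.hasFDerivAt.clm_comp hJ'.hasFDerivAt).unique
      ((h2.clm_comp h1.hasFDerivAt).congr_of_eventuallyEq hc)
    have h6 := congrArg (fun A : F' →L[ℝ] F' →L[ℝ] F => A u v) h5
    simp at h6
    rw [add_comm, h6, add_comm]
  intro u v
  apply hinj
  have h5 := h (fderiv ℝ f y u) (fderiv ℝ f y v)
  rw [← h3', ← h3'] at h5
  have e1 := h4 (J' y u) v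
  have e2 := h4 (J' y v) u
  have e3 : J (f y) _ = J (f y) _ := congrArg (J (f y)) (h4 v u)
  have e4 : J (f y) _ = J (f y) _ := congrArg (J (f y)) (h4 u v)
  simp only [map_add, map_sub, map_zero, h3'] at e1 e2 e3 e4 h5 ⊢
  rw [h9 u v] at e4
  rw [h9 v (J' y u)] at e3
  rw [h9 u (J' y v)] at e4
  rw [h9 (J' y u) (J' y v)] at e1
  linear_combination (norm := module) e1 - e2 + e3 - e4 + h5

/-- If two closed forms are related by an almost complex structure, then this is integrable. -/
theorem nijenhuisAt_of_closedAt {α η : F → F →L[ℝ] F →L[ℝ] ℝ} {J : F → F →L[ℝ] F} {y : F}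
    (hα : DifferentiableAt ℝ α y) (hJ : DifferentiableAt ℝ J y)
    (hαs : ∀ᶠ y' in 𝓝 y, ∀ u v, α y' u v = -α y' v u)
    (hηs : ∀ᶠ y' in 𝓝 y, ∀ u v, η y' u v = -η y' v u)
    (hη : ∀ᶠ y' in 𝓝 y, ∀ u v, α y' (J y' u) v = η y' u v)
    (hJJ : ∀ᶠ y' in 𝓝 y, ∀ u, J y' (J y' u) = -u)
    (hnd : ∀ u, (∀ v, α y u v = 0) → u = 0)
    (hcα : ClosedAt α y) (hcη : ClosedAt η y) : NijenhuisAt J y := by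
  have hη' : η =ᶠ[𝓝 y] fun y' => α y' ∘L J y' := by
    filter_upwards [hη] with y' h
    ext u v
    exact (h u v).symm
  have h1 : HasFDerivAt η _ y :=
    (hα.hasFDerivAt.clm_comp hJ.hasFDerivAt).congr_of_eventuallyEq hη'
  have hb : ∀ u v w, fderiv ℝ η y u v w =
      fderiv ℝ α y u (J y v) w + α y (fderiv ℝ J y u v) w := by
    intro u v w
    rw [h1.fderiv]
    simp [add_comm]
  have hanti : ∀ β : F → F →L[ℝ] F →L[ℝ] ℝ, DifferentiableAt ℝ β y →
      (∀ᶠ y' in 𝓝 y, ∀ u v, β y' u v = -β y' v u) →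
      ∀ u v w, fderiv ℝ β y u v w = -fderiv ℝ β y u w v := by
    intro β hβ hs u v w
    rw [← fderiv_clm_apply_apply hβ, ← fderiv_clm_apply_apply hβ]
    have : (fun y' => β y' v w) =ᶠ[𝓝 y] -fun y' => β y' w v := by
      filter_upwards [hs] with y' h
      exact h v w
    rw [this.fderiv_eq, fderiv_neg]
    rfl
  have ha' := hanti α hα hαs
  have hb' := hanti η h1.differentiableAt hηs
  have hJ' : ∀ u v, fderiv ℝ J y u (J y v) = -J y (fderiv ℝ J y u v) := by
    intro u v
    have h2 : (fun y' => J y' ∘L J y') =ᶠ[𝓝 y] fun _ => -ContinuousLinearMap.id ℝ F := by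
      filter_upwards [hJJ] with y' h
      ext v
      exact h v
    have h3 := (hJ.hasFDerivAt.clm_comp hJ.hasFDerivAt).unique
      ((hasFDerivAt_const (-ContinuousLinearMap.id ℝ F) y).congr_of_eventuallyEq h2)
    have h4 := congrArg (fun A : F →L[ℝ] F →L[ℝ] F => A u v) h3
    simp at h4
    exact eq_neg_of_add_eq_zero_right h4
  -- Antisymmetry of both `α` and `η = α(J ·, ·)` makes `J` self-adjoint for `α`.
  have hJs : ∀ x w, α y (J y x) w = α y x (J y w) := by
    intro x w
    rw [hη.self_of_nhds, hηs.self_of_nhds, ← hη.self_of_nhds, hαs.self_of_nhds, neg_neg]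
  have hJJ' := hJJ.self_of_nhds
  -- The derivative of `η(J u, w) = -α(u, w)`, with the derivative of `J` eliminated through
  -- self-adjointness and `hb`.
  have hstar : ∀ v u w, fderiv ℝ η y v (J y u) w = -fderiv ℝ α y v u w
      - fderiv ℝ η y v u (J y w) + fderiv ℝ α y v (J y u) (J y w) := by
    intro v u w
    rw [hb, hb, hJJ', hJ', map_neg, map_neg]
    simp only [neg_apply]
    rw [hJs]
    ring
  intro u v
  -- Paired with `w` by `α`, the Nijenhuis tensor becomes a combination of first derivatives of `α`
  -- and `η`. It vanishes by closedness of `η` on `(J u, v, w)` and `(J v, u, w)` and of `α` on `(u,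
  -- v, w)` and `(J u, J v, w)`.
  apply hnd
  intro w
  simp only [map_add, map_sub, add_apply, sub_apply, hJs]
  have e1 := hb (J y u) v w
  have e2 := hb (J y v) u w
  have e3 := hb v u (J y w)
  have e4 := hb u v (J y w)
  have c1 := hcη (J y u) v w
  have c2 := hcη (J y v) u w
  have c3 := hcα u v w
  have c4 := hcα (J y u) (J y v) w
  have s1 := hstar v u w
  have s2 := hstar u v w
  have s3 := hstar w u v
  have t1 := hb' v w (J y u)
  have t2 := hb' u w (J y v)
  have t3 := hb' w (J y v) u
  have t4 := ha' v u w
  have t5 := ha' (J y v) (J y u) w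
  linarith

end VectorSpace

/-! ### Pull-back of forms and complex structures -/

section ManifoldTensors

variable {F : Type*} [NormedAddCommGroup F] [NormedSpace ℝ F] [FiniteDimensional ℝ F]
  {M : Type*} [TopologicalSpace M] [ChartedSpace F M] [IsManifold 𝓘(ℝ, F) ∞ M]
  {F' : Type*} [NormedAddCommGroup F'] [NormedSpace ℝ F'] [FiniteDimensional ℝ F']
  {N : Type*} [TopologicalSpace N] [ChartedSpace F' N] [IsManifold 𝓘(ℝ, F') ∞ N]
  {B : ∀ x : M, TangentSpace 𝓘(ℝ, F) x →L[ℝ] TangentSpace 𝓘(ℝ, F) x →L[ℝ] ℝ}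
  {B' : ∀ x : N, TangentSpace 𝓘(ℝ, F') x →L[ℝ] TangentSpace 𝓘(ℝ, F') x →L[ℝ] ℝ}
  {J : ∀ x : M, TangentSpace 𝓘(ℝ, F) x →L[ℝ] TangentSpace 𝓘(ℝ, F) x}
  {J' : ∀ x : N, TangentSpace 𝓘(ℝ, F') x →L[ℝ] TangentSpace 𝓘(ℝ, F') x}
  {φ : N → M} {x₀ : N} {x₁ : M} {p : N}

/-- The value of a field of endomorphisms, as an endomorphism of the model space. -/
def endAt (J : ∀ x : M, TangentSpace 𝓘(ℝ, F) x →L[ℝ] TangentSpace 𝓘(ℝ, F) x) (x : M) :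
    F →L[ℝ] F := J x

/-- The value of a field of bilinear forms, as a bilinear form on the model space. -/
def formAt (B : ∀ x : M, TangentSpace 𝓘(ℝ, F) x →L[ℝ] TangentSpace 𝓘(ℝ, F) x →L[ℝ] ℝ) (x : M) :
    F →L[ℝ] F →L[ℝ] ℝ := B x

theorem mdiff_id (x : M) : mdiff (F := F) (F' := F) (fun y : M => y) x =
    ContinuousLinearMap.id ℝ F := mfderiv_id

/-- A change of chart is a pull-back along the identity map, so smoothness at `p` is visible in
every chart around `p`, not only in the preferred one. -/
theorem SmoothFormAt.contDiffAt_chartForm {p : M} (h : SmoothFormAt B p)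
    (hp : p ∈ (chartAt F x₁).source) :
    ContDiffAt ℝ ∞ (chartForm B x₁) (extChartAt 𝓘(ℝ, F) x₁ p) := by
  have hid : ContMDiffAt 𝓘(ℝ, F) 𝓘(ℝ, F) ∞ (fun y : M => y) p := contMDiffAt_id
  have h1 := chartForm_pullback (φ := fun y : M => y) (B := B) (B' := B) (x₀ := x₁) (x₁ := p)
    (hid.of_le (by simp)) hp (mem_chart_source F p) (by
      filter_upwards with q u v
      rw [mdiff_id]
      rfl)
  have h2 := contDiffAt_chartMap (x₀ := x₁) (x₁ := p) le_rfl hid hp (mem_chart_source F p)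
  refine ContDiffAt.congr_of_eventuallyEq ?_ h1
  refine ContDiffAt.clm_bilinearComp ?_ (h2.fderiv_right (m := ∞) (by simp))
  refine ContDiffAt.comp (g := chartForm B _) _ ?_ h2
  rw [chartMap_apply hp]
  exact smoothFormAt_iff.1 h

theorem SmoothFormAt.pullback (h : SmoothFormAt B (φ p))
    (hφ : ContMDiffAt 𝓘(ℝ, F') 𝓘(ℝ, F) ∞ φ p)
    (hB : ∀ᶠ q in 𝓝 p, ∀ u v : F', formAt B' q u v = formAt B (φ q) (mdiff φ q u) (mdiff φ q v)) :
    SmoothFormAt B' p := by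
  rw [smoothFormAt_iff]
  have h1 := chartForm_pullback (B := B) (B' := B') (x₀ := p) (x₁ := φ p)
    (hφ.of_le (by simp)) (mem_chart_source F' p) (mem_chart_source F (φ p)) hB
  have h2 := contDiffAt_chartMap (x₀ := p) (x₁ := φ p) le_rfl hφ (mem_chart_source F' p)
    (mem_chart_source F (φ p))
  refine ContDiffAt.congr_of_eventuallyEq ?_ h1
  refine ContDiffAt.clm_bilinearComp ?_ (h2.fderiv_right (m := ∞) (by simp))
  refine ContDiffAt.comp (g := chartForm B _) _ ?_ h2
  rw [chartMap_apply (mem_chart_source F' p)]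
  exact smoothFormAt_iff.1 h

theorem IsClosedTwoForm.closedAt (h : IsClosedTwoForm B) {p : M}
    (hp : p ∈ (chartAt F x₁).source) : ClosedAt (chartForm B x₁) (extChartAt 𝓘(ℝ, F) x₁ p) := by
  intro u v w
  refine h x₁ _ ((extChartAt 𝓘(ℝ, F) x₁).map_source ?_) u v w
  rwa [extChartAt_source]

theorem isClosedTwoForm_of_closedAt
    (h : ∀ x₁ p : M, p ∈ (chartAt F x₁).source →
      ClosedAt (chartForm B x₁) (extChartAt 𝓘(ℝ, F) x₁ p)) : IsClosedTwoForm B := by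
  intro x₁ y hy u v w
  have h1 := (extChartAt 𝓘(ℝ, F) x₁).map_target hy
  rw [extChartAt_source] at h1
  have h2 := h x₁ _ h1
  rw [(extChartAt 𝓘(ℝ, F) x₁).right_inv hy] at h2
  exact h2 u v w

/-- A form that is locally the pull-back of closed smooth forms is closed. -/
theorem isClosedTwoForm_of_pullback (hc : IsClosedTwoForm B) (hs : ∀ x, SmoothFormAt B x)
    (ha : ∀ (x : M) (u v : F), formAt B x u v = -formAt B x v u)
    (hB : ∀ p : N, ∃ φ : N → M, ContMDiffAt 𝓘(ℝ, F') 𝓘(ℝ, F) ∞ φ p ∧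
      ∀ᶠ q in 𝓝 p, ∀ u v : F', formAt B' q u v = formAt B (φ q) (mdiff φ q u) (mdiff φ q v)) :
    IsClosedTwoForm B' := by
  refine isClosedTwoForm_of_closedAt fun x₀ p hp => ?_
  obtain ⟨φ, hφ, hφB⟩ := hB p
  have h1 := chartForm_pullback (B := B) (B' := B') (x₀ := x₀) (x₁ := φ p)
    (hφ.of_le (by simp)) hp (mem_chart_source F (φ p)) hφB
  have h2 := contDiffAt_chartMap (x₀ := x₀) (x₁ := φ p) le_rfl hφ hp (mem_chart_source F (φ p))
  have h3 := chartMap_apply (F := F) (φ := φ) (x₁ := φ p) hp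
  refine ClosedAt.congr ?_ h1
  refine ClosedAt.pullback (h2.of_le (by norm_cast)) ?_ ?_ fun u v => ?_
  · rw [h3]
    exact (smoothFormAt_iff.1 (hs _)).of_le (by simp)
  · rw [h3]
    exact hc.closedAt (mem_chart_source F (φ p))
  · rw [chartForm_apply, chartForm_apply]
    exact ha _ _ _

theorem chartInv_chartEnd {y : F} (hy : y ∈ (extChartAt 𝓘(ℝ, F) x₁).target) (u : F) :
    chartInv x₁ y (chartEnd J x₁ y u) = endAt J ((extChartAt 𝓘(ℝ, F) x₁).symm y) (chartInv x₁ y u) :=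
  congrArg (fun A : F →L[ℝ] F => A _) (isInvertible_chartInv hy).self_comp_inverse

theorem chartInv_injective {y : F} (hy : y ∈ (extChartAt 𝓘(ℝ, F) x₁).target) :
    Injective (chartInv x₁ y) := (isInvertible_chartInv hy).injective

theorem chartEnd_chartEnd (hJ : ∀ (x : M) (u : F), endAt J x (endAt J x u) = -u) {y : F}
    (hy : y ∈ (extChartAt 𝓘(ℝ, F) x₁).target) (u : F) :
    chartEnd J x₁ y (chartEnd J x₁ y u) = -u := by
  apply chartInv_injective hy
  rw [map_neg]
  refine (chartInv_chartEnd hy _).trans ?_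
  rw [chartInv_chartEnd hy]
  exact hJ _ _

theorem chartForm_chartEnd {A : ∀ x : M, TangentSpace 𝓘(ℝ, F) x →L[ℝ] TangentSpace 𝓘(ℝ, F) x →L[ℝ] ℝ}
    (h : ∀ (x : M) (u v : F), formAt A x (endAt J x u) v = formAt B x u v) {y : F}
    (hy : y ∈ (extChartAt 𝓘(ℝ, F) x₁).target) (u v : F) :
    chartForm A x₁ y (chartEnd J x₁ y u) v = chartForm B x₁ y u v := by
  rw [chartForm_apply, chartForm_apply, chartInv_chartEnd hy]
  exact h _ _ _

theorem chartForm_nondegenerate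
    (h : ∀ (x : M) (u : F), (∀ v : F, formAt B x u v = 0) → u = 0) {y : F}
    (hy : y ∈ (extChartAt 𝓘(ℝ, F) x₁).target) (u : F) (hu : ∀ v, chartForm B x₁ y u v = 0) :
    u = 0 := by
  have h1 := h _ (chartInv x₁ y u) fun v => by
    obtain ⟨w, rfl⟩ := (isInvertible_chartInv hy).surjective v
    exact hu w
  exact chartInv_injective hy (h1.trans (map_zero _).symm)

theorem isInvertible_chartForm
    (h : ∀ (x : M) (u : F), (∀ v : F, formAt B x u v = 0) → u = 0) {y : F}
    (hy : y ∈ (extChartAt 𝓘(ℝ, F) x₁).target) : (chartForm B x₁ y).IsInvertible := by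
  have hi : Injective (chartForm B x₁ y : F →ₗ[ℝ] F →L[ℝ] ℝ) := by
    rw [← LinearMap.ker_eq_bot, LinearMap.ker_eq_bot']
    intro u hu
    exact chartForm_nondegenerate h hy u fun v => congrArg (fun L : F →L[ℝ] ℝ => L v) hu
  have hd : Module.finrank ℝ F = Module.finrank ℝ (F →L[ℝ] ℝ) := by
    rw [← LinearEquiv.finrank_eq (LinearMap.toContinuousLinearMap (E := F) (F' := ℝ) (𝕜 := ℝ))]
    exact (Subspace.dual_finrank_eq (K := ℝ) (V := F)).symm
  exact ⟨(LinearEquiv.ofInjectiveOfFinrankEq _ hi hd).toContinuousLinearEquiv, by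
    ext u v
    rfl⟩

/-- An endomorphism field determined by two smooth forms is smooth. -/
theorem smoothEndAt_of_forms
    {A : ∀ x : M, TangentSpace 𝓘(ℝ, F) x →L[ℝ] TangentSpace 𝓘(ℝ, F) x →L[ℝ] ℝ} {p : M}
    (h : ∀ (x : M) (u v : F), formAt A x (endAt J x u) v = formAt B x u v)
    (hA : ∀ (x : M) (u : F), (∀ v : F, formAt A x u v = 0) → u = 0)
    (hAs : SmoothFormAt A p) (hBs : SmoothFormAt B p) : SmoothEndAt J p := by
  rw [smoothEndAt_iff]
  rw [smoothFormAt_iff] at hAs hBs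
  have hinv : ∀ y ∈ (extChartAt 𝓘(ℝ, F) p).target, (chartForm A p y).IsInvertible :=
    fun y hy => isInvertible_chartForm hA hy
  -- In coordinates `J = A⁻¹ ∘ B`, and inversion is smooth at an invertible linear map.
  have hev : chartEnd J p =ᶠ[𝓝 (extChartAt 𝓘(ℝ, F) p p)]
      fun y => (chartForm A p y).inverse ∘L chartForm B p y := by
    filter_upwards [extChartAt_target_mem_nhds (I := 𝓘(ℝ, F)) p] with y hy
    ext u
    rw [ContinuousLinearMap.comp_apply]
    have h1 : chartForm B p y u = chartForm A p y (chartEnd J p y u) := by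
      ext v
      exact (chartForm_chartEnd h hy u v).symm
    rw [h1]
    exact (congrArg (fun L : F →L[ℝ] F => L (chartEnd J p y u)) (hinv y hy).inverse_comp_self).symm
  refine ContDiffAt.congr_of_eventuallyEq ?_ hev
  refine ContDiffAt.clm_comp ?_ hBs
  obtain ⟨e, he⟩ := hinv _ (mem_extChartAt_target p)
  have h2 : ContDiffAt ℝ ∞ ContinuousLinearMap.inverse (chartForm A p (extChartAt 𝓘(ℝ, F) p p)) := by
    rw [← he]
    exact contDiffAt_map_inverse e
  exact ContDiffAt.comp _ h2 hAs

/-- The coordinate expression of a relation `dφ ∘ J' = J ∘ dφ`. -/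
theorem fderiv_chartMap_comp_chartEnd
    (hφ : ContMDiffAt 𝓘(ℝ, F') 𝓘(ℝ, F) 1 φ p)
    (hp : p ∈ (chartAt F' x₀).source) (hp' : φ p ∈ (chartAt F x₁).source)
    (hJ : ∀ᶠ q in 𝓝 p, ∀ u : F', mdiff φ q (endAt J' q u) = endAt J (φ q) (mdiff φ q u)) :
    ∀ᶠ y in 𝓝 (extChartAt 𝓘(ℝ, F') x₀ p),
      fderiv ℝ (chartMap φ x₀ x₁ : F' → F) y ∘L chartEnd J' x₀ y =
        chartEnd J x₁ (chartMap φ x₀ x₁ y) ∘L fderiv ℝ (chartMap φ x₀ x₁) y := by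
  have h1 : ∀ᶠ q in 𝓝 p, ContMDiffAt 𝓘(ℝ, F') 𝓘(ℝ, F) 1 φ q :=
    (contMDiffAt_iff_contMDiffAt_nhds (by simp)).1 hφ
  have h2 : ∀ᶠ q in 𝓝 p, φ q ∈ (chartAt F x₁).source :=
    hφ.continuousAt.eventually_mem ((chartAt F x₁).open_source.mem_nhds hp')
  filter_upwards [eventually_extChartAt_symm hp (hJ.and (h1.and h2))] with y
  rintro ⟨q, hq, rfl, hJq, hφq, hq'⟩
  have h3 := mdiff_comp_chartInv hφq hq hq'
  have h0 : (extChartAt 𝓘(ℝ, F') x₀).symm (extChartAt 𝓘(ℝ, F') x₀ q) = q :=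
    (extChartAt 𝓘(ℝ, F') x₀).left_inv (by rwa [extChartAt_source])
  have h0' : (extChartAt 𝓘(ℝ, F) x₁).symm (extChartAt 𝓘(ℝ, F) x₁ (φ q)) = φ q :=
    (extChartAt 𝓘(ℝ, F) x₁).left_inv (by rwa [extChartAt_source])
  have hy : extChartAt 𝓘(ℝ, F') x₀ q ∈ (extChartAt 𝓘(ℝ, F') x₀).target :=
    (extChartAt 𝓘(ℝ, F') x₀).map_source (by rwa [extChartAt_source])
  have hy' : extChartAt 𝓘(ℝ, F) x₁ (φ q) ∈ (extChartAt 𝓘(ℝ, F) x₁).target :=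
    (extChartAt 𝓘(ℝ, F) x₁).map_source (by rwa [extChartAt_source])
  have h5 : ∀ x' : N, x' = q → ∀ a : F', endAt J' x' a = endAt J' q a := by
    rintro _ rfl a
    rfl
  have h5' : ∀ x' : M, x' = φ q → ∀ a : F, endAt J x' a = endAt J (φ q) a := by
    rintro _ rfl a
    rfl
  have h6 : ∀ u : F', mdiff φ q (chartInv x₀ (extChartAt 𝓘(ℝ, F') x₀ q) u) = _ :=
    fun u : F' => congrArg (fun A : F' →L[ℝ] F => A u) h3
  refine ContinuousLinearMap.ext fun u : F' => ?_
  apply chartInv_injective hy'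
  rw [chartMap_apply hq]
  refine (h6 _).symm.trans ?_
  refine (congrArg (mdiff φ q) (chartInv_chartEnd hy u)).trans ?_
  refine Eq.trans ?_ (chartInv_chartEnd hy' _).symm
  refine Eq.trans ?_ (h5' _ h0' _).symm
  refine Eq.trans (congrArg (mdiff φ q) (h5 _ h0 _)) ?_
  exact (hJq _).trans (congrArg (endAt J (φ q)) (h6 u))

end ManifoldTensors

/-! ### The Nijenhuis tensor in charts -/

section Nijenhuis

variable {F : Type*} [NormedAddCommGroup F] [NormedSpace ℝ F] [FiniteDimensional ℝ F]
  {M : Type*} [TopologicalSpace M] [ChartedSpace F M] [IsManifold 𝓘(ℝ, F) ∞ M]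
  {J : ∀ x : M, TangentSpace 𝓘(ℝ, F) x →L[ℝ] TangentSpace 𝓘(ℝ, F) x}

/-- The coordinate expression of a vector field. -/
def vecChart (V : ∀ x : M, TangentSpace 𝓘(ℝ, F) x) (x₀ : M) (y : F) : F :=
  (chartInv x₀ y).inverse (V ((extChartAt 𝓘(ℝ, F) x₀).symm y) : F)

theorem contMDiffAt_vec_iff {V : ∀ x : M, TangentSpace 𝓘(ℝ, F) x} {x₀ : M} :
    ContMDiffAt 𝓘(ℝ, F) (𝓘(ℝ, F).prod 𝓘(ℝ, F)) ∞
      (fun y => (Bundle.TotalSpace.mk y (V y) : TangentBundle 𝓘(ℝ, F) M)) x₀ ↔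
    ContDiffAt ℝ ∞ (vecChart V x₀) (extChartAt 𝓘(ℝ, F) x₀ x₀) := by
  refine (Bundle.contMDiffAt_section (IB := 𝓘(ℝ, F)) (F := F)
    (E := fun x : M => TangentSpace 𝓘(ℝ, F) x) x₀).trans ?_
  apply contMDiffAt_comp_extChartAt_iff
  filter_upwards [(chartAt F x₀).open_source.mem_nhds (mem_chart_source F x₀)] with x hx
  have h4 : (extChartAt 𝓘(ℝ, F) x₀).symm (extChartAt 𝓘(ℝ, F) x₀ x) = x :=
    (extChartAt 𝓘(ℝ, F) x₀).left_inv (by rwa [extChartAt_source])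
  have h5 : ∀ x' : M, x' = x → (V x : F) = V x' := by
    rintro _ rfl
    rfl
  have hb : x ∈ (trivializationAt F (TangentSpace 𝓘(ℝ, F)) x₀).baseSet := by simpa using hx
  have h3 := continuousLinearMapAt_trivializationAt_eq hx
  have h6 : (trivializationAt F (TangentSpace 𝓘(ℝ, F)) x₀).continuousLinearMapAt ℝ x (V x) =
      (trivializationAt F (TangentSpace 𝓘(ℝ, F)) x₀ ⟨x, V x⟩).2 := by
    rw [Bundle.Trivialization.continuousLinearMapAt_apply,
      Bundle.Trivialization.linearMapAt_apply, if_pos hb]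
  refine h6.symm.trans ?_
  have h7 := congrArg (fun A : F →L[ℝ] F => A (V x)) h3
  exact h7.trans (congrArg (chartInv x₀ (extChartAt 𝓘(ℝ, F) x₀ x)).inverse (h5 _ h4))

/-- The bracket at `x` is pulled back from the preferred chart at `x`, whose differential there is
the identity; hence the coordinate formula has no correction factor. -/
theorem mlieBracket_eq (V W : ∀ x : M, TangentSpace 𝓘(ℝ, F) x) (x : M) :
    (VectorField.mlieBracket 𝓘(ℝ, F) V W x : F) =
      fderiv ℝ (vecChart W x) (extChartAt 𝓘(ℝ, F) x x) (vecChart V x (extChartAt 𝓘(ℝ, F) x x))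
      - fderiv ℝ (vecChart V x) (extChartAt 𝓘(ℝ, F) x x)
        (vecChart W x (extChartAt 𝓘(ℝ, F) x x)) := by
  have hr : range 𝓘(ℝ, F) = univ := ModelWithCorners.range_eq_univ _
  have h1 : (mfderiv 𝓘(ℝ, F) 𝓘(ℝ, F) (extChartAt 𝓘(ℝ, F) x) x : F →L[ℝ] F) =
      ContinuousLinearMap.id ℝ F := by
    have h2 := mfderivWithin_extChartAt_symm_comp_mfderiv_extChartAt' (I := 𝓘(ℝ, F))
      (mem_extChartAt_source (I := 𝓘(ℝ, F)) x)
    rw [hr, mfderivWithin_univ] at h2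
    have h3 := chartInv_self (F := F) x
    have h4 : chartInv x (extChartAt 𝓘(ℝ, F) x x) ∘L
      (mfderiv 𝓘(ℝ, F) 𝓘(ℝ, F) (extChartAt 𝓘(ℝ, F) x) x : F →L[ℝ] F) =
        ContinuousLinearMap.id ℝ F := h2
    rw [h3] at h4
    exact h4
  have h5 : ∀ V : ∀ x : M, TangentSpace 𝓘(ℝ, F) x,
      VectorField.mpullbackWithin 𝓘(ℝ, F) 𝓘(ℝ, F) (extChartAt 𝓘(ℝ, F) x).symm V univ =
        vecChart V x := by
    intro V
    funext y
    rw [VectorField.mpullbackWithin_apply, mfderivWithin_univ]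
    rfl
  rw [← VectorField.mlieBracketWithin_univ, VectorField.mlieBracketWithin_apply, hr, h5, h5,
    preimage_univ, univ_inter, VectorField.lieBracketWithin_univ]
  have h6 := congrArg (fun A : F →L[ℝ] F => A.inverse (VectorField.lieBracket ℝ (vecChart V x)
    (vecChart W x) (extChartAt 𝓘(ℝ, F) x x))) h1
  refine h6.trans ?_
  simp only [ContinuousLinearMap.inverse_id]
  rfl

theorem vecChart_end (V : ∀ x : M, TangentSpace 𝓘(ℝ, F) x) {x₀ : M} {y : F}
    (hy : y ∈ (extChartAt 𝓘(ℝ, F) x₀).target) :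
    vecChart (fun x => J x (V x)) x₀ y = chartEnd J x₀ y (vecChart V x₀ y) := by
  apply chartInv_injective hy
  rw [chartInv_chartEnd hy]
  have h1 : ∀ w : F, chartInv x₀ y ((chartInv x₀ y).inverse w) = w := fun w =>
    congrArg (fun A : F →L[ℝ] F => A w) (isInvertible_chartInv hy).self_comp_inverse
  exact (h1 _).trans (congrArg (endAt J _) (h1 _)).symm

theorem chartEnd_self (x : M) : chartEnd J x (extChartAt 𝓘(ℝ, F) x x) = endAt J x := by
  have h5 : ∀ x' : M, x' = x → endAt J x' = endAt J x := by
    rintro _ rfl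
    rfl
  ext u
  have h1 := chartInv_chartEnd (J := J) (mem_extChartAt_target (I := 𝓘(ℝ, F)) x) u
  rw [chartInv_self] at h1
  exact h1.trans (congrArg (fun A : F →L[ℝ] F => A u) (h5 _ (extChartAt_to_inv x)))

/-- The vanishing of the Nijenhuis tensor, in coordinates. -/
theorem nijenhuisVanishes_iff (hs : ∀ x, SmoothEndAt J x)
    (hJ : ∀ (x : M) (u : F), endAt J x (endAt J x u) = -u) :
    NijenhuisVanishes J ↔ ∀ x, NijenhuisAt (chartEnd J x) (extChartAt 𝓘(ℝ, F) x x) := by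
  -- Tensoriality: by `J² = -1` the derivatives of `V` and `W` drop out, and only their values at
  -- `x` remain.
  have hformula : ∀ (x : M) (V W : ∀ y : M, TangentSpace 𝓘(ℝ, F) y),
      ContDiffAt ℝ ∞ (vecChart V x) (extChartAt 𝓘(ℝ, F) x x) →
      ContDiffAt ℝ ∞ (vecChart W x) (extChartAt 𝓘(ℝ, F) x x) → ∀ u v : F,
      u = vecChart V x (extChartAt 𝓘(ℝ, F) x x) → v = vecChart W x (extChartAt 𝓘(ℝ, F) x x) →
      (VectorField.mlieBracket 𝓘(ℝ, F) (fun y => J y (V y)) (fun y => J y (W y)) x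
      - J x (VectorField.mlieBracket 𝓘(ℝ, F) (fun y => J y (V y)) W x)
      - J x (VectorField.mlieBracket 𝓘(ℝ, F) V (fun y => J y (W y)) x)
      - VectorField.mlieBracket 𝓘(ℝ, F) V W x : F) =
      fderiv ℝ (chartEnd J x) (extChartAt 𝓘(ℝ, F) x x) (endAt J x u) v
      - fderiv ℝ (chartEnd J x) (extChartAt 𝓘(ℝ, F) x x) (endAt J x v) u
      + endAt J x (fderiv ℝ (chartEnd J x) (extChartAt 𝓘(ℝ, F) x x) v u)
      - endAt J x (fderiv ℝ (chartEnd J x) (extChartAt 𝓘(ℝ, F) x x) u v) := by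
    intro x V W hV hW u v hu hv
    have hJd : DifferentiableAt ℝ (chartEnd J x) (extChartAt 𝓘(ℝ, F) x x) :=
      (smoothEndAt_iff.1 (hs x)).differentiableAt (by simp)
    have hd : ∀ V : ∀ y : M, TangentSpace 𝓘(ℝ, F) y,
        ContDiffAt ℝ ∞ (vecChart V x) (extChartAt 𝓘(ℝ, F) x x) → ∀ w : F,
        fderiv ℝ (vecChart (fun y => J y (V y)) x) (extChartAt 𝓘(ℝ, F) x x) w =
        endAt J x (fderiv ℝ (vecChart V x) (extChartAt 𝓘(ℝ, F) x x) w) +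
        fderiv ℝ (chartEnd J x) (extChartAt 𝓘(ℝ, F) x x) w
          (vecChart V x (extChartAt 𝓘(ℝ, F) x x)) := by
      intro V hV w
      have h1 : vecChart (fun y => J y (V y)) x =ᶠ[𝓝 (extChartAt 𝓘(ℝ, F) x x)]
          fun y => chartEnd J x y (vecChart V x y) := by
        filter_upwards [extChartAt_target_mem_nhds (I := 𝓘(ℝ, F)) x] with y hy
        exact vecChart_end V hy
      have h2 := hJd.hasFDerivAt.clm_apply (hV.differentiableAt (by simp)).hasFDerivAt
      rw [h1.fderiv_eq, h2.fderiv, ← chartEnd_self]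
      simp
    have he : ∀ V : ∀ y : M, TangentSpace 𝓘(ℝ, F) y,
        vecChart (fun y => J y (V y)) x (extChartAt 𝓘(ℝ, F) x x) =
          endAt J x (vecChart V x (extChartAt 𝓘(ℝ, F) x x)) := by
      intro V
      rw [vecChart_end V (mem_extChartAt_target x), chartEnd_self]
    have e1 := mlieBracket_eq (fun y => J y (V y)) (fun y => J y (W y)) x
    have e2 := mlieBracket_eq (fun y => J y (V y)) W x
    have e3 := mlieBracket_eq V (fun y => J y (W y)) x
    have e4 := mlieBracket_eq V W x
    rw [hd V hV, hd W hW, he, he, ← hu, ← hv] at e1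
    rw [hd V hV, he, ← hu, ← hv] at e2
    rw [hd W hW, he, ← hu, ← hv] at e3
    rw [← hu, ← hv] at e4
    obtain ⟨b1, hb1⟩ : ∃ b : F, b = VectorField.mlieBracket 𝓘(ℝ, F)
      (fun y => J y (V y)) (fun y => J y (W y)) x := ⟨_, rfl⟩
    obtain ⟨b2, hb2⟩ : ∃ b : F, b = VectorField.mlieBracket 𝓘(ℝ, F)
      (fun y => J y (V y)) W x := ⟨_, rfl⟩
    obtain ⟨b3, hb3⟩ : ∃ b : F, b = VectorField.mlieBracket 𝓘(ℝ, F)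
      V (fun y => J y (W y)) x := ⟨_, rfl⟩
    obtain ⟨b4, hb4⟩ : ∃ b : F, b = VectorField.mlieBracket 𝓘(ℝ, F) V W x := ⟨_, rfl⟩
    have hgoal : b1 - endAt J x b2 - endAt J x b3 - b4 =
      fderiv ℝ (chartEnd J x) (extChartAt 𝓘(ℝ, F) x x) (endAt J x u) v
      - fderiv ℝ (chartEnd J x) (extChartAt 𝓘(ℝ, F) x x) (endAt J x v) u
      + endAt J x (fderiv ℝ (chartEnd J x) (extChartAt 𝓘(ℝ, F) x x) v u)
      - endAt J x (fderiv ℝ (chartEnd J x) (extChartAt 𝓘(ℝ, F) x x) u v) := by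
      rw [hb1.trans e1, hb2.trans e2, hb3.trans e3, hb4.trans e4]
      simp only [map_add, map_sub, hJ]
      module
    rw [hb1, hb2, hb3, hb4] at hgoal
    exact hgoal
  constructor
  · intro h x u v
    rw [chartEnd_self]
    -- Fields with constant coordinates near `x` realise every prescribed value.
    have hc : ∀ u : F, ∃ V : ∀ y : M, TangentSpace 𝓘(ℝ, F) y,
        vecChart V x =ᶠ[𝓝 (extChartAt 𝓘(ℝ, F) x x)] fun _ => u := by
      intro u
      refine ⟨fun y => (chartInv x (extChartAt 𝓘(ℝ, F) x y) u : F), ?_⟩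
      filter_upwards [extChartAt_target_mem_nhds (I := 𝓘(ℝ, F)) x] with y hy
      have h1 : ∀ w : F, (chartInv x y).inverse (chartInv x y w) = w := fun w =>
        congrArg (fun A : F →L[ℝ] F => A w) (isInvertible_chartInv hy).inverse_comp_self
      refine Eq.trans ?_ (h1 u)
      exact congrArg (fun y' => (chartInv x y).inverse (chartInv x y' u))
        ((extChartAt 𝓘(ℝ, F) x).right_inv hy)
    obtain ⟨V, hV⟩ := hc u
    obtain ⟨W, hW⟩ := hc v
    have hV' := (contDiffAt_const (c := u)).congr_of_eventuallyEq hV (n := ∞) (𝕜 := ℝ)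
    have hW' := (contDiffAt_const (c := v)).congr_of_eventuallyEq hW (n := ∞) (𝕜 := ℝ)
    rw [← hformula x V W hV' hW' u v hV.self_of_nhds.symm hW.self_of_nhds.symm]
    exact h x V W (contMDiffAt_vec_iff.2 hV') (contMDiffAt_vec_iff.2 hW')
  · intro h x V W hV hW
    refine (hformula x V W (contMDiffAt_vec_iff.1 hV) (contMDiffAt_vec_iff.1 hW) _ _ rfl rfl).trans
      ?_
    have := h x (vecChart V x (extChartAt 𝓘(ℝ, F) x x)) (vecChart W x (extChartAt 𝓘(ℝ, F) x x))
    rwa [chartEnd_self] at this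

end Nijenhuis

/-! ### Construction and restriction of Kähler structures -/

section Kahler

variable {F : Type*} [NormedAddCommGroup F] [NormedSpace ℝ F] [FiniteDimensional ℝ F]
  {M : Type*} [TopologicalSpace M] [ChartedSpace F M] [IsManifold 𝓘(ℝ, F) ∞ M]
  {F' : Type*} [NormedAddCommGroup F'] [NormedSpace ℝ F'] [FiniteDimensional ℝ F']
  {N : Type*} [TopologicalSpace N] [ChartedSpace F' N] [IsManifold 𝓘(ℝ, F') ∞ N]
  {B : ∀ x : M, TangentSpace 𝓘(ℝ, F) x →L[ℝ] TangentSpace 𝓘(ℝ, F) x →L[ℝ] ℝ}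
  {J : ∀ x : M, TangentSpace 𝓘(ℝ, F) x →L[ℝ] TangentSpace 𝓘(ℝ, F) x}

/-- Compactness of the unit sphere gives `c ‖v‖² ≤ b v v` for some `c > 0`, so the unit ball of `b`
is norm-bounded. -/
theorem isVonNBounded_setOf_apply_self_lt_one {b : F →L[ℝ] F →L[ℝ] ℝ}
    (hpos : ∀ u, u ≠ 0 → 0 < b u u) : Bornology.IsVonNBounded ℝ {v : F | b v v < 1} := by
  rw [NormedSpace.isVonNBounded_iff, Metric.isBounded_iff_subset_closedBall 0]
  obtain ⟨c, hc, hcb⟩ := (isCompact_sphere (0 : F) 1).exists_forall_le' (f := fun v => b v v)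
    (a := 0) (by fun_prop) (fun v hv => hpos v (by
      rintro rfl
      simp at hv))
  refine ⟨1 + 1 / c, fun v hv => ?_⟩
  rw [mem_closedBall_zero_iff]
  rcases eq_or_ne v 0 with rfl | h0
  · rw [norm_zero]
    positivity
  have hn : 0 < ‖v‖ := norm_pos_iff.2 h0
  have h1 := hcb (‖v‖⁻¹ • v) (by simp [norm_smul, hn.ne'])
  simp only [map_smul, smul_apply, smul_eq_mul] at h1
  have h2 : c * ‖v‖ ^ 2 ≤ b v v := by
    have : b v v = ‖v‖ ^ 2 * (‖v‖⁻¹ * (‖v‖⁻¹ * b v v)) := by field_simp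
    rw [this, mul_comm c]
    gcongr
  have h3 : c * ‖v‖ ^ 2 < 1 := h2.trans_lt hv
  by_contra! h4
  have h5 : 1 / c < ‖v‖ := by linarith
  rw [div_lt_iff₀ hc] at h5
  nlinarith [one_div_pos.2 hc]

theorem exists_smoothMetric (hsymm : ∀ (x : M) (u v : F), formAt B x u v = formAt B x v u)
    (hpos : ∀ (x : M) (u : F), u ≠ 0 → 0 < formAt B x u u) (hB : ∀ x, SmoothFormAt B x) :
    ∃ g : SmoothMetric F M, g.inner = B :=
  ⟨{ inner := B
     symm := hsymm
     pos := hpos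
     isVonNBounded := fun x => isVonNBounded_setOf_apply_self_lt_one (b := formAt B x) (hpos x)
     contMDiff := fun x => hB x }, rfl⟩

theorem SmoothFormAt.comp_end {x : M} (hB : SmoothFormAt B x) (hJ : SmoothEndAt J x) :
    SmoothFormAt (fun x => (B x).comp (J x)) x := by
  rw [smoothFormAt_iff] at hB ⊢
  rw [smoothEndAt_iff] at hJ
  refine (hB.clm_comp hJ).congr_of_eventuallyEq ?_
  filter_upwards [extChartAt_target_mem_nhds (I := 𝓘(ℝ, F)) x] with y hy
  ext u v
  exact (chartForm_chartEnd (A := B) (B := fun x => (B x).comp (J x)) (fun _ _ _ => rfl) hy u v).symm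

theorem SmoothMetric.smoothFormAt (g : SmoothMetric F M) (x : M) : SmoothFormAt g.inner x :=
  g.contMDiff x

theorem SmoothMetric.formAt_symm (g : SmoothMetric F M) (x : M) (u v : F) :
    formAt g.inner x u v = formAt g.inner x v u := g.symm x u v

theorem SmoothMetric.formAt_pos (g : SmoothMetric F M) (x : M) {u : F} (hu : u ≠ 0) :
    0 < formAt g.inner x u u := g.pos x u hu

theorem SmoothMetric.formAt_nondegenerate (g : SmoothMetric F M) (x : M) (u : F)
    (hu : ∀ v, formAt g.inner x u v = 0) : u = 0 := by
  by_contra h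
  exact (g.formAt_pos x h).ne' (hu u)

theorem isKahler_of {g : SmoothMetric F M} (hJs : ∀ x, SmoothEndAt J x)
    (hJJ : ∀ (x : M) (u : F), endAt J x (endAt J x u) = -u)
    (hherm : ∀ (x : M) (u v : F),
      formAt g.inner x (endAt J x u) (endAt J x v) = formAt g.inner x u v)
    (hN : ∀ x, NijenhuisAt (chartEnd J x) (extChartAt 𝓘(ℝ, F) x x))
    (hc : IsClosedTwoForm (fun x => (g.inner x).comp (J x))) : IsKahler g J where
  contMDiff_J := fun x => hJs x
  J_J := hJJ
  hermitian := hherm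
  integrable := (nijenhuisVanishes_iff hJs hJJ).2 hN
  closed := hc

namespace KahlerStructure

variable (κ : KahlerStructure F M)

theorem endAt_endAt (x : M) (u : F) : endAt κ.J x (endAt κ.J x u) = -u := κ.isKahler.J_J x u

theorem formAt_endAt_endAt (x : M) (u v : F) :
    formAt κ.g.inner x (endAt κ.J x u) (endAt κ.J x v) = formAt κ.g.inner x u v :=
  κ.isKahler.hermitian x u v

theorem smoothEndAt (x : M) : SmoothEndAt κ.J x := κ.isKahler.contMDiff_J x

theorem smoothFormAt_form (x : M) : SmoothFormAt κ.form x :=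
  (κ.g.smoothFormAt x).comp_end (κ.smoothEndAt x)

theorem formAt_form (x : M) (u v : F) :
    formAt κ.form x u v = formAt κ.g.inner x (endAt κ.J x u) v := rfl

theorem formAt_form_antisymm (x : M) (u v : F) :
    formAt κ.form x u v = -formAt κ.form x v u := by
  rw [formAt_form, formAt_form, ← κ.formAt_endAt_endAt, κ.endAt_endAt, map_neg,
    neg_apply, κ.g.formAt_symm]

theorem isClosedTwoForm_form : IsClosedTwoForm κ.form := κ.isKahler.closed

theorem nijenhuisAt (x : M) : NijenhuisAt (chartEnd κ.J x) (extChartAt 𝓘(ℝ, F) x x) :=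
  (nijenhuisVanishes_iff κ.smoothEndAt κ.endAt_endAt).1 κ.isKahler.integrable x

theorem formAt_form_nondegenerate (x : M) (u : F) (hu : ∀ v, formAt κ.form x u v = 0) : u = 0 := by
  have h := κ.g.formAt_nondegenerate x (endAt κ.J x u) hu
  rw [← neg_eq_zero, ← κ.endAt_endAt x u, h, map_zero]

end KahlerStructure

theorem fderiv_chartMap_self {φ : N → M} {p : N} (hφ : ContMDiffAt 𝓘(ℝ, F') 𝓘(ℝ, F) 1 φ p) :
    fderiv ℝ (chartMap φ p (φ p) : F' → F) (extChartAt 𝓘(ℝ, F') p p) = mdiff φ p := by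
  have h := mdiff_comp_chartInv hφ (mem_chart_source F' p) (mem_chart_source F (φ p))
  rw [chartInv_self, chartInv_self] at h
  exact h.symm

/-- A Kähler structure restricts along an immersion whose tangent spaces are complex. -/
theorem KahlerStructure.exists_restrict (κ : KahlerStructure F M) {φ : N → M}
    (hφ : ContMDiff 𝓘(ℝ, F') 𝓘(ℝ, F) ∞ φ)
    (hinj : ∀ p, Injective (mdiff φ p : F' →L[ℝ] F))
    (hJ : ∀ (p : N) (u : F'), ∃ w : F', mdiff φ p w = endAt κ.J (φ p) (mdiff φ p u)) :
    ∃ κN : KahlerStructure F' N, PreservesKahler κN κ φ := by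
  -- A left inverse of the differential serves to write down the restricted `J`. Its choice does not
  -- matter, because `J` preserves the image of the differential.
  have hleft : ∀ p, ∃ P : F →L[ℝ] F', ∀ u : F', P (mdiff φ p u) = u := by
    intro p
    obtain ⟨P, hP⟩ := LinearMap.exists_leftInverse_of_injective
      (mdiff φ p : F' →L[ℝ] F).toLinearMap (LinearMap.ker_eq_bot.2 (hinj p))
    exact ⟨P.toContinuousLinearMap, fun u => congrArg (fun L : F' →ₗ[ℝ] F' => L u) hP⟩
  choose P hP using hleft
  obtain ⟨B', hB'⟩ :
      ∃ B' : ∀ x : N, TangentSpace 𝓘(ℝ, F') x →L[ℝ] TangentSpace 𝓘(ℝ, F') x →L[ℝ] ℝ,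
      ∀ (p : N) (u v : F'),
        formAt B' p u v = formAt κ.g.inner (φ p) (mdiff φ p u) (mdiff φ p v) :=
    ⟨fun p => ((formAt κ.g.inner (φ p)).bilinearComp (mdiff φ p) (mdiff φ p) :
      F' →L[ℝ] F' →L[ℝ] ℝ), fun _ _ _ => rfl⟩
  obtain ⟨J', hPJ⟩ : ∃ J' : ∀ x : N, TangentSpace 𝓘(ℝ, F') x →L[ℝ] TangentSpace 𝓘(ℝ, F') x,
      ∀ (p : N) (u : F'), endAt J' p u = P p (endAt κ.J (φ p) (mdiff φ p u)) :=
    ⟨fun p => (P p ∘L (endAt κ.J (φ p) ∘L mdiff φ p) : F' →L[ℝ] F'), fun _ _ => rfl⟩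
  have hJ' : ∀ (p : N) (u : F'), mdiff φ p (endAt J' p u) = endAt κ.J (φ p) (mdiff φ p u) := by
    intro p u
    obtain ⟨w, hw⟩ := hJ p u
    rw [hPJ, ← hw, hP]
  have hBs : ∀ p, SmoothFormAt B' p := fun p =>
    (κ.g.smoothFormAt (φ p)).pullback (hφ p) (Filter.Eventually.of_forall fun q u v => hB' q u v)
  obtain ⟨g, hg⟩ := exists_smoothMetric (B := B') (fun p u v => by
      rw [hB', hB', κ.g.formAt_symm])
    (fun p u hu => by
      rw [hB']
      exact κ.g.formAt_pos _ fun h => hu (hinj p (h.trans (map_zero _).symm))) hBs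
  have hω : ∀ (p : N) (u v : F'), formAt (fun p => (B' p).comp (J' p)) p u v =
      formAt κ.form (φ p) (mdiff φ p u) (mdiff φ p v) := by
    intro p u v
    rw [κ.formAt_form, ← hJ', ← hB']
    rfl
  have hωs : ∀ p, SmoothFormAt (fun p => (B' p).comp (J' p)) p := fun p =>
    (κ.smoothFormAt_form (φ p)).pullback (hφ p) (Filter.Eventually.of_forall fun q u v => hω q u v)
  -- The left inverses were chosen pointwise, so smoothness of `J'` cannot be read off its
  -- definition; it follows from that of the metric and of the form, which determine `J'`.
  have hJs : ∀ p, SmoothEndAt J' p := fun p =>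
    smoothEndAt_of_forms (A := B') (fun _ _ _ => rfl)
      (fun x u hu => by
        subst hg
        exact g.formAt_nondegenerate x u hu) (hBs p) (hωs p)
  have hJJ : ∀ (p : N) (u : F'), endAt J' p (endAt J' p u) = -u := by
    intro p u
    apply hinj p
    rw [hJ', hJ', κ.endAt_endAt, map_neg]
  subst hg
  refine ⟨⟨g, J', isKahler_of hJs hJJ ?_ ?_ ?_⟩, ?_⟩
  · intro p u v
    rw [hB', hB', hJ', hJ', κ.formAt_endAt_endAt]
  · intro p
    have h2 := contDiffAt_chartMap (x₀ := p) (x₁ := φ p) le_rfl (hφ p) (mem_chart_source F' p)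
      (mem_chart_source F (φ p))
    have h3 := chartMap_apply (F := F) (φ := φ) (x₁ := φ p) (mem_chart_source F' p)
    refine NijenhuisAt.of_comp (h2.of_le (by norm_cast)) (J := chartEnd κ.J (φ p)) ?_
      ((smoothEndAt_iff.1 (hJs p)).differentiableAt (by simp)) ?_
      (fderiv_chartMap_comp_chartEnd ((hφ p).of_le (by simp)) (mem_chart_source F' p)
        (mem_chart_source F (φ p)) (Filter.Eventually.of_forall fun q u => hJ' q u)) ?_
    · rw [h3]
      exact (smoothEndAt_iff.1 (κ.smoothEndAt _)).differentiableAt (by simp)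
    · rw [fderiv_chartMap_self ((hφ p).of_le (by simp))]
      exact hinj p
    · rw [h3]
      exact κ.nijenhuisAt _
  · exact isClosedTwoForm_of_pullback κ.isClosedTwoForm_form κ.smoothFormAt_form
      κ.formAt_form_antisymm fun p => ⟨φ, hφ p, Filter.Eventually.of_forall fun q u v => hω q u v⟩
  · intro p u v
    exact ⟨(hB' p u v).symm, hJ' p u⟩

end Kahler

/-! ### Sections of submersions and descent of hyper-Kähler structures -/

section Mdiff

variable {F : Type*} [NormedAddCommGroup F] [NormedSpace ℝ F]
  {M : Type*} [TopologicalSpace M] [ChartedSpace F M]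
  {F' : Type*} [NormedAddCommGroup F'] [NormedSpace ℝ F']
  {N : Type*} [TopologicalSpace N] [ChartedSpace F' N]
  {F'' : Type*} [NormedAddCommGroup F''] [NormedSpace ℝ F'']
  {P : Type*} [TopologicalSpace P] [ChartedSpace F'' P]

theorem hasMFDerivAt_mdiff {f : M → N} {x : M} (hf : ContMDiffAt 𝓘(ℝ, F) 𝓘(ℝ, F') ∞ f x) :
    HasMFDerivAt 𝓘(ℝ, F) 𝓘(ℝ, F') f x (mdiff f x : F →L[ℝ] F') :=
  (hf.mdifferentiableAt (by simp)).hasMFDerivAt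

theorem mdiff_eq_of_hasMFDerivAt {f : M → N} {x : M} {L : F →L[ℝ] F'}
    (hf : HasMFDerivAt 𝓘(ℝ, F) 𝓘(ℝ, F') f x L) : mdiff f x = L := hf.mfderiv

theorem mdiff_comp {f : M → N} {g : N → P} {x : M} (hg : ContMDiffAt 𝓘(ℝ, F') 𝓘(ℝ, F'') ∞ g (f x))
    (hf : ContMDiffAt 𝓘(ℝ, F) 𝓘(ℝ, F') ∞ f x) :
    (mdiff (fun y => g (f y)) x : F →L[ℝ] F'') =
      (mdiff g (f x) : F' →L[ℝ] F'') ∘L (mdiff f x : F →L[ℝ] F') :=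
  mdiff_eq_of_hasMFDerivAt ((hasMFDerivAt_mdiff hg).comp x (hasMFDerivAt_mdiff hf))

theorem mdiff_comp_apply {f : M → N} {g : N → P} {x : M}
    (hg : ContMDiffAt 𝓘(ℝ, F') 𝓘(ℝ, F'') ∞ g (f x))
    (hf : ContMDiffAt 𝓘(ℝ, F) 𝓘(ℝ, F') ∞ f x) (u : F) :
    (mdiff (fun y => g (f y)) x : F →L[ℝ] F'') u =
      (mdiff g (f x) : F' →L[ℝ] F'') ((mdiff f x : F →L[ℝ] F') u) := by
  rw [mdiff_comp hg hf]
  rfl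

theorem mdiff_congr {f g : M → N} {x : M} (h : f =ᶠ[𝓝 x] g) :
    (mdiff f x : F →L[ℝ] F') = mdiff g x := h.mfderiv_eq

variable [FiniteDimensional ℝ F] [FiniteDimensional ℝ F'] [IsManifold 𝓘(ℝ, F) ∞ M]
  [IsManifold 𝓘(ℝ, F') ∞ N]

/-- A submersion has local sections. -/
theorem exists_localSection {f : M → N} (hf : ContMDiff 𝓘(ℝ, F) 𝓘(ℝ, F') ∞ f) {x : M}
    (hs : Surjective (mdiff f x : F →L[ℝ] F')) :
    ∃ s : N → M, s (f x) = x ∧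
      ∀ᶠ q in 𝓝 (f x), ContMDiffAt 𝓘(ℝ, F') 𝓘(ℝ, F) ∞ s q ∧ f (s q) = q := by
  obtain ⟨r, hr⟩ := (mdiff f x : F →L[ℝ] F').toLinearMap.exists_rightInverse_of_surjective
    (LinearMap.range_eq_top.2 hs)
  let R : F' →L[ℝ] F := r.toContinuousLinearMap
  have hR : ∀ v, mdiff f x (R v) = v := fun v => congrArg (fun L : F' →ₗ[ℝ] F' => L v) hr
  -- Leaving `x` along a linear right inverse `R` of the differential gives a map `h` for which `f ∘
  -- h` has the identity as derivative at `0`. The section is `h` after the local inverse of `f ∘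
  -- h`.
  let a : F' → F := fun y => extChartAt 𝓘(ℝ, F) x x + R y
  have ha : ContMDiff 𝓘(ℝ, F') 𝓘(ℝ, F) ∞ a := (contDiff_const.add R.contDiff).contMDiff
  have ha0 : a 0 = extChartAt 𝓘(ℝ, F) x x := by simp [a]
  have hU : IsOpen (a ⁻¹' (extChartAt 𝓘(ℝ, F) x).target) :=
    (isOpen_extChartAt_target x).preimage ha.continuous
  have h0 : (0 : F') ∈ a ⁻¹' (extChartAt 𝓘(ℝ, F) x).target := by
    rw [mem_preimage, ha0]
    exact mem_extChartAt_target x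
  let h : F' → M := fun y => (extChartAt 𝓘(ℝ, F) x).symm (a y)
  have hh : ContMDiffOn 𝓘(ℝ, F') 𝓘(ℝ, F) ∞ h (a ⁻¹' (extChartAt 𝓘(ℝ, F) x).target) :=
    (contMDiffOn_extChartAt_symm x).comp ha.contMDiffOn fun y hy => hy
  have hh0 : h 0 = x := by
    simp only [h, ha0]
    exact extChartAt_to_inv x
  have hdh : HasMFDerivAt 𝓘(ℝ, F') 𝓘(ℝ, F) h 0 R := by
    have h1 : HasMFDerivAt 𝓘(ℝ, F') 𝓘(ℝ, F) a 0 R :=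
      (R.hasFDerivAt.const_add _).hasMFDerivAt
    have h2 := hasMFDerivAt_extChartAt_symm (mem_extChartAt_target (I := 𝓘(ℝ, F)) x)
    rw [← ha0] at h2
    have h3 := h2.comp (0 : F') h1
    rw [ha0, chartInv_self] at h3
    exact h3
  have hfh : ContMDiffOn 𝓘(ℝ, F') 𝓘(ℝ, F') ∞ (f ∘ h) (a ⁻¹' (extChartAt 𝓘(ℝ, F) x).target) :=
    hf.comp_contMDiffOn hh
  have hdfh : HasMFDerivAt 𝓘(ℝ, F') 𝓘(ℝ, F') (f ∘ h) 0 (ContinuousLinearMap.id ℝ F') := by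
    have h1 := hasMFDerivAt_mdiff (hf x)
    rw [← hh0] at h1
    have h2 := h1.comp (0 : F') hdh
    rw [hh0] at h2
    refine h2.congr_mfderiv ?_
    exact ContinuousLinearMap.ext fun v : F' => hR v
  obtain ⟨Φ, hΦ0, hΦU, hΦ⟩ := isLocalDiffeomorphAt_of_bijective_mfderiv hU hfh h0 (by
    rw [hdfh.mfderiv]
    exact bijective_id)
  have hq : f x = Φ.toPartialEquiv 0 := by
    rw [← hΦ hΦ0, comp_apply, hh0]
  have hqt : f x ∈ Φ.target := hq ▸ Φ.map_source hΦ0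
  have hq0 : Φ.symm (f x) = (0 : F') := by
    rw [hq]
    exact Φ.left_inv hΦ0
  refine ⟨fun q => h (Φ.symm q), ?_, ?_⟩
  · simp only [hq0, hh0]
  · filter_upwards [Φ.open_target.mem_nhds hqt] with q hq'
    constructor
    · have h4 : ContMDiffAt 𝓘(ℝ, F') 𝓘(ℝ, F) ∞ h (Φ.symm.toPartialEquiv q) :=
        hh.contMDiffAt (hU.mem_nhds (hΦU (Φ.map_target hq')))
      exact ContMDiffAt.comp (g := h) q h4
        (Φ.contMDiffOn_invFun.contMDiffAt (Φ.open_target.mem_nhds hq'))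
    · exact (hΦ (Φ.map_target hq')).trans (Φ.right_inv hq')

end Mdiff

/-! ### Lifts orthogonal to the kernel -/

section Lift

variable {V W : Type*} [AddCommGroup V] [Module ℝ V] [AddCommGroup W] [Module ℝ W]
  [FiniteDimensional ℝ V] [FiniteDimensional ℝ W]

/-- A surjective linear map has a section with values in the orthogonal complement of its
kernel. -/
theorem exists_orthogonal_lift {b : V →ₗ[ℝ] V →ₗ[ℝ] ℝ} (hb : ∀ u, u ≠ 0 → 0 < b u u)
    {p : V →ₗ[ℝ] W} (hp : Surjective p) :
    ∃ r : W →ₗ[ℝ] V, (∀ w, p (r w) = w) ∧ ∀ w v, p v = 0 → b (r w) v = 0 := by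
  -- `T u` records `p u` and the pairing of `u` with `ker p`. Positivity makes it injective, hence
  -- bijective by dimension, and the preimage of `(w, 0)` is the orthogonal lift of `w`.
  let T : V →ₗ[ℝ] W × (LinearMap.ker p →ₗ[ℝ] ℝ) :=
    p.prod ((LinearMap.lcomp ℝ ℝ (LinearMap.ker p).subtype) ∘ₗ b)
  have hT : Injective T := by
    rw [← LinearMap.ker_eq_bot, LinearMap.ker_eq_bot']
    intro u hu
    have h1 : p u = 0 := congrArg Prod.fst hu
    have h2 := congrArg (fun L : LinearMap.ker p →ₗ[ℝ] ℝ => L ⟨u, h1⟩) (congrArg Prod.snd hu)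
    by_contra h0
    exact (hb u h0).ne' h2
  have hd : Module.finrank ℝ V = Module.finrank ℝ (W × (LinearMap.ker p →ₗ[ℝ] ℝ)) := by
    rw [Module.finrank_prod, Subspace.dual_finrank_eq (K := ℝ) (V := LinearMap.ker p),
      ← LinearMap.finrank_range_add_finrank_ker p, LinearMap.range_eq_top.2 hp, finrank_top]
  let e := LinearEquiv.ofInjectiveOfFinrankEq T hT hd
  have he : ∀ w, T (e.symm (w, 0)) = (w, 0) := fun w => e.apply_symm_apply _
  refine ⟨e.symm.toLinearMap ∘ₗ LinearMap.inl ℝ _ _, fun w => congrArg Prod.fst (he w),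
    fun w v hv => ?_⟩
  exact congrArg (fun L : LinearMap.ker p →ₗ[ℝ] ℝ => L ⟨v, hv⟩) (congrArg Prod.snd (he w))

end Lift

/-! ### Descent of hyper-Kähler structures along submersions -/

section Descent

variable {F : Type*} [NormedAddCommGroup F] [NormedSpace ℝ F] [FiniteDimensional ℝ F]
  {M : Type*} [TopologicalSpace M] [ChartedSpace F M] [IsManifold 𝓘(ℝ, F) ∞ M]
  {F' : Type*} [NormedAddCommGroup F'] [NormedSpace ℝ F'] [FiniteDimensional ℝ F']
  {Z : Type*} [TopologicalSpace Z] [ChartedSpace F' Z] [IsManifold 𝓘(ℝ, F') ∞ Z]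
  {F'' : Type*} [NormedAddCommGroup F''] [NormedSpace ℝ F''] [FiniteDimensional ℝ F'']
  {Q : Type*} [TopologicalSpace Q] [ChartedSpace F'' Q] [IsManifold 𝓘(ℝ, F'') ∞ Q]

/-- An almost complex structure that relates two closed forms is integrable. -/
theorem nijenhuisAt_chartEnd_of_closed
    {A B : ∀ x : M, TangentSpace 𝓘(ℝ, F) x →L[ℝ] TangentSpace 𝓘(ℝ, F) x →L[ℝ] ℝ}
    {J : ∀ x : M, TangentSpace 𝓘(ℝ, F) x →L[ℝ] TangentSpace 𝓘(ℝ, F) x} {x : M}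
    (hA : SmoothFormAt A x) (hJ : SmoothEndAt J x)
    (hAs : ∀ (x : M) (u v : F), formAt A x u v = -formAt A x v u)
    (hBs : ∀ (x : M) (u v : F), formAt B x u v = -formAt B x v u)
    (hAB : ∀ (x : M) (u v : F), formAt A x (endAt J x u) v = formAt B x u v)
    (hJJ : ∀ (x : M) (u : F), endAt J x (endAt J x u) = -u)
    (hnd : ∀ (x : M) (u : F), (∀ v : F, formAt A x u v = 0) → u = 0)
    (hAc : IsClosedTwoForm A) (hBc : IsClosedTwoForm B) :
    NijenhuisAt (chartEnd J x) (extChartAt 𝓘(ℝ, F) x x) := by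
  have hanti : ∀ C : ∀ x : M, TangentSpace 𝓘(ℝ, F) x →L[ℝ] TangentSpace 𝓘(ℝ, F) x →L[ℝ] ℝ,
      (∀ (x : M) (u v : F), formAt C x u v = -formAt C x v u) → ∀ y u v : F,
      chartForm C x y u v = -chartForm C x y v u := fun C hC y u v => hC _ _ _
  have h1 := smoothFormAt_iff.1 hA
  have h2 := smoothEndAt_iff.1 hJ
  have h3 := hAc.closedAt (mem_chart_source F x)
  have h4 := hBc.closedAt (mem_chart_source F x)
  have hev := extChartAt_target_mem_nhds (I := 𝓘(ℝ, F)) x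
  have h5 : ∀ᶠ y in 𝓝 (extChartAt 𝓘(ℝ, F) x x), ∀ u v : F,
      chartForm A x y (chartEnd J x y u) v = chartForm B x y u v := by
    filter_upwards [hev] with y hy u v
    exact chartForm_chartEnd hAB hy u v
  have h6 : ∀ᶠ y in 𝓝 (extChartAt 𝓘(ℝ, F) x x), ∀ u : F,
      chartEnd J x y (chartEnd J x y u) = -u := by
    filter_upwards [hev] with y hy u
    exact chartEnd_chartEnd hJJ hy u
  have h7 := chartForm_nondegenerate hnd (mem_extChartAt_target x)
  exact nijenhuisAt_of_closedAt (h1.differentiableAt (by simp)) (h2.differentiableAt (by simp))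
    (Filter.Eventually.of_forall (hanti A hAs)) (Filter.Eventually.of_forall (hanti B hBs))
    h5 h6 h7 h3 h4

theorem SmoothFormAt.of_neg
    {A B : ∀ x : M, TangentSpace 𝓘(ℝ, F) x →L[ℝ] TangentSpace 𝓘(ℝ, F) x →L[ℝ] ℝ} {x : M}
    (hA : SmoothFormAt A x) (h : ∀ (x : M) (u v : F), formAt B x u v = -formAt A x u v) :
    SmoothFormAt B x := by
  rw [smoothFormAt_iff] at hA ⊢
  refine hA.neg.congr_of_eventuallyEq (Filter.Eventually.of_forall fun y => ?_)
  exact ContinuousLinearMap.ext fun u => ContinuousLinearMap.ext fun v => h _ _ _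

namespace HyperKahlerStructure

variable (hk : HyperKahlerStructure F M)

theorem endAt_zero_one (x : M) (v : F) :
    endAt (hk.J 0) x (endAt (hk.J 1) x v) = endAt (hk.J 2) x v := hk.quaternion x v

theorem endAt_endAt (i : Fin 3) (x : M) (v : F) : endAt (hk.J i) x (endAt (hk.J i) x v) = -v :=
  (hk.kahler i).endAt_endAt x v

theorem formAt_form (i : Fin 3) (x : M) (u v : F) :
    formAt (hk.kahler i).form x u v = formAt hk.g.inner x (endAt (hk.J i) x u) v := rfl

/-- From `J₁J₂ = J₃` and the squares one gets `J₃J₂J₁ = 1`; applying `J₃` once more gives the claim.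
-/
theorem endAt_anticomm_zero_one (x : M) (v : F) :
    endAt (hk.J 1) x (endAt (hk.J 0) x v) = -endAt (hk.J 2) x v := by
  have h1 := hk.endAt_endAt 2 x (endAt (hk.J 1) x (endAt (hk.J 0) x v))
  rw [← hk.endAt_zero_one x (endAt (hk.J 1) x (endAt (hk.J 0) x v)), hk.endAt_endAt 1, map_neg,
    hk.endAt_endAt 0, neg_neg] at h1
  rw [h1, neg_neg]

/-- `J_{i+2} J_i = J_{i+1}` for cyclic indices. -/
theorem endAt_add_two (i : Fin 3) (x : M) (v : F) :
    endAt (hk.J (i + 2)) x (endAt (hk.J i) x v) = endAt (hk.J (i + 1)) x v := by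
  fin_cases i
  · change endAt (hk.J 2) x (endAt (hk.J 0) x v) = endAt (hk.J 1) x v
    rw [← hk.endAt_zero_one, hk.endAt_anticomm_zero_one, map_neg, ← hk.endAt_zero_one,
      hk.endAt_endAt, neg_neg]
  · exact hk.endAt_zero_one x v
  · change endAt (hk.J 1) x (endAt (hk.J 2) x v) = endAt (hk.J 0) x v
    rw [← neg_neg (endAt (hk.J 2) x v), ← hk.endAt_anticomm_zero_one, map_neg, hk.endAt_endAt,
      neg_neg]

/-- Each complex structure is thus determined by two of the Kähler forms. On a quotient this yields
its smoothness and, through `nijenhuisAt_chartEnd_of_closed`, its integrability. -/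
theorem formAt_form_endAt (i : Fin 3) (x : M) (u v : F) :
    formAt (hk.kahler (i + 2)).form x (endAt (hk.J i) x u) v =
      formAt (hk.kahler (i + 1)).form x u v := by
  rw [formAt_form, formAt_form, endAt_add_two]

theorem formAt_eq_form (i : Fin 3) (x : M) (u v : F) :
    formAt hk.g.inner x u v = -formAt (hk.kahler i).form x (endAt (hk.J i) x u) v := by
  rw [formAt_form, endAt_endAt, map_neg, neg_apply, neg_neg]

set_option maxHeartbeats 1600000 in
/-- A hyper-Kähler structure descends along a submersion `π` defined on a submanifold if the
horizontal distribution is quaternionic and the Kähler forms are basic. -/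
theorem exists_descent {ι : Z → M} (hι : ContMDiff 𝓘(ℝ, F') 𝓘(ℝ, F) ∞ ι)
    (hinj : ∀ z, Injective (mdiff ι z : F' →L[ℝ] F)) {π : Z → Q}
    (hπ : ContMDiff 𝓘(ℝ, F') 𝓘(ℝ, F'') ∞ π) (hsurj : Surjective π)
    (hsub : ∀ z, Surjective (mdiff π z : F' →L[ℝ] F''))
    (hJ : ∀ (i : Fin 3) (z : Z) (u : F'),
      (∀ w : F', (mdiff π z : F' →L[ℝ] F'') w = 0 →
        formAt hk.g.inner (ι z) (mdiff ι z u) (mdiff ι z w) = 0) →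
      ∃ u' : F', mdiff ι z u' = endAt (hk.J i) (ι z) (mdiff ι z u) ∧
        ∀ w : F', (mdiff π z : F' →L[ℝ] F'') w = 0 →
          formAt hk.g.inner (ι z) (mdiff ι z u') (mdiff ι z w) = 0)
    (hω : ∀ (i : Fin 3) (z z' : Z) (a b a' b' : F'), π z = π z' →
      (mdiff π z : F' →L[ℝ] F'') a = mdiff π z' a' → (mdiff π z : F' →L[ℝ] F'') b = mdiff π z' b' →
      formAt (hk.kahler i).form (ι z) (mdiff ι z a) (mdiff ι z b) =
        formAt (hk.kahler i).form (ι z') (mdiff ι z' a') (mdiff ι z' b')) :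
    ∃ hkQ : HyperKahlerStructure F'' Q,
      (∀ (i : Fin 3) (z : Z) (u v : F'),
        formAt (hkQ.kahler i).form (π z) (mdiff π z u) (mdiff π z v) =
          formAt (hk.kahler i).form (ι z) (mdiff ι z u) (mdiff ι z v)) ∧
      (∀ (z : Z) (u v : F'), (∀ w : F', (mdiff π z : F' →L[ℝ] F'') w = 0 →
        formAt hk.g.inner (ι z) (mdiff ι z u) (mdiff ι z w) = 0) →
        formAt hkQ.g.inner (π z) (mdiff π z u) (mdiff π z v) =
          formAt hk.g.inner (ι z) (mdiff ι z u) (mdiff ι z v)) := by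
  -- An arbitrary point in each fibre, with no regularity in `q`: the structure is first defined
  -- pointwise by horizontal lifts at these points.
  choose s hs using hsurj
  have hlift : ∀ q, ∃ r : F'' →L[ℝ] F', (∀ w, mdiff π (s q) (r w) = w) ∧
      ∀ (w : F'') (v : F'), (mdiff π (s q) : F' →L[ℝ] F'') v = 0 →
        formAt hk.g.inner (ι (s q)) (mdiff ι (s q) (r w)) (mdiff ι (s q) v) = 0 := by
    intro q
    obtain ⟨r, h1, h2⟩ := exists_orthogonal_lift
      (b := (ContinuousLinearMap.coeLM ℝ) ∘ₗ ((formAt hk.g.inner (ι (s q))).bilinearComp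
        (mdiff ι (s q) : F' →L[ℝ] F) (mdiff ι (s q) : F' →L[ℝ] F)).toLinearMap)
      (fun u hu => hk.g.formAt_pos _ fun h => hu (hinj _ (h.trans (map_zero _).symm)))
      (p := (mdiff π (s q) : F' →L[ℝ] F'').toLinearMap) (hsub (s q))
    exact ⟨r.toContinuousLinearMap, h1, h2⟩
  choose r hr hrv using hlift
  obtain ⟨D, hD⟩ : ∃ D : Q → F'' →L[ℝ] F, ∀ q u, D q u = mdiff ι (s q) (r q u) :=
    ⟨fun q => mdiff ι (s q) ∘L r q, fun _ _ => rfl⟩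
  have hDinj : ∀ q, Injective (D q) := by
    intro q u v h
    rw [hD, hD] at h
    rw [← hr q u, hinj _ h, hr]
  have hleft : ∀ q, ∃ P : F →L[ℝ] F'', ∀ u, P (D q u) = u := by
    intro q
    obtain ⟨P, hP⟩ := LinearMap.exists_leftInverse_of_injective
      (D q).toLinearMap (LinearMap.ker_eq_bot.2 (hDinj q))
    exact ⟨P.toContinuousLinearMap, fun u => congrArg (fun L : F'' →ₗ[ℝ] F'' => L u) hP⟩
  choose P hP using hleft
  obtain ⟨B, hB⟩ : ∃ B : ∀ x : Q, TangentSpace 𝓘(ℝ, F'') x →L[ℝ] TangentSpace 𝓘(ℝ, F'') x →L[ℝ] ℝ,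
      ∀ (q : Q) (u v : F''), formAt B q u v = formAt hk.g.inner (ι (s q)) (D q u) (D q v) :=
    ⟨fun q => ((formAt hk.g.inner (ι (s q))).bilinearComp (D q) (D q) : F'' →L[ℝ] F'' →L[ℝ] ℝ),
      fun _ _ _ => rfl⟩
  obtain ⟨J', hPJ⟩ : ∃ J' : Fin 3 → ∀ x : Q, TangentSpace 𝓘(ℝ, F'') x →L[ℝ] TangentSpace 𝓘(ℝ, F'') x,
      ∀ (i : Fin 3) (q : Q) (u : F''),
        endAt (J' i) q u = P q (endAt (hk.J i) (ι (s q)) (D q u)) :=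
    ⟨fun i q => (P q ∘L (endAt (hk.J i) (ι (s q)) ∘L D q) : F'' →L[ℝ] F''), fun _ _ _ => rfl⟩
  -- Uniqueness of horizontal lifts: the difference of two is both vertical and orthogonal to
  -- vertical vectors.
  have hlift' : ∀ (q : Q) (u : F'), (∀ w : F', (mdiff π (s q) : F' →L[ℝ] F'') w = 0 →
      formAt hk.g.inner (ι (s q)) (mdiff ι (s q) u) (mdiff ι (s q) w) = 0) →
      u = r q (mdiff π (s q) u) := by
    intro q u hu
    by_contra hne
    have h1 : (mdiff π (s q) : F' →L[ℝ] F'') (u - r q (mdiff π (s q) u)) = 0 := by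
      rw [map_sub, hr, sub_self]
    have h2 : formAt hk.g.inner (ι (s q)) (mdiff ι (s q) (u - r q (mdiff π (s q) u)))
        (mdiff ι (s q) (u - r q (mdiff π (s q) u))) = 0 := by
      nth_rewrite 1 [map_sub]
      rw [map_sub, sub_apply, hu _ h1, hrv _ _ _ h1, sub_zero]
    refine (hk.g.formAt_pos _ fun h => ?_).ne' h2
    exact hne (sub_eq_zero.1 (hinj _ (h.trans (map_zero _).symm)))
  have hDJ : ∀ (i : Fin 3) (q : Q) (u : F''),
      D q (endAt (J' i) q u) = endAt (hk.J i) (ι (s q)) (D q u) := by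
    intro i q u
    obtain ⟨u', h1, h2⟩ := hJ i (s q) (r q u) (hrv q u)
    rw [hPJ, hD q u, ← h1, hlift' q u' h2, ← hD, hP]
  have hBs : ∀ i : Fin 3, ∀ (q : Q) (u v : F''), formAt (fun p => (B p).comp (J' i p)) q u v =
      formAt (hk.kahler i).form (ι (s q)) (D q u) (D q v) := by
    intro i q u v
    rw [hk.formAt_form, ← hDJ, ← hB]
    rfl
  have hform : ∀ (i : Fin 3) (z : Z) (u v : F'),
      formAt (fun p => (B p).comp (J' i p)) (π z) (mdiff π z u) (mdiff π z v) =
        formAt (hk.kahler i).form (ι z) (mdiff ι z u) (mdiff ι z v) := by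
    intro i z u v
    rw [hBs, hD, hD]
    exact hω i _ _ _ _ _ _ (hs _) (hr _ _) (hr _ _)
  -- As the forms are basic, they may be evaluated along any local section `t` in place of `s`. Near
  -- `q` they are therefore pull-backs by the smooth map `ι ∘ t`, whence smooth and closed.
  have hloc : ∀ q : Q, ∃ φ : Q → M, ContMDiffAt 𝓘(ℝ, F'') 𝓘(ℝ, F) ∞ φ q ∧ ∀ i : Fin 3,
      ∀ᶠ q' in 𝓝 q, ∀ u v : F'', formAt (fun p => (B p).comp (J' i p)) q' u v =
        formAt (hk.kahler i).form (φ q') (mdiff φ q' u) (mdiff φ q' v) := by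
    intro q
    obtain ⟨t, ht0, ht⟩ := exists_localSection hπ (hsub (s q))
    rw [hs] at ht ht0
    refine ⟨fun q' => ι (t q'), (hι _).comp q ht.self_of_nhds.1, fun i => ?_⟩
    filter_upwards [ht.eventually_nhds] with q' hq' u v
    have h1 : ∀ u, (mdiff π (t q') : F' →L[ℝ] F'') (mdiff t q' u) = u := by
      intro u
      rw [← mdiff_comp_apply (hπ _) hq'.self_of_nhds.1,
        mdiff_congr (g := fun q => q) (hq'.mono fun _ h => h.2), mdiff_id]
      rfl
    rw [mdiff_comp_apply (hι _) hq'.self_of_nhds.1, mdiff_comp_apply (hι _) hq'.self_of_nhds.1,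
      hBs, hD, hD]
    exact hω i _ _ _ _ _ _ ((hs _).trans hq'.self_of_nhds.2.symm)
      ((hr _ _).trans (h1 u).symm) ((hr _ _).trans (h1 v).symm)
  have hωs : ∀ (i : Fin 3) (q : Q), SmoothFormAt (fun p => (B p).comp (J' i p)) q := by
    intro i q
    obtain ⟨φ, hφ, h⟩ := hloc q
    exact ((hk.kahler i).smoothFormAt_form _).pullback hφ (h i)
  have hωc : ∀ i : Fin 3, IsClosedTwoForm (fun p => (B p).comp (J' i p)) := by
    intro i
    refine isClosedTwoForm_of_pullback (hk.kahler i).isClosedTwoForm_form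
      (hk.kahler i).smoothFormAt_form (hk.kahler i).formAt_form_antisymm fun q => ?_
    obtain ⟨φ, hφ, h⟩ := hloc q
    exact ⟨φ, hφ, h i⟩
  have hJJ : ∀ (i : Fin 3) (q : Q) (u : F''), endAt (J' i) q (endAt (J' i) q u) = -u := by
    intro i q u
    apply hDinj q
    rw [hDJ, hDJ, hk.endAt_endAt, map_neg]
  have hcyc : ∀ (i : Fin 3) (q : Q) (u v : F''),
      formAt (fun p => (B p).comp (J' (i + 2) p)) q (endAt (J' i) q u) v =
        formAt (fun p => (B p).comp (J' (i + 1) p)) q u v := by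
    intro i q u v
    rw [hBs, hBs, hDJ, hk.formAt_form_endAt]
  have hpos : ∀ (q : Q) (u : F''), u ≠ 0 → 0 < formAt B q u u := by
    intro q u hu
    rw [hB]
    exact hk.g.formAt_pos _ fun h => hu (hDinj q (h.trans (map_zero _).symm))
  have hnd : ∀ (i : Fin 3) (q : Q) (u : F''),
      (∀ v : F'', formAt (fun p => (B p).comp (J' i p)) q u v = 0) → u = 0 := by
    intro i q u hu
    by_contra hne
    refine (hpos q u hne).ne' ?_
    have h1 := hu (-endAt (J' i) q u)
    rw [hBs, map_neg, map_neg, hDJ, hk.formAt_form] at h1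
    have h2 : formAt hk.g.inner (ι (s q)) (endAt (hk.J i) (ι (s q)) (D q u))
      (endAt (hk.J i) (ι (s q)) (D q u)) = formAt hk.g.inner (ι (s q)) (D q u) (D q u) :=
      (hk.kahler i).formAt_endAt_endAt _ _ _
    rw [h2, neg_eq_zero] at h1
    rw [hB, h1]
  have hJs : ∀ (i : Fin 3) (q : Q), SmoothEndAt (J' i) q := fun i q =>
    smoothEndAt_of_forms (hcyc i) (hnd (i + 2)) (hωs (i + 2) q) (hωs (i + 1) q)
  have hBω : ∀ (i : Fin 3) (q : Q) (u v : F''), formAt B q u v =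
      -formAt (fun p => (B p).comp (J' i p)) q (endAt (J' i) q u) v := by
    intro i q u v
    have h2 : formAt (fun p => (B p).comp (J' i p)) q (endAt (J' i) q u) v =
      formAt B q (endAt (J' i) q (endAt (J' i) q u)) v := rfl
    rw [h2, hJJ, map_neg, neg_apply, neg_neg]
  have hanti : ∀ (i : Fin 3) (q : Q) (u v : F''), formAt (fun p => (B p).comp (J' i p)) q u v =
      -formAt (fun p => (B p).comp (J' i p)) q v u := by
    intro i q u v
    rw [hBs, hBs]
    exact (hk.kahler i).formAt_form_antisymm _ _ _
  -- The metric was defined by pointwise lifts as well; it is smooth because `g = -ω₁(J₁ ·, ·)`.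
  have hBsm : ∀ q, SmoothFormAt B q := fun q =>
    ((hωs 0 q).comp_end (hJs 0 q)).of_neg (hBω 0)
  obtain ⟨g, hg⟩ := exists_smoothMetric (B := B)
    (fun q u v => by rw [hB, hB, hk.g.formAt_symm]) hpos hBsm
  subst hg
  have hkQ : ∀ i : Fin 3, IsKahler g (J' i) := by
    intro i
    refine isKahler_of (hJs i) (hJJ i) (fun q u v => ?_) (fun q => ?_) (hωc i)
    · rw [hB, hB, hDJ, hDJ]
      exact (hk.kahler i).formAt_endAt_endAt _ _ _
    · exact nijenhuisAt_chartEnd_of_closed (hωs (i + 2) q) (hJs i q) (hanti _) (hanti (i + 1))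
        (hcyc i) (hJJ i) (hnd (i + 2)) (hωc _) (hωc _)
  refine ⟨⟨g, J', hkQ, fun q u => ?_⟩, hform, fun z u v hu => ?_⟩
  · apply hDinj q
    refine (hDJ 0 q _).trans ?_
    refine (congrArg (endAt (hk.J 0) (ι (s q))) (hDJ 1 q u)).trans ?_
    exact (hk.endAt_zero_one _ _).trans (hDJ 2 q u).symm
  -- The isometry property is needed at every `z`, not only at the chosen points. Nondegeneracy of
  -- `ω₃` shows that the horizontal vector `J₁ u` projects to `J₁` of the projection of `u`, and
  -- then `g = -ω₁(J₁ ·, ·)` on both sides.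
  · obtain ⟨u', h1, h2⟩ := hJ 0 z u hu
    have h3 : (mdiff π z : F' →L[ℝ] F'') u' = endAt (J' 0) (π z) (mdiff π z u) := by
      rw [← sub_eq_zero]
      refine hnd 2 (π z) _ fun v => ?_
      obtain ⟨b, rfl⟩ := hsub z v
      have h4 := hcyc 0 (π z) (mdiff π z u) (mdiff π z b)
      have h5 := hk.formAt_form_endAt 0 (ι z) (mdiff ι z u) (mdiff ι z b)
      rw [hform] at h4
      rw [map_sub, sub_apply, hform, h1, sub_eq_zero]
      exact h5.trans h4.symm
    rw [hBω 0, ← h3, hform, h1, ← hk.formAt_eq_form]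

end HyperKahlerStructure

end Descent

/-! ### Geodesics and isometries -/

section EulerLagrange

variable {F : Type*} [NormedAddCommGroup F] [NormedSpace ℝ F] [FiniteDimensional ℝ F]
  {F' : Type*} [NormedAddCommGroup F'] [NormedSpace ℝ F'] [FiniteDimensional ℝ F']

/-- The Euler-Lagrange equation at time `t` of the energy of the metric `G`. -/
def EulerLagrangeAt (G : F → F →L[ℝ] F →L[ℝ] ℝ) (c : ℝ → F) (t : ℝ) : Prop :=
  ∀ w : F, deriv (fun r => G (c r) (deriv c r) w) t =
    (1 / 2) * fderiv ℝ G (c t) w (deriv c t) (deriv c t)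

theorem EulerLagrangeAt.congr {G : F → F →L[ℝ] F →L[ℝ] ℝ} {c C : ℝ → F} {t : ℝ}
    (h : EulerLagrangeAt G c t) (hC : C =ᶠ[𝓝 t] c) : EulerLagrangeAt G C t := by
  intro w
  have h1 : (fun r => G (C r) (deriv C r) w) =ᶠ[𝓝 t] fun r => G (c r) (deriv c r) w := by
    filter_upwards [hC, hC.deriv] with r h1 h2
    rw [h1, h2]
  rw [h1.deriv_eq, hC.deriv_eq, hC.self_of_nhds]
  exact h w

/-- Isometries preserve the Euler-Lagrange equation. -/
theorem EulerLagrangeAt.map {G₁ : F' → F' →L[ℝ] F' →L[ℝ] ℝ} {G₂ : F → F →L[ℝ] F →L[ℝ] ℝ}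
    {φ : F' → F} {c : ℝ → F'} {t : ℝ} (hφ : ContDiffAt ℝ 2 φ (c t)) (hc : ContDiffAt ℝ 2 c t)
    (hG₂ : ContDiffAt ℝ 1 G₂ (φ (c t)))
    (hsymm : ∀ u v, G₂ (φ (c t)) u v = G₂ (φ (c t)) v u)
    (hG : G₁ =ᶠ[𝓝 (c t)] fun y => (G₂ (φ y)).bilinearComp (fderiv ℝ φ y) (fderiv ℝ φ y))
    (hsurj : Surjective (fderiv ℝ φ (c t))) (h : EulerLagrangeAt G₁ c t) :
    EulerLagrangeAt G₂ (fun r => φ (c r)) t := by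
  have hcd : HasDerivAt c (deriv c t) t := (hc.differentiableAt (by simp)).hasDerivAt
  have hc' : ContDiffAt ℝ 1 (deriv c) t := by
    have h1 : ContDiffAt ℝ 1 (fderiv ℝ c) t := hc.fderiv_right (by norm_num)
    exact h1.clm_apply contDiffAt_const
  have hφ' : ContDiffAt ℝ 1 (fderiv ℝ φ) (c t) := hφ.fderiv_right (by norm_num)
  have hA : HasDerivAt (fun r => fderiv ℝ φ (c r)) (fderiv ℝ (fderiv ℝ φ) (c t) (deriv c t)) t :=
    (hφ'.differentiableAt (by simp)).hasFDerivAt.comp_hasDerivAt t hcd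
  have hC : HasDerivAt (fun r => φ (c r)) (fderiv ℝ φ (c t) (deriv c t)) t :=
    (hφ.differentiableAt (by simp)).hasFDerivAt.comp_hasDerivAt t hcd
  have hg : HasDerivAt (fun r => G₂ (φ (c r)))
      (fderiv ℝ G₂ (φ (c t)) (fderiv ℝ φ (c t) (deriv c t))) t :=
    HasFDerivAt.comp_hasDerivAt (f := fun r => φ (c r)) (l := G₂) t
      (hG₂.differentiableAt (by simp)).hasFDerivAt hC
  have hV := hA.clm_apply (hc'.differentiableAt (by simp)).hasDerivAt
  have hCd : deriv (fun r => φ (c r)) =ᶠ[𝓝 t] fun r => fderiv ℝ φ (c r) (deriv c r) := by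
    have h1 : ∀ᶠ r in 𝓝 t, ContDiffAt ℝ 2 c r := hc.eventually (by simp)
    have h2 : ∀ᶠ r in 𝓝 t, ContDiffAt ℝ 2 φ (c r) :=
      hc.continuousAt.eventually (hφ.eventually (by simp))
    filter_upwards [h1, h2] with r h1 h2
    exact ((h2.differentiableAt (by simp)).hasFDerivAt.comp_hasDerivAt r
      (h1.differentiableAt (by simp)).hasDerivAt).deriv
  intro W
  obtain ⟨w, rfl⟩ := hsurj W
  have h1 := h w
  have h2 : (fun r => G₁ (c r) (deriv c r) w) =ᶠ[𝓝 t]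
      fun r => G₂ (φ (c r)) (fderiv ℝ φ (c r) (deriv c r)) (fderiv ℝ φ (c r) w) := by
    filter_upwards [hc.continuousAt.eventually hG] with r hr
    rw [hr]
    rfl
  have h3 := (hg.clm_apply hV).clm_apply (hA.clm_apply (hasDerivAt_const t w))
  rw [h2.deriv_eq, h3.deriv, hG.fderiv_eq, fderiv_pullback_apply hφ hG₂] at h1
  have h4 : (fun r => G₂ (φ (c r)) (deriv (fun r => φ (c r)) r) (fderiv ℝ φ (c t) w)) =ᶠ[𝓝 t]
      fun r => G₂ (φ (c r)) (fderiv ℝ φ (c r) (deriv c r)) (fderiv ℝ φ (c t) w) := by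
    filter_upwards [hCd] with r hr
    rw [hr]
  have h5 := (hg.clm_apply hV).clm_apply (hasDerivAt_const t (fderiv ℝ φ (c t) w))
  rw [h4.deriv_eq, h5.deriv, hC.deriv]
  -- The terms with the second derivative of `φ` on the two sides agree, by its symmetry and that of
  -- `G₂`.
  have h6 : fderiv ℝ (fderiv ℝ φ) (c t) w (deriv c t) =
      fderiv ℝ (fderiv ℝ φ) (c t) (deriv c t) w := (hφ.isSymmSndFDerivAt (by simp)) _ _
  rw [h6] at h1
  have h7 := hsymm (fderiv ℝ (fderiv ℝ φ) (c t) (deriv c t) w) (fderiv ℝ φ (c t) (deriv c t))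
  simp only [add_apply, map_zero, add_zero] at h1 ⊢
  linarith

/-- The force term of the Hamiltonian form of the geodesic equation. -/
def geodesicForce (G : F → F →L[ℝ] F →L[ℝ] ℝ) (y a : F) : F →L[ℝ] ℝ :=
  (1 / 2 : ℝ) • (ContinuousLinearMap.apply ℝ ℝ a ∘L
    (ContinuousLinearMap.apply ℝ (F →L[ℝ] ℝ) a ∘L fderiv ℝ G y))

/-- The Hamiltonian vector field of the energy of `G`. -/
def geodesicField (G : F → F →L[ℝ] F →L[ℝ] ℝ) (x : F × (F →L[ℝ] ℝ)) : F × (F →L[ℝ] ℝ) :=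
  ((G x.1).inverse x.2, geodesicForce G x.1 ((G x.1).inverse x.2))

set_option maxSynthPendingDepth 3 in
-- A field of class `C¹` is locally Lipschitz, as uniqueness of solutions requires. One derivative
-- of `G` enters the force term, hence `C²` for `G`.
theorem contDiffAt_geodesicField {G : F → F →L[ℝ] F →L[ℝ] ℝ} {x : F × (F →L[ℝ] ℝ)}
    (hG : ContDiffAt ℝ 2 G x.1) (hinv : (G x.1).IsInvertible) :
    ContDiffAt ℝ 1 (geodesicField G) x := by
  have h1 : ContDiffAt ℝ 1 (fun y : F × (F →L[ℝ] ℝ) => (G y.1).inverse) x := by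
    obtain ⟨e, he⟩ := hinv
    have h2 : ContDiffAt ℝ 1 ContinuousLinearMap.inverse (G x.1) := by
      rw [← he]
      exact contDiffAt_map_inverse e
    exact ContDiffAt.comp x h2 (ContDiffAt.comp x (hG.of_le (by norm_num)) contDiffAt_fst)
  have h2 : ContDiffAt ℝ 1 (fun y : F × (F →L[ℝ] ℝ) => (G y.1).inverse y.2) x :=
    h1.clm_apply contDiffAt_snd
  have h3 : ContDiffAt ℝ 1 (fun y : F × (F →L[ℝ] ℝ) => fderiv ℝ G y.1) x :=
    ContDiffAt.comp (g := fderiv ℝ G) x (hG.fderiv_right (m := 1) (by norm_num)) contDiffAt_fst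
  refine h2.prodMk (contDiffAt_clm_apply_iff.2 fun w => ?_)
  exact contDiffAt_const.mul (((h3.clm_apply contDiffAt_const).clm_apply h2).clm_apply h2)

/-- In terms of the momentum `G(c) c'` the Euler-Lagrange equation is a first-order system: the
equation itself prescribes the derivative of the momentum, and inverting `G` recovers the velocity.
-/
theorem hasDerivAt_geodesicField {G : F → F →L[ℝ] F →L[ℝ] ℝ} {c : ℝ → F} {t : ℝ}
    (hG : ContDiffAt ℝ 2 G (c t)) (hc : ContDiffAt ℝ 2 c t) (hinv : (G (c t)).IsInvertible)
    (h : EulerLagrangeAt G c t) :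
    HasDerivAt (fun r => (c r, G (c r) (deriv c r)))
      (geodesicField G (c t, G (c t) (deriv c t))) t := by
  have hcd : HasDerivAt c (deriv c t) t := (hc.differentiableAt (by simp)).hasDerivAt
  have hc' : ContDiffAt ℝ 1 (deriv c) t := by
    have h1 : ContDiffAt ℝ 1 (fderiv ℝ c) t := hc.fderiv_right (by norm_num)
    exact h1.clm_apply contDiffAt_const
  have h1 : (G (c t)).inverse (G (c t) (deriv c t)) = deriv c t :=
    congrArg (fun A : F →L[ℝ] F => A (deriv c t)) hinv.inverse_comp_self
  have hg : HasDerivAt (fun r => G (c r)) (fderiv ℝ G (c t) (deriv c t)) t :=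
    (hG.differentiableAt (by simp)).hasFDerivAt.comp_hasDerivAt t hcd
  have h2 := hg.clm_apply (hc'.differentiableAt (by simp)).hasDerivAt
  refine HasDerivAt.prodMk ?_ ?_
  · simpa only [h1] using hcd
  · refine h2.congr_deriv ?_
    simp only [h1]
    ext w
    have h3 := h w
    rw [(h2.clm_apply (hasDerivAt_const t w)).deriv, map_zero, add_zero] at h3
    exact h3

/-- Solutions of the geodesic equation are determined by their initial values. -/
theorem eventuallyEq_of_eulerLagrangeAt {G : F → F →L[ℝ] F →L[ℝ] ℝ} {c₁ c₂ : ℝ → F} {t : ℝ}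
    (hG : ContDiffAt ℝ 2 G (c₁ t)) (hinv : (G (c₁ t)).IsInvertible)
    (hc₁ : ContDiffAt ℝ 2 c₁ t) (hc₂ : ContDiffAt ℝ 2 c₂ t)
    (h₁ : ∀ᶠ r in 𝓝 t, EulerLagrangeAt G c₁ r) (h₂ : ∀ᶠ r in 𝓝 t, EulerLagrangeAt G c₂ r)
    (h0 : c₁ t = c₂ t) (h0' : deriv c₁ t = deriv c₂ t) : c₁ =ᶠ[𝓝 t] c₂ := by
  obtain ⟨K, s, hs, hK⟩ :=
    (contDiffAt_geodesicField (x := (c₁ t, G (c₁ t) (deriv c₁ t))) hG hinv).exists_lipschitzOnWith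
  have hGe : ∀ᶠ y in 𝓝 (c₁ t), ContDiffAt ℝ 2 G y := hG.eventually (by simp)
  have hGi : ∀ᶠ y in 𝓝 (c₁ t), (G y).IsInvertible := by
    obtain ⟨e, he⟩ := hinv
    have h1 : ∀ᶠ A in 𝓝 (G (c₁ t)), A ∈ range ((↑) : (F ≃L[ℝ] (F →L[ℝ] ℝ)) → F →L[ℝ] F →L[ℝ] ℝ) := by
      rw [← he]
      exact ContinuousLinearEquiv.nhds e
    exact hG.continuousAt.eventually h1
  have key : ∀ c : ℝ → F, c t = c₁ t → deriv c t = deriv c₁ t → ContDiffAt ℝ 2 c t →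
      (∀ᶠ r in 𝓝 t, EulerLagrangeAt G c r) → ∀ᶠ r in 𝓝 t,
      HasDerivAt (fun r => (c r, G (c r) (deriv c r)))
        (geodesicField G (c r, G (c r) (deriv c r))) r ∧ (c r, G (c r) (deriv c r)) ∈ s := by
    intro c hct hct' hc h
    have hcc := hc.continuousAt
    rw [ContinuousAt, hct] at hcc
    have h1 := hcc.eventually hGe
    have h2 := hcc.eventually hGi
    have h3 : ContinuousAt (fun r => (c r, G (c r) (deriv c r))) t :=
      (hasDerivAt_geodesicField (by rwa [hct]) hc (by rwa [hct]) h.self_of_nhds).continuousAt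
    rw [ContinuousAt, hct, hct'] at h3
    have hce : ∀ᶠ r in 𝓝 t, ContDiffAt ℝ 2 c r := hc.eventually (by simp)
    filter_upwards [h1, h2, h, hce, h3.eventually hs] with r h1 h2 h hce hm
    exact ⟨hasDerivAt_geodesicField h1 hce h2 h, hm⟩
  have h3 := ODE_solution_unique_of_eventually (v := fun _ => geodesicField G) (s := fun _ => s)
    (t₀ := t) (Filter.Eventually.of_forall fun _ => hK) (key c₁ rfl rfl hc₁ h₁)
    (key c₂ h0.symm h0'.symm hc₂ h₂) (by rw [h0, h0'])
  filter_upwards [h3] with r hr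
  exact congrArg Prod.fst hr

end EulerLagrange

/-! ### Geodesics in charts, and fixed loci of isometries -/

section Geodesic

variable {F : Type*} [NormedAddCommGroup F] [NormedSpace ℝ F] [FiniteDimensional ℝ F]
  {M : Type*} [TopologicalSpace M] [ChartedSpace F M] [IsManifold 𝓘(ℝ, F) ∞ M]

theorem contDiffAt_extChartAt_comp {γ : ℝ → M} {t : ℝ} {x : M}
    (hγ : ContMDiffAt 𝓘(ℝ, ℝ) 𝓘(ℝ, F) ∞ γ t) (hx : γ t ∈ (chartAt F x).source) :
    ContDiffAt ℝ ∞ (fun r => extChartAt 𝓘(ℝ, F) x (γ r)) t :=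
  (ContMDiffAt.comp (g := extChartAt 𝓘(ℝ, F) x) t (contMDiffAt_extChartAt' hx) hγ).contDiffAt

/-- An isometry maps geodesics to curves that satisfy the geodesic equation in any chart. -/
theorem IsGeodesicOn.eulerLagrangeAt {g : SmoothMetric F M} {γ : ℝ → M} {s : Set ℝ}
    (hγ : IsGeodesicOn g γ s) (hs : IsOpen s) {φ : M → M} (hφ : ContMDiff 𝓘(ℝ, F) 𝓘(ℝ, F) ∞ φ)
    (hφg : ∀ (x : M) (u v : F), formAt g.inner x u v =
      formAt g.inner (φ x) (mdiff φ x u) (mdiff φ x v)) {t : ℝ} (ht : t ∈ s) {x₀ : M}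
    (hx₀ : φ (γ t) ∈ (chartAt F x₀).source) :
    EulerLagrangeAt (chartForm g.inner x₀) (fun r => extChartAt 𝓘(ℝ, F) x₀ (φ (γ r))) t := by
  have hγt : ContMDiffAt 𝓘(ℝ, ℝ) 𝓘(ℝ, F) ∞ γ t := hγ.1.contMDiffAt (hs.mem_nhds ht)
  have hc := contDiffAt_extChartAt_comp hγt (mem_chart_source F (γ t))
  have hΦ := contDiffAt_chartMap (x₀ := γ t) le_rfl (hφ (γ t)) (mem_chart_source F (γ t)) hx₀
  have hΦ0 := chartMap_apply (F := F) (φ := φ) (x₁ := x₀) (mem_chart_source F (γ t))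
  -- The definition of a geodesic uses at time `t` the chart centred at `γ t`; the equation is
  -- transferred from there to a chart that does not move with `t`.
  have h1 : EulerLagrangeAt (chartForm g.inner (γ t))
      (fun r => extChartAt 𝓘(ℝ, F) (γ t) (γ r)) t := hγ.2 t ht
  have hinj : Injective (mdiff φ (γ t) : F →L[ℝ] F) := by
    rw [injective_iff_map_eq_zero]
    intro u hu
    refine g.formAt_nondegenerate (γ t) u fun v => ?_
    rw [hφg, hu, map_zero]
    rfl
  have hsurj : Surjective (fderiv ℝ (chartMap φ (γ t) x₀ : F → F)
      (extChartAt 𝓘(ℝ, F) (γ t) (γ t))) := by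
    refine LinearMap.surjective_of_injective (f := (fderiv ℝ (chartMap φ (γ t) x₀ : F → F)
      (extChartAt 𝓘(ℝ, F) (γ t) (γ t))).toLinearMap) ?_
    have h2 := mdiff_comp_chartInv ((hφ (γ t)).of_le (by simp)) (mem_chart_source F (γ t)) hx₀
    rw [chartInv_self] at h2
    intro u v huv
    apply hinj
    have h3 := fun u : F => congrArg (fun A : F →L[ℝ] F => A u) h2
    exact (h3 u).trans ((congrArg (chartInv x₀ (extChartAt 𝓘(ℝ, F) x₀ (φ (γ t)))) huv).trans
      (h3 v).symm)
  have h2 := h1.map (φ := chartMap φ (γ t) x₀) (G₂ := chartForm g.inner x₀)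
    (hΦ.of_le (by norm_cast)) (hc.of_le (by norm_cast)) ?_ ?_ ?_ hsurj
  · refine h2.congr ?_
    filter_upwards [hγt.continuousAt.eventually_mem
      ((chartAt F (γ t)).open_source.mem_nhds (mem_chart_source F (γ t)))] with r hr
    exact (chartMap_apply hr).symm
  · rw [hΦ0]
    exact ((g.smoothFormAt _).contDiffAt_chartForm hx₀).of_le (by simp)
  · intro u v
    exact g.formAt_symm _ _ _
  · exact chartForm_pullback ((hφ (γ t)).of_le (by simp)) (mem_chart_source F (γ t)) hx₀
      (Filter.Eventually.of_forall fun q u v => hφg q u v)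

/-- The fixed locus of an isometry is totally geodesic. -/
theorem isTotallyGeodesic_fixedPoints {F' : Type*} [NormedAddCommGroup F'] [NormedSpace ℝ F']
    {g : SmoothMetric F M} {σ : M → M} (hσ : ContMDiff 𝓘(ℝ, F) 𝓘(ℝ, F) ∞ σ)
    (hσg : ∀ (x : M) (u v : F), formAt g.inner x u v =
      formAt g.inner (σ x) (mdiff σ x u) (mdiff σ x v)) {S : Set M} (hS : ∀ x, x ∈ S ↔ σ x = x)
    [ChartedSpace F' S] (hval : ContMDiff 𝓘(ℝ, F') 𝓘(ℝ, F) ∞ (Subtype.val : S → M)) :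
    IsTotallyGeodesic (F' := F') g S := by
  intro ε γ hε hγ h0 h0'
  have hs : IsOpen (Ioo (-ε) ε) := isOpen_Ioo
  have h0s : (0 : ℝ) ∈ Ioo (-ε) ε := ⟨by linarith, hε⟩
  have hγs : ∀ t ∈ Ioo (-ε) ε, ContMDiffAt 𝓘(ℝ, ℝ) 𝓘(ℝ, F) ∞ γ t := fun t ht =>
    hγ.1.contMDiffAt (hs.mem_nhds ht)
  have hfix : ∀ s : S, σ s = s := fun s => (hS s).1 s.2
  have hσ0 : σ (γ 0) = γ 0 := hfix ⟨γ 0, h0⟩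
  -- Vectors tangent to `S` are fixed by `dσ`, as `σ` restricts to the identity there. So `γ` and `σ
  -- ∘ γ` start with the same velocity.
  have hdσ : mdiff σ (γ 0) (mdiff γ 0 (1 : ℝ) : F) = (mdiff γ 0 (1 : ℝ) : F) := by
    obtain ⟨w, hw⟩ := h0'
    have h1 := mdiff_comp_apply (hσ ((⟨γ 0, h0⟩ : S) : M)) (hval ⟨γ 0, h0⟩) w
    have h2 : (fun s : S => σ s) = Subtype.val := funext hfix
    rw [h2] at h1
    have hw' : (mdiff (Subtype.val : S → M) ⟨γ 0, h0⟩ : F' →L[ℝ] F) w = mdiff γ 0 (1 : ℝ) := hw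
    rw [hw'] at h1
    exact h1.symm
  have hsrc : ∀ᶠ t in 𝓝 (0 : ℝ), γ t ∈ (chartAt F (γ 0)).source :=
    (hγs 0 h0s).continuousAt.eventually_mem
      ((chartAt F (γ 0)).open_source.mem_nhds (mem_chart_source F (γ 0)))
  have hsrc' : ∀ᶠ t in 𝓝 (0 : ℝ), σ (γ t) ∈ (chartAt F (γ 0)).source := by
    have h1 : ContinuousAt (fun t => σ (γ t)) 0 :=
      hσ.continuous.continuousAt.comp (hγs 0 h0s).continuousAt
    refine h1.eventually_mem ((chartAt F (γ 0)).open_source.mem_nhds ?_)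
    rw [hσ0]
    exact mem_chart_source F (γ 0)
  have hσγ : ContMDiffAt 𝓘(ℝ, ℝ) 𝓘(ℝ, F) ∞ (fun r => σ (γ r)) 0 := (hσ _).comp 0 (hγs 0 h0s)
  have hd : ∀ c : ℝ → M, ContMDiffAt 𝓘(ℝ, ℝ) 𝓘(ℝ, F) ∞ c 0 → c 0 = γ 0 →
      deriv (fun r => extChartAt 𝓘(ℝ, F) (γ 0) (c r)) 0 =
        mdiff (extChartAt 𝓘(ℝ, F) (γ 0)) (γ 0) (mdiff c 0 (1 : ℝ) : F) := by
    intro c hc hc0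
    have h1 := mdiff_comp_apply (g := extChartAt 𝓘(ℝ, F) (γ 0)) (f := c) (x := 0)
      (contMDiffAt_extChartAt' (by rw [hc0]; exact mem_chart_source F (γ 0))) hc (1 : ℝ)
    rw [hc0] at h1
    rw [← h1]
    have h2 : mdiff (fun r => extChartAt 𝓘(ℝ, F) (γ 0) (c r)) 0 =
      fderiv ℝ (fun r => extChartAt 𝓘(ℝ, F) (γ 0) (c r)) 0 := mfderiv_eq_fderiv
    rw [h2]
    rfl
  have hG := (g.smoothFormAt (γ 0)).contDiffAt_chartForm (mem_chart_source F (γ 0))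
  have hinv : (chartForm g.inner (γ 0) (extChartAt 𝓘(ℝ, F) (γ 0) (γ 0))).IsInvertible :=
    isInvertible_chartForm g.formAt_nondegenerate (mem_extChartAt_target (γ 0))
  have hev := hs.mem_nhds h0s
  have hEL1 : ∀ᶠ r in 𝓝 (0 : ℝ), EulerLagrangeAt (chartForm g.inner (γ 0))
      (fun r => extChartAt 𝓘(ℝ, F) (γ 0) (γ r)) r := by
    filter_upwards [hev, hsrc] with r hr hr'
    -- The identity as isometry: this only moves the equation to the chart at `γ 0`.
    refine hγ.eulerLagrangeAt hs (φ := fun x => x) contMDiff_id (fun x u v => ?_) hr hr'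
    rw [mdiff_id]
    rfl
  have hEL2 : ∀ᶠ r in 𝓝 (0 : ℝ), EulerLagrangeAt (chartForm g.inner (γ 0))
      (fun r => extChartAt 𝓘(ℝ, F) (γ 0) (σ (γ r))) r := by
    filter_upwards [hev, hsrc'] with r hr hr'
    exact hγ.eulerLagrangeAt hs hσ hσg hr hr'
  have hfinal := eventuallyEq_of_eulerLagrangeAt (t := 0) (hG.of_le (by norm_cast)) hinv
    ((contDiffAt_extChartAt_comp (hγs 0 h0s) (mem_chart_source F (γ 0))).of_le (by norm_cast))
    ((contDiffAt_extChartAt_comp hσγ (by rw [hσ0]; exact mem_chart_source F (γ 0))).of_le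
      (by norm_cast)) hEL1 hEL2 (by rw [hσ0]) (by
      rw [hd γ (hγs 0 h0s) rfl, hd _ hσγ hσ0, mdiff_comp_apply (hσ _) (hγs 0 h0s), hdσ])
  filter_upwards [hfinal, hsrc, hsrc'] with r h1 h2 h3
  rw [hS]
  rw [← extChartAt_source 𝓘(ℝ, F)] at h2 h3
  exact ((extChartAt 𝓘(ℝ, F) (γ 0)).injOn h2 h3 h1).symm

end Geodesic

/-! ### Linear algebra of involutions -/

section Involution

variable {E : Type*} [NormedAddCommGroup E] [NormedSpace ℝ E] [FiniteDimensional ℝ E]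
  {V : Type*} [NormedAddCommGroup V] [NormedSpace ℝ V] [FiniteDimensional ℝ V]

/-- The maps `A + T A` and `1 - L` send `E` jointly onto the fixed space of `T` times the
`(-1)`-eigenspace of `L`, and their common kernel consists of the `L`-fixed vectors of `ker A`. This
counts the dimension of a fixed locus inside a zero set. -/
theorem finrank_eq_of_equivariant_surjective {A : E →L[ℝ] V} (hA : Surjective A) {L : E →L[ℝ] E}
    {T : V →L[ℝ] V} (hL : ∀ u, L (L u) = u) (hT : ∀ v, T (T v) = v)
    (hAL : ∀ u, A (L u) = T (A u)) :
    Module.finrank ℝ E = Module.finrank ℝ (LinearMap.ker (T - 1 : V →ₗ[ℝ] V)) +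
      Module.finrank ℝ (LinearMap.ker (L + 1 : E →ₗ[ℝ] E)) +
      Module.finrank ℝ (LinearMap.ker (A : E →ₗ[ℝ] V) ⊓ LinearMap.ker (L - 1 : E →ₗ[ℝ] E) :) := by
  let P₁ : E →ₗ[ℝ] LinearMap.ker (T - 1 : V →ₗ[ℝ] V) :=
    LinearMap.codRestrict _ ((A + T.comp A : E →L[ℝ] V) : E →ₗ[ℝ] V) fun u => by
      simp [hT, add_comm]
  let P₂ : E →ₗ[ℝ] LinearMap.ker (L + 1 : E →ₗ[ℝ] E) :=
    LinearMap.codRestrict _ ((1 - L : E →L[ℝ] E) : E →ₗ[ℝ] E) fun u => by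
      simp [hL]
  have hsurj : Surjective (P₁.prod P₂) := by
    rintro ⟨⟨w, hw⟩, ⟨u, hu⟩⟩
    have hw' : T w = w := by simpa [sub_eq_zero] using hw
    have hu' : L u = -u := by simpa [eq_neg_iff_add_eq_zero] using hu
    obtain ⟨v, rfl⟩ := hA w
    -- The coefficients compensate for maps that are not normalised: `A + T A` takes `(v + L v) / 4`
    -- to `A v`, and `1 - L` takes `u / 2` to `u`. Each summand is killed by the other map.
    refine ⟨(1 / 4 : ℝ) • (v + L v) + (1 / 2 : ℝ) • u, Prod.ext (Subtype.ext ?_) (Subtype.ext ?_)⟩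
    · change A _ + T (A _) = A v
      have hAu : T (A u) = -A u := by rw [← hAL, hu', map_neg]
      simp only [map_add, map_smul, hAL, hw', hAu]
      module
    · change (1 / 4 : ℝ) • (v + L v) + (1 / 2 : ℝ) • u -
        L ((1 / 4 : ℝ) • (v + L v) + (1 / 2 : ℝ) • u) = u
      simp only [map_add, map_smul, hL, hu']
      module
  have hker : LinearMap.ker (P₁.prod P₂) =
      LinearMap.ker (A : E →ₗ[ℝ] V) ⊓ LinearMap.ker (L - 1 : E →ₗ[ℝ] E) := by
    ext u
    rw [LinearMap.ker_prod]
    simp only [Submodule.mem_inf, LinearMap.mem_ker]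
    have e1 : P₁ u = 0 ↔ A u + T (A u) = 0 := Subtype.ext_iff
    have e2 : P₂ u = 0 ↔ u - L u = 0 := Subtype.ext_iff
    have e3 : (L - 1 : E →ₗ[ℝ] E) u = 0 ↔ u - L u = 0 := by
      change L u - u = 0 ↔ _
      rw [sub_eq_zero, sub_eq_zero, eq_comm]
    rw [e1, e2, e3]
    refine and_congr_left fun h => ?_
    rw [← hAL, ← sub_eq_zero.1 h, ← two_smul ℝ]
    simp
  have := LinearMap.finrank_range_add_finrank_ker (P₁.prod P₂)
  rw [LinearMap.range_eq_top.2 hsurj, finrank_top, Module.finrank_prod, hker] at this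
  exact this.symm

/-- `J` exchanges the two eigenspaces of `L`, so they have equal dimension. At fixed points of the
involution this forces a codimension that does not depend on the point. -/
theorem finrank_eq_two_mul_of_anticommute {L J : E →L[ℝ] E} (hL : ∀ u, L (L u) = u)
    (hJ : ∀ u, J (J u) = -u) (hLJ : ∀ u, L (J u) = -J (L u)) :
    Module.finrank ℝ E = 2 * Module.finrank ℝ (LinearMap.ker (L + 1 : E →ₗ[ℝ] E)) := by
  -- A trivial constraint, with values in a point, reduces the count to the two eigenspaces of `L`.
  have h := finrank_eq_of_equivariant_surjective (A := (0 : E →L[ℝ] PUnit)) (T := 1)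
    (fun x => ⟨0, Subsingleton.elim _ _⟩) hL (fun _ => rfl) (fun _ => rfl)
  have hi : Injective J := fun u v huv => by
    have := congrArg J huv
    simpa [hJ] using this
  have h1 : Module.finrank ℝ (LinearMap.ker (((0 : E →L[ℝ] PUnit) : E →ₗ[ℝ] PUnit)) ⊓
      LinearMap.ker (L - 1 : E →ₗ[ℝ] E) :) = Module.finrank ℝ (LinearMap.ker (L + 1 : E →ₗ[ℝ] E)) := by
    have e : LinearMap.ker (((0 : E →L[ℝ] PUnit) : E →ₗ[ℝ] PUnit)) ⊓
      LinearMap.ker (L - 1 : E →ₗ[ℝ] E) = LinearMap.ker (L - 1 : E →ₗ[ℝ] E) := by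
      rw [inf_eq_right]
      intro u _
      exact Subsingleton.elim _ _
    rw [e]
    refine le_antisymm ?_ ?_
    · refine LinearMap.finrank_le_finrank_of_injective
        (f := LinearMap.restrict (J : E →ₗ[ℝ] E) fun u hu => ?_) ?_
      · have hu' : L u = u := by simpa [sub_eq_zero] using hu
        simp [hLJ, hu']
      · intro u v huv
        exact Subtype.ext (hi (congrArg Subtype.val huv))
    · refine LinearMap.finrank_le_finrank_of_injective
        (f := LinearMap.restrict (J : E →ₗ[ℝ] E) fun u hu => ?_) ?_
      · have hu' : L u = -u := by simpa [eq_neg_iff_add_eq_zero] using hu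
        simp [hLJ, hu']
      · intro u v huv
        exact Subtype.ext (hi (congrArg Subtype.val huv))
  have h2 : Module.finrank ℝ (LinearMap.ker ((1 : PUnit →L[ℝ] PUnit) - 1 : PUnit →ₗ[ℝ] PUnit)) = 0 :=
    Module.finrank_zero_of_subsingleton
  rw [h1, h2] at h
  omega

/-- An injective map into a kernel is onto it if the dimensions agree. -/
theorem exists_eq_of_finrank_le {F : Type*} [NormedAddCommGroup F] [NormedSpace ℝ F]
    [FiniteDimensional ℝ F] {A : F →L[ℝ] E} (hA : Injective A) {p : Submodule ℝ E}
    (hp : ∀ u, A u ∈ p) (hd : Module.finrank ℝ p ≤ Module.finrank ℝ F) {v : E} (hv : v ∈ p) :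
    ∃ u, A u = v := by
  have h1 : LinearMap.range (A : F →ₗ[ℝ] E) = p :=
    Submodule.eq_of_le_of_finrank_le (by rintro _ ⟨u, rfl⟩; exact hp u)
      (hd.trans (LinearMap.finrank_range_of_inj hA).ge)
  rw [← h1] at hv
  exact hv

end Involution

/-! ### Tangent spaces of submanifolds -/

section Tangent

variable {F : Type*} [NormedAddCommGroup F] [NormedSpace ℝ F]
  {M : Type*} [TopologicalSpace M] [ChartedSpace F M] [IsManifold 𝓘(ℝ, F) ∞ M]
  {F' : Type*} [NormedAddCommGroup F'] [NormedSpace ℝ F']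
  {N : Type*} [TopologicalSpace N] [ChartedSpace F' N] [IsManifold 𝓘(ℝ, F') ∞ N]

/-- In adapted charts an immersion is `u ↦ (u, 0)`, and projecting to the first factor undoes it.
Injectivity of the differential is deduced from this left inverse. -/
theorem exists_leftInverse_of_isImmersionAt {f : N → M} {x : N}
    (h : Manifold.IsImmersionAt 𝓘(ℝ, F') 𝓘(ℝ, F) ∞ f x) :
    ∃ r : M → N, ContMDiffAt 𝓘(ℝ, F) 𝓘(ℝ, F') ∞ r (f x) ∧ ∀ᶠ y in 𝓝 x, r (f y) = y := by
  have h1 : ∀ y ∈ h.domChart.source, h.domChart y =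
      (h.equiv.symm (h.codChart (f y))).1 := by
    intro y hy
    have := h.writtenInCharts
      (show h.domChart.extend 𝓘(ℝ, F') y ∈ _ from (h.domChart.extend 𝓘(ℝ, F')).map_source
        (by simpa using hy))
    simp only [comp_apply, OpenPartialHomeomorph.extend_coe, OpenPartialHomeomorph.extend_coe_symm,
      modelWithCornersSelf_coe, modelWithCornersSelf_coe_symm, id] at this
    rw [h.domChart.left_inv hy] at this
    rw [this]
    simp
  refine ⟨fun m => h.domChart.symm (h.equiv.symm (h.codChart m)).1, ?_, ?_⟩
  · have h2 : ContMDiffAt 𝓘(ℝ, F) 𝓘(ℝ, F) ∞ h.codChart (f x) :=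
      contMDiffAt_of_mem_maximalAtlas h.codChart_mem_maximalAtlas h.mem_codChart_source
    have h3 : ContMDiffAt 𝓘(ℝ, F) 𝓘(ℝ, F') ∞
        (fun m => (h.equiv.symm (h.codChart m)).1) (f x) :=
      ((ContinuousLinearMap.fst ℝ F' h.complement).comp
        (h.equiv.symm : F →L[ℝ] F' × h.complement)).contMDiff.contMDiffAt.comp (f x) h2
    have h4 := contMDiffAt_symm_of_mem_maximalAtlas (I := 𝓘(ℝ, F')) h.domChart_mem_maximalAtlas
      (h.domChart.map_source h.mem_domChart_source)
    rw [h1 x h.mem_domChart_source] at h4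
    exact ContMDiffAt.comp (g := h.domChart.symm) (f x) h4 h3
  · filter_upwards [h.domChart.open_source.mem_nhds h.mem_domChart_source] with y hy
    rw [← h1 y hy, h.domChart.left_inv hy]

theorem mdiff_injective_of_isImmersionAt [FiniteDimensional ℝ F'] {f : N → M} {x : N}
    (h : Manifold.IsImmersionAt 𝓘(ℝ, F') 𝓘(ℝ, F) ∞ f x) : Injective (mdiff f x : F' →L[ℝ] F) := by
  obtain ⟨r, hr, hrf⟩ := exists_leftInverse_of_isImmersionAt h
  have h1 : (mdiff (fun y => r (f y)) x : F' →L[ℝ] F') = mdiff (fun y : N => y) x :=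
    mdiff_congr hrf
  intro u v huv
  have h2 := mdiff_comp_apply hr h.contMDiffAt u
  have h3 := mdiff_comp_apply hr h.contMDiffAt v
  rw [h1, mdiff_id] at h2 h3
  rw [huv] at h2
  exact h2.trans h3.symm

theorem mdiff_const_eq_zero {f : N → M} {x : N} {c : M} (h : ∀ y, f y = c) :
    (mdiff f x : F' →L[ℝ] F) = 0 := by
  rw [show f = fun _ => c from funext h]
  exact mfderiv_const

variable [FiniteDimensional ℝ F] [FiniteDimensional ℝ F']
  {V : Type*} [NormedAddCommGroup V] [NormedSpace ℝ V] [FiniteDimensional ℝ V]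

omit [FiniteDimensional ℝ F'] in
/-- The tangent space of the zero set of a submersion. -/
theorem mem_range_mdiff_val_iff {S : Set M} [ChartedSpace F' S] [IsManifold 𝓘(ℝ, F') ∞ S]
    [FiniteDimensional ℝ F']
    (hS : Manifold.IsSmoothEmbedding 𝓘(ℝ, F') 𝓘(ℝ, F) ∞ (Subtype.val : S → M)) {Φ : M → V}
    (hΦ : ContMDiff 𝓘(ℝ, F) 𝓘(ℝ, V) ∞ Φ) (h0 : ∀ x ∈ S, Φ x = 0) (p : S)
    (hs : Surjective (mdiff Φ (p : M) : F →L[ℝ] V))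
    (hd : Module.finrank ℝ F = Module.finrank ℝ V + Module.finrank ℝ F') (v : F) :
    (∃ u : F', (mdiff (Subtype.val : S → M) p : F' →L[ℝ] F) u = v) ↔
      (mdiff Φ (p : M) : F →L[ℝ] V) v = 0 := by
  have h1 : ∀ u : F', (mdiff Φ (p : M) : F →L[ℝ] V)
      ((mdiff (Subtype.val : S → M) p : F' →L[ℝ] F) u) = 0 := by
    intro u
    rw [← mdiff_comp_apply (hΦ _) (hS.contMDiff _), mdiff_const_eq_zero (c := 0) fun y : S => h0 y y.2]
    rfl
  refine ⟨?_, fun hv => ?_⟩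
  · rintro ⟨u, rfl⟩
    exact h1 u
  · refine exists_eq_of_finrank_le (p := LinearMap.ker ((mdiff Φ (p : M) : F →L[ℝ] V) : F →ₗ[ℝ] V))
      (mdiff_injective_of_isImmersionAt (hS.isImmersion.isImmersionAt p)) h1 ?_ hv
    have := LinearMap.finrank_range_add_finrank_ker ((mdiff Φ (p : M) : F →L[ℝ] V) : F →ₗ[ℝ] V)
    rw [LinearMap.range_eq_top.2 hs, finrank_top] at this
    omega

theorem mdiff_involutive {σ : M → M} (hσ : ContMDiff 𝓘(ℝ, F) 𝓘(ℝ, F) ∞ σ) (hinv : Involutive σ)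
    (x : M) (u : F) : (mdiff σ (σ x) : F →L[ℝ] F) ((mdiff σ x : F →L[ℝ] F) u) = u := by
  rw [← mdiff_comp_apply (hσ _) (hσ _), show (fun y => σ (σ y)) = fun y => y from funext hinv,
    mdiff_id]
  rfl

/-- The tangent space of the fixed locus of an involution in the zero set of a submersion. -/
theorem mem_range_mdiff_val_fixed_iff {σ : M → M} (hσ : ContMDiff 𝓘(ℝ, F) 𝓘(ℝ, F) ∞ σ)
    (hinv : Involutive σ) {Φ : M → V} (hΦ : ContMDiff 𝓘(ℝ, F) 𝓘(ℝ, V) ∞ Φ) {T : V →L[ℝ] V}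
    (hT : ∀ v, T (T v) = v) (hΦσ : ∀ x, Φ (σ x) = T (Φ x)) {S : Set M}
    (hS0 : ∀ x ∈ S, Φ x = 0 ∧ σ x = x) [ChartedSpace F' S] [IsManifold 𝓘(ℝ, F') ∞ S]
    (hS : Manifold.IsSmoothEmbedding 𝓘(ℝ, F') 𝓘(ℝ, F) ∞ (Subtype.val : S → M)) (p : S)
    (hs : Surjective (mdiff Φ (p : M) : F →L[ℝ] V))
    (hd : Module.finrank ℝ F = Module.finrank ℝ (LinearMap.ker (T - 1 : V →ₗ[ℝ] V)) +
      Module.finrank ℝ (LinearMap.ker ((mdiff σ (p : M) : F →L[ℝ] F) + 1 : F →ₗ[ℝ] F)) +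
      Module.finrank ℝ F') (v : F) :
    (∃ u : F', (mdiff (Subtype.val : S → M) p : F' →L[ℝ] F) u = v) ↔
      (mdiff Φ (p : M) : F →L[ℝ] V) v = 0 ∧ (mdiff σ (p : M) : F →L[ℝ] F) v = v := by
  have hp := (hS0 p p.2).2
  have h1 : ∀ u : F', (mdiff Φ (p : M) : F →L[ℝ] V)
      ((mdiff (Subtype.val : S → M) p : F' →L[ℝ] F) u) = 0 := by
    intro u
    rw [← mdiff_comp_apply (hΦ _) (hS.contMDiff _),
      mdiff_const_eq_zero (c := 0) fun y : S => (hS0 y y.2).1]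
    rfl
  have h2 : ∀ u : F', (mdiff σ (p : M) : F →L[ℝ] F)
      ((mdiff (Subtype.val : S → M) p : F' →L[ℝ] F) u) =
      (mdiff (Subtype.val : S → M) p : F' →L[ℝ] F) u := by
    intro u
    rw [← mdiff_comp_apply (hσ _) (hS.contMDiff _),
      show (fun y : S => σ y) = Subtype.val from funext fun y => (hS0 y y.2).2]
  obtain ⟨L, hL⟩ : ∃ L : F →L[ℝ] F, L = mdiff σ (p : M) := ⟨_, rfl⟩
  obtain ⟨A, hA⟩ : ∃ A : F →L[ℝ] V, A = mdiff Φ (p : M) := ⟨_, rfl⟩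
  have hLL : ∀ u, L (L u) = u := by
    intro u
    have h : ∀ x', x' = (p : M) → (mdiff σ x' : F →L[ℝ] F) = mdiff σ (p : M) := by rintro _ rfl; rfl
    have := mdiff_involutive hσ hinv (p : M) u
    rw [h _ hp] at this
    rw [hL]; exact this
  have hAL : ∀ u, A (L u) = T (A u) := by
    intro u
    have e1 := mdiff_comp_apply (f := σ) (g := Φ) (hΦ _) (hσ (p : M)) u
    have h : ∀ x', x' = (p : M) → (mdiff Φ x' : F →L[ℝ] V) = mdiff Φ (p : M) := by rintro _ rfl; rfl
    rw [h _ hp, show (fun y => Φ (σ y)) = fun y => T (Φ y) from funext hΦσ] at e1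
    have e2 := mdiff_eq_of_hasMFDerivAt (f := fun y => T (Φ y))
      ((T.hasMFDerivAt (x := Φ p)).comp (p : M) (hasMFDerivAt_mdiff (hΦ p)))
    rw [e2] at e1
    rw [hA, hL]; exact e1.symm
  rw [← hA] at hs h1 ⊢
  rw [← hL] at h2 hd ⊢
  refine ⟨?_, fun hv => ?_⟩
  · rintro ⟨u, rfl⟩
    exact ⟨h1 u, h2 u⟩
  · refine exists_eq_of_finrank_le
      (p := LinearMap.ker (A : F →ₗ[ℝ] V) ⊓ LinearMap.ker (L - 1 : F →ₗ[ℝ] F))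
      (mdiff_injective_of_isImmersionAt (hS.isImmersion.isImmersionAt p))
      (fun u => ⟨h1 u, ?_⟩) ?_ ⟨hv.1, ?_⟩
    · exact sub_eq_zero.2 (h2 u)
    · have := finrank_eq_of_equivariant_surjective hs hLL hT hAL
      omega
    · exact sub_eq_zero.2 hv.2

/-- Locally `f = (f ∘ π) ∘ s` for a smooth section `s` of `π`. -/
theorem contMDiff_of_comp_submersion {F'' : Type*} [NormedAddCommGroup F''] [NormedSpace ℝ F'']
    {P : Type*} [TopologicalSpace P] [ChartedSpace F'' P] {π : N → M}
    (hπ : ContMDiff 𝓘(ℝ, F') 𝓘(ℝ, F) ∞ π) (hsurj : Surjective π)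
    (hs : ∀ x, Surjective (mdiff π x : F' →L[ℝ] F)) {f : M → P}
    (hf : ContMDiff 𝓘(ℝ, F') 𝓘(ℝ, F'') ∞ fun x => f (π x)) : ContMDiff 𝓘(ℝ, F) 𝓘(ℝ, F'') ∞ f := by
  intro q
  obtain ⟨x, rfl⟩ := hsurj q
  obtain ⟨s, hsx, hsec⟩ := exists_localSection hπ (hs x)
  refine ContMDiffAt.congr_of_eventuallyEq ((hf (s (π x))).comp (π x) hsec.self_of_nhds.1) ?_
  filter_upwards [hsec] with y hy
  simp [hy.2]

end Tangent

/-! ### Topology of orbit spaces -/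

section OrbitTopology

variable {K : Type*} [Group K] {Z : Type*} [TopologicalSpace Z] [MulAction K Z]
  {Q : Type*} [TopologicalSpace Q] {π : Z → Q}

/-- The saturation of an open set is the union of its translates. -/
theorem isOpenQuotientMap_of_orbits (hc : ∀ k : K, Continuous fun z : Z => k • z)
    (hπ : Topology.IsQuotientMap π) (hπK : ∀ z z', π z = π z' ↔ ∃ k : K, k • z = z') :
    IsOpenQuotientMap π := by
  refine ⟨hπ.surjective, hπ.continuous, fun U hU => ?_⟩
  rw [← hπ.isOpen_preimage]
  have : π ⁻¹' (π '' U) = ⋃ k : K, (fun z : Z => k • z) ⁻¹' U := by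
    ext z
    simp only [mem_preimage, mem_image, mem_iUnion]
    constructor
    · rintro ⟨y, hy, hyz⟩
      obtain ⟨k, rfl⟩ := (hπK _ _).1 hyz.symm
      exact ⟨k, hy⟩
    · rintro ⟨k, hk⟩
      exact ⟨_, hk, ((hπK _ _).2 ⟨k, rfl⟩).symm⟩
  rw [this]
  exact isOpen_iUnion fun k => hU.preimage (hc k)

/-- The orbit relation is the projection of the closed set `{k z = z'}` along the compact group,
hence closed; for an open quotient map this is the Hausdorff property. -/
theorem t2Space_of_compact_orbits [TopologicalSpace K] [CompactSpace K] [T2Space Z]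
    (hc : Continuous fun p : K × Z => p.1 • p.2) (hπ : IsOpenQuotientMap π)
    (hπK : ∀ z z', π z = π z' ↔ ∃ k : K, k • z = z') : T2Space Q := by
  rw [t2Space_iff_of_isOpenQuotientMap hπ]
  have h1 : IsClosed {q : K × Z × Z | q.1 • q.2.1 = q.2.2} :=
    isClosed_eq (hc.comp (continuous_fst.prodMk (continuous_fst.comp continuous_snd)))
      (continuous_snd.comp continuous_snd)
  have h2 := isClosedMap_snd_of_compactSpace _ h1
  convert h2 using 1
  ext ⟨z, z'⟩
  simp [hπK]

theorem secondCountableTopology_of_isOpenQuotientMap [SecondCountableTopology Z]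
    (hπ : IsOpenQuotientMap π) : SecondCountableTopology Q :=
  hπ.isQuotientMap.secondCountableTopology hπ.isOpenMap

end OrbitTopology

/-! ### Manifold structures pulled back along open embeddings -/

section OpenEmbedding

variable {F : Type*} [NormedAddCommGroup F] [NormedSpace ℝ F]
  {M : Type*} [TopologicalSpace M] [ChartedSpace F M] [IsManifold 𝓘(ℝ, F) ∞ M]
  {R : Type*} [TopologicalSpace R]

/-- The charts of `M` at the image points are composed with `f`, so that `f` reads as the identity
in charts. This provides the manifold structure of the real quotient. -/
theorem exists_manifold_of_isOpenEmbedding {f : R → M} (hf : Topology.IsOpenEmbedding f) :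
    ∃ (_ : ChartedSpace F R), IsManifold 𝓘(ℝ, F) ∞ R ∧ IsLocalDiffeomorph 𝓘(ℝ, F) 𝓘(ℝ, F) ∞ f := by
  let t : R → OpenPartialHomeomorph R M := fun r =>
    haveI : Nonempty R := ⟨r⟩
    hf.toOpenPartialHomeomorph f
  have htf : ∀ r, ⇑(t r) = f := fun r => rfl
  have hts : ∀ r, (t r).source = univ := fun r => rfl
  let e : R → OpenPartialHomeomorph R F := fun r => (t r).trans (chartAt F (f r))
  have hes : ∀ r, (e r).source = f ⁻¹' (chartAt F (f r)).source := fun r => by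
    simp [e, hts, htf]
  have hef : ∀ r x, e r x = chartAt F (f r) (f x) := fun r x => rfl
  have hesymm : ∀ r y, (e r).symm y = (t r).symm ((chartAt F (f r)).symm y) := fun r y => rfl
  have hfe : ∀ r, ∀ y ∈ (e r).target, f ((e r).symm y) = (chartAt F (f r)).symm y := by
    intro r y hy
    rw [hesymm]
    exact (t r).right_inv (by
      rw [OpenPartialHomeomorph.trans_target] at hy
      exact hy.2)
  have he : ∀ r, r ∈ (e r).source := fun r => by rw [hes]; exact mem_chart_source F (f r)
  let _ := chartedSpaceOfCharts e he
  have hM : IsManifold 𝓘(ℝ, F) ∞ R := by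
    refine isManifold_chartedSpaceOfCharts e he fun x y => ?_
    have h1 : ContMDiffOn 𝓘(ℝ, F) 𝓘(ℝ, F) ∞ (fun z => chartAt F (f y) ((chartAt F (f x)).symm z))
        ((chartAt F (f x)).target ∩ (chartAt F (f x)).symm ⁻¹' (chartAt F (f y)).source) :=
      contMDiffOn_chart.comp (contMDiffOn_chart_symm.mono inter_subset_left) inter_subset_right
    have hsub : ∀ z ∈ ((e x).symm.trans (e y)).source, z ∈ (e x).target ∧
        (chartAt F (f x)).symm z ∈ (chartAt F (f y)).source := by
      intro z hz
      rw [OpenPartialHomeomorph.trans_source] at hz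
      refine ⟨hz.1, ?_⟩
      have := hz.2
      rw [mem_preimage, hes, mem_preimage] at this
      rwa [hfe x z hz.1] at this
    refine (h1.contDiffOn.mono fun z hz => ⟨?_, (hsub z hz).2⟩).congr fun z hz => ?_
    · have := (hsub z hz).1
      rw [OpenPartialHomeomorph.trans_target] at this
      exact this.1
    · change e y ((e x).symm z) = _
      rw [hef, hfe x z (hsub z hz).1]
  refine ⟨inferInstance, hM, fun r => ?_⟩
  have hch : ∀ x : R, chartAt F x = e x := fun x => rfl
  have hfs : ContMDiff 𝓘(ℝ, F) 𝓘(ℝ, F) ∞ f := by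
    intro x
    have h1 : ContMDiffAt 𝓘(ℝ, F) 𝓘(ℝ, F) ∞ (chartAt F x) x := contMDiffAt_of_mem_maximalAtlas
      (IsManifold.chart_mem_maximalAtlas x) (mem_chart_source F x)
    have h2 : ContMDiffAt 𝓘(ℝ, F) 𝓘(ℝ, F) ∞ (chartAt F (f x)).symm (chartAt F x x) :=
      contMDiffAt_symm_of_mem_maximalAtlas
      (IsManifold.chart_mem_maximalAtlas (f x)) ((chartAt F (f x)).map_source (mem_chart_source F (f x)))
    refine (ContMDiffAt.comp (g := (chartAt F (f x)).symm) x h2 h1).congr_of_eventuallyEq ?_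
    filter_upwards [(e x).open_source.mem_nhds (he x)] with y hy
    rw [hes] at hy
    exact ((chartAt F (f x)).left_inv hy).symm
  refine ⟨⟨(t r).toPartialEquiv, (t r).open_source, (t r).open_target, hfs.contMDiffOn, ?_⟩,
    mem_univ r, fun x _ => rfl⟩
  intro y hy
  obtain ⟨x, rfl⟩ : ∃ x, f x = y := ⟨(t r).symm y, (t r).right_inv hy⟩
  have h1 : ContMDiffAt 𝓘(ℝ, F) 𝓘(ℝ, F) ∞ (chartAt F (f x)) (f x) := contMDiffAt_of_mem_maximalAtlas
    (IsManifold.chart_mem_maximalAtlas (f x)) (mem_chart_source F (f x))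
  have h2 : ContMDiffAt 𝓘(ℝ, F) 𝓘(ℝ, F) ∞ (chartAt F x).symm (chartAt F (f x) (f x)) :=
    contMDiffAt_symm_of_mem_maximalAtlas
    (IsManifold.chart_mem_maximalAtlas x) ((chartAt F x).map_source (mem_chart_source F x))
  refine ((ContMDiffAt.comp (g := (chartAt F x).symm) (f x) h2 h1).congr_of_eventuallyEq
    ?_).contMDiffWithinAt
  have hopen : IsOpen ((t r).target ∩ (chartAt F (f x)).source) :=
    (t r).open_target.inter (chartAt F (f x)).open_source
  filter_upwards [hopen.mem_nhds ⟨hy, mem_chart_source F (f x)⟩] with z hz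
  obtain ⟨x', rfl⟩ : ∃ x, f x = z := ⟨(t r).symm z, (t r).right_inv hz.1⟩
  change (t r).symm (t r x') = (chartAt F x).symm (chartAt F x x')
  rw [(t r).left_inv (mem_univ _), (chartAt F x).left_inv]
  rw [hch, hes]
  exact hz.2

end OpenEmbedding

/-! ### Orbit spaces of free actions on submanifolds -/

section OrbitSpace

variable {E : Type*} [NormedAddCommGroup E] [NormedSpace ℝ E] [FiniteDimensional ℝ E]
  {X : Type*} [TopologicalSpace X] [ChartedSpace E X] [IsManifold 𝓘(ℝ, E) ∞ X]
  {EK : Type*} [NormedAddCommGroup EK] [NormedSpace ℝ EK] [FiniteDimensional ℝ EK]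
  {K : Type*} [TopologicalSpace K] [ChartedSpace EK K] [Group K] [MulAction K X]
  {F : Type*} [NormedAddCommGroup F] [NormedSpace ℝ F] [FiniteDimensional ℝ F]
  {S : Set X}

/-- The restriction of an action to an invariant subset. -/
abbrev mulActionOfInvariant {G : Type*} [Group G] {Y : Type*} [MulAction G Y] {S : Set Y}
    (hS : ∀ (k : G), ∀ x ∈ S, k • x ∈ S) : MulAction G S where
  smul k z := ⟨k • (z : Y), hS k z z.2⟩
  one_smul z := Subtype.ext (one_smul G (z : Y))
  mul_smul k l z := Subtype.ext (mul_smul k l (z : Y))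

theorem orbitSpace_mk_eq_iff {G : Type*} [Group G] {Y : Type*} [MulAction G Y] {S : Set Y}
    (z z' : S) : (Quotient.mk'' z : OrbitSpace G S) = Quotient.mk'' z' ↔
      ∃ k : G, k • (z : Y) = z' := by
  rw [eq_comm, Quotient.eq'']
  rfl

/-- The infinitesimal action `ξ ↦ ξ_X(x)` of the Lie algebra of `K`. -/
def infAct (K : Type*) [TopologicalSpace K] [ChartedSpace EK K] [Group K] [MulAction K X] (x : X) :
    EK →L[ℝ] E := mdiff (fun k : K => k • x) 1

variable [LieGroup 𝓘(ℝ, EK) ∞ K] [ContMDiffSMul 𝓘(ℝ, EK) 𝓘(ℝ, E) ∞ K X]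

theorem contMDiff_smul_left (x : X) : ContMDiff 𝓘(ℝ, EK) 𝓘(ℝ, E) ∞ fun k : K => k • x :=
  (contMDiff_smul (I := 𝓘(ℝ, EK)) (I' := 𝓘(ℝ, E)) (G := K) (M := X)).comp
    (contMDiff_id.prodMk contMDiff_const)

/-- The last two clauses are what descent needs: vertical vectors are those of the infinitesimal
action, and tangent vectors at two points of one orbit with equal projections agree up to some `dk`
and a vertical vector. -/
theorem exists_orbitSpace_manifold [T2Space X] [SecondCountableTopology X] [CompactSpace K]
    (hS : ∀ (k : K), ∀ x ∈ S, k • x ∈ S) [ChartedSpace F S] [IsManifold 𝓘(ℝ, F) ∞ S]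
    (hι : Manifold.IsSmoothEmbedding 𝓘(ℝ, F) 𝓘(ℝ, E) ∞ (Subtype.val : S → X))
    (hfree : ∀ x ∈ S, ∀ k : K, k • x = x → k = 1)
    (hinf : ∀ x ∈ S, Injective (infAct (E := E) (EK := EK) K x)) {n : ℕ}
    (hn : S.Nonempty → Module.finrank ℝ F = Module.finrank ℝ EK + n) :
    T2Space (OrbitSpace K S) ∧ SecondCountableTopology (OrbitSpace K S) ∧
    ∃ (_ : ChartedSpace (EuclideanSpace ℝ (Fin n)) (OrbitSpace K S)),
      IsManifold (𝓡 n) ∞ (OrbitSpace K S) ∧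
      ContMDiff 𝓘(ℝ, F) (𝓡 n) ∞ (Quotient.mk'' : S → OrbitSpace K S) ∧
      (∀ z, Surjective (mdiff (Quotient.mk'' : S → OrbitSpace K S) z :
        F →L[ℝ] EuclideanSpace ℝ (Fin n))) ∧
      (∀ (z : S) (w : F), (mdiff (Quotient.mk'' : S → OrbitSpace K S) z :
        F →L[ℝ] EuclideanSpace ℝ (Fin n)) w = 0 ↔
          ∃ ξ : EK, (mdiff (Subtype.val : S → X) z : F →L[ℝ] E) w = infAct K (z : X) ξ) ∧
      ∀ (z z' : S), (Quotient.mk'' z : OrbitSpace K S) = Quotient.mk'' z' →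
        ∃ k : K, k • (z : X) = z' ∧ ∀ a a' : F,
          (mdiff (Quotient.mk'' : S → OrbitSpace K S) z : F →L[ℝ] EuclideanSpace ℝ (Fin n)) a =
            mdiff (Quotient.mk'' : S → OrbitSpace K S) z' a' →
          ∃ ξ : EK, (mdiff (Subtype.val : S → X) z' : F →L[ℝ] E) a' =
            (mdiff (fun y : X => k • y) (z : X) : E →L[ℝ] E)
              ((mdiff (Subtype.val : S → X) z : F →L[ℝ] E) a) + infAct K (z' : X) ξ := by
  let _ : MulAction K S := mulActionOfInvariant hS
  have hval : ∀ (k : K) (z : S), ((k • z : S) : X) = k • (z : X) := fun _ _ => rfl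
  have hιs := hι.contMDiff
  have hact : ContMDiff (𝓘(ℝ, EK).prod 𝓘(ℝ, F)) 𝓘(ℝ, F) ∞ fun p : K × S => p.1 • p.2 := by
    rw [ContMDiff.iff_comp_isImmersion hι.isImmersion]
    have h1 : ContMDiff (𝓘(ℝ, EK).prod 𝓘(ℝ, F)) 𝓘(ℝ, E) ∞ fun p : K × S => p.1 • (p.2 : X) :=
      (contMDiff_smul (I := 𝓘(ℝ, EK)) (I' := 𝓘(ℝ, E)) (G := K) (M := X)).comp
        (contMDiff_fst.prodMk (hιs.comp contMDiff_snd))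
    exact ⟨Topology.IsInducing.subtypeVal.continuous_iff.2 h1.continuous, h1⟩
  have hcs : ∀ k : K, ContMDiff 𝓘(ℝ, F) 𝓘(ℝ, F) ∞ fun z : S => k • z := fun k =>
    hact.comp (contMDiff_const.prodMk contMDiff_id)
  have hcl : ∀ z : S, ContMDiff 𝓘(ℝ, EK) 𝓘(ℝ, F) ∞ fun k : K => k • z := fun z =>
    hact.comp (contMDiff_id.prodMk contMDiff_const)
  have hπK : ∀ z z' : S, (Quotient.mk'' z : OrbitSpace K S) = Quotient.mk'' z' ↔
      ∃ k : K, k • z = z' := by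
    intro z z'
    rw [orbitSpace_mk_eq_iff]
    exact exists_congr fun k => (Subtype.ext_iff (a1 := k • z) (a2 := z')).symm
  have hπ : IsOpenQuotientMap (Quotient.mk'' : S → OrbitSpace K S) :=
    isOpenQuotientMap_of_orbits (fun k => (hcs k).continuous) isQuotientMap_quotient_mk' hπK
  have hfreeS : ∀ (z : S) (k : K), k • z = z → k = 1 := fun z k h =>
    hfree z z.2 k (congrArg Subtype.val h)
  have hone : ∀ z' : S, ∀ z : S, z' = z → (mdiff (Subtype.val : S → X) z' : F →L[ℝ] E) =
      mdiff (Subtype.val : S → X) z := by rintro z _ rfl; rfl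
  have hvert : ∀ (z : S) (ξ : EK), (mdiff (Subtype.val : S → X) z : F →L[ℝ] E)
      ((mdiff (fun k : K => k • z) 1 : EK →L[ℝ] F) ξ) = infAct K (z : X) ξ := by
    intro z ξ
    have := mdiff_comp_apply (f := fun k : K => k • z) (g := (Subtype.val : S → X)) (x := 1)
      (hιs _) (hcl z 1) ξ
    rw [hone _ z (one_smul K z)] at this
    exact this.symm
  have hinfS : ∀ z : S, Injective (mdiff (fun k : K => k • z) 1 : EK →L[ℝ] F) := by
    intro z a b hab
    refine hinf z z.2 ?_
    rw [← hvert, ← hvert, hab]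
  refine ⟨t2Space_of_compact_orbits hact.continuous hπ hπK,
    secondCountableTopology_of_isOpenQuotientMap hπ, ?_⟩
  obtain ⟨hQ1, hQ2, hπs, hsub⟩ := exists_quotient_manifold hact hfreeS hinfS hπ hπK
    (n := n) fun h => hn (nonempty_coe_sort.1 h)
  have hone' : ∀ z' : S, ∀ z : S, z' = z → (mdiff (Quotient.mk'' : S → OrbitSpace K S) z' :
      F →L[ℝ] EuclideanSpace ℝ (Fin n)) = mdiff (Quotient.mk'' : S → OrbitSpace K S) z := by
    rintro z _ rfl; rfl
  have hvert0 : ∀ (z : S) (ξ : EK), (mdiff (Quotient.mk'' : S → OrbitSpace K S) z :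
      F →L[ℝ] EuclideanSpace ℝ (Fin n)) ((mdiff (fun k : K => k • z) 1 : EK →L[ℝ] F) ξ) = 0 := by
    intro z ξ
    have := mdiff_comp_apply (f := fun k : K => k • z) (g := (Quotient.mk'' : S → OrbitSpace K S))
      (x := 1) (hπs _) (hcl z 1) ξ
    rw [hone' _ z (one_smul K z), mdiff_const_eq_zero (c := (Quotient.mk'' z : OrbitSpace K S))
      fun k => ((hπK _ _).2 ⟨k, rfl⟩).symm] at this
    exact this.symm
  have hker : ∀ (z : S) (w : F), (mdiff (Quotient.mk'' : S → OrbitSpace K S) z :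
        F →L[ℝ] EuclideanSpace ℝ (Fin n)) w = 0 ↔
          ∃ ξ : EK, (mdiff (Subtype.val : S → X) z : F →L[ℝ] E) w = infAct K (z : X) ξ := by
    intro z w
    constructor
    · intro hw
      -- The infinitesimal action injects the Lie algebra into the kernel of `dπ`, which has the
      -- same dimension, so it fills the kernel.
      obtain ⟨ξ, hξ⟩ := exists_eq_of_finrank_le (hinfS z) (p := LinearMap.ker
        ((mdiff (Quotient.mk'' : S → OrbitSpace K S) z : F →L[ℝ] EuclideanSpace ℝ (Fin n)) :
          F →ₗ[ℝ] EuclideanSpace ℝ (Fin n))) (hvert0 z) (by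
          have hr := LinearMap.range_eq_top.2 (show Surjective
            ((mdiff (Quotient.mk'' : S → OrbitSpace K S) z : F →L[ℝ] EuclideanSpace ℝ (Fin n)) :
              F →ₗ[ℝ] EuclideanSpace ℝ (Fin n)) from hsub z)
          have h1 := LinearMap.finrank_range_add_finrank_ker
            ((mdiff (Quotient.mk'' : S → OrbitSpace K S) z : F →L[ℝ] EuclideanSpace ℝ (Fin n)) :
              F →ₗ[ℝ] EuclideanSpace ℝ (Fin n))
          rw [hr, finrank_top, finrank_euclideanSpace,
            Fintype.card_fin] at h1
          have h2 := hn ⟨z, z.2⟩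
          omega) hw
      exact ⟨ξ, by rw [← hvert, hξ]⟩
    · rintro ⟨ξ, hξ⟩
      rw [← hvert] at hξ
      rw [mdiff_injective_of_isImmersionAt (hι.isImmersion.isImmersionAt z) hξ]
      exact hvert0 z ξ
  refine ⟨hQ1, hQ2, hπs, hsub, hker, fun z z' h => ?_⟩
  obtain ⟨k, rfl⟩ := (hπK z z').1 h
  refine ⟨k, rfl, fun a a' haa' => ?_⟩
  have e1 := mdiff_comp_apply (f := fun y : S => k • y) (g := (Quotient.mk'' : S → OrbitSpace K S))
      (x := z) (hπs _) (hcs k z) a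
  rw [show (fun y : S => (Quotient.mk'' (k • y) : OrbitSpace K S)) = Quotient.mk'' from
    funext fun y => ((hπK _ _).2 ⟨k, rfl⟩).symm, haa'] at e1
  have e2 := mdiff_comp_apply (f := fun y : S => k • y) (g := (Subtype.val : S → X))
      (x := z) (hιs _) (hcs k z) a
  have e3 := mdiff_comp_apply (f := (Subtype.val : S → X)) (g := fun y : X => k • y)
      (x := z) (ContMDiffSMul.contMDiff_const_smul (I := 𝓘(ℝ, EK)) k _) (hιs z) a
  obtain ⟨ξ, hξ⟩ := (hker (k • z)
    (a' - (mdiff (fun y : S => k • y) z : F →L[ℝ] F) a)).1 (by rw [map_sub, e1, sub_self])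
  refine ⟨ξ, ?_⟩
  rw [map_sub, sub_eq_iff_eq_add, add_comm] at hξ
  rw [hξ, ← e2]
  exact congrArg₂ (· + ·) e3 rfl

end OrbitSpace

/-! ### The hyper-Kähler quotient -/

section Reduction

variable {F : Type*} [NormedAddCommGroup F] [NormedSpace ℝ F] [FiniteDimensional ℝ F]
  {M : Type*} [TopologicalSpace M] [ChartedSpace F M] [IsManifold 𝓘(ℝ, F) ∞ M]
  {F' : Type*} [NormedAddCommGroup F'] [NormedSpace ℝ F'] [FiniteDimensional ℝ F']
  {F'' : Type*} [NormedAddCommGroup F''] [NormedSpace ℝ F''] [FiniteDimensional ℝ F'']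
  {Q : Type*} [TopologicalSpace Q] [ChartedSpace F'' Q] [IsManifold 𝓘(ℝ, F'') ∞ Q]

theorem isKahlerReduction_of {κ : KahlerStructure F M} {Z : Set M} [ChartedSpace F' Z]
    [IsManifold 𝓘(ℝ, F') ∞ Z] {κQ : KahlerStructure F'' Q} {π : Z → Q}
    (hι : Manifold.IsSmoothEmbedding 𝓘(ℝ, F') 𝓘(ℝ, F) ∞ (Subtype.val : Z → M))
    (hπ : ContMDiff 𝓘(ℝ, F') 𝓘(ℝ, F'') ∞ π) (hsurj : Surjective π)
    (hsub : ∀ z, Surjective (mdiff π z : F' →L[ℝ] F''))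
    (hg : ∀ (z : Z) (u v : F'), (∀ w : F', (mdiff π z : F' →L[ℝ] F'') w = 0 →
        formAt κ.g.inner (z : M) (mdiff (Subtype.val : Z → M) z u)
          (mdiff (Subtype.val : Z → M) z w) = 0) →
        formAt κQ.g.inner (π z) (mdiff π z u) (mdiff π z v) =
          formAt κ.g.inner (z : M) (mdiff (Subtype.val : Z → M) z u)
            (mdiff (Subtype.val : Z → M) z v))
    (hω : ∀ (z : Z) (u v : F'), formAt κQ.form (π z) (mdiff π z u) (mdiff π z v) =
          formAt κ.form (z : M) (mdiff (Subtype.val : Z → M) z u)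
            (mdiff (Subtype.val : Z → M) z v)) : IsKahlerReduction (F' := F') κ Z κQ π where
  embedding := hι
  surjective := hsurj
  submersion := by
    refine (isSubmersion_of_surjective_mfderiv hπ hsub
      (c := Module.finrank ℝ F' - Module.finrank ℝ F'') fun z => ?_).isSubmersion
    have := LinearMap.finrank_le_finrank_of_surjective
      (f := ((mdiff π z : F' →L[ℝ] F'') : F' →ₗ[ℝ] F'')) (hsub z)
    omega
  metric := hg
  form := hω

end Reduction

/-! ### Moment maps, the zero level and its quotient -/

section ZeroLevel

variable {E : Type*} [NormedAddCommGroup E] [NormedSpace ℝ E]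
  {X : Type*} [TopologicalSpace X] [ChartedSpace E X] [IsManifold 𝓘(ℝ, E) ∞ X]
  {EK : Type*} [NormedAddCommGroup EK] [NormedSpace ℝ EK]
  {K : Type*} [TopologicalSpace K] [ChartedSpace EK K] [Group K] [MulAction K X]

section MomentMap

variable {κ : KahlerStructure E X} {μ : X → EK →L[ℝ] ℝ}

theorem IsMomentMap.mdiff_apply (h : IsMomentMap K κ μ) (x : X) (v : E) (ξ : EK) :
    (mdiff μ x : E →L[ℝ] EK →L[ℝ] ℝ) v ξ = formAt κ.form x (infAct K x ξ) v :=
  h.hamiltonian x ξ v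

theorem IsMomentMap.formAt_smul (h : IsMomentMap K κ μ) (k : K) (x : X) (u v : E) :
    formAt κ.form (k • x) (mdiff (fun y : X => k • y) x u) (mdiff (fun y : X => k • y) x v) =
      formAt κ.form x u v :=
  h.symplectic k x u v

variable [LieGroup 𝓘(ℝ, EK) ∞ K]

/-- `Ad(k)` is inverted by `Ad(k⁻¹)`. Equivariance evaluates `μ (k • x)` only on vectors `Ad(k) ξ`,
which are therefore all vectors. -/
theorem diffOne_conj_surjective [FiniteDimensional ℝ EK] (k : K) : Surjective (diffOne (EK := EK) fun h : K => k * h * k⁻¹) := by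
  intro ξ
  have hc : ∀ k : K, ContMDiff 𝓘(ℝ, EK) 𝓘(ℝ, EK) ∞ fun h : K => k * h * k⁻¹ := fun k =>
    contMDiff_mul_right.comp contMDiff_mul_left
  refine ⟨diffOne (fun h : K => k⁻¹ * h * k⁻¹⁻¹) ξ, ?_⟩
  have h1 := mdiff_comp_apply (f := fun h : K => k⁻¹ * h * k⁻¹⁻¹) (g := fun h : K => k * h * k⁻¹)
    (x := 1) (hc k _) (hc k⁻¹ _) ξ
  have h2 : ∀ l : K, l = 1 → (mdiff (fun h : K => k * h * k⁻¹) l : EK →L[ℝ] EK) =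
    mdiff (fun h : K => k * h * k⁻¹) 1 := by rintro _ rfl; rfl
  rw [h2 _ (by simp), show (fun y => k * (k⁻¹ * y * k⁻¹⁻¹) * k⁻¹) = fun y => y by
    funext y; group] at h1
  exact h1.symm.trans (congrArg (fun L : EK →L[ℝ] EK => L ξ) (mdiff_id (F := EK) (1 : K)))

theorem IsMomentMap.smul_eq_zero [FiniteDimensional ℝ EK] (h : IsMomentMap K κ μ) (k : K) {x : X} (hx : μ x = 0) :
    μ (k • x) = 0 := by
  ext ξ
  obtain ⟨η, rfl⟩ := diffOne_conj_surjective k ξ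
  rw [h.equivariant, hx]
  rfl

/-- Orbits in the zero level are isotropic: `μ` is constant along such an orbit, and its derivative
there in an orbit direction is this pairing. -/
theorem IsMomentMap.formAt_infAct_infAct [FiniteDimensional ℝ E] [FiniteDimensional ℝ EK]
    [ContMDiffSMul 𝓘(ℝ, EK) 𝓘(ℝ, E) ∞ K X]
    (h : IsMomentMap K κ μ) {x : X} (hx : μ x = 0) (ξ η : EK) :
    formAt κ.form x (infAct K x ξ) (infAct K x η) = 0 := by
  have h1 := mdiff_comp_apply (f := fun k : K => k • x) (g := μ) (x := 1) (h.contMDiff _)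
    (contMDiff_smul_left (E := E) (EK := EK) x 1) η
  have h2 : ∀ y, y = x → (mdiff μ y : E →L[ℝ] EK →L[ℝ] ℝ) = mdiff μ x := by rintro _ rfl; rfl
  rw [h2 _ (one_smul K x), mdiff_const_eq_zero (c := 0) fun k : K => h.smul_eq_zero k hx] at h1
  rw [← h.mdiff_apply]
  exact (congrArg (fun L : EK →L[ℝ] ℝ => L ξ) h1).symm

end MomentMap

variable [FiniteDimensional ℝ E] [FiniteDimensional ℝ EK] [LieGroup 𝓘(ℝ, EK) ∞ K]
  [ContMDiffSMul 𝓘(ℝ, EK) 𝓘(ℝ, E) ∞ K X]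
  {hk : HyperKahlerStructure E X} {μ : Fin 3 → X → EK →L[ℝ] ℝ}

theorem contMDiff_moment (hμ : ∀ i, IsMomentMap K (hk.kahler i) (μ i)) :
    ContMDiff 𝓘(ℝ, E) 𝓘(ℝ, Fin 3 → EK →L[ℝ] ℝ) ∞ fun (x : X) (i : Fin 3) => μ i x :=
  contMDiff_pi_space.2 fun i => (hμ i).contMDiff

theorem mdiff_moment_apply (hμ : ∀ i, IsMomentMap K (hk.kahler i) (μ i)) (x : X) (v : E)
    (i : Fin 3) (ξ : EK) :
    (mdiff (fun (x : X) (i : Fin 3) => μ i x) x : E →L[ℝ] Fin 3 → EK →L[ℝ] ℝ) v i ξ =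
      formAt (hk.kahler i).form x (infAct K x ξ) v := by
  let P : (Fin 3 → EK →L[ℝ] ℝ) →L[ℝ] EK →L[ℝ] ℝ := ContinuousLinearMap.proj i
  have h1 := mdiff_eq_of_hasMFDerivAt (f := fun y => P fun i => μ i y)
    ((P.hasMFDerivAt (x := fun i => μ i x)).comp x (hasMFDerivAt_mdiff (contMDiff_moment hμ x)))
  rw [← (hμ i).mdiff_apply]
  exact (congrArg (fun L : E →L[ℝ] EK →L[ℝ] ℝ => L v ξ) h1).symm

/-- If `ξ` generates the zero vector at `x`, every value of `dμ` at `x` vanishes on `ξ`;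
surjectivity of `dμ` then excludes `ξ ≠ 0`. -/
theorem infAct_injective (hμ : ∀ i, IsMomentMap K (hk.kahler i) (μ i))
    (hreg : IsRegularAtZero (E := E) (fun (x : X) (i : Fin 3) => μ i x)) {x : X}
    (hx : x ∈ zeroLevel μ) : Injective (infAct (E := E) (EK := EK) K x) := by
  rw [injective_iff_map_eq_zero]
  intro ξ hξ
  by_contra h
  obtain ⟨α, hα⟩ := SeparatingDual.exists_eq_one (R := ℝ) h
  obtain ⟨v, hv⟩ := hreg x (funext hx) fun _ => α
  have h1 := mdiff_moment_apply hμ x v 0 ξ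
  rw [hξ] at h1
  have h2 : α ξ = 0 := (congrArg (fun a : Fin 3 → EK →L[ℝ] ℝ => a 0 ξ) hv).symm.trans
    (h1.trans (congrArg (fun L : E →L[ℝ] ℝ => L v)
      (map_zero (formAt (hk.kahler 0).form x))))
  rw [hα] at h2
  exact one_ne_zero h2

theorem finrank_ker_moment (hreg : IsRegularAtZero (E := E) (fun (x : X) (i : Fin 3) => μ i x))
    {x : X} (hx : x ∈ zeroLevel μ) : Module.finrank ℝ E = 3 * Module.finrank ℝ EK +
      Module.finrank ℝ (LinearMap.ker ((mdiff (fun (x : X) (i : Fin 3) => μ i x) x :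
        E →L[ℝ] Fin 3 → EK →L[ℝ] ℝ) : E →ₗ[ℝ] Fin 3 → EK →L[ℝ] ℝ)) := by
  have hr := LinearMap.range_eq_top.2 (show Surjective
    ((mdiff (fun (x : X) (i : Fin 3) => μ i x) x :
        E →L[ℝ] Fin 3 → EK →L[ℝ] ℝ) : E →ₗ[ℝ] Fin 3 → EK →L[ℝ] ℝ) from hreg x (funext hx))
  have h1 := LinearMap.finrank_range_add_finrank_ker ((mdiff (fun (x : X) (i : Fin 3) => μ i x) x :
        E →L[ℝ] Fin 3 → EK →L[ℝ] ℝ) : E →ₗ[ℝ] Fin 3 → EK →L[ℝ] ℝ)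
  have h2 : Module.finrank ℝ (EK →L[ℝ] ℝ) = Module.finrank ℝ EK :=
    (LinearMap.toContinuousLinearMap (𝕜 := ℝ) (E := EK) (F' := ℝ)).finrank_eq.symm.trans
      Subspace.dual_finrank_eq
  rw [hr, finrank_top, Module.finrank_pi_fintype] at h1
  simp only [h2, Finset.sum_const, Finset.card_univ, Fintype.card_fin, smul_eq_mul] at h1
  exact h1.symm

/-- The subtraction does not truncate: the Lie algebra injects into `ker dμ`, whose dimension is
that of `E` less three times that of the Lie algebra. -/
theorem finrank_eq_of_zeroLevel (hμ : ∀ i, IsMomentMap K (hk.kahler i) (μ i))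
    (hreg : IsRegularAtZero (E := E) (fun (x : X) (i : Fin 3) => μ i x))
    (hne : (zeroLevel μ).Nonempty) :
    Module.finrank ℝ E = 4 * Module.finrank ℝ EK +
      (Module.finrank ℝ E - 4 * Module.finrank ℝ EK) := by
  obtain ⟨x, hx⟩ := hne
  have h1 := finrank_ker_moment hreg hx
  have h2 := LinearMap.finrank_le_finrank_of_injective
    (f := LinearMap.codRestrict (LinearMap.ker ((mdiff (fun (x : X) (i : Fin 3) => μ i x) x :
        E →L[ℝ] Fin 3 → EK →L[ℝ] ℝ) : E →ₗ[ℝ] Fin 3 → EK →L[ℝ] ℝ))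
      ((infAct (E := E) (EK := EK) K x : EK →L[ℝ] E) : EK →ₗ[ℝ] E) fun η => by
        change (mdiff (fun (x : X) (i : Fin 3) => μ i x) x : E →L[ℝ] Fin 3 → EK →L[ℝ] ℝ)
          (infAct K x η) = 0
        ext i ξ
        rw [mdiff_moment_apply hμ]
        exact (hμ i).formAt_infAct_infAct (hx i) ξ η)
    (fun a b hab => infAct_injective hμ hreg hx (congrArg Subtype.val hab))
  omega

namespace HyperKahlerStructure

variable (hk)

/-- On vectors orthogonal to `w` for `g` and for all the `ω_j`, this remains so after applying
`J_i`. -/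
theorem formAt_form_endAt_eq_zero {x : X} {u w : E} (hg : formAt hk.g.inner x u w = 0)
    (hω : ∀ j, formAt (hk.kahler j).form x w u = 0) (i : Fin 3) :
    formAt hk.g.inner x (endAt (hk.J i) x u) w = 0 ∧
      ∀ j, formAt (hk.kahler j).form x w (endAt (hk.J i) x u) = 0 := by
  have hω' : ∀ j, formAt hk.g.inner x (endAt (hk.J j) x u) w = 0 := by
    intro j
    have := (hk.kahler j).formAt_form_antisymm x u w
    rw [hω j, neg_zero] at this
    exact this
  -- By the quaternion relations `J_j J_i` is `-1`, `-J_{i+2}` or `J_{i+1}` according to `j = i`, `i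
  -- + 1`, `i + 2`, and each case is covered by the hypotheses.
  have key : ∀ j, formAt hk.g.inner x (endAt (hk.J j) x (endAt (hk.J i) x u)) w = 0 := by
    intro j
    have hj : j = i ∨ j = i + 1 ∨ j = i + 2 := by
      fin_cases i <;> fin_cases j <;> simp
    rcases hj with rfl | rfl | rfl
    · rw [hk.endAt_endAt, map_neg, neg_apply, hg, neg_zero]
    · have h1 := hk.endAt_add_two (i + 1) x (endAt (hk.J i) x u)
      rw [show i + 1 + 2 = i by fin_cases i <;> rfl] at h1
      have h2 : endAt (hk.J (i + 1)) x (endAt (hk.J i) x u) = - endAt (hk.J (i + 2)) x u := by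
        have h3 := hk.endAt_add_two (i + 2) x (endAt (hk.J i) x u)
        have h4 := hk.endAt_add_two i x u
        have h5 := congrArg (endAt (hk.J (i + 1)) x) h4
        have h6 := hk.endAt_add_two (i + 2) x u
        rw [show i + 2 + 2 = i + 1 by fin_cases i <;> rfl,
          show i + 2 + 1 = i by fin_cases i <;> rfl] at h6
        have h7 := congrArg (endAt (hk.J (i + 1)) x) h6
        rw [hk.endAt_endAt] at h7
        exact h7.symm
      rw [h2, map_neg, neg_apply, hω', neg_zero]
    · rw [hk.endAt_add_two]
      exact hω' _
  refine ⟨hω' i, fun j => ?_⟩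
  rw [(hk.kahler j).formAt_form_antisymm, hk.formAt_form, key, neg_zero]

end HyperKahlerStructure

/-- The hypotheses of `exists_descent` hold since horizontal vectors are those orthogonal to the
orbit directions for `g` and all three forms, a quaternionic condition, and since the forms are
`K`-invariant with orbit directions in the kernel of their restriction. The explicit tangent and
vertical spaces are recorded for the comparison with the real quotient. -/
theorem exists_hyperKahlerQuotient [T2Space X] [SecondCountableTopology X] [CompactSpace K]
    (hμ : ∀ i, IsMomentMap K (hk.kahler i) (μ i))
    (hreg : IsRegularAtZero (E := E) (fun (x : X) (i : Fin 3) => μ i x))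
    (hfree : ∀ x ∈ zeroLevel μ, ∀ k : K, k • x = x → k = 1) :
    T2Space (OrbitSpace K (zeroLevel μ)) ∧
    SecondCountableTopology (OrbitSpace K (zeroLevel μ)) ∧
    ∃ (m : ℕ) (_ : ChartedSpace (EuclideanSpace ℝ (Fin m)) (zeroLevel μ))
      (_ : IsManifold (𝓡 m) ∞ (zeroLevel μ))
      (n : ℕ) (_ : ChartedSpace (EuclideanSpace ℝ (Fin n)) (OrbitSpace K (zeroLevel μ)))
      (_ : IsManifold (𝓡 n) ∞ (OrbitSpace K (zeroLevel μ)))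
      (hkQ : HyperKahlerStructure (EuclideanSpace ℝ (Fin n)) (OrbitSpace K (zeroLevel μ))),
      ((zeroLevel μ).Nonempty → Module.finrank ℝ E = 4 * Module.finrank ℝ EK + n) ∧
      Manifold.IsSmoothEmbedding (𝓡 m) 𝓘(ℝ, E) ∞ (Subtype.val : zeroLevel μ → X) ∧
      (∀ (z : zeroLevel μ) (v : E), (∃ u : EuclideanSpace ℝ (Fin m),
        (mdiff (Subtype.val : zeroLevel μ → X) z : EuclideanSpace ℝ (Fin m) →L[ℝ] E) u = v) ↔
          ∀ (i : Fin 3) (ξ : EK), formAt (hk.kahler i).form (z : X) (infAct K (z : X) ξ) v = 0) ∧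
      ContMDiff (𝓡 m) (𝓡 n) ∞ (Quotient.mk'' : zeroLevel μ → OrbitSpace K (zeroLevel μ)) ∧
      (∀ z, Surjective (mdiff (Quotient.mk'' : zeroLevel μ → OrbitSpace K (zeroLevel μ)) z :
        EuclideanSpace ℝ (Fin m) →L[ℝ] EuclideanSpace ℝ (Fin n))) ∧
      (∀ (z : zeroLevel μ) (w : EuclideanSpace ℝ (Fin m)),
        (mdiff (Quotient.mk'' : zeroLevel μ → OrbitSpace K (zeroLevel μ)) z :
          EuclideanSpace ℝ (Fin m) →L[ℝ] EuclideanSpace ℝ (Fin n)) w = 0 ↔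
        ∃ ξ : EK, (mdiff (Subtype.val : zeroLevel μ → X) z : EuclideanSpace ℝ (Fin m) →L[ℝ] E) w =
          infAct K (z : X) ξ) ∧
      ∀ i, IsKahlerReduction (F' := EuclideanSpace ℝ (Fin m)) (hk.kahler i) (zeroLevel μ)
        (hkQ.kahler i) Quotient.mk'' := by
  obtain ⟨n, hn⟩ : ∃ n, n = Module.finrank ℝ E - 4 * Module.finrank ℝ EK := ⟨_, rfl⟩
  have hdim := finrank_eq_of_zeroLevel hμ hreg
  rw [← hn] at hdim
  have hdim' : (zeroLevel μ).Nonempty → Module.finrank ℝ E =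
      Module.finrank ℝ (Fin 3 → EK →L[ℝ] ℝ) + (Module.finrank ℝ EK + n) := by
    intro h
    have h2 : Module.finrank ℝ (EK →L[ℝ] ℝ) = Module.finrank ℝ EK :=
      (LinearMap.toContinuousLinearMap (𝕜 := ℝ) (E := EK) (F' := ℝ)).finrank_eq.symm.trans
        Subspace.dual_finrank_eq
    have := hdim h
    rw [Module.finrank_pi_fintype]
    simp only [h2, Finset.sum_const, Finset.card_univ, Fintype.card_fin, smul_eq_mul]
    omega
  have hS : {x : X | (fun i => μ i x) = 0} = zeroLevel μ := ext fun x => funext_iff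
  have hsub := exists_submanifold_of_regular (contMDiff_moment hμ) (d := Module.finrank ℝ EK + n)
    (by rw [hS]; exact hdim') hreg
  rw [hS] at hsub
  obtain ⟨hZ1, hZ2, hι⟩ := hsub
  have hinv : ∀ (k : K), ∀ x ∈ zeroLevel μ, k • x ∈ zeroLevel μ :=
    fun k x hx i => (hμ i).smul_eq_zero k (hx i)
  have htan : ∀ (z : zeroLevel μ) (v : E), (∃ u : EuclideanSpace ℝ (Fin (Module.finrank ℝ EK + n)),
        (mdiff (Subtype.val : zeroLevel μ → X) z :
          EuclideanSpace ℝ (Fin (Module.finrank ℝ EK + n)) →L[ℝ] E) u = v) ↔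
          ∀ (i : Fin 3) (ξ : EK), formAt (hk.kahler i).form (z : X) (infAct K (z : X) ξ) v = 0 := by
    intro z v
    rw [mem_range_mdiff_val_iff hι (contMDiff_moment hμ) (fun x hx => funext hx) z
      (hreg z (funext z.2)) (by rw [finrank_euclideanSpace, Fintype.card_fin]; exact hdim' ⟨z, z.2⟩)]
    simp only [← mdiff_moment_apply hμ]
    constructor
    · intro h i ξ
      rw [h]
      rfl
    · intro h
      ext i ξ
      exact h i ξ
  obtain ⟨hT2, hSC, hQ1, hQ2, hπ, hπs, hker, hfib⟩ := exists_orbitSpace_manifold hinv hι hfree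
    (fun x hx => infAct_injective hμ hreg hx) (n := n) (fun _ => by simp)
  obtain ⟨hkQ, hform, hmetric⟩ := hk.exists_descent hι.contMDiff
    (fun z => mdiff_injective_of_isImmersionAt (hι.isImmersion.isImmersionAt z)) hπ
    Quotient.mk''_surjective hπs (by
      intro i z u hu
      have hu' : ∀ ξ : EK, formAt hk.g.inner (z : X) ((mdiff (Subtype.val : zeroLevel μ → X) z :
          EuclideanSpace ℝ (Fin (Module.finrank ℝ EK + n)) →L[ℝ] E) u) (infAct K (z : X) ξ) = 0 := by
        intro ξ
        obtain ⟨w, hw⟩ := (htan z (infAct K (z : X) ξ)).2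
          fun i η => (hμ i).formAt_infAct_infAct (z.2 i) η ξ
        rw [← hw]
        exact hu w ((hker z w).2 ⟨ξ, hw⟩)
      -- `J_i u` stays orthogonal to the orbit for the forms, hence tangent to the level, and for
      -- `g`, hence horizontal.
      have h1 := fun ξ => hk.formAt_form_endAt_eq_zero (hu' ξ)
        (fun j => (htan z _).1 ⟨u, rfl⟩ j ξ) i
      obtain ⟨u', hu''⟩ := (htan z _).2 fun j ξ => (h1 ξ).2 j
      refine ⟨u', hu'', fun w hw => ?_⟩
      obtain ⟨ξ, hξ⟩ := (hker z w).1 hw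
      rw [hξ, hu'']
      exact (h1 ξ).1) (by
      intro i z z' a b a' b' hz ha hb
      -- The forms are basic: transport by `k` preserves `ω_i`, and the vertical corrections `ξ`,
      -- `η` pair to zero with everything tangent to the level.
      obtain ⟨k, hkz, hk'⟩ := hfib z z' hz
      obtain ⟨ξ, hξ⟩ := hk' a a' ha
      obtain ⟨η, hη⟩ := hk' b b' hb
      have e1 := (htan z' _).1 ⟨a', rfl⟩ i η
      have e2 := (htan z' _).1 ⟨b', rfl⟩ i ξ
      have e3 := (hμ i).formAt_infAct_infAct (z'.2 i) ξ η
      have e4 : ∀ x' : X, k • (z : X) = x' → ∀ u v : E, formAt (hk.kahler i).form x'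
          ((mdiff (fun y : X => k • y) (z : X) : E →L[ℝ] E) u)
          ((mdiff (fun y : X => k • y) (z : X) : E →L[ℝ] E) v) =
          formAt (hk.kahler i).form (z : X) u v := by
        rintro _ rfl u v
        exact (hμ i).formAt_smul k z u v
      have e5 := e4 _ hkz ((mdiff (Subtype.val : zeroLevel μ → X) z :
        EuclideanSpace ℝ (Fin (Module.finrank ℝ EK + n)) →L[ℝ] E) a)
        ((mdiff (Subtype.val : zeroLevel μ → X) z :
        EuclideanSpace ℝ (Fin (Module.finrank ℝ EK + n)) →L[ℝ] E) b)
      rw [hξ, (hk.kahler i).formAt_form_antisymm, neg_eq_zero] at e1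
      rw [hη, map_add, e3, add_zero] at e2
      rw [hξ, hη, ← e5]
      simp only [map_add, add_apply] at e1 ⊢
      rw [e3, add_zero] at e1
      rw [e1, e2, e3]
      simp)
  exact ⟨hT2, hSC, _, hZ1, hZ2, n, hQ1, hQ2, hkQ, hdim, hι, htan, hπ, hπs, hker, fun i =>
    isKahlerReduction_of hι hπ Quotient.mk''_surjective hπs hmetric (hform i)⟩

end ZeroLevel

/-! ### Fixed loci of involutions of hyper-Kähler manifolds -/

section FixedLocus

variable {F : Type*} [NormedAddCommGroup F] [NormedSpace ℝ F] [FiniteDimensional ℝ F]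
  {M : Type*} [TopologicalSpace M] [ChartedSpace F M] [IsManifold 𝓘(ℝ, F) ∞ M]

theorem PreservesKahler.formAt_form {F' : Type*} [NormedAddCommGroup F'] [NormedSpace ℝ F']
    {N : Type*} [TopologicalSpace N] [ChartedSpace F' N] [IsManifold 𝓘(ℝ, F') ∞ N]
    {κN : KahlerStructure F' N} {κ : KahlerStructure F M} {f : N → M}
    (h : PreservesKahler κN κ f) (p : N) (u v : F') :
    formAt κ.form (f p) (mdiff f p u) (mdiff f p v) = formAt κN.form p u v :=
  (congrArg (fun w : F => formAt κ.g.inner (f p) w (mdiff f p v)) (h p u v).2.symm).trans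
    (h p (κN.J p u) v).1

variable (hk : HyperKahlerStructure F M) {σ : M → M}

/-- A smooth involution of a hyper-Kähler manifold that multiplies the three Kähler forms by
`-1`, `1`, `-1`. -/
structure IsRealInvolution (σ : M → M) : Prop where
  contMDiff : ContMDiff 𝓘(ℝ, F) 𝓘(ℝ, F) ∞ σ
  involutive : Involutive σ
  form : ∀ (i : Fin 3) (x : M) (u v : F),
    formAt (hk.kahler i).form (σ x) (mdiff σ x u) (mdiff σ x v) =
      (-1 : ℝ) ^ (i.val + 1) * formAt (hk.kahler i).form x u v

namespace IsRealInvolution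

variable {hk} (h : IsRealInvolution hk σ)
include h

theorem mdiff_mdiff (x : M) (u : F) :
    (mdiff σ (σ x) : F →L[ℝ] F) ((mdiff σ x : F →L[ℝ] F) u) = u :=
  mdiff_involutive h.contMDiff h.involutive x u

theorem mdiff_surjective (x : M) : Surjective (mdiff σ x : F →L[ℝ] F) := by
  intro u
  refine ⟨(mdiff σ (σ x) : F →L[ℝ] F) u, ?_⟩
  have h1 : ∀ y, y = x → (mdiff σ y : F →L[ℝ] F) = mdiff σ x := by rintro _ rfl; rfl
  have h2 := h.mdiff_mdiff (σ x) u
  rwa [h1 _ (h.involutive x)] at h2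

/-- `J_i` is determined by `ω_{i+1}` and `ω_{i+2}`, so its sign is the product of theirs; this is
`(-1)^i` because the signs `-1, 1, -1` have product `1`. The behaviour of the forms alone is thus
enough. -/
theorem mdiff_endAt (i : Fin 3) (x : M) (u : F) :
    (mdiff σ x : F →L[ℝ] F) (endAt (hk.J i) x u) =
      (-1 : ℝ) ^ (i.val + 1) • endAt (hk.J i) (σ x) (mdiff σ x u) := by
  rw [← sub_eq_zero]
  refine (hk.kahler (i + 2)).formAt_form_nondegenerate (σ x) _ fun w => ?_
  obtain ⟨v, rfl⟩ := h.mdiff_surjective x w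
  have hs : (-1 : ℝ) ^ ((i + 2).val + 1) = (-1 : ℝ) ^ (i.val + 1) * (-1 : ℝ) ^ ((i + 1).val + 1) := by
    fin_cases i <;> norm_num [Fin.val_add]
  rw [map_sub, map_smul, sub_apply, smul_apply,
    hk.formAt_form_endAt, h.form, hk.formAt_form_endAt, h.form, hs, smul_eq_mul]
  ring

/-- `g = -ω₂(J₂ ·, ·)`, and the involution preserves both `ω₂` and `J₂`. -/
theorem formAt_inner (x : M) (u v : F) :
    formAt hk.g.inner (σ x) (mdiff σ x u) (mdiff σ x v) = formAt hk.g.inner x u v := by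
  have h1 := h.mdiff_endAt 1 x u
  have h2 := h.form 1 x (endAt (hk.J 1) x u) v
  rw [h1] at h2
  rw [hk.formAt_eq_form 1 x u v, hk.formAt_eq_form 1 (σ x)]
  simp only [Fin.val_one, Nat.reduceAdd, even_two, Even.neg_pow, one_pow, one_smul, one_mul] at h2
  rw [h2]

theorem mdiff_mdiff_of_fixed {x : M} (hx : σ x = x) (u : F) :
    (mdiff σ x : F →L[ℝ] F) ((mdiff σ x : F →L[ℝ] F) u) = u := by
  have h1 : ∀ y, y = x → (mdiff σ y : F →L[ℝ] F) = mdiff σ x := by rintro _ rfl; rfl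
  have h2 := h.mdiff_mdiff x u
  rwa [h1 _ hx] at h2

theorem mdiff_endAt_of_fixed {x : M} (hx : σ x = x) (i : Fin 3) (u : F) :
    (mdiff σ x : F →L[ℝ] F) (endAt (hk.J i) x u) =
      (-1 : ℝ) ^ (i.val + 1) • endAt (hk.J i) x (mdiff σ x u) := by
  have h1 : ∀ y, y = x → endAt (hk.J i) y = endAt (hk.J i) x := by rintro _ rfl; rfl
  rw [h.mdiff_endAt, h1 _ hx]

theorem formAt_of_fixed {x : M} (hx : σ x = x) (i : Fin 3) (u v : F) :
    formAt (hk.kahler i).form x (mdiff σ x u) (mdiff σ x v) =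
      (-1 : ℝ) ^ (i.val + 1) * formAt (hk.kahler i).form x u v := by
  have h1 : ∀ y, y = x → formAt (hk.kahler i).form y = formAt (hk.kahler i).form x := by
    rintro _ rfl; rfl
  rw [← h.form, h1 _ hx]

theorem formAt_inner_of_fixed {x : M} (hx : σ x = x) (u v : F) :
    formAt hk.g.inner x (mdiff σ x u) (mdiff σ x v) = formAt hk.g.inner x u v := by
  have h1 : ∀ y, y = x → formAt hk.g.inner y = formAt hk.g.inner x := by
    rintro _ rfl; rfl
  rw [← h.formAt_inner x u v, h1 _ hx]

theorem finrank_eq_two_mul {x : M} (hx : σ x = x) : Module.finrank ℝ F = 2 * Module.finrank ℝ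
    (LinearMap.ker ((mdiff σ x : F →L[ℝ] F) + 1 : F →ₗ[ℝ] F)) :=
  finrank_eq_two_mul_of_anticommute (J := endAt (hk.J 0) x) (h.mdiff_mdiff_of_fixed hx)
    (hk.endAt_endAt 0 x) fun u => by
      rw [h.mdiff_endAt_of_fixed hx 0 u]
      simp

variable {V : Type*} [NormedAddCommGroup V] [NormedSpace ℝ V] [FiniteDimensional ℝ V]
  {Φ : M → V} {T : V →L[ℝ] V} {S : Set M}

/-- The codimension at a fixed point is the dimension of the fixed space of `T` plus that of the
`(-1)`-eigenspace of `dσ`. The latter is half the dimension of `M`, so the locus has one dimension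
throughout. -/
theorem exists_manifold_fixed (hΦ : ContMDiff 𝓘(ℝ, F) 𝓘(ℝ, V) ∞ Φ) (hT : ∀ v, T (T v) = v)
    (hΦσ : ∀ x, Φ (σ x) = T (Φ x)) (hS : ∀ x, x ∈ S ↔ Φ x = 0 ∧ σ x = x)
    (hs : ∀ x ∈ S, Surjective (mdiff Φ x : F →L[ℝ] V)) :
    ∃ (d : ℕ) (_ : ChartedSpace (EuclideanSpace ℝ (Fin d)) S) (_ : IsManifold (𝓡 d) ∞ S),
      Manifold.IsSmoothEmbedding (𝓡 d) 𝓘(ℝ, F) ∞ (Subtype.val : S → M) ∧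
      ∀ (p : S) (v : F), (∃ u : EuclideanSpace ℝ (Fin d), (mdiff (Subtype.val : S → M) p :
        EuclideanSpace ℝ (Fin d) →L[ℝ] F) u = v) ↔
          (mdiff Φ (p : M) : F →L[ℝ] V) v = 0 ∧ (mdiff σ (p : M) : F →L[ℝ] F) v = v := by
  -- Truncated arithmetic is harmless: both numbers are correct as soon as `S` has a point, and
  -- otherwise nothing is asked of them.
  obtain ⟨b, hb⟩ : ∃ b, b = Module.finrank ℝ F / 2 := ⟨_, rfl⟩
  obtain ⟨d, hd⟩ : ∃ d, d = Module.finrank ℝ F -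
    Module.finrank ℝ (LinearMap.ker (T - 1 : V →ₗ[ℝ] V)) - b := ⟨_, rfl⟩
  have hbS : ∀ x ∈ S, Module.finrank ℝ
      (LinearMap.ker ((mdiff σ x : F →L[ℝ] F) + 1 : F →ₗ[ℝ] F)) = b := by
    intro x hx
    have := h.finrank_eq_two_mul ((hS x).1 hx).2
    omega
  have hdS : ∀ x ∈ S, Module.finrank ℝ F =
      Module.finrank ℝ (LinearMap.ker (T - 1 : V →ₗ[ℝ] V)) + b + d := by
    intro x hx
    have h1 : ∀ y, y = x → (mdiff Φ y : F →L[ℝ] V) = mdiff Φ x := by rintro _ rfl; rfl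
    have h2 := finrank_eq_of_equivariant_surjective (hs x hx)
      (h.mdiff_mdiff_of_fixed ((hS x).1 hx).2) hT fun u => by
        have e1 := mdiff_comp_apply (f := σ) (g := Φ) (hΦ _) (h.contMDiff x) u
        rw [h1 _ ((hS x).1 hx).2, show (fun y => Φ (σ y)) = fun y => T (Φ y) from funext hΦσ] at e1
        have e2 := mdiff_eq_of_hasMFDerivAt (f := fun y => T (Φ y))
          ((T.hasMFDerivAt (x := Φ x)).comp x (hasMFDerivAt_mdiff (hΦ x)))
        rw [e2] at e1
        exact e1.symm
    rw [hbS x hx] at h2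
    omega
  obtain ⟨h1, h2, h3⟩ := exists_submanifold_fixed h.contMDiff h.involutive hΦ hT hΦσ S hS hs
    (b := b) (d := d) (by rintro x hx _ rfl; exact hbS x hx) fun ⟨x, hx⟩ => hdS x hx
  refine ⟨d, h1, h2, h3, fun p v => mem_range_mdiff_val_fixed_iff h.contMDiff h.involutive hΦ hT hΦσ
    (fun x hx => (hS x).1 hx) h3 p (hs p p.2) ?_ v⟩
  rw [hbS p p.2, finrank_euclideanSpace, Fintype.card_fin]
  exact hdS p p.2

/-- At fixed points `dσ` commutes with `J₂`. The tangent space, which is the fixed part of `ker dΦ`,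
is therefore `J₂`-stable when the kernel is, and the Kähler structure restricts. -/
theorem exists_kahlerSubmanifold_fixed (hΦ : ContMDiff 𝓘(ℝ, F) 𝓘(ℝ, V) ∞ Φ)
    (hT : ∀ v, T (T v) = v) (hΦσ : ∀ x, Φ (σ x) = T (Φ x)) (hS : ∀ x, x ∈ S ↔ Φ x = 0 ∧ σ x = x)
    (hs : ∀ x ∈ S, Surjective (mdiff Φ x : F →L[ℝ] V))
    (hJ : ∀ x ∈ S, ∀ v, (mdiff Φ x : F →L[ℝ] V) v = 0 →
      (mdiff Φ x : F →L[ℝ] V) (endAt (hk.J 1) x v) = 0) :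
    ∃ (d : ℕ) (_ : ChartedSpace (EuclideanSpace ℝ (Fin d)) S) (_ : IsManifold (𝓡 d) ∞ S)
      (κS : KahlerStructure (EuclideanSpace ℝ (Fin d)) S),
      IsKahlerSubmanifold (hk.kahler 1) S κS ∧
      ∀ (p : S) (v : F), (∃ u : EuclideanSpace ℝ (Fin d), (mdiff (Subtype.val : S → M) p :
        EuclideanSpace ℝ (Fin d) →L[ℝ] F) u = v) ↔
          (mdiff Φ (p : M) : F →L[ℝ] V) v = 0 ∧ (mdiff σ (p : M) : F →L[ℝ] F) v = v := by
  obtain ⟨d, h1, h2, h3, h4⟩ := h.exists_manifold_fixed hΦ hT hΦσ hS hs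
  obtain ⟨κS, hκ⟩ := (hk.kahler 1).exists_restrict h3.contMDiff
    (fun p => mdiff_injective_of_isImmersionAt (h3.isImmersion.isImmersionAt p)) fun p u => by
      obtain ⟨e1, e2⟩ := (h4 p _).1 ⟨u, rfl⟩
      refine (h4 p _).2 ⟨hJ p p.2 _ e1, ?_⟩
      have e3 := h.mdiff_endAt_of_fixed ((hS p).1 p.2).2 1
        ((mdiff (Subtype.val : S → M) p : EuclideanSpace ℝ (Fin d) →L[ℝ] F) u)
      rw [e2] at e3
      exact e3.trans (by simp; rfl)
  exact ⟨d, h1, h2, κS, ⟨h3, hκ⟩, h4⟩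

/-- Tangent spaces are the `+1`-eigenspaces of `dσ`. `J₁` and `J₃` anticommute with `dσ` and so
exchange its eigenspaces, which gives the real splitting. `ω₁` and `ω₃` change sign under `dσ`, so
by nondegeneracy the eigenspace is its own orthogonal. -/
theorem exists_fixedPoints : ∃ (d : ℕ)
      (_ : ChartedSpace (EuclideanSpace ℝ (Fin d)) (fixedPoints σ))
      (_ : IsManifold (𝓡 d) ∞ (fixedPoints σ))
      (κS : KahlerStructure (EuclideanSpace ℝ (Fin d)) (fixedPoints σ)),
      IsKahlerSubmanifold (hk.kahler 1) (fixedPoints σ) κS ∧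
      IsTotallyGeodesic (F' := EuclideanSpace ℝ (Fin d)) hk.g (fixedPoints σ) ∧
      (∀ i : Fin 3, i ≠ 1 →
        IsTotallyReal (F' := EuclideanSpace ℝ (Fin d)) (hk.kahler i) (fixedPoints σ) ∧
        IsLagrangian (F' := EuclideanSpace ℝ (Fin d)) (hk.kahler i) (fixedPoints σ)) ∧
      ∀ (p : fixedPoints σ) (v : F), (∃ u : EuclideanSpace ℝ (Fin d),
        (mdiff (Subtype.val : fixedPoints σ → M) p : EuclideanSpace ℝ (Fin d) →L[ℝ] F) u = v) ↔
          (mdiff σ (p : M) : F →L[ℝ] F) v = v := by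
  -- The constraint is void here: it takes values in a point.
  obtain ⟨d, h1, h2, κS, h3, h4⟩ := h.exists_kahlerSubmanifold_fixed (S := fixedPoints σ)
    (Φ := fun _ => (0 : PUnit.{1})) (T := 0) contMDiff_const (fun _ => rfl) (fun _ => rfl)
    (fun x => ⟨fun hx => ⟨rfl, hx⟩, fun hx => hx.2⟩) (fun x _ v => ⟨0, rfl⟩) (fun _ _ _ _ => rfl)
  have h5 : ∀ (p : fixedPoints σ) (v : F), (∃ u : EuclideanSpace ℝ (Fin d),
        (mdiff (Subtype.val : fixedPoints σ → M) p : EuclideanSpace ℝ (Fin d) →L[ℝ] F) u = v) ↔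
          (mdiff σ (p : M) : F →L[ℝ] F) v = v := fun p v =>
    (h4 p v).trans ⟨fun hv => hv.2, fun hv => ⟨rfl, hv⟩⟩
  have hmem : ∀ (p : fixedPoints σ) (v : F),
      v ∈ (subTangent (F := F) (F' := EuclideanSpace ℝ (Fin d)) (fixedPoints σ) p : Submodule ℝ F) ↔
        (mdiff σ (p : M) : F →L[ℝ] F) v = v := fun p v => h5 p v
  refine ⟨d, h1, h2, κS, h3, isTotallyGeodesic_fixedPoints h.contMDiff
    (fun x u v => (h.formAt_inner x u v).symm) (S := fixedPoints σ)
    (fun x => Iff.rfl) h3.embedding.contMDiff,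
    fun i hi => ⟨fun p => ?_, fun p v => ?_⟩, h5⟩
  · have hp : σ p = p := p.2
    have hLJ : ∀ u : F, (mdiff σ (p : M) : F →L[ℝ] F) (endAt (hk.J i) p u) =
        -endAt (hk.J i) p ((mdiff σ (p : M) : F →L[ℝ] F) u) := by
      intro u
      rw [h.mdiff_endAt_of_fixed hp i u]
      fin_cases i
      · simp
      · exact absurd rfl hi
      · exact (congrArg (fun s : ℝ => s • _) (by norm_num : (-1 : ℝ) ^ (2 + 1) = -1)).trans
          (neg_one_smul ℝ _)
    obtain ⟨P, hP⟩ : ∃ P : Submodule ℝ F, P = subTangent (F := F) (F' := EuclideanSpace ℝ (Fin d))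
      (fixedPoints σ) p := ⟨_, rfl⟩
    obtain ⟨L, hL⟩ : ∃ L : F →L[ℝ] F, L = mdiff σ (p : M) := ⟨_, rfl⟩
    obtain ⟨J, hJ⟩ : ∃ J : F →L[ℝ] F, J = endAt (hk.J i) p := ⟨_, rfl⟩
    have hPL : ∀ v, v ∈ P ↔ L v = v := by rw [hP, hL]; exact hmem p
    have hLL : ∀ v, L (L v) = v := by rw [hL]; exact h.mdiff_mdiff_of_fixed hp
    have hJJ : ∀ v, J (J v) = -v := by rw [hJ]; exact hk.endAt_endAt i p
    rw [← hL, ← hJ] at hLJ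
    suffices hc : IsCompl P (P.map (J : F →ₗ[ℝ] F)) by
      rw [hP, hJ] at hc
      exact hc
    rw [isCompl_iff, Submodule.disjoint_def, codisjoint_iff, Submodule.eq_top_iff']
    constructor
    · rintro v hv ⟨w, hw, rfl⟩
      have e1 : L (J w) = J w := (hPL _).1 hv
      rw [hLJ, (hPL w).1 hw, neg_eq_iff_add_eq_zero, ← two_smul ℝ, smul_eq_zero] at e1
      exact e1.resolve_left two_ne_zero
    · intro v
      rw [Submodule.mem_sup]
      refine ⟨(1 / 2 : ℝ) • (v + L v), (hPL _).2 ?_, (1 / 2 : ℝ) • (v - L v),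
        ⟨-J ((1 / 2 : ℝ) • (v - L v)), (hPL _).2 ?_, ?_⟩, by module⟩
      · rw [map_smul, map_add, hLL, add_comm]
      · rw [map_neg, hLJ, map_smul, map_sub, hLL]
        simp only [map_smul, map_sub]
        module
      · change J (-J _) = _
        rw [map_neg, hJJ, neg_neg]
  · have hp : σ p = p := p.2
    have hLω : ∀ u w : F, formAt (hk.kahler i).form p ((mdiff σ (p : M) : F →L[ℝ] F) u)
        ((mdiff σ (p : M) : F →L[ℝ] F) w) = -formAt (hk.kahler i).form p u w := by
      intro u w
      rw [h.formAt_of_fixed hp i u w]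
      fin_cases i
      · simp
      · exact absurd rfl hi
      · exact (congrArg (fun s : ℝ => s * _) (by norm_num : (-1 : ℝ) ^ (2 + 1) = -1)).trans
          (neg_one_mul _)
    have hnd := (hk.kahler i).formAt_form_nondegenerate (p : M)
    obtain ⟨L, hL⟩ : ∃ L : F →L[ℝ] F, L = mdiff σ (p : M) := ⟨_, rfl⟩
    obtain ⟨B, hB⟩ : ∃ B : F →L[ℝ] F →L[ℝ] ℝ, B = formAt (hk.kahler i).form p := ⟨_, rfl⟩
    have hLL : ∀ v, L (L v) = v := by rw [hL]; exact h.mdiff_mdiff_of_fixed hp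
    rw [← hB] at hnd
    rw [← hL, ← hB] at hLω
    have key : ∀ v : F, L v = v ↔ ∀ w : F, L w = w → B v w = 0 := by
      intro v
      constructor
      · intro hv w hw
        have := hLω v w
        rw [hv, hw] at this
        linarith
      · intro hv
        rw [eq_comm, ← sub_eq_zero]
        refine hnd _ fun w => ?_
        -- The fixed vector `w + L w` gives `B v w = -B v (L w)`, and the latter is `B (L v) w`
        -- since `B` changes sign under `L`. So `v - L v` pairs to zero with every `w`.
        have e1 := hv (w + L w) (by rw [map_add, hLL, add_comm])
        have e2 := hLω v (L w)
        have e3 := hLω v w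
        rw [hLL] at e2
        rw [map_add] at e1
        rw [map_sub, sub_apply]
        linarith
    refine (hmem p v).trans ?_
    rw [← hL]
    refine (key v).trans (forall_congr' fun w => ?_)
    have e1 := hmem p w
    rw [← hL] at e1
    rw [hB]
    exact imp_congr e1.symm Iff.rfl

end IsRealInvolution

end FixedLocus

/-! ### Compatible involutions -/

section Compatible

variable {E : Type*} [NormedAddCommGroup E] [NormedSpace ℝ E] [FiniteDimensional ℝ E]
  {X : Type*} [TopologicalSpace X] [ChartedSpace E X] [IsManifold 𝓘(ℝ, E) ∞ X]
  {EK : Type*} [NormedAddCommGroup EK] [NormedSpace ℝ EK] [FiniteDimensional ℝ EK]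
  {K : Type*} [TopologicalSpace K] [ChartedSpace EK K] [Group K] [MulAction K X]
  {hk : HyperKahlerStructure E X} {μ : Fin 3 → X → EK →L[ℝ] ℝ} {σ : X → X} {τ : K →* K}

theorem diffOne_involutive [IsManifold 𝓘(ℝ, EK) ∞ K] (hτ : ContMDiff 𝓘(ℝ, EK) 𝓘(ℝ, EK) ∞ τ)
    (hinv : Involutive τ) (ξ : EK) : diffOne τ (diffOne τ ξ) = ξ := by
  have h1 := mdiff_involutive hτ hinv 1 ξ
  have h2 : ∀ l : K, l = 1 → (mdiff τ l : EK →L[ℝ] EK) = mdiff τ 1 := by rintro _ rfl; rfl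
  rwa [h2 _ (map_one τ)] at h1

/-- The moment map on the fixed locus of `σ` vanishes on the fixed space of `τ` only if it
vanishes. -/
theorem CompatibleInvolutions.realZeroLevel_eq [IsManifold 𝓘(ℝ, EK) ∞ K]
    (h : CompatibleInvolutions hk μ σ τ) : realZeroLevel μ σ τ = zeroLevel μ ∩ fixedPoints σ := by
  ext x
  constructor
  · rintro ⟨⟨⟨h0, h2⟩, hσ⟩, h1⟩
    refine ⟨fun i => ?_, hσ⟩
    fin_cases i
    · exact h0
    · ext ξ
      have e1 := h.moment 1 x ξ
      rw [show σ x = x from hσ] at e1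
      -- At a fixed point of `σ` the value of `μ₂` is `τ`-invariant, so on `ξ` it is half its value
      -- on `ξ + τ ξ`, which lies in the fixed space of `τ`.
      have e2 := h1 (ξ + diffOne τ ξ) (by
        rw [map_add, diffOne_involutive h.contMDiff_τ h.involutive_τ, add_comm])
      rw [map_add] at e2
      have e3 : μ 1 x ξ = μ 1 x (diffOne τ ξ) := e1.trans (by simp)
      change μ 1 x ξ = 0
      linarith
    · exact h2
  · rintro ⟨h1, hσ⟩
    exact ⟨⟨⟨h1 0, h1 2⟩, hσ⟩, fun ξ _ => by rw [h1 1]; rfl⟩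

theorem CompatibleInvolutions.isRealInvolution (h : CompatibleInvolutions hk μ σ τ) :
    IsRealInvolution hk σ :=
  ⟨h.contMDiff_σ, h.involutive_σ, h.form⟩

theorem CompatibleInvolutions.moment_eq (h : CompatibleInvolutions hk μ σ τ) (i : Fin 3) (x : X) :
    μ i (σ x) = (-1 : ℝ) ^ (i.val + 1) • (μ i x).comp (diffOne τ) := by
  ext ξ
  exact h.moment i x ξ

theorem CompatibleInvolutions.moment_eq_zero_iff (h : CompatibleInvolutions hk μ σ τ) (i : Fin 3)
    (x : X) : μ i (σ x) = 0 ↔ μ i x = 0 := by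
  have h1 : ∀ y, μ i y = 0 → μ i (σ y) = 0 := by
    intro y hy
    rw [h.moment_eq, hy]
    simp
  refine ⟨fun hx => ?_, h1 x⟩
  have := h1 _ hx
  rwa [h.involutive_σ x] at this

theorem CompatibleInvolutions.preimage_complexZeroLevel (h : CompatibleInvolutions hk μ σ τ) :
    σ ⁻¹' complexZeroLevel μ = complexZeroLevel μ :=
  ext fun x => and_congr (h.moment_eq_zero_iff 0 x) (h.moment_eq_zero_iff 2 x)

theorem CompatibleInvolutions.smul_mem [LieGroup 𝓘(ℝ, EK) ∞ K]
    (hμ : ∀ i, IsMomentMap K (hk.kahler i) (μ i)) (h : CompatibleInvolutions hk μ σ τ) {k : K}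
    (hk' : k ∈ fixedSubgroup τ) {x : X} (hx : x ∈ complexZeroLevel μ ∩ fixedPoints σ) :
    k • x ∈ complexZeroLevel μ ∩ fixedPoints σ := by
  refine ⟨⟨(hμ 0).smul_eq_zero k hx.1.1, (hμ 2).smul_eq_zero k hx.1.2⟩, ?_⟩
  have h1 : σ x = x := hx.2
  have h2 : τ k = k := hk'
  change σ (k • x) = k • x
  rw [h.map_smul, h1, h2]

variable (τ) in
/-- The action `α ↦ s α ∘ dτ` of `τ` on the dual of the Lie algebra, twisted by `s`. -/
def dualInvolution (s : ℝ) : (EK →L[ℝ] ℝ) →L[ℝ] EK →L[ℝ] ℝ :=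
  s • (ContinuousLinearMap.compL ℝ EK EK ℝ).flip (diffOne τ)

theorem dualInvolution_apply (s : ℝ) (α : EK →L[ℝ] ℝ) :
    dualInvolution τ s α = s • α.comp (diffOne τ) := rfl

theorem dualInvolution_involutive [IsManifold 𝓘(ℝ, EK) ∞ K]
    (hτ : ContMDiff 𝓘(ℝ, EK) 𝓘(ℝ, EK) ∞ τ) (hinv : Involutive τ) (i : ℕ) (α : EK →L[ℝ] ℝ) :
    dualInvolution τ ((-1 : ℝ) ^ i) (dualInvolution τ ((-1 : ℝ) ^ i) α) = α := by
  ext ξ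
  simp only [dualInvolution_apply, smul_apply, ContinuousLinearMap.comp_apply,
    diffOne_involutive hτ hinv, smul_smul, ← pow_add]
  rw [Even.neg_one_pow ⟨i, rfl⟩, one_smul]

section Complex

variable (hμ : ∀ i, IsMomentMap K (hk.kahler i) (μ i))
include hμ

theorem contMDiff_complexMoment :
    ContMDiff 𝓘(ℝ, E) 𝓘(ℝ, (EK →L[ℝ] ℝ) × (EK →L[ℝ] ℝ)) ∞ fun x : X => (μ 0 x, μ 2 x) :=
  (hμ 0).contMDiff.prodMk_space (hμ 2).contMDiff

theorem mdiff_complexMoment_eq_zero_iff (x : X) (v : E) :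
    (mdiff (fun x : X => (μ 0 x, μ 2 x)) x : E →L[ℝ] (EK →L[ℝ] ℝ) × (EK →L[ℝ] ℝ)) v = 0 ↔
      ∀ ξ : EK, formAt (hk.kahler 0).form x (infAct K x ξ) v = 0 ∧
        formAt (hk.kahler 2).form x (infAct K x ξ) v = 0 := by
  rw [mdiff_eq_of_hasMFDerivAt (f := fun x : X => (μ 0 x, μ 2 x))
    (HasMFDerivAt.prodMk_vectorSpace (hasMFDerivAt_mdiff ((hμ 0).contMDiff x))
      (hasMFDerivAt_mdiff ((hμ 2).contMDiff x)))]
  constructor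
  · intro h ξ
    rw [← (hμ 0).mdiff_apply, ← (hμ 2).mdiff_apply]
    exact ⟨congrArg (fun α : (EK →L[ℝ] ℝ) × (EK →L[ℝ] ℝ) => α.1 ξ) h,
      congrArg (fun α : (EK →L[ℝ] ℝ) × (EK →L[ℝ] ℝ) => α.2 ξ) h⟩
  · intro h
    refine Prod.ext (ContinuousLinearMap.ext fun ξ => ?_) (ContinuousLinearMap.ext fun ξ => ?_)
    · exact ((hμ 0).mdiff_apply x v ξ).trans (h ξ).1
    · exact ((hμ 2).mdiff_apply x v ξ).trans (h ξ).2

/-- Up to sign, replacing `v` by `J₂ v` exchanges the pairings of `v` with orbit directions under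
`ω₁` and `ω₃`. The kernel of the differential of `(μ₁, μ₃)` is therefore `J₂`-stable. -/
theorem mdiff_complexMoment_endAt {x : X} {v : E}
    (hv : (mdiff (fun x : X => (μ 0 x, μ 2 x)) x : E →L[ℝ] (EK →L[ℝ] ℝ) × (EK →L[ℝ] ℝ)) v = 0) :
    (mdiff (fun x : X => (μ 0 x, μ 2 x)) x : E →L[ℝ] (EK →L[ℝ] ℝ) × (EK →L[ℝ] ℝ))
      (endAt (hk.J 1) x v) = 0 := by
  rw [mdiff_complexMoment_eq_zero_iff hμ] at hv ⊢
  intro ξ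
  obtain ⟨h0, h2⟩ := hv ξ
  have e1 : ∀ u w : E, formAt (hk.kahler 0).form x (endAt (hk.J 1) x u) w =
    formAt (hk.kahler 2).form x u w := hk.formAt_form_endAt 1 x
  have e2 := e1 (endAt (hk.J 1) x v) (infAct K x ξ)
  rw [hk.endAt_endAt, map_neg, neg_apply] at e2
  rw [(hk.kahler 0).formAt_form_antisymm, neg_eq_zero] at h0
  rw [(hk.kahler 2).formAt_form_antisymm, neg_eq_zero] at h2
  rw [(hk.kahler 0).formAt_form_antisymm, (hk.kahler 2).formAt_form_antisymm, e1, ← e2, h0, h2]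
  simp

/-- The tangent spaces are the kernels just shown to be `J₂`-stable, so `exists_restrict` applies.
-/
theorem admitsKahlerSubmanifold_complexZeroLevel
    (hreg : IsRegularAtZero (E := E) fun x : X => (μ 0 x, μ 2 x)) :
    AdmitsKahlerSubmanifold (hk.kahler 1) (complexZeroLevel μ) := by
  have hS : {x : X | (μ 0 x, μ 2 x) = 0} = complexZeroLevel μ := ext fun x => Prod.ext_iff
  have hd : (complexZeroLevel μ).Nonempty → Module.finrank ℝ E =
      Module.finrank ℝ ((EK →L[ℝ] ℝ) × (EK →L[ℝ] ℝ)) +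
        (Module.finrank ℝ E - Module.finrank ℝ ((EK →L[ℝ] ℝ) × (EK →L[ℝ] ℝ))) := by
    rintro ⟨x, hx⟩
    have := LinearMap.finrank_le_finrank_of_surjective
      (f := ((mdiff (fun x : X => (μ 0 x, μ 2 x)) x :
        E →L[ℝ] (EK →L[ℝ] ℝ) × (EK →L[ℝ] ℝ)) : E →ₗ[ℝ] (EK →L[ℝ] ℝ) × (EK →L[ℝ] ℝ)))
      (hreg x (Prod.ext hx.1 hx.2))
    omega
  have hsub := exists_submanifold_of_regular (contMDiff_complexMoment hμ)
    (by rw [hS]; exact hd) hreg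
  rw [hS] at hsub
  obtain ⟨h1, h2, h3⟩ := hsub
  have h4 := fun p : complexZeroLevel μ => mem_range_mdiff_val_iff h3 (contMDiff_complexMoment hμ)
    (fun x hx => Prod.ext hx.1 hx.2) p (hreg p (Prod.ext p.2.1 p.2.2))
    (by rw [finrank_euclideanSpace, Fintype.card_fin]; exact hd ⟨p, p.2⟩)
  obtain ⟨κ, hκ⟩ := (hk.kahler 1).exists_restrict h3.contMDiff
    (fun p => mdiff_injective_of_isImmersionAt (h3.isImmersion.isImmersionAt p)) fun p u =>
      (h4 p _).2 (mdiff_complexMoment_endAt hμ ((h4 p _).1 ⟨u, rfl⟩))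
  exact ⟨_, h1, h2, κ, h3, hκ⟩

theorem CompatibleInvolutions.admitsKahlerSubmanifold [IsManifold 𝓘(ℝ, EK) ∞ K]
    (h : CompatibleInvolutions hk μ σ τ)
    (hreg : IsRegularAtZero (E := E) fun x : X => (μ 0 x, μ 2 x)) :
    AdmitsKahlerSubmanifold (hk.kahler 1) (complexZeroLevel μ ∩ fixedPoints σ) := by
  -- Both `μ₁` and `μ₃` carry the sign `-1`; the exponent `3` of the latter is normalised to `1`
  -- below.
  let T := dualInvolution (EK := EK) τ ((-1 : ℝ) ^ 1)
  have hT := dualInvolution_involutive (EK := EK) h.contMDiff_τ h.involutive_τ 1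
  obtain ⟨d, h1, h2, κ, h3, -⟩ := h.isRealInvolution.exists_kahlerSubmanifold_fixed
    (S := complexZeroLevel μ ∩ fixedPoints σ) (T := T.prodMap T) (contMDiff_complexMoment hμ)
    (fun α => Prod.ext (hT α.1) (hT α.2))
    (fun x => Prod.ext (h.moment_eq 0 x) ((h.moment_eq 2 x).trans (by
      change _ = (-1 : ℝ) ^ 1 • (μ 2 x).comp (diffOne τ)
      norm_num)))
    (fun x => and_congr_left' (Prod.ext_iff (x := (μ 0 x, μ 2 x)) (y := 0)).symm)
    (fun x hx => hreg x (Prod.ext hx.1.1 hx.1.2)) fun x _ v hv => mdiff_complexMoment_endAt hμ hv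
  exact ⟨d, h1, h2, κ, h3⟩

variable [LieGroup 𝓘(ℝ, EK) ∞ K] [ContMDiffSMul 𝓘(ℝ, EK) 𝓘(ℝ, E) ∞ K X]

theorem CompatibleInvolutions.exists_manifold_realZeroLevel (h : CompatibleInvolutions hk μ σ τ)
    (hreg : IsRegularAtZero (E := E) (fun (x : X) (i : Fin 3) => μ i x)) :
    ∃ (d : ℕ) (_ : ChartedSpace (EuclideanSpace ℝ (Fin d)) (realZeroLevel μ σ τ))
      (_ : IsManifold (𝓡 d) ∞ (realZeroLevel μ σ τ)),
      Manifold.IsSmoothEmbedding (𝓡 d) 𝓘(ℝ, E) ∞ (Subtype.val : realZeroLevel μ σ τ → X) ∧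
      ∀ (p : realZeroLevel μ σ τ) (v : E), (∃ u : EuclideanSpace ℝ (Fin d),
        (mdiff (Subtype.val : realZeroLevel μ σ τ → X) p : EuclideanSpace ℝ (Fin d) →L[ℝ] E) u = v) ↔
          (∀ (i : Fin 3) (ξ : EK), formAt (hk.kahler i).form (p : X) (infAct K (p : X) ξ) v = 0) ∧
          (mdiff σ (p : X) : E →L[ℝ] E) v = v := by
  let T : (Fin 3 → EK →L[ℝ] ℝ) →L[ℝ] Fin 3 → EK →L[ℝ] ℝ := ContinuousLinearMap.pi fun i =>
    (dualInvolution τ ((-1 : ℝ) ^ (i.val + 1))).comp (ContinuousLinearMap.proj i)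
  have hTa : ∀ α i, T α i = dualInvolution τ ((-1 : ℝ) ^ (i.val + 1)) (α i) := fun _ _ => rfl
  have hS : ∀ x, x ∈ realZeroLevel μ σ τ ↔ (fun i => μ i x) = 0 ∧ σ x = x := by
    intro x
    rw [h.realZeroLevel_eq]
    exact and_congr_left' funext_iff.symm
  obtain ⟨d, h1, h2, h3, h4⟩ := h.isRealInvolution.exists_manifold_fixed
    (S := realZeroLevel μ σ τ) (T := T) (contMDiff_moment hμ)
    (fun α => by
      funext i
      rw [hTa, hTa]
      exact dualInvolution_involutive h.contMDiff_τ h.involutive_τ _ _)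
    (fun x => by
      funext i
      rw [hTa]
      exact h.moment_eq i x) hS (fun x hx => hreg x ((hS x).1 hx).1)
  refine ⟨d, h1, h2, h3, fun p v => (h4 p v).trans (and_congr_left' ?_)⟩
  simp only [← mdiff_moment_apply hμ]
  constructor
  · intro h i ξ
    rw [h]
    rfl
  · intro h
    ext i ξ
    exact h i ξ

end Complex

end Compatible

/-! ### The induced involution of the quotient and the real quotient -/

/-- A local section through `x` shows that every point near `f x` is the image of a point near `x`.
-/
theorem isOpenMap_of_surjective_mdiff {F : Type*} [NormedAddCommGroup F] [NormedSpace ℝ F]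
    [FiniteDimensional ℝ F] {M : Type*} [TopologicalSpace M] [ChartedSpace F M]
    [IsManifold 𝓘(ℝ, F) ∞ M] {F' : Type*} [NormedAddCommGroup F'] [NormedSpace ℝ F']
    [FiniteDimensional ℝ F'] {N : Type*} [TopologicalSpace N] [ChartedSpace F' N]
    [IsManifold 𝓘(ℝ, F') ∞ N] {f : M → N} (hf : ContMDiff 𝓘(ℝ, F) 𝓘(ℝ, F') ∞ f)
    (hs : ∀ x, Surjective (mdiff f x : F →L[ℝ] F')) : IsOpenMap f := by
  refine IsOpenMap.of_nhds_le fun x U hU => ?_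
  obtain ⟨s, hsx, hsec⟩ := exists_localSection hf (hs x)
  have h1 : Filter.Tendsto s (𝓝 (f x)) (𝓝 x) := by
    have := hsec.self_of_nhds.1.continuousAt.tendsto
    rwa [hsx] at this
  filter_upwards [h1 hU, hsec] with q hq hq'
  rw [← hq'.2]
  exact hq

theorem mdiff_bijective_of_isLocalDiffeomorph {F : Type*} [NormedAddCommGroup F] [NormedSpace ℝ F]
    {M : Type*} [TopologicalSpace M] [ChartedSpace F M] [IsManifold 𝓘(ℝ, F) ∞ M]
    {F' : Type*} [NormedAddCommGroup F'] [NormedSpace ℝ F']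
    {N : Type*} [TopologicalSpace N] [ChartedSpace F' N] [IsManifold 𝓘(ℝ, F') ∞ N] {f : M → N}
    (hf : IsLocalDiffeomorph 𝓘(ℝ, F) 𝓘(ℝ, F') ∞ f) (x : M) :
    Bijective (mdiff f x : F →L[ℝ] F') := by
  have := (hf x).mfderivToContinuousLinearEquiv_coe (by simp)
  change Bijective (mfderiv 𝓘(ℝ, F) 𝓘(ℝ, F') f x)
  rw [← this]
  exact ((hf x).mfderivToContinuousLinearEquiv (by simp)).bijective

theorem ContMDiff.of_comp_isLocalDiffeomorph {F : Type*} [NormedAddCommGroup F] [NormedSpace ℝ F]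
    {M : Type*} [TopologicalSpace M] [ChartedSpace F M]
    {F' : Type*} [NormedAddCommGroup F'] [NormedSpace ℝ F']
    {N : Type*} [TopologicalSpace N] [ChartedSpace F' N]
    {F'' : Type*} [NormedAddCommGroup F''] [NormedSpace ℝ F'']
    {P : Type*} [TopologicalSpace P] [ChartedSpace F'' P] {f : M → N} {g : P → M}
    (hf : IsLocalDiffeomorph 𝓘(ℝ, F) 𝓘(ℝ, F') ∞ f) (hg : Continuous g)
    (h : ContMDiff 𝓘(ℝ, F'') 𝓘(ℝ, F') ∞ fun x => f (g x)) : ContMDiff 𝓘(ℝ, F'') 𝓘(ℝ, F) ∞ g := by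
  intro x
  obtain ⟨Φ, hx, hΦ⟩ := hf (g x)
  have h1 : ContMDiffAt 𝓘(ℝ, F') 𝓘(ℝ, F) ∞ Φ.symm (f (g x)) :=
    Φ.contMDiffOn_invFun.contMDiffAt (Φ.open_target.mem_nhds (by
      rw [hΦ hx]; exact Φ.map_source hx))
  refine (ContMDiffAt.comp (g := Φ.symm) x h1 (h x)).congr_of_eventuallyEq ?_
  filter_upwards [hg.continuousAt.preimage_mem_nhds (Φ.open_source.mem_nhds hx)] with y hy
  change g y = Φ.symm (f (g y))
  rw [hΦ hy]
  exact (Φ.left_inv hy).symm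

/-! ### The induced involution and the comparison map -/

section Quotient

variable {E : Type*} [NormedAddCommGroup E] [NormedSpace ℝ E] [FiniteDimensional ℝ E]
  {X : Type*} [TopologicalSpace X] [ChartedSpace E X] [IsManifold 𝓘(ℝ, E) ∞ X]
  {EK : Type*} [NormedAddCommGroup EK] [NormedSpace ℝ EK] [FiniteDimensional ℝ EK]
  {K : Type*} [TopologicalSpace K] [ChartedSpace EK K] [Group K] [MulAction K X]
  {hk : HyperKahlerStructure E X} {μ : Fin 3 → X → EK →L[ℝ] ℝ} {σ : X → X} {τ : K →* K}
  {F' : Type*} [NormedAddCommGroup F'] [NormedSpace ℝ F'] [FiniteDimensional ℝ F']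
  [ChartedSpace F' (zeroLevel μ)] [IsManifold 𝓘(ℝ, F') ∞ (zeroLevel μ)]
  {F'' : Type*} [NormedAddCommGroup F''] [NormedSpace ℝ F''] [FiniteDimensional ℝ F'']
  [ChartedSpace F'' (OrbitSpace K (zeroLevel μ))]
  [IsManifold 𝓘(ℝ, F'') ∞ (OrbitSpace K (zeroLevel μ))]
  {hkQ : HyperKahlerStructure F'' (OrbitSpace K (zeroLevel μ))}

/-- The restriction of `σ` to `μ⁻¹(0)`. -/
def CompatibleInvolutions.levelMap (h : CompatibleInvolutions hk μ σ τ) (z : zeroLevel μ) :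
    zeroLevel μ := ⟨σ z, h.map_mem_zeroLevel z.2⟩

theorem CompatibleInvolutions.contMDiff_levelMap (h : CompatibleInvolutions hk μ σ τ)
    (hι : Manifold.IsSmoothEmbedding 𝓘(ℝ, F') 𝓘(ℝ, E) ∞ (Subtype.val : zeroLevel μ → X)) :
    ContMDiff 𝓘(ℝ, F') 𝓘(ℝ, F') ∞ h.levelMap := by
  rw [ContMDiff.iff_comp_isImmersion hι.isImmersion]
  have h1 : ContMDiff 𝓘(ℝ, F') 𝓘(ℝ, E) ∞ fun z : zeroLevel μ => σ z :=
    h.contMDiff_σ.comp hι.contMDiff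
  exact ⟨Topology.IsInducing.subtypeVal.continuous_iff.2 h1.continuous, h1⟩

theorem CompatibleInvolutions.mdiff_levelMap (h : CompatibleInvolutions hk μ σ τ)
    (hι : Manifold.IsSmoothEmbedding 𝓘(ℝ, F') 𝓘(ℝ, E) ∞ (Subtype.val : zeroLevel μ → X))
    (z : zeroLevel μ) (a : F') :
    (mdiff (Subtype.val : zeroLevel μ → X) (h.levelMap z) : F' →L[ℝ] E)
      ((mdiff h.levelMap z : F' →L[ℝ] F') a) =
    (mdiff σ (z : X) : E →L[ℝ] E) ((mdiff (Subtype.val : zeroLevel μ → X) z : F' →L[ℝ] E) a) := by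
  have e1 := mdiff_comp_apply (f := h.levelMap) (g := (Subtype.val : zeroLevel μ → X)) (x := z)
    (hι.contMDiff _) (h.contMDiff_levelMap hι z) a
  have e2 := mdiff_comp_apply (f := (Subtype.val : zeroLevel μ → X)) (g := σ) (x := z)
    (h.contMDiff_σ _) (hι.contMDiff z) a
  exact e1.symm.trans e2

theorem CompatibleInvolutions.contMDiff_quotientMap (h : CompatibleInvolutions hk μ σ τ)
    (hι : Manifold.IsSmoothEmbedding 𝓘(ℝ, F') 𝓘(ℝ, E) ∞ (Subtype.val : zeroLevel μ → X))
    (hπ : ContMDiff 𝓘(ℝ, F') 𝓘(ℝ, F'') ∞ (Quotient.mk'' : zeroLevel μ → OrbitSpace K (zeroLevel μ)))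
    (hπs : ∀ z, Surjective (mdiff (Quotient.mk'' : zeroLevel μ → OrbitSpace K (zeroLevel μ)) z :
        F' →L[ℝ] F'')) : ContMDiff 𝓘(ℝ, F'') 𝓘(ℝ, F'') ∞ h.quotientMap :=
  contMDiff_of_comp_submersion hπ Quotient.mk''_surjective hπs
    (hπ.comp (h.contMDiff_levelMap hι))

theorem CompatibleInvolutions.mdiff_quotientMap (h : CompatibleInvolutions hk μ σ τ)
    (hι : Manifold.IsSmoothEmbedding 𝓘(ℝ, F') 𝓘(ℝ, E) ∞ (Subtype.val : zeroLevel μ → X))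
    (hπ : ContMDiff 𝓘(ℝ, F') 𝓘(ℝ, F'') ∞ (Quotient.mk'' : zeroLevel μ → OrbitSpace K (zeroLevel μ)))
    (hπs : ∀ z, Surjective (mdiff (Quotient.mk'' : zeroLevel μ → OrbitSpace K (zeroLevel μ)) z :
        F' →L[ℝ] F'')) (z : zeroLevel μ) (a : F') :
    (mdiff h.quotientMap (Quotient.mk'' z) : F'' →L[ℝ] F'')
      ((mdiff (Quotient.mk'' : zeroLevel μ → OrbitSpace K (zeroLevel μ)) z : F' →L[ℝ] F'') a) =
    (mdiff (Quotient.mk'' : zeroLevel μ → OrbitSpace K (zeroLevel μ)) (h.levelMap z) :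
      F' →L[ℝ] F'') ((mdiff h.levelMap z : F' →L[ℝ] F') a) := by
  have e1 := mdiff_comp_apply (f := h.levelMap)
    (g := (Quotient.mk'' : zeroLevel μ → OrbitSpace K (zeroLevel μ))) (x := z)
    (hπ _) (h.contMDiff_levelMap hι z) a
  have e2 := mdiff_comp_apply (f := (Quotient.mk'' : zeroLevel μ → OrbitSpace K (zeroLevel μ)))
    (g := h.quotientMap) (x := z) (h.contMDiff_quotientMap hι hπ hπs _) (hπ z) a
  exact e2.symm.trans e1

/-- Tangent vectors of the quotient are projections of vectors tangent to the level, on which the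
quotient forms are those of `X`; there `σ` acts with the given signs. -/
theorem CompatibleInvolutions.isRealInvolution_quotientMap (h : CompatibleInvolutions hk μ σ τ)
    (hι : Manifold.IsSmoothEmbedding 𝓘(ℝ, F') 𝓘(ℝ, E) ∞ (Subtype.val : zeroLevel μ → X))
    (hπ : ContMDiff 𝓘(ℝ, F') 𝓘(ℝ, F'') ∞ (Quotient.mk'' : zeroLevel μ → OrbitSpace K (zeroLevel μ)))
    (hπs : ∀ z, Surjective (mdiff (Quotient.mk'' : zeroLevel μ → OrbitSpace K (zeroLevel μ)) z :
        F' →L[ℝ] F''))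
    (hform : ∀ (i : Fin 3) (z : zeroLevel μ) (u v : F'),
      formAt (hkQ.kahler i).form (Quotient.mk'' z)
        (mdiff (Quotient.mk'' : zeroLevel μ → OrbitSpace K (zeroLevel μ)) z u)
        (mdiff (Quotient.mk'' : zeroLevel μ → OrbitSpace K (zeroLevel μ)) z v) =
      formAt (hk.kahler i).form (z : X) (mdiff (Subtype.val : zeroLevel μ → X) z u)
        (mdiff (Subtype.val : zeroLevel μ → X) z v)) : IsRealInvolution hkQ h.quotientMap where
  contMDiff := h.contMDiff_quotientMap hι hπ hπs
  involutive := by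
    rintro ⟨z⟩
    exact congrArg Quotient.mk'' (Subtype.ext (h.involutive_σ z))
  form := by
    intro i q u v
    obtain ⟨z, rfl⟩ := Quotient.mk''_surjective q
    obtain ⟨a, rfl⟩ := hπs z u
    obtain ⟨b, rfl⟩ := hπs z v
    rw [h.mdiff_quotientMap hι hπ hπs, h.mdiff_quotientMap hι hπ hπs, hform]
    refine (hform i (h.levelMap z) _ _).trans ?_
    rw [h.mdiff_levelMap hι, h.mdiff_levelMap hι]
    exact h.isRealInvolution.form i z _ _

/-- The inclusion of `(μ⁻¹(0))^σ` in `μ⁻¹(0)`. -/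
def CompatibleInvolutions.incl [IsManifold 𝓘(ℝ, EK) ∞ K] (h : CompatibleInvolutions hk μ σ τ)
    (z : realZeroLevel μ σ τ) : zeroLevel μ := ⟨z, (h.realZeroLevel_eq.subset z.2).1⟩

/-- The map `(μ⁻¹(0))^σ → (X /// K)^σ̄`. -/
def CompatibleInvolutions.toFixed [IsManifold 𝓘(ℝ, EK) ∞ K] (h : CompatibleInvolutions hk μ σ τ)
    (z : realZeroLevel μ σ τ) : fixedPoints h.quotientMap :=
  ⟨Quotient.mk'' (h.incl z),
    congrArg Quotient.mk'' (Subtype.ext (h.realZeroLevel_eq.subset z.2).2)⟩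

/-- The map `Y^σ // K^τ → (X /// K)^σ̄` induced by the inclusion. -/
def CompatibleInvolutions.realQuotientMap [IsManifold 𝓘(ℝ, EK) ∞ K]
    (h : CompatibleInvolutions hk μ σ τ) :
    OrbitSpace (fixedSubgroup τ) (realZeroLevel μ σ τ) → fixedPoints h.quotientMap :=
  Quotient.lift h.toFixed fun z z' hz => Subtype.ext <| (orbitSpace_mk_eq_iff _ _).2 <| by
    obtain ⟨k, hk⟩ := hz
    exact ⟨k⁻¹, inv_smul_eq_iff.2 hk.symm⟩

/-- If `k z = z'` with both points fixed by `σ`, applying `σ` gives `τ(k) z = z'`, and freeness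
yields `τ(k) = k`. -/
theorem CompatibleInvolutions.realQuotientMap_injective [IsManifold 𝓘(ℝ, EK) ∞ K]
    (h : CompatibleInvolutions hk μ σ τ)
    (hfree : ∀ x ∈ zeroLevel μ, ∀ k : K, k • x = x → k = 1) : Injective h.realQuotientMap := by
  rintro ⟨z⟩ ⟨z'⟩ hz
  obtain ⟨k, hk'⟩ := (orbitSpace_mk_eq_iff (h.incl z) (h.incl z')).1 (congrArg Subtype.val hz)
  have hk : k • (z : X) = z' := hk'
  have h1 := congrArg σ hk
  have e1 : σ z = z := (h.realZeroLevel_eq.subset z.2).2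
  have e2 : σ z' = z' := (h.realZeroLevel_eq.subset z'.2).2
  rw [h.map_smul, e1, e2, ← hk] at h1
  have h2 := hfree z (h.incl z).2 (k⁻¹ * τ k) (by rw [mul_smul, h1, inv_smul_smul])
  exact (orbitSpace_mk_eq_iff z z').2 ⟨⟨k, (inv_mul_eq_one.1 h2).symm⟩, hk⟩

end Quotient

/-! ### The real quotient as a Kähler reduction -/

section RealQuotient

variable {E : Type*} [NormedAddCommGroup E] [NormedSpace ℝ E] [FiniteDimensional ℝ E]
  {X : Type*} [TopologicalSpace X] [ChartedSpace E X] [IsManifold 𝓘(ℝ, E) ∞ X]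
  {EK : Type*} [NormedAddCommGroup EK] [NormedSpace ℝ EK] [FiniteDimensional ℝ EK]
  {K : Type*} [TopologicalSpace K] [ChartedSpace EK K] [Group K] [MulAction K X]
  [LieGroup 𝓘(ℝ, EK) ∞ K] [ContMDiffSMul 𝓘(ℝ, EK) 𝓘(ℝ, E) ∞ K X]
  {hk : HyperKahlerStructure E X} {μ : Fin 3 → X → EK →L[ℝ] ℝ} {σ : X → X} {τ : K →* K}
  {F' : Type*} [NormedAddCommGroup F'] [NormedSpace ℝ F'] [FiniteDimensional ℝ F']
  [ChartedSpace F' (zeroLevel μ)] [IsManifold 𝓘(ℝ, F') ∞ (zeroLevel μ)]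
  {F'' : Type*} [NormedAddCommGroup F''] [NormedSpace ℝ F''] [FiniteDimensional ℝ F'']
  [ChartedSpace F'' (OrbitSpace K (zeroLevel μ))]
  [IsManifold 𝓘(ℝ, F'') ∞ (OrbitSpace K (zeroLevel μ))]
  {hkQ : HyperKahlerStructure F'' (OrbitSpace K (zeroLevel μ))}
  {F₁ : Type*} [NormedAddCommGroup F₁] [NormedSpace ℝ F₁] [FiniteDimensional ℝ F₁]
  [ChartedSpace F₁ (realZeroLevel μ σ τ)] [IsManifold 𝓘(ℝ, F₁) ∞ (realZeroLevel μ σ τ)]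
  (h : CompatibleInvolutions hk μ σ τ)
  {F₂ : Type*} [NormedAddCommGroup F₂] [NormedSpace ℝ F₂] [FiniteDimensional ℝ F₂]
  [ChartedSpace F₂ (fixedPoints h.quotientMap)] [IsManifold 𝓘(ℝ, F₂) ∞ (fixedPoints h.quotientMap)]
  (hι : Manifold.IsSmoothEmbedding 𝓘(ℝ, F') 𝓘(ℝ, E) ∞ (Subtype.val : zeroLevel μ → X))
  (htan : ∀ (z : zeroLevel μ) (v : E), (∃ u : F',
    (mdiff (Subtype.val : zeroLevel μ → X) z : F' →L[ℝ] E) u = v) ↔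
      ∀ (i : Fin 3) (ξ : EK), formAt (hk.kahler i).form (z : X) (infAct K (z : X) ξ) v = 0)
  (hπ : ContMDiff 𝓘(ℝ, F') 𝓘(ℝ, F'') ∞ (Quotient.mk'' : zeroLevel μ → OrbitSpace K (zeroLevel μ)))
  (hπs : ∀ z, Surjective (mdiff (Quotient.mk'' : zeroLevel μ → OrbitSpace K (zeroLevel μ)) z :
    F' →L[ℝ] F''))
  (hιS : Manifold.IsSmoothEmbedding 𝓘(ℝ, F₁) 𝓘(ℝ, E) ∞ (Subtype.val : realZeroLevel μ σ τ → X))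
  (htanS : ∀ (p : realZeroLevel μ σ τ) (v : E), (∃ u : F₁,
    (mdiff (Subtype.val : realZeroLevel μ σ τ → X) p : F₁ →L[ℝ] E) u = v) ↔
      (∀ (i : Fin 3) (ξ : EK), formAt (hk.kahler i).form (p : X) (infAct K (p : X) ξ) v = 0) ∧
      (mdiff σ (p : X) : E →L[ℝ] E) v = v)
  (hιF : Manifold.IsSmoothEmbedding 𝓘(ℝ, F₂) 𝓘(ℝ, F'') ∞
    (Subtype.val : fixedPoints h.quotientMap → OrbitSpace K (zeroLevel μ)))
  (htanF : ∀ (p : fixedPoints h.quotientMap) (u : F₂),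
    (mdiff h.quotientMap (p : OrbitSpace K (zeroLevel μ)) : F'' →L[ℝ] F'')
      ((mdiff (Subtype.val : fixedPoints h.quotientMap → OrbitSpace K (zeroLevel μ)) p :
        F₂ →L[ℝ] F'') u) =
      (mdiff (Subtype.val : fixedPoints h.quotientMap → OrbitSpace K (zeroLevel μ)) p :
        F₂ →L[ℝ] F'') u)

namespace CompatibleInvolutions

theorem mdiff_infAct (h : CompatibleInvolutions hk μ σ τ) {x : X} (hx : σ x = x) (ξ : EK) :
    (mdiff σ x : E →L[ℝ] E) (infAct K x ξ) = infAct K x (diffOne τ ξ) := by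
  have h1 : ∀ y, y = x → (mdiff σ y : E →L[ℝ] E) = mdiff σ x := by rintro _ rfl; rfl
  have h2 : ∀ l : K, l = 1 → (mdiff (fun k : K => k • x) l : EK →L[ℝ] E) =
    mdiff (fun k : K => k • x) 1 := by rintro _ rfl; rfl
  have e1 := mdiff_comp_apply (f := fun k : K => k • x) (g := σ) (x := 1) (h.contMDiff_σ _)
    (contMDiff_smul_left (E := E) (EK := EK) x 1) ξ
  have e2 := mdiff_comp_apply (f := τ) (g := fun k : K => k • x) (x := 1)
    (contMDiff_smul_left (E := E) (EK := EK) x _) (h.contMDiff_τ 1) ξ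
  rw [h1 _ (one_smul K x)] at e1
  rw [h2 _ (map_one τ)] at e2
  rw [show (fun k : K => σ (k • x)) = fun k => τ k • x from funext fun k => by
    rw [h.map_smul, hx]] at e1
  exact e1.symm.trans e2

section
include hι hιS

theorem contMDiff_incl : ContMDiff 𝓘(ℝ, F₁) 𝓘(ℝ, F') ∞ h.incl := by
  rw [ContMDiff.iff_comp_isImmersion hι.isImmersion]
  exact ⟨Topology.IsInducing.subtypeVal.continuous_iff.2 continuous_subtype_val, hιS.contMDiff⟩

theorem mdiff_incl (z : realZeroLevel μ σ τ) (u : F₁) :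
    (mdiff (Subtype.val : zeroLevel μ → X) (h.incl z) : F' →L[ℝ] E)
      ((mdiff h.incl z : F₁ →L[ℝ] F') u) =
    (mdiff (Subtype.val : realZeroLevel μ σ τ → X) z : F₁ →L[ℝ] E) u :=
  (mdiff_comp_apply (f := h.incl) (g := (Subtype.val : zeroLevel μ → X)) (x := z)
    (hι.contMDiff _) (h.contMDiff_incl hι hιS z) u).symm

include hπ hιF

theorem contMDiff_toFixed : ContMDiff 𝓘(ℝ, F₁) 𝓘(ℝ, F₂) ∞ h.toFixed := by
  rw [ContMDiff.iff_comp_isImmersion hιF.isImmersion]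
  have h1 : ContMDiff 𝓘(ℝ, F₁) 𝓘(ℝ, F'') ∞
      fun z => (Quotient.mk'' (h.incl z) : OrbitSpace K (zeroLevel μ)) :=
    hπ.comp (h.contMDiff_incl hι hιS)
  exact ⟨Topology.IsInducing.subtypeVal.continuous_iff.2 h1.continuous, h1⟩

theorem mdiff_toFixed (z : realZeroLevel μ σ τ) (u : F₁) :
    (mdiff (Subtype.val : fixedPoints h.quotientMap → OrbitSpace K (zeroLevel μ)) (h.toFixed z) :
      F₂ →L[ℝ] F'') ((mdiff h.toFixed z : F₁ →L[ℝ] F₂) u) =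
    (mdiff (Quotient.mk'' : zeroLevel μ → OrbitSpace K (zeroLevel μ)) (h.incl z) : F' →L[ℝ] F'')
      ((mdiff h.incl z : F₁ →L[ℝ] F') u) := by
  have e1 := mdiff_comp_apply (f := h.toFixed)
    (g := (Subtype.val : fixedPoints h.quotientMap → OrbitSpace K (zeroLevel μ))) (x := z)
    (hιF.contMDiff _) (h.contMDiff_toFixed hι hπ hιS hιF z) u
  have e2 := mdiff_comp_apply (f := h.incl)
    (g := (Quotient.mk'' : zeroLevel μ → OrbitSpace K (zeroLevel μ))) (x := z)
    (hπ _) (h.contMDiff_incl hι hιS z) u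
  exact e1.symm.trans e2

include htan hπs htanS htanF

/-- A vector tangent to the fixed locus of the quotient lifts to `μ⁻¹(0)`. Its lift need not be
`σ`-invariant, but its projection is, so the lift may be averaged. -/
theorem mdiff_toFixed_surjective (z : realZeroLevel μ σ τ) :
    Surjective (mdiff h.toFixed z : F₁ →L[ℝ] F₂) := by
  intro w
  have hz : h.levelMap (h.incl z) = h.incl z := Subtype.ext (h.realZeroLevel_eq.subset z.2).2
  have hσz : σ z = z := (h.realZeroLevel_eq.subset z.2).2
  obtain ⟨a, ha⟩ := hπs (h.incl z)
    ((mdiff (Subtype.val : fixedPoints h.quotientMap → OrbitSpace K (zeroLevel μ)) (h.toFixed z) :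
      F₂ →L[ℝ] F'') w)
  have c1 : ∀ y, y = h.incl z → (mdiff (Quotient.mk'' : zeroLevel μ → OrbitSpace K (zeroLevel μ)) y :
    F' →L[ℝ] F'') = mdiff (Quotient.mk'' : zeroLevel μ → OrbitSpace K (zeroLevel μ)) (h.incl z) := by
    rintro _ rfl; rfl
  have c2 : ∀ y, y = h.incl z → (mdiff (Subtype.val : zeroLevel μ → X) y : F' →L[ℝ] E) =
    mdiff (Subtype.val : zeroLevel μ → X) (h.incl z) := by rintro _ rfl; rfl
  have e1 := h.mdiff_quotientMap hι hπ hπs (h.incl z) a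
  have e2 := h.mdiff_levelMap hι (h.incl z) a
  rw [c1 _ hz] at e1
  rw [c2 _ hz] at e2
  have e3 := htanF (h.toFixed z) w
  rw [← ha] at e3
  replace e1 := e1.symm.trans e3
  -- The average over the involution: the projection is unchanged by `e1`, and `dσ` now fixes the
  -- vector, so it is tangent to `(μ⁻¹(0))^σ`.
  obtain ⟨A, hA⟩ : ∃ A : F', A = (1 / 2 : ℝ) • (a + (mdiff h.levelMap (h.incl z) : F' →L[ℝ] F') a) :=
    ⟨_, rfl⟩
  have e4 : (mdiff (Quotient.mk'' : zeroLevel μ → OrbitSpace K (zeroLevel μ)) (h.incl z) :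
      F' →L[ℝ] F'') A = (mdiff (Subtype.val : fixedPoints h.quotientMap → OrbitSpace K (zeroLevel μ))
        (h.toFixed z) : F₂ →L[ℝ] F'') w := by
    rw [hA, _root_.map_smul, map_add, e1, ← ha]
    module
  have e5 : (mdiff σ (z : X) : E →L[ℝ] E)
      ((mdiff (Subtype.val : zeroLevel μ → X) (h.incl z) : F' →L[ℝ] E) A) =
      (mdiff (Subtype.val : zeroLevel μ → X) (h.incl z) : F' →L[ℝ] E) A := by
    rw [hA, _root_.map_smul, map_add, e2]
    have := h.isRealInvolution.mdiff_mdiff_of_fixed hσz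
      ((mdiff (Subtype.val : zeroLevel μ → X) (h.incl z) : F' →L[ℝ] E) a)
    rw [_root_.map_smul, map_add]
    refine congrArg (fun v : E => (1 / 2 : ℝ) • v) ?_
    rw [add_comm]
    exact congrArg₂ (· + ·) this rfl
  obtain ⟨u, hu⟩ := (htanS z _).2 ⟨(htan (h.incl z) _).1 ⟨A, rfl⟩, e5⟩
  have e6 : (mdiff h.incl z : F₁ →L[ℝ] F') u = A :=
    mdiff_injective_of_isImmersionAt (hι.isImmersion.isImmersionAt (h.incl z))
      ((h.mdiff_incl hι hιS z u).trans hu)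
  refine ⟨u, mdiff_injective_of_isImmersionAt (hιF.isImmersion.isImmersionAt (h.toFixed z)) ?_⟩
  rw [h.mdiff_toFixed hι hπ hιS hιF, e6, e4]

/-- Openness is inherited from the map defined on `(μ⁻¹(0))^σ`, which is a submersion onto its
image. -/
theorem isOpenEmbedding_realQuotientMap
    (hfree : ∀ x ∈ zeroLevel μ, ∀ k : K, k • x = x → k = 1) :
    Topology.IsOpenEmbedding h.realQuotientMap := by
  have hj := h.contMDiff_toFixed hι hπ hιS hιF
  have hjo := isOpenMap_of_surjective_mdiff hj
    (h.mdiff_toFixed_surjective hι htan hπ hπs hιS htanS hιF htanF)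
  refine Topology.IsOpenEmbedding.of_continuous_injective_isOpenMap
    (hj.continuous.quotient_lift _) (h.realQuotientMap_injective hfree) fun U hU => ?_
  have : h.realQuotientMap '' U = h.toFixed '' (Quotient.mk'' ⁻¹' U) := by
    ext q
    constructor
    · rintro ⟨⟨z⟩, hz, rfl⟩
      exact ⟨z, hz, rfl⟩
    · rintro ⟨z, hz, rfl⟩
      exact ⟨_, hz, rfl⟩
  rw [this]
  exact hjo _ (hU.preimage continuous_quotient_mk')

end

include hι htan hπ hπs hιS htanS htanF

/-- Manifold and Kähler structures are pulled back from the fixed locus along the open embedding, so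
the comparison map preserves them by construction, and no Lie group structure on `K^τ` enters. The
content is that the pulled-back structure is the reduction of `X`. -/
theorem exists_realQuotient [T2Space (OrbitSpace K (zeroLevel μ))]
    [SecondCountableTopology (OrbitSpace K (zeroLevel μ))]
    (hfree : ∀ x ∈ zeroLevel μ, ∀ k : K, k • x = x → k = 1)
    (hμ : ∀ i, IsMomentMap K (hk.kahler i) (μ i))
    (hker : ∀ (z : zeroLevel μ) (w : F'),
        (mdiff (Quotient.mk'' : zeroLevel μ → OrbitSpace K (zeroLevel μ)) z :
          F' →L[ℝ] F'') w = 0 ↔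
        ∃ ξ : EK, (mdiff (Subtype.val : zeroLevel μ → X) z : F' →L[ℝ] E) w =
          infAct K (z : X) ξ)
    (hQ : IsKahlerReduction (F' := F') (hk.kahler 1) (zeroLevel μ) (hkQ.kahler 1) Quotient.mk'')
    {κF : KahlerStructure F₂ (fixedPoints h.quotientMap)}
    (hF : IsKahlerSubmanifold (hkQ.kahler 1) (fixedPoints h.quotientMap) κF) :
    T2Space (OrbitSpace (fixedSubgroup τ) (realZeroLevel μ σ τ)) ∧
    SecondCountableTopology (OrbitSpace (fixedSubgroup τ) (realZeroLevel μ σ τ)) ∧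
    ∃ (_ : ChartedSpace F₂ (OrbitSpace (fixedSubgroup τ) (realZeroLevel μ σ τ)))
      (_ : IsManifold 𝓘(ℝ, F₂) ∞ (OrbitSpace (fixedSubgroup τ) (realZeroLevel μ σ τ)))
      (κR : KahlerStructure F₂ (OrbitSpace (fixedSubgroup τ) (realZeroLevel μ σ τ))),
      IsKahlerReduction (F' := F₁) (hk.kahler 1) (realZeroLevel μ σ τ) κR Quotient.mk'' ∧
      IsLocalDiffeomorph 𝓘(ℝ, F₂) 𝓘(ℝ, F₂) ∞ h.realQuotientMap ∧
      PreservesKahler κR κF h.realQuotientMap := by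
  have hιF := hF.embedding
  have hopen := h.isOpenEmbedding_realQuotientMap hι htan hπ hπs hιS htanS hιF htanF hfree
  have hj := h.contMDiff_toFixed hι hπ hιS hιF
  have hjs := h.mdiff_toFixed_surjective hι htan hπ hπs hιS htanS hιF htanF
  refine ⟨T2Space.of_injective_continuous hopen.injective hopen.continuous,
    hopen.isEmbedding.secondCountableTopology, ?_⟩
  obtain ⟨hR1, hR2, hloc⟩ := exists_manifold_of_isOpenEmbedding (F := F₂) hopen
  have hfs := hloc.contMDiff
  have hfb := mdiff_bijective_of_isLocalDiffeomorph hloc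
  obtain ⟨κR, hκ⟩ := κF.exists_restrict hfs (fun p => (hfb p).1) fun p u => (hfb p).2 _
  refine ⟨hR1, hR2, κR, ?_, hloc, hκ⟩
  let πR : realZeroLevel μ σ τ → OrbitSpace (fixedSubgroup τ) (realZeroLevel μ σ τ) := Quotient.mk''
  have hπR : ContMDiff 𝓘(ℝ, F₁) 𝓘(ℝ, F₂) ∞ πR :=
    ContMDiff.of_comp_isLocalDiffeomorph hloc continuous_quotient_mk' hj
  have hd : ∀ (z : realZeroLevel μ σ τ) (u : F₁),
      (mdiff h.realQuotientMap (πR z) : F₂ →L[ℝ] F₂) ((mdiff πR z : F₁ →L[ℝ] F₂) u) =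
        (mdiff h.toFixed z : F₁ →L[ℝ] F₂) u := fun z u =>
    (mdiff_comp_apply (f := πR) (g := h.realQuotientMap) (x := z) (hfs _) (hπR z) u).symm
  have hπRs : ∀ z, Surjective (mdiff πR z : F₁ →L[ℝ] F₂) := by
    intro z w
    obtain ⟨u, hu⟩ := hjs z ((mdiff h.realQuotientMap (πR z) : F₂ →L[ℝ] F₂) w)
    exact ⟨u, (hfb _).1 ((hd z u).trans hu)⟩
  refine isKahlerReduction_of hιS hπR Quotient.mk''_surjective hπRs (fun z u v hu => ?_)
    fun z u v => ?_
  · have hσz : σ z = z := (h.realZeroLevel_eq.subset z.2).2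
    have e1 : formAt κF.g.inner (h.toFixed z) (mdiff h.toFixed z u) (mdiff h.toFixed z v) =
        formAt κR.g.inner (πR z) (mdiff πR z u) (mdiff πR z v) := by
      rw [← hd, ← hd]
      exact (hκ (πR z) _ _).1
    have e2 := (hF.restrict (h.toFixed z) ((mdiff h.toFixed z : F₁ →L[ℝ] F₂) u)
      ((mdiff h.toFixed z : F₁ →L[ℝ] F₂) v)).1
    have e3 : formAt hkQ.g.inner (Quotient.mk'' (h.incl z) : OrbitSpace K (zeroLevel μ))
        (mdiff (Quotient.mk'' : zeroLevel μ → OrbitSpace K (zeroLevel μ)) (h.incl z)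
          (mdiff h.incl z u : F') : F'')
        (mdiff (Quotient.mk'' : zeroLevel μ → OrbitSpace K (zeroLevel μ)) (h.incl z)
          (mdiff h.incl z v : F') : F'') =
        formAt κF.g.inner (h.toFixed z) (mdiff h.toFixed z u) (mdiff h.toFixed z v) := by
      rw [← h.mdiff_toFixed hι hπ hιS hιF, ← h.mdiff_toFixed hι hπ hιS hιF]
      exact e2
    rw [← e1, ← e3]
    -- A vector horizontal for the quotient by `K^τ` is horizontal for the quotient by `K`, so the
    -- Riemannian submersion `μ⁻¹(0) → X /// K` computes its length.
    have e4 : ∀ w : F', (mdiff (Quotient.mk'' : zeroLevel μ → OrbitSpace K (zeroLevel μ)) (h.incl z) :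
          F' →L[ℝ] F'') w = 0 → formAt hk.g.inner (z : X)
          ((mdiff (Subtype.val : zeroLevel μ → X) (h.incl z) : F' →L[ℝ] E) (mdiff h.incl z u))
          ((mdiff (Subtype.val : zeroLevel μ → X) (h.incl z) : F' →L[ℝ] E) w) = 0 := by
      intro w hw
      obtain ⟨ξ, hξ⟩ := (hker (h.incl z) w).1 hw
      rw [h.mdiff_incl hι hιS, hξ]
      have hz0 := (h.incl z).2
      have hLu := ((htanS z _).1 ⟨u, rfl⟩).2
      have hLξ := fun η : EK => h.mdiff_infAct hσz η
      have hττ := diffOne_involutive (EK := EK) h.contMDiff_τ h.involutive_τ ξ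
      obtain ⟨U, hU⟩ : ∃ U : E, U = (mdiff (Subtype.val : realZeroLevel μ σ τ → X) z :
        F₁ →L[ℝ] E) u := ⟨_, rfl⟩
      rw [← hU] at hLu ⊢
      have p1 : formAt hk.g.inner (z : X) U (infAct K (z : X) (ξ + diffOne τ ξ)) = 0 := by
        obtain ⟨w₁, hw₁⟩ := (htanS z (infAct K (z : X) (ξ + diffOne τ ξ))).2
          ⟨fun i η => (hμ i).formAt_infAct_infAct (hz0 i) η _, by
            rw [hLξ, map_add, hττ, add_comm]⟩
        have q1 : (mdiff h.toFixed z : F₁ →L[ℝ] F₂) w₁ = 0 := by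
          refine mdiff_injective_of_isImmersionAt (hιF.isImmersion.isImmersionAt (h.toFixed z)) ?_
          rw [h.mdiff_toFixed hι hπ hιS hιF, map_zero]
          exact (hker (h.incl z) _).2 ⟨_, (h.mdiff_incl hι hιS z w₁).trans hw₁⟩
        have q2 := hu w₁ ((hfb (πR z)).1 ((hd z w₁).trans (q1.trans (map_zero _).symm)))
        rw [hw₁, ← hU] at q2
        exact q2
      -- `dσ` is an isometry that fixes `U` and takes the direction of `ξ` to that of `τ ξ`. The two
      -- pairings with `U` agree, and by `p1` their sum is zero.
      have p2 := h.isRealInvolution.formAt_inner_of_fixed hσz U (infAct K (z : X) ξ)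
      rw [hLu, hLξ] at p2
      rw [map_add, map_add, p2] at p1
      change formAt hk.g.inner (z : X) U (infAct K (z : X) ξ) = 0
      linarith
    refine (hQ.metric (h.incl z) _ _ e4).trans ?_
    exact congrArg₂ (fun a b : E => formAt hk.g.inner (z : X) a b) (h.mdiff_incl hι hιS z u)
      (h.mdiff_incl hι hιS z v)
  · have e1 := hκ.formAt_form (πR z) ((mdiff πR z : F₁ →L[ℝ] F₂) u) ((mdiff πR z : F₁ →L[ℝ] F₂) v)
    rw [hd, hd] at e1
    have e2 := hF.restrict.formAt_form (h.toFixed z) ((mdiff h.toFixed z : F₁ →L[ℝ] F₂) u)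
      ((mdiff h.toFixed z : F₁ →L[ℝ] F₂) v)
    rw [h.mdiff_toFixed hι hπ hιS hιF, h.mdiff_toFixed hι hπ hιS hιF] at e2
    have e3 := hQ.form (h.incl z) ((mdiff h.incl z : F₁ →L[ℝ] F') u)
      ((mdiff h.incl z : F₁ →L[ℝ] F') v)
    refine e1.symm.trans (e2.symm.trans (e3.trans ?_))
    exact congrArg₂ (fun a b : E => formAt (hk.kahler 1).form (z : X) a b)
      (h.mdiff_incl hι hιS z u) (h.mdiff_incl hι hιS z v)

end CompatibleInvolutions

end RealQuotient

end

theorem mainTheorem5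
    {E : Type*} [NormedAddCommGroup E] [NormedSpace ℝ E] [FiniteDimensional ℝ E]
    {X : Type*} [TopologicalSpace X] [T2Space X] [SecondCountableTopology X]
    [ChartedSpace E X] [IsManifold 𝓘(ℝ, E) ∞ X]
    {EK : Type*} [NormedAddCommGroup EK] [NormedSpace ℝ EK] [FiniteDimensional ℝ EK]
    {K : Type*} [TopologicalSpace K] [T2Space K] [CompactSpace K] [ConnectedSpace K]
    [ChartedSpace EK K] [Group K] [LieGroup 𝓘(ℝ, EK) ∞ K]
    [MulAction K X] [ContMDiffSMul 𝓘(ℝ, EK) 𝓘(ℝ, E) ∞ K X]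
    (hk : HyperKahlerStructure E X) (μ : Fin 3 → X → EK →L[ℝ] ℝ)
    (hμ : ∀ i, IsMomentMap K (hk.kahler i) (μ i))
    (σ : X → X) (τ : K →* K) (hστ : CompatibleInvolutions hk μ σ τ)
    (hreg : IsRegularAtZero (E := E) (fun (x : X) (i : Fin 3) => μ i x))
    (hfree : ∀ x ∈ zeroLevel μ, ∀ k : K, k • x = x → k = 1) :
    -- `Y` and `Y^σ` are invariant; they are Kähler for `J₂` if `0` is regular for `(μ₁, μ₃)`
    σ ⁻¹' complexZeroLevel μ = complexZeroLevel μ ∧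
    (∀ k ∈ fixedSubgroup τ, ∀ x ∈ complexZeroLevel μ ∩ Function.fixedPoints σ,
      k • x ∈ complexZeroLevel μ ∩ Function.fixedPoints σ) ∧
    (IsRegularAtZero (E := E) (fun x : X => (μ 0 x, μ 2 x)) →
      AdmitsKahlerSubmanifold (hk.kahler 1) (complexZeroLevel μ) ∧
      AdmitsKahlerSubmanifold (hk.kahler 1) (complexZeroLevel μ ∩ Function.fixedPoints σ)) ∧
    realZeroLevel μ σ τ = zeroLevel μ ∩ Function.fixedPoints σ ∧
    -- the hyper-Kähler quotient `X /// K = μ⁻¹(0) / K`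
    T2Space (OrbitSpace K (zeroLevel μ)) ∧
    SecondCountableTopology (OrbitSpace K (zeroLevel μ)) ∧
    ∃ (m : ℕ) (_ : ChartedSpace (EuclideanSpace ℝ (Fin m)) (zeroLevel μ))
      (_ : IsManifold (𝓡 m) ∞ (zeroLevel μ))
      (n : ℕ) (_ : ChartedSpace (EuclideanSpace ℝ (Fin n)) (OrbitSpace K (zeroLevel μ)))
      (_ : IsManifold (𝓡 n) ∞ (OrbitSpace K (zeroLevel μ)))
      (hkQ : HyperKahlerStructure (EuclideanSpace ℝ (Fin n)) (OrbitSpace K (zeroLevel μ))),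
      (∀ i, IsKahlerReduction (F' := EuclideanSpace ℝ (Fin m)) (hk.kahler i) (zeroLevel μ)
        (hkQ.kahler i) Quotient.mk'') ∧
    -- the symplectic quotient `Y^σ // K^τ` is Kähler
    T2Space (OrbitSpace (fixedSubgroup τ) (realZeroLevel μ σ τ)) ∧
    SecondCountableTopology (OrbitSpace (fixedSubgroup τ) (realZeroLevel μ σ τ)) ∧
    ∃ (a : ℕ) (_ : ChartedSpace (EuclideanSpace ℝ (Fin a)) (realZeroLevel μ σ τ))
      (_ : IsManifold (𝓡 a) ∞ (realZeroLevel μ σ τ))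
      (b : ℕ) (_ : ChartedSpace (EuclideanSpace ℝ (Fin b))
        (OrbitSpace (fixedSubgroup τ) (realZeroLevel μ σ τ)))
      (_ : IsManifold (𝓡 b) ∞ (OrbitSpace (fixedSubgroup τ) (realZeroLevel μ σ τ)))
      (κR : KahlerStructure (EuclideanSpace ℝ (Fin b))
        (OrbitSpace (fixedSubgroup τ) (realZeroLevel μ σ τ))),
      IsKahlerReduction (F' := EuclideanSpace ℝ (Fin a)) (hk.kahler 1) (realZeroLevel μ σ τ)
        κR Quotient.mk'' ∧
    -- the fixed locus of `σ̄` in `X /// K`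
    ∃ (c : ℕ) (_ : ChartedSpace (EuclideanSpace ℝ (Fin c))
        (Function.fixedPoints hστ.quotientMap))
      (_ : IsManifold (𝓡 c) ∞ (Function.fixedPoints hστ.quotientMap))
      (κF : KahlerStructure (EuclideanSpace ℝ (Fin c)) (Function.fixedPoints hστ.quotientMap)),
      IsKahlerSubmanifold (hkQ.kahler 1) (Function.fixedPoints hστ.quotientMap) κF ∧
      IsTotallyGeodesic (F' := EuclideanSpace ℝ (Fin c)) hkQ.g
        (Function.fixedPoints hστ.quotientMap) ∧
      (∀ i : Fin 3, i ≠ 1 →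
        IsTotallyReal (F' := EuclideanSpace ℝ (Fin c)) (hkQ.kahler i)
          (Function.fixedPoints hστ.quotientMap) ∧
        IsLagrangian (F' := EuclideanSpace ℝ (Fin c)) (hkQ.kahler i)
          (Function.fixedPoints hστ.quotientMap)) ∧
    -- the map `Y^σ // K^τ → (X /// K)^σ̄` induced by the inclusion is a Kähler local diffeomorphism
      ∃ f : OrbitSpace (fixedSubgroup τ) (realZeroLevel μ σ τ) →
          Function.fixedPoints hστ.quotientMap,
        (∀ (z : realZeroLevel μ σ τ) (w : zeroLevel μ), (w : X) = z →
          (f (Quotient.mk'' z) : OrbitSpace K (zeroLevel μ)) = Quotient.mk'' w) ∧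
        IsLocalDiffeomorph (𝓡 b) (𝓡 c) ∞ f ∧
        PreservesKahler κR κF f := by
  have hreal := hστ.realZeroLevel_eq
  obtain ⟨hT2, hSC, m, hZ1, hZ2, n, hQ1, hQ2, hkQ, -, hι, htan, hπ, hπs, hker, hQ⟩ :=
    exists_hyperKahlerQuotient hμ hreg hfree
  obtain ⟨a, hS1, hS2, hιS, htanS⟩ := hστ.exists_manifold_realZeroLevel hμ hreg
  obtain ⟨c, hF1, hF2, κF, hF, hgeo, hLag, htanF⟩ :=
    (hστ.isRealInvolution_quotientMap (hkQ := hkQ) hι hπ hπs fun i z u v =>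
      (hQ i).form z u v).exists_fixedPoints
  -- The real quotient is modelled on the same Euclidean space as the fixed locus, so below `c`
  -- serves as the dimension of both.
  obtain ⟨hT2R, hSCR, hR1, hR2, κR, hR, hloc, hpres⟩ := hστ.exists_realQuotient hι htan hπ hπs hιS
    htanS (fun p u => (htanF p _).1 ⟨u, rfl⟩) hfree hμ hker (hQ 1) hF
  refine ⟨hστ.preimage_complexZeroLevel, fun k hk' x hx => hστ.smul_mem hμ hk' hx,
    fun hreg' => ⟨admitsKahlerSubmanifold_complexZeroLevel hμ hreg',
      hστ.admitsKahlerSubmanifold hμ hreg'⟩, hreal, hT2, hSC, m, hZ1, hZ2, n, hQ1, hQ2, hkQ, hQ,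
    hT2R, hSCR, a, hS1, hS2, c, hR1, hR2, κR, hR, c, hF1, hF2, κF, hF, hgeo, hLag,
    hστ.realQuotientMap, ?_, hloc, hpres⟩
  rintro z ⟨w, hw⟩ rfl
  rfl
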